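/- Let $\ell,N\ge 0$ and $m_1,\dots,m_N\ge 0$ be integers, let $a_1,\dots,a_N$ be nonzero real constants, and let $I_1,\dots,I_\ell\subset\mathbb R\setminus\{0\}$ be nonempty open intervals such that, for $x_\mu\in I_\mu$, one has $x_\mu^2\neq x_\nu^2$ ($\mu\ne\nu$) and $x_\mu^2\ne a_i^2$. Let $X_\mu$ be a nowhere vanishing smooth function on $I_\mu$. Let $B^{(i)}$ ($i=1,\dots,N$) be a $2m_i$-dimensional Kähler manifold (a nonempty coordinate domain in $\mathbb R^{2m_i}$) with Kähler metric $\boldsymbol g^{(i)}$, not necessarily definite, and Kähler form $\boldsymbol\omega^{(i)}=d\boldsymbol\beta^{(i)}$. Metrics are smooth and nondegenerate, of arbitrary signature. Put $$U_\mu=\prod_{\nu\ne\mu}(x_\mu^2-x_\nu^2),\qquad A^{(k)}=\sum_{\nu_1<\dots<\nu_k}x_{\nu_1}^2\cdots x_{\nu_k}^2,\qquad A^{(k)}_\mu=\sum_{\substack{\nu_1<\dots<\nu_k\\ \nu_i\neq\mu}}x_{\nu_1}^2\cdots x_{\nu_k}^2,$$ $$\boldsymbol\theta_k=d\psi_k-2\sum_{i=1}^N(-1)^{\ell-k}a_i^{2\ell-2k-1}\boldsymbol\beta^{(i)},\quad\text{so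 that}\quad d\boldsymbol\theta_k+2\sum_{i=1}^N(-1)^{\ell-k}a_i^{2\ell-2k-1}\boldsymbol\omega^{(i)}=0,$$ with real coordinates $\psi_k$, and consider the metric $$\boldsymbol g=\sum_{\mu=1}^{\ell}\frac{U_\mu}{X_\mu}dx_\mu^2+\sum_{\mu=1}^{\ell}\frac{X_\mu}{U_\mu}\Bigl(\sum_{k=0}^{\ell-1}A^{(k)}_\mu\boldsymbol\theta_k\Bigr)^2+\sum_{i=1}^N\prod_{\mu=1}^\ell(x_\mu^2-a_i^2)\,\boldsymbol g^{(i)}+A^{(\ell)}\boldsymbol g^{(0)},\tag{gCKY}$$ where $\boldsymbol g^{(0)}$ is one of the following. * General case: $\boldsymbol g^{(0)}$ is any metric on an $m_0$-dimensional manifold $B^{(0)}$ (a nonempty coordinate domain in $\mathbb R^{m_0}$, $m_0\ge0$), and $\boldsymbol g$ lives on $\prod_\mu I_\mu\times\mathbb R^{\ell}\times\prod_i B^{(i)}\times B^{(0)}$, with coordinates $\psi_0,\dots,\psi_{\ell-1}$ on $\mathbb R^\ell$. * Special case: $m_0=1$ and $\boldsymbol g^{(0)}=\dfrac{c}{(A^{(\ell)})^2}\Bigl(\sum_{k=0}^{\ell}A^{(k)}\boldsymbol\theta_k\Bigr)^2$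 with a constant $c\ne0$, and $\boldsymbol g$ lives on $\prod_\mu I_\mu\times\mathbb R^{\ell+1}\times\prod_i B^{(i)}$, with coordinates $\psi_0,\dots,\psi_\ell$ on $\mathbb R^{\ell+1}$. Let $\Lambda\in\mathbb R$, and for each $\mu$ fix a base point $p_\mu\in I_\mu$. **General case.** The metric $\boldsymbol g$ is Einstein with constant $\Lambda$, that is $R_{ab}=\Lambda g_{ab}$, if and only if there are constants $\alpha_0,\dots,\alpha_\ell$ with $\alpha_\ell=-\Lambda$ and $d_1,\dots,d_\ell$ such that, with $\mathcal X(x)=\sum_{i=0}^{\ell}\alpha_i x^{2i}$, (i) for every $\mu$ and $x_\mu\in I_\mu$, $$X_\mu(x_\mu)=\frac{1}{x_\mu^{m_0-1}\prod_{i=1}^N(x_\mu^2-a_i^2)^{m_i}}\Bigl(d_\mu+\int_{p_\mu}^{x_\mu}\mathcal X(t)\,t^{m_0-2}\prod_{i=1}^N(t^2-a_i^2)^{m_i}\,dt\Bigr);\tag{EC}$$ (ii) each $\boldsymbol g^{(i)}$, $i=1,\dots,N$, is Kähler–Einstein with constant $(-1)^{\ell-1}\mathcal X(a_i)$; (iii)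 $\boldsymbol g^{(0)}$ is Einstein with constant $(-1)^{\ell-1}\alpha_0$. **Special case.** The metric $\boldsymbol g$ is Einstein with constant $\Lambda$ if and only if there are constants $\alpha_{-1},\alpha_0,\dots,\alpha_\ell$ and $d_1,\dots,d_\ell$ with $$\alpha_\ell=-\Lambda,\qquad \alpha_0=(-1)^{\ell-1}2c\sum_{j=1}^N\frac{m_j}{a_j^2},\qquad\alpha_{-1}=(-1)^{\ell-1}2c,$$ such that (i) with $m_0=1$ and (ii) hold with $\mathcal X$ replaced by $\mathcal X_{\rm special}(x)=\dfrac{\alpha_{-1}}{x^2}+\sum_{i=0}^{\ell}\alpha_i x^{2i}$. -/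

import Mathlib

open scoped ContDiff

noncomputable section

namespace GenKerrNUT

/-! ### Riemannian and Kähler geometry in a coordinate chart

A chart domain is an open subset of `ι → ℝ`; a (0,2)-tensor field is a matrix-valued function
`g`, with `g p i j` the component on the coordinate vectors `∂_i, ∂_j` at `p`. -/

section Chart

variable {ι : Type} [Fintype ι] [DecidableEq ι]

/-- The partial derivative `∂_k f` at `p`. -/
def pd (k : ι) (f : (ι → ℝ) → ℝ) (p : ι → ℝ) : ℝ :=
  fderiv ℝ f p (Pi.single k 1)

/-- `g` is a smooth (pseudo-)Riemannian metric on `U`, of arbitrary signature. -/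
structure IsMetricOn (U : Set (ι → ℝ)) (g : (ι → ℝ) → Matrix ι ι ℝ) : Prop where
  smooth : ∀ i j, ContDiffOn ℝ ∞ (fun p => g p i j) U
  symm : ∀ p ∈ U, ∀ i j, g p i j = g p j i
  nondeg : ∀ p ∈ U, (g p).det ≠ 0

/-- Christoffel symbols `Γ^k_{ij} = ½ g^{kl} (∂_i g_{jl} + ∂_j g_{il} - ∂_l g_{ij})`
of the Levi-Civita connection. -/
def christoffel (g : (ι → ℝ) → Matrix ι ι ℝ) (k i j : ι) (p : ι → ℝ) : ℝ :=
  (1 / 2) * ∑ l, (g p)⁻¹ k l *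
    (pd i (fun q => g q j l) p + pd j (fun q => g q i l) p - pd l (fun q => g q i j) p)

/-- The Ricci tensor
`R_{ij} = ∂_k Γ^k_{ij} - ∂_j Γ^k_{ik} + Γ^k_{kl} Γ^l_{ij} - Γ^k_{jl} Γ^l_{ik}`
(positive on round spheres). -/
def ricci (g : (ι → ℝ) → Matrix ι ι ℝ) (p : ι → ℝ) : Matrix ι ι ℝ :=
  Matrix.of fun i j =>
    ∑ k, (pd k (christoffel g k i j) p - pd j (christoffel g k i k) p)
      + ∑ k, ∑ l, (christoffel g k k l p * christoffel g l i j p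
          - christoffel g k j l p * christoffel g l i k p)

/-- `g` is Einstein on `U` with cosmological constant `Λ`: `R_{ij} = Λ g_{ij}`. -/
def IsEinsteinOn (U : Set (ι → ℝ)) (g : (ι → ℝ) → Matrix ι ι ℝ) (Λ : ℝ) : Prop :=
  ∀ p ∈ U, ricci g p = Λ • g p

/-- `(g, J)` is a Kähler structure on `U`: `J` is a smooth almost complex structure
(`(J v)^i = J i j v^j`), the metric `g` is Hermitian for `J`, and `J` is parallel for the
Levi-Civita connection of `g`. As spacetime metrics have arbitrary signature, definiteness
of `g` is not imposed. -/
structure IsKahlerOn (U : Set (ι → ℝ)) (g J : (ι → ℝ) → Matrix ι ι ℝ) : Prop where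
  metric : IsMetricOn U g
  smooth : ∀ i j, ContDiffOn ℝ ∞ (fun p => J p i j) U
  sq : ∀ p ∈ U, J p * J p = -1
  hermitian : ∀ p ∈ U, (J p).transpose * g p * J p = g p
  parallel : ∀ p ∈ U, ∀ k i j,
    pd k (fun q => J q i j) p + ∑ l, christoffel g i k l p * J p l j
      - ∑ l, christoffel g l k j p * J p i l = 0

/-- Kähler-Einstein with cosmological constant `lam`. -/
def IsKahlerEinsteinOn (U : Set (ι → ℝ)) (g J : (ι → ℝ) → Matrix ι ι ℝ) (lam : ℝ) : Prop :=
  IsKahlerOn U g J ∧ IsEinsteinOn U g lam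

/-- The Kähler form `ω(u, v) = g(J u, v)`; for a unitary frame `(e_α, J e_α)` with dual
coframe `(e^α, ê^α)` this is `∑ e^α ∧ ê^α`. -/
def kahlerForm (g J : (ι → ℝ) → Matrix ι ι ℝ) (p : ι → ℝ) : Matrix ι ι ℝ :=
  (J p).transpose * g p

/-- The 1-form `β` (with components `β p i`) is a smooth potential of the 2-form `Ω` on `U`:
`∂_i β_j - ∂_j β_i = Ω_{ij}`, i.e. `dβ = Ω`. -/
structure IsPotentialOn (U : Set (ι → ℝ)) (β : (ι → ℝ) → ι → ℝ)
    (Ω : (ι → ℝ) → Matrix ι ι ℝ) : Prop where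
  smooth : ∀ i, ContDiffOn ℝ ∞ (fun p => β p i) U
  deriv_eq : ∀ p ∈ U, ∀ i j,
    pd i (fun q => β q j) p - pd j (fun q => β q i) p = Ω p i j

end Chart

/-! ### The metric functions -/

section Functions

variable {ℓ : ℕ}

/-- `U_μ = ∏_{ν ≠ μ} (x_μ² - x_ν²)`. -/
def Ufun (x : Fin ℓ → ℝ) (μ : Fin ℓ) : ℝ :=
  ∏ ν ∈ Finset.univ.erase μ, (x μ ^ 2 - x ν ^ 2)

/-- `A^{(k)}`: the `k`-th elementary symmetric function of `x_1², …, x_ℓ²`. -/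
def Afun (x : Fin ℓ → ℝ) (k : ℕ) : ℝ :=
  ∑ s ∈ Finset.powersetCard k (Finset.univ : Finset (Fin ℓ)), ∏ ν ∈ s, x ν ^ 2

/-- `A^{(k)}_μ`: the `k`-th elementary symmetric function of the `x_ν²` with `ν ≠ μ`. -/
def Amu (x : Fin ℓ → ℝ) (μ : Fin ℓ) (k : ℕ) : ℝ :=
  ∑ s ∈ Finset.powersetCard k (Finset.univ.erase μ), ∏ ν ∈ s, x ν ^ 2

end Functions

/-! ### Coordinates `(x_μ, ψ_k, y_{(i)}, z)` on the total space -/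

/-- Index set of the coordinates: `x_μ` (`ℓ` of them), `ψ_k` (`κ` of them), the coordinates of
`B^{(i)}` (`2 m_i` of them for each `i`), and the coordinates of `B^{(0)}` (`m₀` of them). -/
abbrev Idx (ℓ κ N : ℕ) (m : Fin N → ℕ) (m₀ : ℕ) : Type :=
  Fin ℓ ⊕ Fin κ ⊕ (Σ i : Fin N, Fin (2 * m i)) ⊕ Fin m₀

section Total

variable {ℓ κ N : ℕ} {m : Fin N → ℕ} {m₀ : ℕ}

abbrev iX (μ : Fin ℓ) : Idx ℓ κ N m m₀ := Sum.inl μ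
abbrev iPsi (k : Fin κ) : Idx ℓ κ N m m₀ := Sum.inr (Sum.inl k)
abbrev iY (i : Fin N) (α : Fin (2 * m i)) : Idx ℓ κ N m m₀ :=
  Sum.inr (Sum.inr (Sum.inl ⟨i, α⟩))
abbrev iZ (α : Fin m₀) : Idx ℓ κ N m m₀ := Sum.inr (Sum.inr (Sum.inr α))

/-- The coordinates `x_μ` of a point. -/
def xOf (q : Idx ℓ κ N m m₀ → ℝ) : Fin ℓ → ℝ := fun μ => q (iX μ)

/-- The projection of a point to (the chart of) `B^{(i)}`. -/
def yOf (q : Idx ℓ κ N m m₀ → ℝ) (i : Fin N) : Fin (2 * m i) → ℝ := fun α => q (iY i α)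

/-- The projection of a point to (the chart of) `B^{(0)}`. -/
def zOf (q : Idx ℓ κ N m m₀ → ℝ) : Fin m₀ → ℝ := fun α => q (iZ α)

/-- The region `∏ I_μ × ℝ^κ × ∏ B^{(i)} × B^{(0)}`. -/
def region (κ : ℕ) (I : Fin ℓ → Set ℝ) (B : ∀ i, Set (Fin (2 * m i) → ℝ))
    (B₀ : Set (Fin m₀ → ℝ)) : Set (Idx ℓ κ N m m₀ → ℝ) :=
  {q | (∀ μ, xOf q μ ∈ I μ) ∧ (∀ i, yOf q i ∈ B i) ∧ zOf q ∈ B₀}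

/-- The coordinate 1-form `dq^a`, as a row of components. -/
def coordForm (a : Idx ℓ κ N m m₀) : Idx ℓ κ N m m₀ → ℝ := Pi.single a 1

/-- The square `η²` of a 1-form, as a symmetric (0,2)-tensor. -/
def formSq (η : Idx ℓ κ N m m₀ → ℝ) : Matrix (Idx ℓ κ N m m₀) (Idx ℓ κ N m m₀) ℝ :=
  Matrix.vecMulVec η η

/-- Pullback of a 1-form on `B^{(i)}` to the total space (components at a point). -/
def pullY₁ (i : Fin N) (b : Fin (2 * m i) → ℝ) : Idx ℓ κ N m m₀ → ℝ :=
  ∑ α, b α • coordForm (iY i α)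

/-- Pullback of a (0,2)-tensor on `B^{(i)}` to the total space. -/
def pullY₂ (i : Fin N) (h : Matrix (Fin (2 * m i)) (Fin (2 * m i)) ℝ) :
    Matrix (Idx ℓ κ N m m₀) (Idx ℓ κ N m m₀) ℝ :=
  ∑ α, ∑ α', h α α' • Matrix.vecMulVec (coordForm (iY i α)) (coordForm (iY i α'))

/-- Pullback of a (0,2)-tensor on `B^{(0)}` to the total space. -/
def pullZ₂ (h : Matrix (Fin m₀) (Fin m₀) ℝ) :
    Matrix (Idx ℓ κ N m m₀) (Idx ℓ κ N m m₀) ℝ :=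
  ∑ α, ∑ α', h α α' • Matrix.vecMulVec (coordForm (iZ α)) (coordForm (iZ α'))

/-- The 1-form `θ_k = dψ_k - 2 ∑_i (-1)^{ℓ-k} a_i^{2ℓ-2k-1} β^{(i)}`, so that
`dθ_k + 2 ∑_i (-1)^{ℓ-k} a_i^{2ℓ-2k-1} ω^{(i)} = 0` when `dβ^{(i)} = ω^{(i)}`. -/
def theta (a : Fin N → ℝ) (β : ∀ i, (Fin (2 * m i) → ℝ) → Fin (2 * m i) → ℝ)
    (k : Fin κ) (q : Idx ℓ κ N m m₀ → ℝ) : Idx ℓ κ N m m₀ → ℝ :=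
  coordForm (iPsi k)
    - (2 : ℝ) • ∑ i, ((-1 : ℝ) ^ ((ℓ : ℤ) - (k : ℤ)) * a i ^ (2 * (ℓ : ℤ) - 2 * (k : ℤ) - 1)) •
        pullY₁ i (β i (yOf q i))

/-- The part of the metric that does not involve `g^{(0)}`:
`∑_μ (U_μ / X_μ) dx_μ² + ∑_μ (X_μ / U_μ) (∑_{k<ℓ} A^{(k)}_μ θ_k)²
  + ∑_i ∏_μ (x_μ² - a_i²) g^{(i)}`. -/
def mainPart (hκ : ℓ ≤ κ) (X : Fin ℓ → ℝ → ℝ) (a : Fin N → ℝ)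
    (g : ∀ i, (Fin (2 * m i) → ℝ) → Matrix (Fin (2 * m i)) (Fin (2 * m i)) ℝ)
    (β : ∀ i, (Fin (2 * m i) → ℝ) → Fin (2 * m i) → ℝ)
    (q : Idx ℓ κ N m m₀ → ℝ) : Matrix (Idx ℓ κ N m m₀) (Idx ℓ κ N m m₀) ℝ :=
  ∑ μ, (Ufun (xOf q) μ / X μ (xOf q μ)) • formSq (coordForm (iX μ))
    + ∑ μ, (X μ (xOf q μ) / Ufun (xOf q) μ) •
        formSq (∑ k : Fin ℓ, Amu (xOf q) μ k • theta a β (Fin.castLE hκ k) q)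
    + ∑ i, (∏ μ, (xOf q μ ^ 2 - a i ^ 2)) • pullY₂ i (g i (yOf q i))

/-- The metric with a general `g^{(0)}` on the `m₀`-dimensional `B^{(0)}`:
the main part plus `A^{(ℓ)} g^{(0)}`; there are `ℓ` coordinates `ψ_0, …, ψ_{ℓ-1}`. -/
def generalMetric (X : Fin ℓ → ℝ → ℝ) (a : Fin N → ℝ)
    (g : ∀ i, (Fin (2 * m i) → ℝ) → Matrix (Fin (2 * m i)) (Fin (2 * m i)) ℝ)
    (β : ∀ i, (Fin (2 * m i) → ℝ) → Fin (2 * m i) → ℝ)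
    (g₀ : (Fin m₀ → ℝ) → Matrix (Fin m₀) (Fin m₀) ℝ)
    (q : Idx ℓ ℓ N m m₀ → ℝ) : Matrix (Idx ℓ ℓ N m m₀) (Idx ℓ ℓ N m m₀) ℝ :=
  mainPart le_rfl X a g β q + Afun (xOf q) ℓ • pullZ₂ (g₀ (zOf q))

/-- The metric with one zero eigenvalue and the special form
`g^{(0)} = c / (A^{(ℓ)})² (∑_{k=0}^{ℓ} A^{(k)} θ_k)²`. There are `ℓ + 1` coordinates
`ψ_0, …, ψ_ℓ`; the additional `ψ_ℓ` is the coordinate of the one-dimensional direction of the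
zero eigenvalue, so there are no further coordinates of `B^{(0)}`. -/
def specialMetric (X : Fin ℓ → ℝ → ℝ) (a : Fin N → ℝ)
    (g : ∀ i, (Fin (2 * m i) → ℝ) → Matrix (Fin (2 * m i)) (Fin (2 * m i)) ℝ)
    (β : ∀ i, (Fin (2 * m i) → ℝ) → Fin (2 * m i) → ℝ) (c : ℝ)
    (q : Idx ℓ (ℓ + 1) N m 0 → ℝ) :
    Matrix (Idx ℓ (ℓ + 1) N m 0) (Idx ℓ (ℓ + 1) N m 0) ℝ :=
  mainPart (Nat.le_succ ℓ) X a g β q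
    + Afun (xOf q) ℓ • (c / Afun (xOf q) ℓ ^ 2) •
        formSq (∑ k : Fin (ℓ + 1), Afun (xOf q) k • theta a β k q)

end Total

/-! ### The explicit integral form of the functions `X_μ` -/

/-- `𝒳(x) = ∑_{i=0}^{ℓ} α_i x^{2i}`. -/
def calX (ℓ : ℕ) (α : ℕ → ℝ) (x : ℝ) : ℝ :=
  ∑ i ∈ Finset.range (ℓ + 1), α i * x ^ (2 * i)

/-- `𝒳_special(x) = α_{-1} x^{-2} + ∑_{i=0}^{ℓ} α_i x^{2i}`, where `α_{-1}` is `αm`. -/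
def calXSpecial (ℓ : ℕ) (αm : ℝ) (α : ℕ → ℝ) (x : ℝ) : ℝ :=
  αm / x ^ 2 + calX ℓ α x

/-- On `I`, with base point `p ∈ I` for the integral,
`X(x) = 1 / (x^{m₀-1} ∏_i (x² - a_i²)^{m_i})
  * (d + ∫_p^x 𝒳(t) t^{m₀-2} ∏_i (t² - a_i²)^{m_i} dt)`. -/
def HasIntegralForm {N : ℕ} (m : Fin N → ℕ) (a : Fin N → ℝ) (m₀ : ℕ) (𝒳 : ℝ → ℝ)
    (I : Set ℝ) (p d : ℝ) (X : ℝ → ℝ) : Prop :=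
  ∀ x ∈ I, X x = 1 / (x ^ ((m₀ : ℤ) - 1) * ∏ i, (x ^ 2 - a i ^ 2) ^ m i) *
    (d + ∫ t in p..x, 𝒳 t * t ^ ((m₀ : ℤ) - 2) * ∏ i, (t ^ 2 - a i ^ 2) ^ m i)

end GenKerrNUT

end

open scoped ContDiff

set_option linter.unusedSectionVars false

noncomputable section

namespace GenKerrNUT

/-! ### Partial derivatives in a chart -/

section Calculus

variable {ι : Type} [Fintype ι] [DecidableEq ι]

/-! The proof computes the Ricci tensor in an adapted moving frame and recognises the Einstein
equations as Lagrange interpolation identities.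

Geometry. The total space fibres, with fibre coordinates `ψ`, over the product of the `x`-domain and
the factors `B^{(i)}`, `B^{(0)}`. The frame consists of the `∂_μ`, of vertical fields dual to the
forms `∑ A_μ^{(k)} θ_k`, and of horizontal lifts of coordinate fields on the factors. Its connection
coefficients are products of a function of `x` and a function on the base. They are written down
explicitly (`FibData.conn`) and justified by uniqueness of the torsion-free metric connection
(`IsLeviCivitaFrame.nabla_eq`); `IsLeviCivitaFrame.ricci_eq` then gives the Ricci tensor.

Both cases are one. Attach to the vertical fields the nodes `s_k`, namely the `x_μ²`, and in the
special case one extra node `0`; let `κ` be their number. The squared length of a vertical field is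
`H_k = G_k / ∏_{j≠k} (s_k - s_j)`. In the general case `G_μ = X_μ`. In the special case `G_μ = X_μ
x_μ²`, and the extra node has the constant numerator `g₀ = (-1)^ℓ c`. The factor `B^{(0)}` is
treated like the others, with eigenvalue `0` and zero endomorphism.

Ricci tensor. Mixed components vanish because the endomorphism `J` is trace free and divergence
free, and because of partial fraction identities between the nodes. For the rest put `y_μ(u) = u
G_μ' + (u p(u) - 1) G_μ`, with `p` as in `pFun`, and `y = -2 g₀` at the extra node. The component
along `∂_μ` and the component along the vertical field of the same node are given by one function
`ricX`, which involves only the divided values `y_k / ∏ (s_k - s_j)` and `y_μ'`. It has the shape of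
the formula `lagrange_derivative` for the derivative of a polynomial at a node.

Reduction to a polynomial. Interpolate the `y_k` at the base point by a polynomial `P` of degree at
most `κ` whose coefficient of degree `κ` is `-Λ`. If only `x_ν` varies, the Einstein equation
becomes a homogeneous linear first-order equation for `y_ν(u) - P(u²)` (`ricX_eq_iff`). This
difference vanishes at the base point, hence on the whole interval (`eq_zero_of_deriv_eq`,
`exists_isPoly`). So one `P` satisfies `P(u²) = y_ν(u)` for all `ν`. The extra node demands `P(0) =
-2 g₀` and `P'(0) = -g₀ ∑ 1/a²`, the sum running over the base coordinates. On a factor with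
eigenvalue `a`, interpolation at `a²` collapses the equation to the Einstein condition with the
constant `(-1)^{ℓ-1} P(a²) / (a²)^{κ-ℓ}` (`IsPoly.base_constant`). Each step is reversible.

Explicit form. The coefficients of `P` are the `α_i`, shifted by one in the special case because
there `P(x²) = x² 𝒳(x)`. The equation `y_μ(u) = P(u²)` says that `X_μ` times a weight has a known
derivative, and integrating it from `p_μ` gives the formula for `X_μ`
(`exists_hasIntegralForm_iff`). -/

theorem fderiv_eq_sum_pd (f : (ι → ℝ) → ℝ) (p v : ι → ℝ) :
    fderiv ℝ f p v = ∑ i, v i * pd i f p := by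
  conv_lhs => rw [pi_eq_sum_univ' v]
  rw [map_sum]
  refine Finset.sum_congr rfl fun i _ => ?_
  rw [map_smul, smul_eq_mul, pd]

theorem pd_congr {U : Set (ι → ℝ)} (hU : IsOpen U) {f f' : (ι → ℝ) → ℝ}
    (h : ∀ q ∈ U, f q = f' q) {p : ι → ℝ} (hp : p ∈ U) (k : ι) : pd k f p = pd k f' p := by
  have : f =ᶠ[nhds p] f' := Filter.eventuallyEq_of_mem (hU.mem_nhds hp) h
  rw [pd, pd, this.fderiv_eq]

theorem pd_const (k : ι) (c : ℝ) (p : ι → ℝ) : pd k (fun _ => c) p = 0 := by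
  simp [pd]

theorem pd_add {f f' : (ι → ℝ) → ℝ} {p : ι → ℝ} (hf : DifferentiableAt ℝ f p)
    (hf' : DifferentiableAt ℝ f' p) (k : ι) :
    pd k (fun q => f q + f' q) p = pd k f p + pd k f' p := by
  rw [pd, fderiv_fun_add hf hf']; rfl

theorem pd_sub {f f' : (ι → ℝ) → ℝ} {p : ι → ℝ} (hf : DifferentiableAt ℝ f p)
    (hf' : DifferentiableAt ℝ f' p) (k : ι) :
    pd k (fun q => f q - f' q) p = pd k f p - pd k f' p := by
  rw [pd, fderiv_fun_sub hf hf']; rfl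

theorem pd_neg (f : (ι → ℝ) → ℝ) (p : ι → ℝ) (k : ι) :
    pd k (fun q => -f q) p = -pd k f p := by
  rw [pd, fderiv_fun_neg]; rfl

theorem pd_mul {f f' : (ι → ℝ) → ℝ} {p : ι → ℝ} (hf : DifferentiableAt ℝ f p)
    (hf' : DifferentiableAt ℝ f' p) (k : ι) :
    pd k (fun q => f q * f' q) p = pd k f p * f' p + f p * pd k f' p := by
  rw [pd, fderiv_fun_mul hf hf']
  simp [pd]; ring

theorem pd_const_mul {f : (ι → ℝ) → ℝ} {p : ι → ℝ} (hf : DifferentiableAt ℝ f p) (c : ℝ)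
    (k : ι) : pd k (fun q => c * f q) p = c * pd k f p := by
  rw [pd_mul (differentiableAt_const c) hf, pd_const]; ring

theorem pd_sum {σ : Type*} {s : Finset σ} {f : σ → (ι → ℝ) → ℝ} {p : ι → ℝ}
    (hf : ∀ i ∈ s, DifferentiableAt ℝ (f i) p) (k : ι) :
    pd k (fun q => ∑ i ∈ s, f i q) p = ∑ i ∈ s, pd k (f i) p := by
  rw [pd, fderiv_fun_sum hf]; simp [pd]

theorem pd_inv {f : (ι → ℝ) → ℝ} {p : ι → ℝ} (hf : DifferentiableAt ℝ f p) (h0 : f p ≠ 0)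
    (k : ι) : pd k (fun q => (f q)⁻¹) p = -pd k f p / f p ^ 2 := by
  have h : HasFDerivAt (fun q => (f q)⁻¹) _ p :=
    (hasDerivAt_inv h0).comp_hasFDerivAt p hf.hasFDerivAt
  rw [pd, h.fderiv]
  simp [pd]
  ring

theorem contDiffOn_pd {U : Set (ι → ℝ)} (hU : IsOpen U) {f : (ι → ℝ) → ℝ}
    (hf : ContDiffOn ℝ ∞ f U) (k : ι) : ContDiffOn ℝ ∞ (fun p => pd k f p) U :=
  (hf.fderiv_of_isOpen hU (by norm_num)).clm_apply contDiffOn_const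

theorem ContDiffOn.diffAt {U : Set (ι → ℝ)} (hU : IsOpen U) {f : (ι → ℝ) → ℝ}
    (hf : ContDiffOn ℝ ∞ f U) {p : ι → ℝ} (hp : p ∈ U) : DifferentiableAt ℝ f p :=
  (hf.contDiffAt (hU.mem_nhds hp)).differentiableAt (by norm_num)

theorem pd_comm {U : Set (ι → ℝ)} (hU : IsOpen U) {f : (ι → ℝ) → ℝ}
    (hf : ContDiffOn ℝ ∞ f U) {p : ι → ℝ} (hp : p ∈ U) (i j : ι) :
    pd i (fun q => pd j f q) p = pd j (fun q => pd i f q) p := by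
  have hs : IsSymmSndFDerivAt ℝ f p :=
    (hf.contDiffAt (hU.mem_nhds hp)).isSymmSndFDerivAt (by simp; exact WithTop.coe_le_coe.2 (le_top : (2 : ℕ∞) ≤ ⊤))
  have hd : DifferentiableAt ℝ (fderiv ℝ f) p :=
    ((hf.fderiv_of_isOpen (m := ∞) hU (by norm_num)).contDiffAt
      (hU.mem_nhds hp)).differentiableAt (by norm_num)
  have key : ∀ a b : ι, pd a (fun q => pd b f q) p
      = fderiv ℝ (fderiv ℝ f) p (Pi.single a 1) (Pi.single b 1) := by
    intro a b
    unfold pd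
    rw [fderiv_clm_apply hd (differentiableAt_const _)]
    simp
  rw [key, key, hs.eq]

theorem contDiffOn_det {n : Type} [Fintype n] [DecidableEq n] {U : Set (ι → ℝ)}
    {M : (ι → ℝ) → Matrix n n ℝ} (hM : ∀ i j, ContDiffOn ℝ ∞ (fun p => M p i j) U) :
    ContDiffOn ℝ ∞ (fun p => (M p).det) U := by
  simp only [Matrix.det_apply]
  refine ContDiffOn.sum fun σ _ => ?_
  exact (contDiffOn_prod fun i _ => hM _ _).const_smul _

/-- By Cramer's rule an entry of the inverse is the determinant of the matrix with one row replaced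
by a unit vector, divided by the nonvanishing determinant. -/
theorem contDiffOn_inv_apply {n : Type} [Fintype n] [DecidableEq n] {U : Set (ι → ℝ)}
    {M : (ι → ℝ) → Matrix n n ℝ} (hM : ∀ i j, ContDiffOn ℝ ∞ (fun p => M p i j) U)
    (hdet : ∀ p ∈ U, (M p).det ≠ 0) (i j : n) :
    ContDiffOn ℝ ∞ (fun p => (M p)⁻¹ i j) U := by
  have h : ∀ p, (M p)⁻¹ i j = ((M p).det)⁻¹ * ((M p).updateRow j (Pi.single i 1)).det := by
    intro p
    rw [Matrix.inv_def, Matrix.smul_apply, Matrix.adjugate_apply, Ring.inverse_eq_inv', smul_eq_mul]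
  simp only [h]
  refine ((contDiffOn_det hM).inv hdet).mul (contDiffOn_det fun a b => ?_)
  by_cases hab : a = j
  · subst hab; simpa using contDiffOn_const
  · simpa [Matrix.updateRow_ne hab] using hM a b

end Calculus

/-! ### The Levi-Civita connection in coordinates and the divergence form of the Ricci tensor -/

section LeviCivita

variable {ι : Type} [Fintype ι] [DecidableEq ι] {U : Set (ι → ℝ)}
  {g : (ι → ℝ) → Matrix ι ι ℝ}

theorem contDiffOn_christoffel (hU : IsOpen U) (hg : IsMetricOn U g) (k i j : ι) :
    ContDiffOn ℝ ∞ (fun p => christoffel g k i j p) U := by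
  unfold christoffel
  refine contDiffOn_const.mul (ContDiffOn.sum fun l _ => ?_)
  refine (contDiffOn_inv_apply hg.smooth hg.nondeg k l).mul ?_
  exact ((contDiffOn_pd hU (hg.smooth j l) i).add (contDiffOn_pd hU (hg.smooth i l) j)).sub
    (contDiffOn_pd hU (hg.smooth i j) l)

theorem pd_metric_symm (hU : IsOpen U) (hg : IsMetricOn U g) {p : ι → ℝ} (hp : p ∈ U)
    (k i j : ι) : pd k (fun q => g q i j) p = pd k (fun q => g q j i) p :=
  pd_congr hU (fun q hq => hg.symm q hq i j) hp k

theorem christoffel_symm (hU : IsOpen U) (hg : IsMetricOn U g) {p : ι → ℝ} (hp : p ∈ U)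
    (k i j : ι) : christoffel g k i j p = christoffel g k j i p := by
  unfold christoffel
  congr 1
  refine Finset.sum_congr rfl fun l _ => ?_
  rw [pd_metric_symm hU hg hp l i j]; ring

theorem sum_metric_christoffel (hg : IsMetricOn U g) {p : ι → ℝ} (hp : p ∈ U) (m i j : ι) :
    ∑ k, g p m k * christoffel g k i j p = (1 / 2) *
      (pd i (fun q => g q j m) p + pd j (fun q => g q i m) p - pd m (fun q => g q i j) p) := by
  have hinv : g p * (g p)⁻¹ = 1 :=
    Matrix.mul_nonsing_inv _ (isUnit_iff_ne_zero.mpr (hg.nondeg p hp))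
  unfold christoffel
  have : ∀ l, ∑ k, g p m k * (g p)⁻¹ k l = if m = l then 1 else 0 := by
    intro l
    have := congrFun (congrFun hinv m) l
    rwa [Matrix.mul_apply, Matrix.one_apply] at this
  simp only [Finset.mul_sum]
  rw [Finset.sum_comm]
  have h2 : ∀ l, ∑ k, g p m k * (1 / 2 * ((g p)⁻¹ k l *
      (pd i (fun q => g q j l) p + pd j (fun q => g q i l) p - pd l (fun q => g q i j) p)))
      = (∑ k, g p m k * (g p)⁻¹ k l) * (1 / 2 *
      (pd i (fun q => g q j l) p + pd j (fun q => g q i l) p - pd l (fun q => g q i j) p)) := by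
    intro l; rw [Finset.sum_mul]; exact Finset.sum_congr rfl fun k _ => by ring
  simp only [h2, this]
  simp

/-- Metric compatibility: lowering the index turns the symbols into Christoffel symbols of the first
kind, and in the sum of the two all derivatives cancel except the one on the left. -/
theorem pd_metric (hU : IsOpen U) (hg : IsMetricOn U g) {p : ι → ℝ} (hp : p ∈ U) (k i j : ι) :
    pd k (fun q => g q i j) p =
      ∑ l, g p j l * christoffel g l k i p + ∑ l, g p i l * christoffel g l k j p := by
  rw [sum_metric_christoffel hg hp, sum_metric_christoffel hg hp,
    pd_metric_symm hU hg hp k j i]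
  ring

/-- The covariant derivative `∇_j V^k` of a vector field, as a matrix with entry `(k, j)`. -/
def covDeriv (g : (ι → ℝ) → Matrix ι ι ℝ) (V : (ι → ℝ) → ι → ℝ) (p : ι → ℝ) : Matrix ι ι ℝ :=
  Matrix.of fun k j => pd j (fun q => V q k) p + ∑ l, christoffel g k j l p * V p l

theorem contDiffOn_covDeriv (hU : IsOpen U) (hg : IsMetricOn U g) {V : (ι → ℝ) → ι → ℝ}
    (hV : ∀ i, ContDiffOn ℝ ∞ (fun q => V q i) U) (k j : ι) :
    ContDiffOn ℝ ∞ (fun p => covDeriv g V p k j) U :=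
  (contDiffOn_pd hU (hV k) j).add
    (ContDiffOn.sum fun l _ => (contDiffOn_christoffel hU hg k j l).mul (hV l))

/-- The contracted Ricci identity `R_{ij} V^i = ∇_k ∇_j V^k - ∇_j ∇_k V^k`. -/
theorem sum_ricci_mul (hU : IsOpen U) (hg : IsMetricOn U g) {V : (ι → ℝ) → ι → ℝ}
    (hV : ∀ i, ContDiffOn ℝ ∞ (fun q => V q i) U) {p : ι → ℝ} (hp : p ∈ U) (j : ι) :
    ∑ i, ricci g p i j * V p i =
      ∑ k, pd k (fun q => covDeriv g V q k j) p
        + ∑ k, ∑ l, christoffel g k k l p * covDeriv g V p l j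
        - ∑ k, ∑ l, christoffel g l k j p * covDeriv g V p k l
        - pd j (fun q => ∑ k, covDeriv g V q k k) p := by
  have hΓ : ∀ k i j, DifferentiableAt ℝ (fun q => christoffel g k i j q) p := fun k i j =>
    ContDiffOn.diffAt hU (contDiffOn_christoffel hU hg k i j) hp
  have hVd : ∀ i, DifferentiableAt ℝ (fun q => V q i) p := fun i =>
    ContDiffOn.diffAt hU (hV i) hp
  have hN : ∀ k j, DifferentiableAt ℝ (fun q => covDeriv g V q k j) p := fun k j =>
    ContDiffOn.diffAt hU (contDiffOn_covDeriv hU hg hV k j) hp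
  have hpdN : ∀ m k j, pd m (fun q => covDeriv g V q k j) p =
      pd m (fun q => pd j (fun q => V q k) q) p
        + ∑ l, (pd m (fun q => christoffel g k j l q) p * V p l
          + christoffel g k j l p * pd m (fun q => V q l) p) := by
    intro m k j
    have h1 : (fun q => covDeriv g V q k j) = fun q => pd j (fun q => V q k) q
        + ∑ l, christoffel g k j l q * V q l := rfl
    rw [h1, pd_add (ContDiffOn.diffAt hU (contDiffOn_pd hU (hV k) j) hp)
      (DifferentiableAt.fun_sum fun l _ => (hΓ k j l).fun_mul (hVd l)),
      pd_sum fun l _ => (hΓ k j l).fun_mul (hVd l)]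
    congr 1
    exact Finset.sum_congr rfl fun l _ => pd_mul (hΓ k j l) (hVd l) m
  rw [pd_sum fun k _ => hN k k]
  simp only [hpdN]
  -- Equality of mixed partials removes the second derivatives of `V`. The remaining terms agree
  -- after renaming summation indices and exchanging the lower indices of the symbols.
  have hc : ∀ k, pd k (fun q => pd j (fun q => V q k) q) p
      = pd j (fun q => pd k (fun q => V q k) q) p := fun k => pd_comm hU (hV k) hp k j
  simp only [hc, ricci, Matrix.of_apply, covDeriv, add_mul, Finset.sum_mul, mul_add, Finset.mul_sum, Finset.sum_add_distrib,
    sub_mul, Finset.sum_sub_distrib]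
  have e1 : ∑ i, ∑ k, pd k (christoffel g k i j) p * V p i
      = ∑ k, ∑ l, pd k (fun q => christoffel g k j l q) p * V p l := by
    rw [Finset.sum_comm]
    refine Finset.sum_congr rfl fun k _ => Finset.sum_congr rfl fun l _ => ?_
    rw [pd_congr hU (fun q hq => christoffel_symm hU hg hq k l j) hp]
  have e2 : ∑ i, ∑ k, pd j (christoffel g k i k) p * V p i
      = ∑ k, ∑ l, pd j (fun q => christoffel g k k l q) p * V p l := by
    rw [Finset.sum_comm]
    refine Finset.sum_congr rfl fun k _ => Finset.sum_congr rfl fun l _ => ?_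
    rw [pd_congr hU (fun q hq => christoffel_symm hU hg hq k l k) hp]
  have e3 : ∑ i, ∑ k, ∑ l, christoffel g k k l p * christoffel g l i j p * V p i
      = ∑ k, ∑ l, ∑ i, christoffel g k k l p * (christoffel g l j i p * V p i) := by
    rw [Finset.sum_comm]
    refine Finset.sum_congr rfl fun k _ => ?_
    rw [Finset.sum_comm]
    refine Finset.sum_congr rfl fun l _ => Finset.sum_congr rfl fun i _ => ?_
    rw [christoffel_symm hU hg hp l i j]; ring
  have e4 : ∑ i, ∑ k, ∑ l, christoffel g k j l p * christoffel g l i k p * V p i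
      = ∑ k, ∑ l, ∑ i, christoffel g l k j p * (christoffel g k l i p * V p i) := by
    rw [Finset.sum_comm, Finset.sum_comm (γ := ι) (α := ι) (s := Finset.univ) (t := Finset.univ)
      (f := fun k l => ∑ i, christoffel g l k j p * (christoffel g k l i p * V p i))]
    refine Finset.sum_congr rfl fun k _ => ?_
    rw [Finset.sum_comm]
    refine Finset.sum_congr rfl fun l _ => Finset.sum_congr rfl fun i _ => ?_
    rw [christoffel_symm hU hg hp k j l, christoffel_symm hU hg hp l i k]; ring
  have e5 : ∑ k, ∑ l, christoffel g k j l p * pd k (fun q => V q l) p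
      = ∑ k, ∑ l, christoffel g l k j p * pd l (fun q => V q k) p := by
    rw [Finset.sum_comm]
    refine Finset.sum_congr rfl fun k _ => Finset.sum_congr rfl fun l _ => ?_
    rw [christoffel_symm hU hg hp l j k]
  rw [e1, e2, e3, e4, e5]
  ring

/-- `Ric(V, W) = div (∇_W V) - tr (∇V ∇W) - W (div V)`. -/
theorem ricci_eq_div (hU : IsOpen U) (hg : IsMetricOn U g) {V W : (ι → ℝ) → ι → ℝ}
    (hV : ∀ i, ContDiffOn ℝ ∞ (fun q => V q i) U) (hW : ∀ i, ContDiffOn ℝ ∞ (fun q => W q i) U)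
    {p : ι → ℝ} (hp : p ∈ U) :
    ∑ j, (∑ i, ricci g p i j * V p i) * W p j =
      (covDeriv g (fun q k => ∑ j, covDeriv g V q k j * W q j) p).trace
        - (covDeriv g V p * covDeriv g W p).trace
        - ∑ j, W p j * pd j (fun q => (covDeriv g V q).trace) p := by
  have hN : ∀ k j, DifferentiableAt ℝ (fun q => covDeriv g V q k j) p := fun k j =>
    ContDiffOn.diffAt hU (contDiffOn_covDeriv hU hg hV k j) hp
  have hWd : ∀ i, DifferentiableAt ℝ (fun q => W q i) p := fun i =>
    ContDiffOn.diffAt hU (hW i) hp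
  have h1 : ∀ k, pd k (fun q => ∑ j, covDeriv g V q k j * W q j) p
      = ∑ j, (pd k (fun q => covDeriv g V q k j) p * W p j
        + covDeriv g V p k j * pd k (fun q => W q j) p) := by
    intro k
    rw [pd_sum fun j _ => (hN k j).fun_mul (hWd j)]
    exact Finset.sum_congr rfl fun j _ => pd_mul (hN k j) (hWd j) k
  simp only [sum_ricci_mul hU hg hV hp, Matrix.trace, Matrix.diag_apply, Matrix.mul_apply]
  have h2 : ∀ k j, covDeriv g W p k j
      = pd j (fun q => W q k) p + ∑ l, christoffel g k j l p * W p l := fun _ _ => rfl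
  have h3 : ∀ k, covDeriv g (fun q k => ∑ j, covDeriv g V q k j * W q j) p k k
      = pd k (fun q => ∑ j, covDeriv g V q k j * W q j) p
        + ∑ l, christoffel g k k l p * ∑ j, covDeriv g V p l j * W p j := fun _ => rfl
  simp only [h2, h3, h1, mul_add, add_mul, sub_mul, Finset.sum_add_distrib,
    Finset.sum_sub_distrib, Finset.mul_sum, Finset.sum_mul]
  have e1 : ∑ j, ∑ k, pd k (fun q => covDeriv g V q k j) p * W p j
      = ∑ k, ∑ j, pd k (fun q => covDeriv g V q k j) p * W p j := Finset.sum_comm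
  have e2 : ∑ j, ∑ k, ∑ l, christoffel g k k l p * covDeriv g V p l j * W p j
      = ∑ k, ∑ l, ∑ j, christoffel g k k l p * (covDeriv g V p l j * W p j) := by
    rw [Finset.sum_comm]
    refine Finset.sum_congr rfl fun k _ => ?_
    rw [Finset.sum_comm]
    exact Finset.sum_congr rfl fun l _ => Finset.sum_congr rfl fun j _ => by ring
  have e3 : ∑ j, ∑ k, ∑ l, christoffel g l k j p * covDeriv g V p k l * W p j
      = ∑ k, ∑ l, ∑ j, covDeriv g V p k l * (christoffel g l k j p * W p j) := by
    rw [Finset.sum_comm]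
    refine Finset.sum_congr rfl fun k _ => ?_
    rw [Finset.sum_comm]
    exact Finset.sum_congr rfl fun l _ => Finset.sum_congr rfl fun j _ => by ring
  have e4 : ∑ j, pd j (fun q => ∑ k, covDeriv g V q k k) p * W p j
      = ∑ j, W p j * pd j (fun q => ∑ k, covDeriv g V q k k) p :=
    Finset.sum_congr rfl fun j _ => by ring
  rw [e1, e2, e3, e4]
  ring

end LeviCivita

end GenKerrNUT

namespace GenKerrNUT

/-! ### Moving frames: uniqueness of the connection and the Ricci tensor -/

section Frames

variable {ι : Type} [Fintype ι] [DecidableEq ι] {U : Set (ι → ℝ)}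
  {g : (ι → ℝ) → Matrix ι ι ℝ}

/-- The inner product `g(u, v)` at `p`. -/
def inn (g : (ι → ℝ) → Matrix ι ι ℝ) (p u v : ι → ℝ) : ℝ := ∑ k, ∑ l, g p k l * u k * v l

theorem inn_sub_left (p u u' v : ι → ℝ) : inn g p (u - u') v = inn g p u v - inn g p u' v := by
  simp [inn, mul_sub, sub_mul, Finset.sum_sub_distrib]

theorem inn_sum_left {σ : Type} [Fintype σ] (p : ι → ℝ) (c : σ → ℝ) (u : σ → ι → ℝ) (v : ι → ℝ) :
    inn g p (fun k => ∑ a, c a * u a k) v = ∑ a, c a * inn g p (u a) v := by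
  simp only [inn, Finset.mul_sum, Finset.sum_mul]
  refine (Finset.sum_congr rfl fun k _ => Finset.sum_comm).trans (Finset.sum_comm.trans ?_)
  refine Finset.sum_congr rfl fun a _ => ?_
  refine Finset.sum_congr rfl fun k _ => Finset.sum_congr rfl fun l _ => ?_
  ring

theorem inn_symm (hg : IsMetricOn U g) {p : ι → ℝ} (hp : p ∈ U) (u v : ι → ℝ) :
    inn g p u v = inn g p v u := by
  unfold inn
  rw [Finset.sum_comm]
  refine Finset.sum_congr rfl fun k _ => Finset.sum_congr rfl fun l _ => ?_
  rw [hg.symm p hp l k]; ring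

/-- `∇_W V`. -/
def nabla (g : (ι → ℝ) → Matrix ι ι ℝ) (W V : (ι → ℝ) → ι → ℝ) (p : ι → ℝ) : ι → ℝ :=
  fun k => ∑ j, covDeriv g V p k j * W p j

/-- Leibniz rule: `pd_metric` splits the derivative of the metric into precisely the two Christoffel
terms that complete the partial derivatives of `V` and `V'` to covariant ones. -/
theorem pd_inn (hU : IsOpen U) (hg : IsMetricOn U g) {V V' : (ι → ℝ) → ι → ℝ}
    (hV : ∀ i, ContDiffOn ℝ ∞ (fun q => V q i) U) (hV' : ∀ i, ContDiffOn ℝ ∞ (fun q => V' q i) U)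
    {p : ι → ℝ} (hp : p ∈ U) (j : ι) :
    pd j (fun q => inn g q (V q) (V' q)) p =
      inn g p (fun k => covDeriv g V p k j) (V' p)
        + inn g p (V p) (fun k => covDeriv g V' p k j) := by
  have hVd : ∀ i, DifferentiableAt ℝ (fun q => V q i) p := fun i =>
    ContDiffOn.diffAt hU (hV i) hp
  have hVd' : ∀ i, DifferentiableAt ℝ (fun q => V' q i) p := fun i =>
    ContDiffOn.diffAt hU (hV' i) hp
  have hgd : ∀ k l, DifferentiableAt ℝ (fun q => g q k l) p := fun k l =>
    ContDiffOn.diffAt hU (hg.smooth k l) hp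
  unfold inn
  have h1 : ∀ k l, DifferentiableAt ℝ (fun q => g q k l * V q k * V' q l) p := fun k l =>
    ((hgd k l).fun_mul (hVd k)).fun_mul (hVd' l)
  rw [pd_sum fun k _ => DifferentiableAt.fun_sum fun l _ => h1 k l]
  have h2 : ∀ k, pd j (fun q => ∑ l, g q k l * V q k * V' q l) p
      = ∑ l, ((pd j (fun q => g q k l) p * V p k + g p k l * pd j (fun q => V q k) p) * V' p l
        + g p k l * V p k * pd j (fun q => V' q l) p) := by
    intro k
    rw [pd_sum fun l _ => h1 k l]
    refine Finset.sum_congr rfl fun l _ => ?_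
    rw [pd_mul ((hgd k l).fun_mul (hVd k)) (hVd' l), pd_mul (hgd k l) (hVd k)]
  simp only [h2, pd_metric hU hg hp, covDeriv, Matrix.of_apply, mul_add, add_mul,
    Finset.sum_add_distrib, Finset.sum_mul, Finset.mul_sum]
  have e1 : ∑ k, ∑ l, ∑ m, g p l m * christoffel g m j k p * V p k * V' p l
      = ∑ k, ∑ l, ∑ m, g p k l * (christoffel g k j m p * V p m) * V' p l := by
    rw [Finset.sum_comm]
    refine Eq.trans ?_ (Finset.sum_comm)
    refine Finset.sum_congr rfl fun l _ => ?_
    rw [Finset.sum_comm]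
    refine Finset.sum_congr rfl fun m _ => Finset.sum_congr rfl fun k _ => ?_
    rw [hg.symm p hp l m]; ring
  have e2 : ∑ k, ∑ l, ∑ m, g p k m * christoffel g m j l p * V p k * V' p l
      = ∑ k, ∑ l, ∑ m, g p k l * V p k * (christoffel g l j m p * V' p m) := by
    refine Finset.sum_congr rfl fun k _ => ?_
    rw [Finset.sum_comm]
    refine Finset.sum_congr rfl fun m _ => Finset.sum_congr rfl fun l _ => ?_
    ring
  rw [e1, e2]
  ring

theorem fderiv_inn (hU : IsOpen U) (hg : IsMetricOn U g) {V V' W : (ι → ℝ) → ι → ℝ}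
    (hV : ∀ i, ContDiffOn ℝ ∞ (fun q => V q i) U) (hV' : ∀ i, ContDiffOn ℝ ∞ (fun q => V' q i) U)
    {p : ι → ℝ} (hp : p ∈ U) :
    fderiv ℝ (fun q => inn g q (V q) (V' q)) p (W p) =
      inn g p (nabla g W V p) (V' p) + inn g p (V p) (nabla g W V' p) := by
  rw [fderiv_eq_sum_pd]
  have h : ∀ V : (ι → ℝ) → ι → ℝ, nabla g W V p = fun k => ∑ j, W p j * covDeriv g V p k j := by
    intro V; funext k; exact Finset.sum_congr rfl fun j _ => mul_comm _ _
  rw [h, h, inn_symm hg hp (V p), inn_sum_left (u := fun j k => covDeriv g V p k j),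
    inn_sum_left (u := fun j k => covDeriv g V' p k j), ← Finset.sum_add_distrib]
  refine Finset.sum_congr rfl fun j _ => ?_
  rw [pd_inn hU hg hV hV' hp, mul_add, inn_symm hg hp (V p)]

/-- A smooth frame `E` with dual coframe `Θ` on `U`, in which the metric has components `h`, and
`om c a b` are the components of `∇_{E_a} E_b` of the torsion-free metric connection. -/
structure IsLeviCivitaFrame (U : Set (ι → ℝ)) (g h : (ι → ℝ) → Matrix ι ι ℝ)
    (E Θ : ι → (ι → ℝ) → ι → ℝ) (om : ι → ι → ι → (ι → ℝ) → ℝ) : Prop where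
  smooth : ∀ a i, ContDiffOn ℝ ∞ (fun q => E a q i) U
  dual : ∀ p ∈ U, ∀ a b, ∑ i, Θ a p i * E b p i = if a = b then 1 else 0
  comp : ∀ p ∈ U, ∀ b c, inn g p (E b p) (E c p) = h p b c
  torsion : ∀ p ∈ U, ∀ a b i, ∑ c, (om c a b p - om c b a p) * E c p i
    = fderiv ℝ (fun q => E b q i) p (E a p) - fderiv ℝ (fun q => E a q i) p (E b p)
  compat : ∀ p ∈ U, ∀ a b c, fderiv ℝ (fun q => h q b c) p (E a p)
    = ∑ d, (om d a b p * h p d c + om d a c p * h p b d)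

variable {h : (ι → ℝ) → Matrix ι ι ℝ} {E Θ : ι → (ι → ℝ) → ι → ℝ}
  {om : ι → ι → ι → (ι → ℝ) → ℝ}

theorem IsLeviCivitaFrame.dual' (H : IsLeviCivitaFrame U g h E Θ om) {p : ι → ℝ} (hp : p ∈ U)
    (i j : ι) : ∑ a, E a p i * Θ a p j = if i = j then 1 else 0 := by
  have h1 : (Matrix.of fun a i => Θ a p i) * (Matrix.of fun i b => E b p i) = 1 := by
    ext a b
    rw [Matrix.mul_apply, Matrix.one_apply]
    exact H.dual p hp a b
  have h2 : (Matrix.of fun i b => E b p i) * (Matrix.of fun a i => Θ a p i) = 1 :=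
    mul_eq_one_comm.mp h1
  have h3 := congrFun (congrFun h2 i) j
  rwa [Matrix.mul_apply, Matrix.one_apply] at h3

/-- Uniqueness of the torsion-free metric connection. The difference `D` of the two connections,
lowered with the metric to `T`, is symmetric in its first two slots (equal torsions) and skew in its
last two (both metric). Such a tensor is zero, and nondegeneracy passes this on to `D`. -/
theorem IsLeviCivitaFrame.nabla_eq (hU : IsOpen U) (hg : IsMetricOn U g)
    (H : IsLeviCivitaFrame U g h E Θ om) {p : ι → ℝ} (hp : p ∈ U) (a b : ι) :
    nabla g (E a) (E b) p = fun k => ∑ c, om c a b p * E c p k := by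
  set D : ι → ι → ι → ℝ := fun a b k => nabla g (E a) (E b) p k - ∑ c, om c a b p * E c p k with hD
  set T : ι → ι → ι → ℝ := fun a b c => inn g p (D a b) (E c p) with hT
  have hsymm : ∀ a b, D a b = D b a := by
    intro a b
    funext k
    have ht := H.torsion p hp a b k
    simp only [fderiv_eq_sum_pd, sub_mul, Finset.sum_sub_distrib] at ht
    have e : nabla g (E a) (E b) p k - nabla g (E b) (E a) p k
        = ∑ i, E a p i * pd i (fun q => E b q k) p - ∑ i, E b p i * pd i (fun q => E a q k) p := by
      simp only [nabla, covDeriv, Matrix.of_apply, add_mul, Finset.sum_add_distrib, Finset.sum_mul]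
      have e1 : ∑ j, ∑ l, christoffel g k j l p * E b p l * E a p j
          = ∑ j, ∑ l, christoffel g k j l p * E a p l * E b p j := by
        rw [Finset.sum_comm]
        refine Finset.sum_congr rfl fun l _ => Finset.sum_congr rfl fun j _ => ?_
        rw [christoffel_symm hU hg hp k j l]; ring
      rw [e1]
      simp only [mul_comm (pd _ _ _)]
      ring
    simp only [hD]
    linarith
  have hskew : ∀ a b c, T a b c = -T a c b := by
    intro a b c
    have hc := H.compat p hp a b c
    have e1 : fderiv ℝ (fun q => h q b c) p (E a p)
        = fderiv ℝ (fun q => inn g q (E b q) (E c q)) p (E a p) := by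
      have : (fun q => h q b c) =ᶠ[nhds p] (fun q => inn g q (E b q) (E c q)) :=
        Filter.eventuallyEq_of_mem (hU.mem_nhds hp) fun q hq => (H.comp q hq b c).symm
      rw [this.fderiv_eq]
    rw [e1, fderiv_inn hU hg (H.smooth b) (H.smooth c) hp, Finset.sum_add_distrib,
      inn_symm hg hp (E b p)] at hc
    have e2 : ∀ b c, T a b c = inn g p (nabla g (E a) (E b) p) (E c p)
        - ∑ d, om d a b p * h p d c := by
      intro b c
      have : D a b = nabla g (E a) (E b) p - fun k => ∑ c, om c a b p * E c p k := rfl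
      simp only [hT, this, inn_sub_left]
      rw [inn_sum_left]
      simp only [H.comp p hp]
    rw [e2, e2]
    have e3 : ∀ d, h p b d = h p d b := fun d => by
      rw [← H.comp p hp, ← H.comp p hp, inn_symm hg hp]
    simp only [e3] at hc
    linarith
  -- Alternating the two symmetries three times each carries `T a b c` to its own negative.
  have hT0 : ∀ a b c, T a b c = 0 := by
    intro a b c
    have s : ∀ a b c, T a b c = T b a c := fun a b c => by simp only [hT]; rw [hsymm]
    have := hskew a b c
    have := hskew c a b
    have := hskew b c a
    have := s a b c
    have := s a c b
    have := s c b a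
    linarith
  have hD0 : D a b = 0 := by
    -- The covector `g(D, ·)` is zero on every frame vector, and by duality with the coframe these
    -- determine it.
    have hv : Matrix.vecMul (D a b) (g p) = 0 := by
      funext l
      have : ∀ c, ∑ l, Matrix.vecMul (D a b) (g p) l * E c p l = 0 := by
        intro c
        have := hT0 a b c
        simp only [hT, inn] at this
        rw [Finset.sum_comm] at this
        rw [← this]
        refine Finset.sum_congr rfl fun l _ => ?_
        rw [Matrix.vecMul, dotProduct, Finset.sum_mul]
        exact Finset.sum_congr rfl fun k _ => by ring
      have h2 : ∑ c, (∑ m, Matrix.vecMul (D a b) (g p) m * E c p m) * Θ c p l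
          = Matrix.vecMul (D a b) (g p) l := by
        simp only [Finset.sum_mul]
        rw [Finset.sum_comm]
        simp only [mul_assoc, ← Finset.mul_sum, H.dual' hp]
        simp
      rw [← h2]
      simp [this]
    exact Matrix.eq_zero_of_vecMul_eq_zero (hg.nondeg p hp) hv
  funext k
  have := congrFun hD0 k
  simp only [hD, Pi.zero_apply] at this
  linarith

/-- In coordinates the matrices `∇E_b` are conjugates, by the frame matrix, of the matrices of
connection coefficients; this removes the frame from the quadratic term of the Ricci tensor. -/
theorem trace_conj_mul_conj {A B S T : Matrix ι ι ℝ} (hTS : T * S = 1) :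
    (S * (A * T) * (S * (B * T))).trace = (A * B).trace := by
  have h1 : S * (A * T) * (S * (B * T)) = S * (A * ((T * S) * (B * T))) := by
    simp only [Matrix.mul_assoc]
  have h2 : A * (B * T) * S = A * B * (T * S) := by simp only [Matrix.mul_assoc]
  rw [h1, hTS, Matrix.one_mul, Matrix.trace_mul_comm, h2, hTS, Matrix.mul_one]

/-- The Ricci tensor in a frame with known connection coefficients. -/
theorem IsLeviCivitaFrame.ricci_eq (hU : IsOpen U) (hg : IsMetricOn U g)
    (H : IsLeviCivitaFrame U g h E Θ om)
    (hom : ∀ a b c, ∀ p ∈ U, DifferentiableAt ℝ (om c a b) p) {p : ι → ℝ} (hp : p ∈ U) (b d : ι) :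
    ∑ j, (∑ i, ricci g p i j * E b p i) * E d p j =
      ∑ a, fderiv ℝ (om a d b) p (E a p)
        - fderiv ℝ (fun q => ∑ a, om a a b q) p (E d p)
        + ∑ e, (∑ a, om a a e p) * om e d b p
        - ∑ a, ∑ e, om e a d p * om a e b p := by
  -- `nabla_eq` as a matrix identity, from which traces of covariant derivatives can be read off in
  -- the frame.
  have hN : ∀ q ∈ U, ∀ b, covDeriv g (E b) q
      = (Matrix.of fun i a => E a q i) * ((Matrix.of fun c a => om c a b q)
        * (Matrix.of fun a i => Θ a q i)) := by
    intro q hq b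
    have h1 : covDeriv g (E b) q * (Matrix.of fun i a => E a q i)
        = (Matrix.of fun i a => E a q i) * (Matrix.of fun c a => om c a b q) := by
      ext k a
      have := congrFun (H.nabla_eq hU hg hq a b) k
      simp only [nabla] at this
      simp only [Matrix.mul_apply, Matrix.of_apply, this]
      exact Finset.sum_congr rfl fun c _ => mul_comm _ _
    have h2 : (Matrix.of fun i a => E a q i) * (Matrix.of fun a i => Θ a q i) = 1 := by
      ext i j
      rw [Matrix.mul_apply, Matrix.one_apply]
      exact H.dual' hq i j
    rw [← Matrix.mul_assoc, ← h1, Matrix.mul_assoc, h2, Matrix.mul_one]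
  have hΘE : ∀ q ∈ U, (Matrix.of fun a i => Θ a q i) * (Matrix.of fun i a => E a q i) = 1 := by
    intro q hq
    ext a b
    rw [Matrix.mul_apply, Matrix.one_apply]
    exact H.dual q hq a b
  have htr : ∀ q ∈ U, ∀ b, (covDeriv g (E b) q).trace = ∑ a, om a a b q := by
    intro q hq b
    rw [hN q hq, Matrix.trace_mul_comm, Matrix.mul_assoc, hΘE q hq, Matrix.mul_one]
    rfl
  have htr2 : (covDeriv g (E b) p * covDeriv g (E d) p).trace
      = ∑ a, ∑ e, om e a d p * om a e b p := by
    rw [hN p hp, hN p hp, trace_conj_mul_conj (hΘE p hp)]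
    simp only [Matrix.trace, Matrix.diag_apply, Matrix.mul_apply, Matrix.of_apply]
    exact Finset.sum_congr rfl fun a _ => Finset.sum_congr rfl fun e _ => mul_comm _ _
  have hEd : ∀ a i, DifferentiableAt ℝ (fun q => E a q i) p := fun a i =>
    ContDiffOn.diffAt hU (H.smooth a i) hp
  -- Since `∇_{E_d} E_b = ∑ om c d b E_c`, its divergence is `∑ E_c (om c d b) + ∑ om c d b div
  -- E_c`, and `div E_c` is the trace found in `htr`.
  have hdiv : (covDeriv g (fun q k => ∑ j, covDeriv g (E b) q k j * E d q j) p).trace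
      = ∑ a, fderiv ℝ (om a d b) p (E a p) + ∑ e, (∑ a, om a a e p) * om e d b p := by
    have e1 : ∀ k, pd k (fun q => ∑ j, covDeriv g (E b) q k j * E d q j) p
        = ∑ c, (pd k (om c d b) p * E c p k + om c d b p * pd k (fun q => E c q k) p) := by
      intro k
      rw [pd_congr hU (f := fun q => ∑ j, covDeriv g (E b) q k j * E d q j)
        (f' := fun q => ∑ c, om c d b q * E c q k) (fun q hq => congrFun (H.nabla_eq hU hg hq d b) k) hp, pd_sum fun c _ => (hom d b c p hp).fun_mul (hEd c k)]
      exact Finset.sum_congr rfl fun c _ => pd_mul (hom d b c p hp) (hEd c k) k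
    have e2 : ∀ l, ∑ j, covDeriv g (E b) p l j * E d p j = ∑ c, om c d b p * E c p l :=
      fun l => congrFun (H.nabla_eq hU hg hp d b) l
    have e3 : ∀ k, covDeriv g (fun q k => ∑ j, covDeriv g (E b) q k j * E d q j) p k k
        = pd k (fun q => ∑ j, covDeriv g (E b) q k j * E d q j) p
          + ∑ l, christoffel g k k l p * ∑ j, covDeriv g (E b) p l j * E d p j := fun _ => rfl
    simp only [← htr p hp, fderiv_eq_sum_pd, Matrix.trace, Matrix.diag_apply, e3, e1, e2]
    simp only [covDeriv, Matrix.of_apply, Finset.sum_add_distrib, Finset.mul_sum, Finset.sum_mul,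
      add_mul]
    have f1 : ∑ k, ∑ c, pd k (om c d b) p * E c p k = ∑ c, ∑ k, E c p k * pd k (om c d b) p := by
      rw [Finset.sum_comm]
      exact Finset.sum_congr rfl fun c _ => Finset.sum_congr rfl fun k _ => mul_comm _ _
    have f2 : ∑ k, ∑ c, om c d b p * pd k (fun q => E c q k) p
        = ∑ c, ∑ k, pd k (fun q => E c q k) p * om c d b p := by
      rw [Finset.sum_comm]
      exact Finset.sum_congr rfl fun c _ => Finset.sum_congr rfl fun k _ => mul_comm _ _
    have f3 : ∑ k, ∑ l, ∑ c, christoffel g k k l p * (om c d b p * E c p l)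
        = ∑ c, ∑ k, ∑ l, christoffel g k k l p * E c p l * om c d b p := by
      rw [Finset.sum_congr rfl fun k _ => Finset.sum_comm, Finset.sum_comm]
      exact Finset.sum_congr rfl fun c _ => Finset.sum_congr rfl fun k _ =>
        Finset.sum_congr rfl fun l _ => by ring
    rw [f1, f2, f3]
    ring
  rw [ricci_eq_div hU hg (H.smooth b) (H.smooth d) hp, htr2, hdiv]
  have h4 : fderiv ℝ (fun q => ∑ a, om a a b q) p (E d p)
      = ∑ j, E d p j * pd j (fun q => (covDeriv g (E b) q).trace) p := by
    rw [fderiv_eq_sum_pd]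
    refine Finset.sum_congr rfl fun j _ => ?_
    rw [pd_congr hU (fun q hq => (htr q hq b).symm) hp]
  rw [h4]
  ring

end Frames

end GenKerrNUT

namespace GenKerrNUT

/-! ### Functions that separate into an `x`-factor and a base factor -/

section Projections

variable {X K Υ : Type} [Fintype X] [Fintype K] [Fintype Υ]
  [DecidableEq X] [DecidableEq K] [DecidableEq Υ]

/-- The `x`-coordinates of a point. -/
def xPart (q : X ⊕ K ⊕ Υ → ℝ) : X → ℝ := fun μ => q (Sum.inl μ)

/-- The base coordinates of a point. -/
def yPart (q : X ⊕ K ⊕ Υ → ℝ) : Υ → ℝ := fun α => q (Sum.inr (Sum.inr α))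

/-- The product of a function of the `x`-coordinates and a function of the base coordinates. -/
def sepFun (u : (X → ℝ) → ℝ) (v : (Υ → ℝ) → ℝ) (q : X ⊕ K ⊕ Υ → ℝ) : ℝ :=
  u (xPart q) * v (yPart q)

/-- The points with `x`-coordinates in `S` and base coordinates in `T`. -/
def cylinder (K : Type) (S : Set (X → ℝ)) (T : Set (Υ → ℝ)) : Set (X ⊕ K ⊕ Υ → ℝ) :=
  {q | xPart q ∈ S ∧ yPart q ∈ T}

theorem contDiff_xPart : ContDiff ℝ ∞ (xPart : (X ⊕ K ⊕ Υ → ℝ) → X → ℝ) :=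
  contDiff_pi.2 fun μ => contDiff_apply ℝ ℝ (Sum.inl μ)

theorem contDiff_yPart : ContDiff ℝ ∞ (yPart : (X ⊕ K ⊕ Υ → ℝ) → Υ → ℝ) :=
  contDiff_pi.2 fun α => contDiff_apply ℝ ℝ (Sum.inr (Sum.inr α))

variable {S : Set (X → ℝ)} {T : Set (Υ → ℝ)}

theorem isOpen_cylinder (hS : IsOpen S) (hT : IsOpen T) : IsOpen (cylinder K S T) :=
  (hS.preimage contDiff_xPart.continuous).inter (hT.preimage contDiff_yPart.continuous)

theorem contDiffOn_sepFun {u : (X → ℝ) → ℝ} {v : (Υ → ℝ) → ℝ} (hu : ContDiffOn ℝ ∞ u S)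
    (hv : ContDiffOn ℝ ∞ v T) : ContDiffOn ℝ ∞ (sepFun (K := K) u v) (cylinder K S T) :=
  (hu.comp contDiff_xPart.contDiffOn fun _ hq => hq.1).mul
    (hv.comp contDiff_yPart.contDiffOn fun _ hq => hq.2)

theorem fderiv_sepFun {u : (X → ℝ) → ℝ} {v : (Υ → ℝ) → ℝ} {p : X ⊕ K ⊕ Υ → ℝ}
    (hu : DifferentiableAt ℝ u (xPart p)) (hv : DifferentiableAt ℝ v (yPart p))
    (w : X ⊕ K ⊕ Υ → ℝ) :
    fderiv ℝ (sepFun u v) p w = fderiv ℝ u (xPart p) (xPart w) * v (yPart p)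
      + u (xPart p) * fderiv ℝ v (yPart p) (yPart w) := by
  let Lx : (X ⊕ K ⊕ Υ → ℝ) →L[ℝ] X → ℝ :=
    ContinuousLinearMap.pi fun μ => ContinuousLinearMap.proj (Sum.inl μ)
  let Ly : (X ⊕ K ⊕ Υ → ℝ) →L[ℝ] Υ → ℝ :=
    ContinuousLinearMap.pi fun α => ContinuousLinearMap.proj (Sum.inr (Sum.inr α))
  have hx : HasFDerivAt (xPart : (X ⊕ K ⊕ Υ → ℝ) → X → ℝ) Lx p := Lx.hasFDerivAt
  have hy : HasFDerivAt (yPart : (X ⊕ K ⊕ Υ → ℝ) → Υ → ℝ) Ly p := Ly.hasFDerivAt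
  have h := (hu.hasFDerivAt.comp p hx).mul (hv.hasFDerivAt.comp p hy)
  have h' : HasFDerivAt (sepFun u v) _ p := h
  rw [h'.fderiv]
  simp only [add_apply, smul_apply,
    ContinuousLinearMap.comp_apply, smul_eq_mul, Function.comp_apply]
  rw [add_comm, mul_comm]
  rfl

end Projections

/-- Data of a metric `∑ dx_μ²/H_μ + ∑ H_k η_k² + ∑ f_b γ_b` on a torus fibration over a product of
base manifolds, `η_k` being dual to the vertical frame `eh k`. The index `e μ` of the vertical
frame belongs to the coordinate `x_μ`. -/
structure FibData (X K Υ Bl : Type) where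
  e : X → K
  t : X → K → (X → ℝ) → ℝ
  H : K → (X → ℝ) → ℝ
  D : X → (X → ℝ) → ℝ
  φ : X → Bl → (X → ℝ) → ℝ
  f : Bl → (X → ℝ) → ℝ
  C : K → Bl → (X → ℝ) → ℝ
  eh : K → K → (X → ℝ) → ℝ
  et : K → K → (X → ℝ) → ℝ
  c : K → Bl → ℝ
  A : K → (Υ → ℝ) → Υ → ℝ
  blk : Υ → Bl
  γ : (Υ → ℝ) → Matrix Υ Υ ℝ
  J : (Υ → ℝ) → Matrix Υ Υ ℝ
  σ : Bl → ℝ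

/-! ### Torus fibrations: structure equations, adapted frame and connection -/

namespace FibData

variable {X K Υ Bl : Type} [Fintype X] [Fintype K] [Fintype Υ]
  [DecidableEq X] [DecidableEq K] [DecidableEq Υ]

/-- The structure equations satisfied by the data on `S × T`. -/
structure IsValid (M : FibData X K Υ Bl) (S : Set (X → ℝ)) (T : Set (Υ → ℝ)) : Prop where
  e_inj : Function.Injective M.e
  openS : IsOpen S
  openT : IsOpen T
  t_smooth : ∀ ν k, ContDiffOn ℝ ∞ (M.t ν k) S
  H_smooth : ∀ k, ContDiffOn ℝ ∞ (M.H k) S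
  D_smooth : ∀ ν, ContDiffOn ℝ ∞ (M.D ν) S
  φ_smooth : ∀ ν b, ContDiffOn ℝ ∞ (M.φ ν b) S
  f_smooth : ∀ b, ContDiffOn ℝ ∞ (M.f b) S
  C_smooth : ∀ k b, ContDiffOn ℝ ∞ (M.C k b) S
  eh_smooth : ∀ k j, ContDiffOn ℝ ∞ (M.eh k j) S
  et_smooth : ∀ k j, ContDiffOn ℝ ∞ (M.et k j) S
  A_smooth : ∀ k α, ContDiffOn ℝ ∞ (fun y => M.A k y α) T
  J_smooth : ∀ α β, ContDiffOn ℝ ∞ (fun y => M.J y α β) T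
  γ_metric : IsMetricOn T M.γ
  H_ne : ∀ k, ∀ x ∈ S, M.H k x ≠ 0
  f_ne : ∀ b, ∀ x ∈ S, M.f b x ≠ 0
  t_self : ∀ ν, ∀ x ∈ S, M.t ν (M.e ν) x = 0
  dH : ∀ ν k, ∀ x ∈ S, pd ν (M.H k) x = if k = M.e ν then M.D ν x else -(M.t ν k x * M.H k x)
  df : ∀ ν b, ∀ x ∈ S, pd ν (M.f b) x = M.φ ν b x * M.f b x
  dual : ∀ x ∈ S, ∀ k l, ∑ j, M.et k j x * M.eh l j x = if k = l then 1 else 0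
  deh : ∀ x ∈ S, ∀ ν k j, pd ν (M.eh k j) x = -(M.t ν k x * M.eh k j x)
    + if k = M.e ν then ∑ l, M.t ν l x * M.eh l j x else 0
  C_eh : ∀ x ∈ S, ∀ b j, ∑ k, M.C k b x * M.eh k j x = M.c j b
  γ_blk : ∀ y ∈ T, ∀ α β, M.blk α ≠ M.blk β → M.γ y α β = 0
  J_blk : ∀ y ∈ T, ∀ α β, M.blk α ≠ M.blk β → M.J y α β = 0
  Γ_blk : ∀ y ∈ T, ∀ α β δ, ¬(M.blk β = M.blk α ∧ M.blk δ = M.blk α) →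
    christoffel M.γ α β δ y = 0
  dA : ∀ y ∈ T, ∀ j α β, pd α (fun y => M.A j y β) y - pd β (fun y => M.A j y α) y
    = M.c j (M.blk α) * kahlerForm M.γ M.J y α β
  skew : ∀ y ∈ T, ∀ α β, kahlerForm M.γ M.J y α β = -kahlerForm M.γ M.J y β α
  J_sq : ∀ y ∈ T, ∀ α β, ∑ δ, M.J y α δ * M.J y δ β = if α = β then -M.σ (M.blk α) else 0
  J_trace : ∀ y ∈ T, ∀ c : Bl → ℝ, ∑ α, c (M.blk α) * M.J y α α = 0
  J_div : ∀ y ∈ T, ∀ α, ∑ δ, pd δ (fun y => M.J y δ α) y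
    + ∑ δ, ∑ ε, christoffel M.γ δ δ ε y * M.J y ε α
    - ∑ δ, ∑ ε, christoffel M.γ ε δ α y * M.J y δ ε = 0

variable (M : FibData X K Υ Bl)

/-- The components of `L_ν g` on the vertical frame. -/
def B (ν : X) (k l : K) (x : X → ℝ) : ℝ :=
  (if k = l then M.t ν k x * M.H k x else 0) - (if l = M.e ν then M.t ν k x * M.H k x else 0)
    - (if k = M.e ν then M.t ν l x * M.H l x else 0)
    + (if k = M.e ν ∧ l = M.e ν then M.D ν x else 0)

/-- The brackets `[∂_ν, eh k] = -∑ L ν l k • eh l`. -/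
def L (ν : X) (l k : K) (x : X → ℝ) : ℝ :=
  (if l = k then M.t ν l x else 0) - (if k = M.e ν then M.t ν l x else 0)

/-- The Christoffel symbols of `∑ dx_μ²/H_μ`. -/
def cX (l m n : X) (x : X → ℝ) : ℝ :=
  (if n = l then (1 / 2) * M.t m (M.e l) x else 0) + (if m = l then (1 / 2) * M.t n (M.e l) x else 0)
    - (if m = n then (1 / 2) * (M.H (M.e l) x * M.t l (M.e m) x / M.H (M.e m) x) else 0)
    - (if l = m ∧ m = n then (1 / 2) * (M.D l x / M.H (M.e l) x) else 0)

/-- The frame, `x`-dependent factor. -/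
def frX : X ⊕ K ⊕ Υ → X ⊕ K ⊕ Υ → (X → ℝ) → ℝ
  | .inr (.inl k), .inr (.inl j) => M.eh k j
  | _, _ => fun _ => 1

/-- The frame, base-dependent factor. -/
def frY : X ⊕ K ⊕ Υ → X ⊕ K ⊕ Υ → (Υ → ℝ) → ℝ
  | .inl μ, .inl ν => fun _ => if μ = ν then 1 else 0
  | .inl _, .inr (.inl _) => fun _ => 0
  | .inl _, .inr (.inr _) => fun _ => 0
  | .inr (.inl _), .inl _ => fun _ => 0
  | .inr (.inl _), .inr (.inl _) => fun _ => 1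
  | .inr (.inl _), .inr (.inr _) => fun _ => 0
  | .inr (.inr _), .inl _ => fun _ => 0
  | .inr (.inr α), .inr (.inl j) => fun y => -M.A j y α
  | .inr (.inr α), .inr (.inr β) => fun _ => if α = β then 1 else 0

/-- The frame `∂_μ`, `eh k`, `∂_α - ∑ A_j(∂_α) ∂_{ψ_j}`. -/
def frame (a : X ⊕ K ⊕ Υ) (q : X ⊕ K ⊕ Υ → ℝ) (i : X ⊕ K ⊕ Υ) : ℝ :=
  sepFun (M.frX a i) (M.frY a i) q

/-- The dual coframe. -/
def coframe : X ⊕ K ⊕ Υ → (X ⊕ K ⊕ Υ → ℝ) → X ⊕ K ⊕ Υ → ℝ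
  | .inl μ => fun _ => Pi.single (.inl μ) 1
  | .inr (.inl k) => fun q => Sum.elim (fun _ => 0) (Sum.elim (fun j => M.et k j (xPart q))
      fun α => ∑ j, M.et k j (xPart q) * M.A j (yPart q) α)
  | .inr (.inr α) => fun _ => Pi.single (.inr (.inr α)) 1

/-- The metric in the frame, `x`-dependent factor. -/
def hX : X ⊕ K ⊕ Υ → X ⊕ K ⊕ Υ → (X → ℝ) → ℝ
  | .inl μ, .inl ν => fun x => if μ = ν then (M.H (M.e μ) x)⁻¹ else 0
  | .inr (.inl k), .inr (.inl l) => fun x => if k = l then M.H k x else 0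
  | .inr (.inr α), .inr (.inr _) => M.f (M.blk α)
  | .inl _, .inr (.inl _) => fun _ => 0
  | .inl _, .inr (.inr _) => fun _ => 0
  | .inr (.inl _), .inl _ => fun _ => 0
  | .inr (.inl _), .inr (.inr _) => fun _ => 0
  | .inr (.inr _), .inl _ => fun _ => 0
  | .inr (.inr _), .inr (.inl _) => fun _ => 0

/-- The metric in the frame, base-dependent factor. -/
def hY : X ⊕ K ⊕ Υ → X ⊕ K ⊕ Υ → (Υ → ℝ) → ℝ
  | .inr (.inr α), .inr (.inr β) => fun y => M.γ y α β
  | _, _ => fun _ => 1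

/-- The metric in the frame. -/
def frameMetric (q : X ⊕ K ⊕ Υ → ℝ) : Matrix (X ⊕ K ⊕ Υ) (X ⊕ K ⊕ Υ) ℝ :=
  Matrix.of fun a b => sepFun (M.hX a b) (M.hY a b) q

/-- The metric in coordinates. -/
def metric (q : X ⊕ K ⊕ Υ → ℝ) : Matrix (X ⊕ K ⊕ Υ) (X ⊕ K ⊕ Υ) ℝ :=
  Matrix.of fun i j => ∑ a, ∑ b, M.frameMetric q a b * M.coframe a q i * M.coframe b q j

/-- The connection in the frame, `x`-dependent factor. -/
def connX : X ⊕ K ⊕ Υ → X ⊕ K ⊕ Υ → X ⊕ K ⊕ Υ → (X → ℝ) → ℝ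
  | .inl l, .inl m, .inl n => M.cX l m n
  | .inl μ, .inr (.inl k), .inr (.inl l) => fun x => -(1 / 2) * (M.H (M.e μ) x * M.B μ k l x)
  | .inl μ, .inr (.inr α), .inr (.inr _) => fun x =>
      -(1 / 2) * (M.H (M.e μ) x * (M.φ μ (M.blk α) x * M.f (M.blk α) x))
  | .inl _, .inl _, .inr _ => fun _ => 0
  | .inl _, .inr _, .inl _ => fun _ => 0
  | .inl _, .inr (.inl _), .inr (.inr _) => fun _ => 0
  | .inl _, .inr (.inr _), .inr (.inl _) => fun _ => 0
  | .inr (.inl k), .inr (.inl l), .inl μ => fun x => (1 / 2) * (M.B μ k l x / M.H k x)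
  | .inr (.inl k), .inl μ, .inr (.inl l) => fun x => (1 / 2) * (M.B μ k l x / M.H k x) - M.L μ k l x
  | .inr (.inl k), .inr (.inr α), .inr (.inr _) => fun x => -(1 / 2) * M.C k (M.blk α) x
  | .inr (.inl _), .inl _, .inl _ => fun _ => 0
  | .inr (.inl _), .inr (.inl _), .inr _ => fun _ => 0
  | .inr (.inl _), .inr (.inr _), .inl _ => fun _ => 0
  | .inr (.inl _), .inl _, .inr (.inr _) => fun _ => 0
  | .inr (.inl _), .inr (.inr _), .inr (.inl _) => fun _ => 0
  | .inr (.inr _), .inl μ, .inr (.inr α) => fun x => (1 / 2) * M.φ μ (M.blk α) x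
  | .inr (.inr _), .inr (.inr α), .inl μ => fun x => (1 / 2) * M.φ μ (M.blk α) x
  | .inr (.inr _), .inr (.inl k), .inr (.inr α) => fun x =>
      (1 / 2) * (M.H k x * M.C k (M.blk α) x / M.f (M.blk α) x)
  | .inr (.inr _), .inr (.inr α), .inr (.inl k) => fun x =>
      (1 / 2) * (M.H k x * M.C k (M.blk α) x / M.f (M.blk α) x)
  | .inr (.inr _), .inr (.inr _), .inr (.inr _) => fun _ => 1
  | .inr (.inr _), .inl _, .inl _ => fun _ => 0
  | .inr (.inr _), .inl _, .inr (.inl _) => fun _ => 0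
  | .inr (.inr _), .inr (.inl _), .inl _ => fun _ => 0
  | .inr (.inr _), .inr (.inl _), .inr (.inl _) => fun _ => 0

/-- The connection in the frame, base-dependent factor. -/
def connY : X ⊕ K ⊕ Υ → X ⊕ K ⊕ Υ → X ⊕ K ⊕ Υ → (Υ → ℝ) → ℝ
  | .inl _, .inr (.inr α), .inr (.inr β) => fun y => M.γ y α β
  | .inr (.inl _), .inr (.inr α), .inr (.inr β) => fun y => kahlerForm M.γ M.J y α β
  | .inr (.inr δ), .inl _, .inr (.inr α) => fun _ => if δ = α then 1 else 0
  | .inr (.inr δ), .inr (.inr α), .inl _ => fun _ => if δ = α then 1 else 0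
  | .inr (.inr δ), .inr (.inl _), .inr (.inr α) => fun y => M.J y δ α
  | .inr (.inr δ), .inr (.inr α), .inr (.inl _) => fun y => M.J y δ α
  | .inr (.inr δ), .inr (.inr α), .inr (.inr β) => fun y => christoffel M.γ δ α β y
  | .inl _, .inl _, _ => fun _ => 1
  | .inl _, .inr (.inl _), _ => fun _ => 1
  | .inl _, .inr (.inr _), .inl _ => fun _ => 1
  | .inl _, .inr (.inr _), .inr (.inl _) => fun _ => 1
  | .inr (.inl _), .inl _, _ => fun _ => 1
  | .inr (.inl _), .inr (.inl _), _ => fun _ => 1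
  | .inr (.inl _), .inr (.inr _), .inl _ => fun _ => 1
  | .inr (.inl _), .inr (.inr _), .inr (.inl _) => fun _ => 1
  | .inr (.inr _), .inl _, .inl _ => fun _ => 1
  | .inr (.inr _), .inl _, .inr (.inl _) => fun _ => 1
  | .inr (.inr _), .inr (.inl _), .inl _ => fun _ => 1
  | .inr (.inr _), .inr (.inl _), .inr (.inl _) => fun _ => 1

/-- The connection coefficients: `∇_{E_a} E_b = ∑ conn c a b • E_c`. -/
def conn (c a b : X ⊕ K ⊕ Υ) : (X ⊕ K ⊕ Υ → ℝ) → ℝ := sepFun (M.connX c a b) (M.connY c a b)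

variable {M} {S : Set (X → ℝ)} {T : Set (Υ → ℝ)}

theorem IsValid.frX_smooth (V : M.IsValid S T) (a i : X ⊕ K ⊕ Υ) :
    ContDiffOn ℝ ∞ (M.frX a i) S := by
  rcases a with μ | k | α <;> rcases i with ν | j | β <;>
    first
      | exact contDiffOn_const
      | exact V.eh_smooth _ _

theorem IsValid.frY_smooth (V : M.IsValid S T) (a i : X ⊕ K ⊕ Υ) :
    ContDiffOn ℝ ∞ (M.frY a i) T := by
  rcases a with μ | k | α <;> rcases i with ν | j | β <;>
    first
      | exact contDiffOn_const
      | exact (V.A_smooth _ _).neg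

theorem contDiffOn_ite {P : Prop} [Decidable P] {ι : Type} [Fintype ι] {U : Set (ι → ℝ)}
    {u v : (ι → ℝ) → ℝ} (hu : ContDiffOn ℝ ∞ u U) (hv : ContDiffOn ℝ ∞ v U) :
    ContDiffOn ℝ ∞ (fun x => if P then u x else v x) U := by
  by_cases h : P <;> simpa [h]

theorem IsValid.hX_smooth (V : M.IsValid S T) (a i : X ⊕ K ⊕ Υ) :
    ContDiffOn ℝ ∞ (M.hX a i) S := by
  rcases a with μ | k | α <;> rcases i with ν | j | β <;>
    first
      | exact contDiffOn_const
      | exact V.f_smooth _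
      | exact contDiffOn_ite ((V.H_smooth _).inv (V.H_ne _)) contDiffOn_const
      | exact contDiffOn_ite (V.H_smooth _) contDiffOn_const

theorem IsValid.hY_smooth (V : M.IsValid S T) (a i : X ⊕ K ⊕ Υ) :
    ContDiffOn ℝ ∞ (M.hY a i) T := by
  rcases a with μ | k | α <;> rcases i with ν | j | β <;>
    first
      | exact contDiffOn_const
      | exact V.γ_metric.smooth _ _

theorem IsValid.B_smooth (V : M.IsValid S T) (ν : X) (k l : K) : ContDiffOn ℝ ∞ (M.B ν k l) S :=
  (((contDiffOn_ite ((V.t_smooth _ _).mul (V.H_smooth _)) contDiffOn_const).sub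
    (contDiffOn_ite ((V.t_smooth _ _).mul (V.H_smooth _)) contDiffOn_const)).sub
    (contDiffOn_ite ((V.t_smooth _ _).mul (V.H_smooth _)) contDiffOn_const)).add
    (contDiffOn_ite (V.D_smooth _) contDiffOn_const)

theorem IsValid.L_smooth (V : M.IsValid S T) (ν : X) (k l : K) : ContDiffOn ℝ ∞ (M.L ν k l) S :=
  (contDiffOn_ite (V.t_smooth _ _) contDiffOn_const).sub
    (contDiffOn_ite (V.t_smooth _ _) contDiffOn_const)

theorem IsValid.cX_smooth (V : M.IsValid S T) (l m n : X) : ContDiffOn ℝ ∞ (M.cX l m n) S :=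
  (((contDiffOn_ite (contDiffOn_const.mul (V.t_smooth _ _)) contDiffOn_const).add
    (contDiffOn_ite (contDiffOn_const.mul (V.t_smooth _ _)) contDiffOn_const)).sub
    (contDiffOn_ite (contDiffOn_const.mul
      (((V.H_smooth _).mul (V.t_smooth _ _)).div (V.H_smooth _) (V.H_ne _))) contDiffOn_const)).sub
    (contDiffOn_ite (contDiffOn_const.mul ((V.D_smooth _).div (V.H_smooth _) (V.H_ne _)))
      contDiffOn_const)

theorem IsValid.connX_smooth (V : M.IsValid S T) (c a b : X ⊕ K ⊕ Υ) :
    ContDiffOn ℝ ∞ (M.connX c a b) S := by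
  rcases c with ρ | l | δ <;> rcases a with μ | k | α <;> rcases b with ν | j | β <;>
    first
      | exact contDiffOn_const
      | exact V.cX_smooth _ _ _
      | exact contDiffOn_const.mul ((V.H_smooth _).mul (V.B_smooth _ _ _))
      | exact contDiffOn_const.mul ((V.H_smooth _).mul ((V.φ_smooth _ _).mul (V.f_smooth _)))
      | exact contDiffOn_const.mul ((V.B_smooth _ _ _).div (V.H_smooth _) (V.H_ne _))
      | exact (contDiffOn_const.mul ((V.B_smooth _ _ _).div (V.H_smooth _) (V.H_ne _))).sub
          (V.L_smooth _ _ _)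
      | exact contDiffOn_const.mul (V.C_smooth _ _)
      | exact contDiffOn_const.mul (V.φ_smooth _ _)
      | exact contDiffOn_const.mul
          (((V.H_smooth _).mul (V.C_smooth _ _)).div (V.f_smooth _) (V.f_ne _))

theorem IsValid.kahlerForm_smooth (V : M.IsValid S T) (α β : Υ) :
    ContDiffOn ℝ ∞ (fun y => kahlerForm M.γ M.J y α β) T := by
  simp only [kahlerForm, Matrix.mul_apply, Matrix.transpose_apply]
  exact ContDiffOn.sum fun δ _ => (V.J_smooth δ α).mul (V.γ_metric.smooth δ β)

theorem IsValid.connY_smooth (V : M.IsValid S T) (c a b : X ⊕ K ⊕ Υ) :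
    ContDiffOn ℝ ∞ (M.connY c a b) T := by
  rcases c with ρ | l | δ <;> rcases a with μ | k | α <;> rcases b with ν | j | β <;>
    first
      | exact contDiffOn_const
      | exact V.γ_metric.smooth _ _
      | exact V.kahlerForm_smooth _ _
      | exact V.J_smooth _ _
      | exact contDiffOn_christoffel V.openT V.γ_metric _ _ _

theorem xPart_frame (a : X ⊕ K ⊕ Υ) (p : X ⊕ K ⊕ Υ → ℝ) :
    xPart (M.frame a p) = Sum.elim (fun μ => Pi.single μ 1) (fun _ => 0) a := by
  funext ν
  rcases a with μ | k | α <;> simp [xPart, frame, sepFun, frX, frY, Pi.single_apply, eq_comm]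

theorem yPart_frame (a : X ⊕ K ⊕ Υ) (p : X ⊕ K ⊕ Υ → ℝ) :
    yPart (M.frame a p)
      = Sum.elim (fun _ => 0) (Sum.elim (fun _ => 0) fun α => Pi.single α 1) a := by
  funext ν
  rcases a with μ | k | α <;> simp [yPart, frame, sepFun, frX, frY, Pi.single_apply, eq_comm]

/-- Vertical vectors project to zero in both factors, and the lift of `∂_α` projects to `∂_α`. Hence
neither the `ψ`-coordinates nor the potentials `A` enter the frame derivatives of the connection
coefficients. -/
theorem fderiv_sepFun_frame (hS : IsOpen S) (hT : IsOpen T) {u : (X → ℝ) → ℝ}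
    {v : (Υ → ℝ) → ℝ} (hu : ContDiffOn ℝ ∞ u S) (hv : ContDiffOn ℝ ∞ v T)
    {p : X ⊕ K ⊕ Υ → ℝ} (hp : p ∈ cylinder K S T) (a : X ⊕ K ⊕ Υ) :
    fderiv ℝ (sepFun u v) p (M.frame a p) =
      Sum.elim (fun μ => pd μ u (xPart p) * v (yPart p)) (Sum.elim (fun _ => 0)
        fun α => u (xPart p) * pd α v (yPart p)) a := by
  rw [fderiv_sepFun (ContDiffOn.diffAt hS hu hp.1) (ContDiffOn.diffAt hT hv hp.2), xPart_frame,
    yPart_frame]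
  rcases a with μ | k | α <;> simp [pd]

theorem IsValid.coframe_frame (V : M.IsValid S T) {p : X ⊕ K ⊕ Υ → ℝ} (hp : p ∈ cylinder K S T)
    (a b : X ⊕ K ⊕ Υ) :
    ∑ i, M.coframe a p i * M.frame b p i = if a = b then 1 else 0 := by
  have hd := V.dual _ hp.1
  rcases a with μ | k | α <;> rcases b with ν | l | β <;>
    simp [coframe, frame, sepFun, frX, frY, Pi.single_apply, hd, eq_comm]

theorem inn_metric (V : M.IsValid S T) {p : X ⊕ K ⊕ Υ → ℝ} (hp : p ∈ cylinder K S T)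
    (b c : X ⊕ K ⊕ Υ) : inn M.metric p (M.frame b p) (M.frame c p) = M.frameMetric p b c := by
  have h1 : inn M.metric p (M.frame b p) (M.frame c p)
      = ∑ a, ∑ d, M.frameMetric p a d * (∑ i, M.coframe a p i * M.frame b p i)
        * ∑ j, M.coframe d p j * M.frame c p j := by
    simp only [inn, metric, Matrix.of_apply, Finset.sum_mul, Finset.mul_sum]
    rw [Finset.sum_congr rfl fun k _ => Finset.sum_comm, Finset.sum_comm]
    refine Finset.sum_congr rfl fun a _ => ?_
    rw [Finset.sum_congr rfl fun k _ => Finset.sum_congr rfl fun l _ => rfl]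
    rw [Finset.sum_congr rfl fun k _ => Finset.sum_comm, Finset.sum_comm]
    refine Finset.sum_congr rfl fun d _ => ?_
    rw [Finset.sum_comm]
    refine Finset.sum_congr rfl fun k _ => Finset.sum_congr rfl fun l _ => ?_
    ring
  rw [h1]
  simp [V.coframe_frame hp]

end FibData

end GenKerrNUT

namespace GenKerrNUT

/-! ### The stated coefficients form the Levi-Civita connection -/

namespace FibData

variable {X K Υ Bl : Type} [Fintype X] [Fintype K] [Fintype Υ]
  [DecidableEq X] [DecidableEq K] [DecidableEq Υ]
  {M : FibData X K Υ Bl} {S : Set (X → ℝ)} {T : Set (Υ → ℝ)}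

theorem IsValid.coframe_smooth (V : M.IsValid S T) (a i : X ⊕ K ⊕ Υ) :
    ContDiffOn ℝ ∞ (fun q => M.coframe a q i) (cylinder K S T) := by
  have hx : ∀ k j, ContDiffOn ℝ ∞ (fun q : X ⊕ K ⊕ Υ → ℝ => M.et k j (xPart q))
      (cylinder K S T) := fun k j =>
    (V.et_smooth k j).comp contDiff_xPart.contDiffOn fun _ hq => hq.1
  have hy : ∀ k α, ContDiffOn ℝ ∞ (fun q : X ⊕ K ⊕ Υ → ℝ => M.A k (yPart q) α)
      (cylinder K S T) := fun k α =>
    (V.A_smooth k α).comp contDiff_yPart.contDiffOn fun _ hq => hq.2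
  rcases a with μ | k | α <;> rcases i with ν | j | β <;>
    first
      | exact contDiffOn_const
      | exact hx _ _
      | exact ContDiffOn.sum fun j _ => (hx _ _).mul (hy _ _)

theorem IsValid.frameMetric_symm (V : M.IsValid S T) {p : X ⊕ K ⊕ Υ → ℝ}
    (hp : p ∈ cylinder K S T) (a b : X ⊕ K ⊕ Υ) :
    M.frameMetric p a b = M.frameMetric p b a := by
  rcases a with μ | k | α <;> rcases b with ν | l | β <;>
    simp only [frameMetric, Matrix.of_apply, sepFun, hX, hY]
  · by_cases h : μ = ν
    · subst h; rfl
    · simp [h, Ne.symm h]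
  · by_cases h : k = l
    · subst h; rfl
    · simp [h, Ne.symm h]
  · by_cases h : M.blk α = M.blk β
    · rw [h, V.γ_metric.symm _ hp.2]
    · rw [V.γ_blk _ hp.2 _ _ h, V.γ_blk _ hp.2 _ _ (Ne.symm h)]; simp

/-- `γ` is block diagonal, so a factor depending only on the block can be attached to either index.
This keeps the expressions below symmetric although they refer to the block of one index. -/
theorem IsValid.f_mul_γ (V : M.IsValid S T) {y : Υ → ℝ} (hy : y ∈ T) (F : Bl → ℝ) (α β : Υ) :
    F (M.blk α) * M.γ y α β = F (M.blk β) * M.γ y α β := by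
  by_cases h : M.blk α = M.blk β
  · rw [h]
  · rw [V.γ_blk _ hy _ _ h]; simp

/-- A null vector has zero `x`- and vertical components since the metric is diagonal there with
nonzero entries. On the base the conformal factors are absorbed into the vector by `f_mul_γ`, and
nondegeneracy of `γ` applies. -/
theorem IsValid.frameMetric_det (V : M.IsValid S T) {p : X ⊕ K ⊕ Υ → ℝ}
    (hp : p ∈ cylinder K S T) : (M.frameMetric p).det ≠ 0 := by
  intro h0
  obtain ⟨v, hv, hv0⟩ := Matrix.exists_mulVec_eq_zero_iff.2 h0
  apply hv
  have h : ∀ a, ∑ b, M.frameMetric p a b * v b = 0 := fun a => congrFun hv0 a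
  have hα : (fun α => M.f (M.blk α) (xPart p) * v (Sum.inr (Sum.inr α))) = 0 := by
    refine Matrix.eq_zero_of_mulVec_eq_zero (V.γ_metric.nondeg _ hp.2) (funext fun α => ?_)
    have := h (.inr (.inr α))
    simp only [Fintype.sum_sum_type, frameMetric, Matrix.of_apply, sepFun, hX, hY, zero_mul,
      Finset.sum_const_zero, zero_add] at this
    rw [Matrix.mulVec, dotProduct, Pi.zero_apply, ← this]
    refine Finset.sum_congr rfl fun β _ => ?_
    have h1 : M.f (M.blk α) (xPart p) * M.γ (yPart p) α β
        = M.f (M.blk β) (xPart p) * M.γ (yPart p) α β :=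
      V.f_mul_γ hp.2 (fun b => M.f b (xPart p)) α β
    rw [h1]; ring
  funext a
  rcases a with μ | k | α
  · have := h (.inl μ)
    simpa [frameMetric, sepFun, hX, hY, V.H_ne _ _ hp.1] using this
  · have := h (.inr (.inl k))
    simpa [frameMetric, sepFun, hX, hY, V.H_ne _ _ hp.1] using this
  · have := congrFun hα α
    simpa [V.f_ne _ _ hp.1] using this

theorem IsValid.isMetricOn (V : M.IsValid S T) : IsMetricOn (cylinder K S T) M.metric where
  smooth i j := by
    refine ContDiffOn.sum fun a _ => ContDiffOn.sum fun b _ => ?_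
    exact ((contDiffOn_sepFun (V.hX_smooth a b) (V.hY_smooth a b)).mul
      (V.coframe_smooth a i)).mul (V.coframe_smooth b j)
  symm p hp i j := by
    simp only [metric, Matrix.of_apply]
    rw [Finset.sum_comm]
    refine Finset.sum_congr rfl fun a _ => Finset.sum_congr rfl fun b _ => ?_
    rw [V.frameMetric_symm hp b a]; ring
  nondeg p hp := by
    have h1 : M.metric p = (Matrix.of fun a i => M.coframe a p i).transpose
        * (M.frameMetric p * (Matrix.of fun a i => M.coframe a p i)) := by
      ext i j
      simp only [metric, Matrix.of_apply, Matrix.mul_apply, Matrix.transpose_apply, Finset.mul_sum]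
      exact Finset.sum_congr rfl fun a _ => Finset.sum_congr rfl fun b _ => by ring
    have h2 : (Matrix.of fun a i => M.coframe a p i) * (Matrix.of fun i a => M.frame a p i) = 1 := by
      ext a b
      rw [Matrix.mul_apply, Matrix.one_apply]
      exact V.coframe_frame hp a b
    have h3 : (Matrix.of fun a i => M.coframe a p i).det ≠ 0 := by
      intro h
      have := congrArg Matrix.det h2
      rw [Matrix.det_mul, h, zero_mul, Matrix.det_one] at this
      exact zero_ne_one this
    rw [h1, Matrix.det_mul, Matrix.det_mul, Matrix.det_transpose]
    exact mul_ne_zero h3 (mul_ne_zero (V.frameMetric_det hp) h3)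

theorem IsValid.fderiv_frame (V : M.IsValid S T) {p : X ⊕ K ⊕ Υ → ℝ}
    (hp : p ∈ cylinder K S T) (a b i : X ⊕ K ⊕ Υ) :
    fderiv ℝ (fun q => M.frame b q i) p (M.frame a p) =
      Sum.elim (fun μ => pd μ (M.frX b i) (xPart p) * M.frY b i (yPart p))
        (Sum.elim (fun _ => 0) fun α => M.frX b i (xPart p) * pd α (M.frY b i) (yPart p)) a :=
  fderiv_sepFun_frame V.openS V.openT (V.frX_smooth b i) (V.frY_smooth b i) hp a

theorem sum_mul_frame_inl (u : X ⊕ K ⊕ Υ → ℝ) (p : X ⊕ K ⊕ Υ → ℝ) (ρ : X) :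
    ∑ c, u c * M.frame c p (.inl ρ) = u (.inl ρ) := by
  simp [Fintype.sum_sum_type, frame, sepFun, frX, frY]

theorem sum_mul_frame_inr (u : X ⊕ K ⊕ Υ → ℝ) (p : X ⊕ K ⊕ Υ → ℝ) (δ : Υ) :
    ∑ c, u c * M.frame c p (.inr (.inr δ)) = u (.inr (.inr δ)) := by
  simp [Fintype.sum_sum_type, frame, sepFun, frX, frY]

theorem sum_mul_frame_psi (u : X ⊕ K ⊕ Υ → ℝ) (p : X ⊕ K ⊕ Υ → ℝ) (j : K) :
    ∑ c, u c * M.frame c p (.inr (.inl j)) = ∑ k, u (.inr (.inl k)) * M.eh k j (xPart p)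
      - ∑ α, u (.inr (.inr α)) * M.A j (yPart p) α := by
  simp [Fintype.sum_sum_type, frame, sepFun, frX, frY, sub_eq_add_neg]

theorem cX_symm (l m n : X) (x : X → ℝ) : M.cX l m n x = M.cX l n m x := by
  by_cases h : m = n
  · rw [h]
  · have h' : ¬(l = m ∧ m = n) := fun h'' => h h''.2
    have h'' : ¬(l = n ∧ n = m) := fun h'' => h h''.2.symm
    simp only [cX, if_neg h, if_neg (Ne.symm h), if_neg h', if_neg h'']
    ring

theorem B_symm (ν : X) (k l : K) (x : X → ℝ) : M.B ν k l x = M.B ν l k x := by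
  by_cases h : k = l
  · rw [h]
  · simp only [B, if_neg h, if_neg (Ne.symm h), and_comm (a := k = M.e ν)]
    ring

theorem IsValid.pd_eh (V : M.IsValid S T) {x : X → ℝ} (hx : x ∈ S) (ν : X) (k j : K) :
    pd ν (M.eh k j) x = -∑ l, M.L ν l k x * M.eh l j x := by
  rw [V.deh x hx]
  simp only [L, sub_mul, Finset.sum_sub_distrib]
  by_cases h : k = M.e ν
  · simp [h]; ring
  · simp [h]

theorem IsValid.C_kahlerForm (V : M.IsValid S T) {y : Υ → ℝ} (hy : y ∈ T) (F : Bl → ℝ) (α β : Υ) :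
    F (M.blk α) * kahlerForm M.γ M.J y α β = F (M.blk β) * kahlerForm M.γ M.J y α β := by
  by_cases h : M.blk α = M.blk β
  · rw [h]
  · have : kahlerForm M.γ M.J y α β = 0 := by
      rw [kahlerForm, Matrix.mul_apply]
      refine Finset.sum_eq_zero fun δ _ => ?_
      rw [Matrix.transpose_apply]
      by_cases h1 : M.blk δ = M.blk α
      · rw [V.γ_blk y hy δ β (h1 ▸ h), mul_zero]
      · rw [V.J_blk y hy δ α h1, zero_mul]
    rw [this]; simp

set_option maxHeartbeats 4000000 in
-- The nontrivial brackets are `[∂_ν, eh k]`, which is governed by `deh`, and the bracket of two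
-- horizontal lifts. The latter is vertical with `ψ_j`-component `-dA_j`, and `dA` together with
-- `C_eh` writes it as a combination of the `eh k` with coefficients `-C_k` times the Kähler form.
theorem IsValid.torsion (V : M.IsValid S T) {p : X ⊕ K ⊕ Υ → ℝ}
    (hp : p ∈ cylinder K S T) (a b i : X ⊕ K ⊕ Υ) :
    ∑ c, (M.conn c a b p - M.conn c b a p) * M.frame c p i
      = fderiv ℝ (fun q => M.frame b q i) p (M.frame a p)
        - fderiv ℝ (fun q => M.frame a q i) p (M.frame b p) := by
  rw [V.fderiv_frame hp, V.fderiv_frame hp]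
  rcases a with μ | k | α <;> rcases b with ν | l | β <;> rcases i with ρ | j | δ <;>
    simp only [sum_mul_frame_inl, sum_mul_frame_inr, sum_mul_frame_psi, conn, sepFun, connX, connY, frX, frY, pd_const, Sum.elim_inl, Sum.elim_inr, pd_neg] <;> simp
  · rw [cX_symm, sub_self]
  · rw [V.pd_eh hp.1]
  · rw [V.pd_eh hp.1, neg_neg]
  · rw [B_symm]; ring
  · have h1 : M.φ ρ (M.blk α) (xPart p) * M.f (M.blk α) (xPart p) * M.γ (yPart p) α β
        = M.φ ρ (M.blk β) (xPart p) * M.f (M.blk β) (xPart p) * M.γ (yPart p) α β :=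
      V.f_mul_γ hp.2 (fun b => M.φ ρ b (xPart p) * M.f b (xPart p)) α β
    rw [V.γ_metric.symm _ hp.2 β α]
    linear_combination (-(1 / 2) * M.H (M.e ρ) (xPart p)) * h1
  -- The vertical component of the bracket of two lifts. The Christoffel contributions drop out by
  -- symmetry; skewness of the Kähler form adds the two halves of the curvature term.
  · have h1 : ∀ k, M.C k (M.blk α) (xPart p) * kahlerForm M.γ M.J (yPart p) α β
        = M.C k (M.blk β) (xPart p) * kahlerForm M.γ M.J (yPart p) α β := fun k =>
      V.C_kahlerForm hp.2 (fun b => M.C k b (xPart p)) α β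
    have h2 : ∀ δ, christoffel M.γ δ α β (yPart p) - christoffel M.γ δ β α (yPart p) = 0 :=
      fun δ => by rw [christoffel_symm V.openT V.γ_metric hp.2, sub_self]
    have h3 := V.dA _ hp.2 j α β
    rw [← V.C_eh _ hp.1, Finset.sum_mul] at h3
    simp only [h2, zero_mul, Finset.sum_const_zero, sub_zero]
    rw [← neg_inj, ← sub_eq_zero, ← Finset.sum_neg_distrib]
    rw [sub_eq_iff_eq_add, zero_add]
    rw [show -(-pd α (fun q => M.A j q β) (yPart p) + pd β (fun q => M.A j q α) (yPart p))
      = pd α (fun q => M.A j q β) (yPart p) - pd β (fun q => M.A j q α) (yPart p) by ring, h3]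
    refine Finset.sum_congr rfl fun k _ => ?_
    rw [V.skew _ hp.2 β α]
    linear_combination (-(1 / 2) * M.eh k j (xPart p)) * h1 k
  · rw [christoffel_symm V.openT V.γ_metric hp.2, sub_self]

theorem IsValid.fderiv_frameMetric (V : M.IsValid S T) {p : X ⊕ K ⊕ Υ → ℝ}
    (hp : p ∈ cylinder K S T) (a b i : X ⊕ K ⊕ Υ) :
    fderiv ℝ (fun q => M.frameMetric q b i) p (M.frame a p) =
      Sum.elim (fun μ => pd μ (M.hX b i) (xPart p) * M.hY b i (yPart p))
        (Sum.elim (fun _ => 0) fun α => M.hX b i (xPart p) * pd α (M.hY b i) (yPart p)) a :=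
  fderiv_sepFun_frame V.openS V.openT (V.hX_smooth b i) (V.hY_smooth b i) hp a

theorem IsValid.sum_J_γ (V : M.IsValid S T) {y : Υ → ℝ} (hy : y ∈ T) (F : Bl → ℝ) (α β : Υ) :
    ∑ δ, M.J y δ α * (F (M.blk δ) * M.γ y δ β) = F (M.blk α) * kahlerForm M.γ M.J y α β := by
  rw [kahlerForm, Matrix.mul_apply, Finset.mul_sum]
  refine Finset.sum_congr rfl fun δ _ => ?_
  rw [Matrix.transpose_apply]
  by_cases h : M.blk δ = M.blk α
  · rw [h]; ring
  · rw [V.J_blk y hy δ α h]; ring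

theorem IsValid.sum_J_γ' (V : M.IsValid S T) {y : Υ → ℝ} (hy : y ∈ T) (F : Bl → ℝ) (α β : Υ) :
    ∑ δ, M.J y δ α * (F (M.blk β) * M.γ y β δ) = F (M.blk α) * kahlerForm M.γ M.J y α β := by
  rw [← V.sum_J_γ hy]
  refine Finset.sum_congr rfl fun δ _ => ?_
  rw [V.f_mul_γ hy, V.γ_metric.symm y hy]

theorem IsValid.t_self' (V : M.IsValid S T) {x : X → ℝ} (hx : x ∈ S) {ν : X} {k : K}
    (h : k = M.e ν) : M.t ν k x = 0 := by rw [h, V.t_self ν x hx]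

set_option maxHeartbeats 4000000 in
-- Along `∂_μ` the metric varies through `H` and `f`, whose derivatives `dH` and `df` are built into
-- the coefficients; along vertical fields it is constant; along horizontal lifts it varies as `γ`
-- does.
theorem IsValid.compat (V : M.IsValid S T) {p : X ⊕ K ⊕ Υ → ℝ}
    (hp : p ∈ cylinder K S T) (a b c : X ⊕ K ⊕ Υ) :
    fderiv ℝ (fun q => M.frameMetric q b c) p (M.frame a p)
      = ∑ d, (M.conn d a b p * M.frameMetric p d c + M.conn d a c p * M.frameMetric p b d) := by
  rw [V.fderiv_frameMetric hp]
  rcases a with μ | k | α <;> rcases b with ν | l | β <;> rcases c with ρ | j | δ <;>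
    simp only [Fintype.sum_sum_type, conn, sepFun, connX, connY, hX, hY, frameMetric,
      Matrix.of_apply, pd_const, Sum.elim_inl, Sum.elim_inr] <;> simp
  · have hH : ∀ μ, M.H (M.e μ) (xPart p) ≠ 0 := fun μ => V.H_ne _ _ hp.1
    have ht : ∀ μ, M.t μ (M.e μ) (xPart p) = 0 := fun μ => V.t_self _ _ hp.1
    simp only [Finset.sum_add_distrib, Finset.sum_ite_eq, Finset.sum_ite_eq', Finset.mem_univ,
      if_true]
    by_cases h : ν = ρ
    · subst h
      simp only [if_true]
      rw [pd_inv (ContDiffOn.diffAt V.openS (V.H_smooth _) hp.1) (hH ν), V.dH _ _ _ hp.1]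
      by_cases h2 : μ = ν
      · subst h2
        simp only [cX, ht, if_true, and_self]
        have := hH μ
        field_simp
        ring
      · have h3 : M.e ν ≠ M.e μ := fun h' => h2 (V.e_inj h').symm
        simp only [cX, if_true, if_neg h2, if_neg h3, if_neg (fun h' : ν = μ ∧ μ = ν => h2 h'.2)]
        have := hH ν
        field_simp
        ring
    · simp only [if_neg h, pd_const, cX, if_neg (fun h' : ρ = μ ∧ μ = ν => h (h'.1.trans h'.2).symm),
        if_neg (fun h' : ν = μ ∧ μ = ρ => h (h'.1.trans h'.2)), if_neg (Ne.symm h)]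
      have h1 := hH ν
      have h2 := hH ρ
      by_cases h3 : μ = ρ
      · subst h3
        simp only [if_true, if_neg (Ne.symm h)]
        field_simp
        ring
      · by_cases h4 : μ = ν
        · subst h4
          simp only [if_true, if_neg h]
          field_simp
          ring
        · simp only [if_neg h3, if_neg h4]
          ring
  -- Two vertical indices: `B` minus the two bracket terms `L` has to be the derivative of the
  -- diagonal matrix of the `H k`, so the off-diagonal terms must cancel.
  · have hH : ∀ k, M.H k (xPart p) ≠ 0 := fun k => V.H_ne _ _ hp.1
    simp only [Finset.sum_add_distrib, Finset.sum_ite_eq, Finset.sum_ite_eq', Finset.mem_univ,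
      if_true]
    have h1 := hH l
    have h2 := hH j
    rw [B_symm μ l j]
    have e : (2⁻¹ * (M.B μ j l (xPart p) / M.H j (xPart p)) - M.L μ j l (xPart p)) * M.H j (xPart p)
        + (2⁻¹ * (M.B μ j l (xPart p) / M.H l (xPart p)) - M.L μ l j (xPart p)) * M.H l (xPart p)
        = M.B μ j l (xPart p) - M.L μ j l (xPart p) * M.H j (xPart p)
          - M.L μ l j (xPart p) * M.H l (xPart p) := by
      field_simp; ring
    rw [e]
    by_cases h : l = j
    · subst h
      simp only [if_true, B, L, and_self]
      rw [V.dH _ _ _ hp.1]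
      by_cases h3 : l = M.e μ
      · simp only [if_pos h3, V.t_self' hp.1 h3]; ring
      · simp only [if_neg h3]; ring
    · simp only [if_neg h, if_neg (Ne.symm h), pd_const, B, L,
        if_neg (fun h' : j = M.e μ ∧ l = M.e μ => h (h'.2.trans h'.1.symm))]
      by_cases h3 : l = M.e μ <;> by_cases h4 : j = M.e μ
      · exact absurd (h3.trans h4.symm) h
      · simp only [if_pos h3, if_neg h4]; ring
      · simp only [if_neg h3, if_pos h4]; ring
      · simp only [if_neg h3, if_neg h4]; ring
  · simp only [Finset.sum_add_distrib, Finset.sum_ite_eq, Finset.sum_ite_eq', Finset.mem_univ,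
      if_true]
    rw [V.df _ _ _ hp.1]
    have h1 := V.f_mul_γ hp.2 (fun b => M.φ μ b (xPart p)) β δ
    linear_combination (1 / 2) * M.f (M.blk β) (xPart p) * h1
  · have h1 := V.H_ne (M.e ν) _ hp.1
    have h2 := V.H_ne j _ hp.1
    rw [B_symm ν j k]
    field_simp; ring
  · have h1 := V.H_ne (M.e ρ) _ hp.1
    have h2 := V.H_ne l _ hp.1
    rw [B_symm ρ l k]
    field_simp; ring
  -- Vertical direction, two base indices: both terms are the same multiple of the Kähler form with
  -- exchanged indices, and it is skew.
  · have e : ∀ α ε x, 2⁻¹ * (M.H k (xPart p) * M.C k (M.blk α) (xPart p) / M.f (M.blk α) (xPart p))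
        * M.J (yPart p) x α * ε = 2⁻¹ * (M.H k (xPart p) * M.C k (M.blk α) (xPart p)
          / M.f (M.blk α) (xPart p)) * (M.J (yPart p) x α * ε) := fun _ _ _ => by ring
    simp only [Finset.sum_add_distrib, e, ← Finset.mul_sum]
    rw [V.sum_J_γ hp.2 (fun b => M.f b (xPart p)), V.sum_J_γ' hp.2 (fun b => M.f b (xPart p)),
      V.skew _ hp.2 δ β]
    have h1 := V.f_ne (M.blk β) _ hp.1
    have h2 := V.f_ne (M.blk δ) _ hp.1
    have h3 := V.C_kahlerForm hp.2 (fun b => M.C k b (xPart p)) β δ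
    field_simp
    linear_combination (-M.H k (xPart p)) * h3
  · have h1 := V.H_ne (M.e ν) _ hp.1
    field_simp; ring
  · have e : ∀ α ε x, 2⁻¹ * (M.H l (xPart p) * M.C l (M.blk α) (xPart p) / M.f (M.blk α) (xPart p))
        * M.J (yPart p) x α * ε = 2⁻¹ * (M.H l (xPart p) * M.C l (M.blk α) (xPart p)
          / M.f (M.blk α) (xPart p)) * (M.J (yPart p) x α * ε) := fun _ _ _ => by ring
    simp only [e, ← Finset.mul_sum]
    rw [V.sum_J_γ hp.2 (fun b => M.f b (xPart p))]
    have h1 := V.f_ne (M.blk α) _ hp.1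
    field_simp; ring
  · have h1 := V.H_ne (M.e ρ) _ hp.1
    have h2 := V.f_mul_γ hp.2 (fun b => M.f b (xPart p)) α β
    rw [V.γ_metric.symm _ hp.2 β α]
    field_simp
    linear_combination (M.φ ρ (M.blk α) (xPart p)) * h2
  · have e : ∀ α ε x, 2⁻¹ * (M.H j (xPart p) * M.C j (M.blk α) (xPart p) / M.f (M.blk α) (xPart p))
        * M.J (yPart p) x α * ε = 2⁻¹ * (M.H j (xPart p) * M.C j (M.blk α) (xPart p)
          / M.f (M.blk α) (xPart p)) * (M.J (yPart p) x α * ε) := fun _ _ _ => by ring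
    simp only [e, ← Finset.mul_sum]
    rw [V.sum_J_γ' hp.2 (fun b => M.f b (xPart p))]
    have h1 := V.f_ne (M.blk α) _ hp.1
    field_simp; ring
  -- Purely base indices: compatibility of `γ` itself. The conformal factor sits on different
  -- indices in the two sums; `Γ_blk` identifies them, as symbols mixing blocks vanish.
  · rw [pd_metric V.openT V.γ_metric hp.2, mul_add, Finset.mul_sum, Finset.mul_sum,
      ← Finset.sum_add_distrib]
    refine Finset.sum_congr rfl fun x _ => ?_
    rw [V.γ_metric.symm _ hp.2 δ x]
    by_cases h : M.blk x = M.blk β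
    · rw [h]; ring
    · rw [V.Γ_blk _ hp.2 x α β fun h' => h h'.2.symm]; ring

theorem IsValid.isLeviCivitaFrame (V : M.IsValid S T) :
    IsLeviCivitaFrame (cylinder K S T) M.metric M.frameMetric M.frame M.coframe M.conn where
  smooth a i := contDiffOn_sepFun (V.frX_smooth a i) (V.frY_smooth a i)
  dual _ hp := V.coframe_frame hp
  comp _ hp := inn_metric V hp
  torsion _ hp := V.torsion hp
  compat _ hp := V.compat hp

end FibData

end GenKerrNUT

namespace GenKerrNUT

/-! ### The Ricci tensor of the fibration, block by block -/

namespace FibData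

variable {X K Υ Bl : Type} [Fintype X] [Fintype K] [Fintype Υ]
  [DecidableEq X] [DecidableEq K] [DecidableEq Υ]
  {M : FibData X K Υ Bl} {S : Set (X → ℝ)} {T : Set (Υ → ℝ)}

variable (M) in
/-- The divergence of `∂_ν`. -/
def w (ν : X) (x : X → ℝ) : ℝ :=
  ∑ l, M.cX l l ν x + ∑ k, (1 / 2) * (M.B ν k k x / M.H k x)
    + ∑ α, (1 / 2) * M.φ ν (M.blk α) x

variable (M) in
/-- The divergence of the frame, `x`-dependent factor. -/
def divX : X ⊕ K ⊕ Υ → (X → ℝ) → ℝ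
  | .inl ν => M.w ν
  | .inr (.inl _) => fun _ => 0
  | .inr (.inr _) => fun _ => 1

variable (M) in
/-- The divergence of the frame, base-dependent factor. -/
def divY : X ⊕ K ⊕ Υ → (Υ → ℝ) → ℝ
  | .inl _ => fun _ => 1
  | .inr (.inl _) => fun _ => 1
  | .inr (.inr α) => fun y => ∑ δ, christoffel M.γ δ δ α y

theorem IsValid.w_smooth (V : M.IsValid S T) (ν : X) : ContDiffOn ℝ ∞ (M.w ν) S :=
  ((ContDiffOn.sum fun _ _ => V.cX_smooth _ _ _).add (ContDiffOn.sum fun _ _ =>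
    contDiffOn_const.mul ((V.B_smooth _ _ _).div (V.H_smooth _) (V.H_ne _)))).add
    (ContDiffOn.sum fun _ _ => contDiffOn_const.mul (V.φ_smooth _ _))

theorem IsValid.divX_smooth (V : M.IsValid S T) (a : X ⊕ K ⊕ Υ) : ContDiffOn ℝ ∞ (M.divX a) S := by
  rcases a with μ | k | α
  exacts [V.w_smooth μ, contDiffOn_const, contDiffOn_const]

theorem IsValid.divY_smooth (V : M.IsValid S T) (a : X ⊕ K ⊕ Υ) : ContDiffOn ℝ ∞ (M.divY a) T := by
  rcases a with μ | k | α
  exacts [contDiffOn_const, contDiffOn_const, ContDiffOn.sum fun _ _ =>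
    contDiffOn_christoffel V.openT V.γ_metric _ _ _]

/-- Divergences of the frame fields. A vertical field has as divergence a trace of `J` weighted by
blocks, which is zero; a horizontal lift has the divergence of `∂_α` with respect to `γ`. -/
theorem IsValid.sum_conn (V : M.IsValid S T) {p : X ⊕ K ⊕ Υ → ℝ}
    (hp : p ∈ cylinder K S T) (b : X ⊕ K ⊕ Υ) :
    ∑ a, M.conn a a b p = sepFun (M.divX b) (M.divY b) p := by
  rcases b with μ | k | α <;>
    simp only [Fintype.sum_sum_type, conn, sepFun, connX, connY, divX, divY]
  · simp [w, add_assoc]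
  · have := V.J_trace _ hp.2 fun b => 1 / 2 * (M.H k (xPart p) * M.C k b (xPart p)
      / M.f b (xPart p))
    simpa using this
  · simp

theorem IsValid.fderiv_conn (V : M.IsValid S T) {p : X ⊕ K ⊕ Υ → ℝ}
    (hp : p ∈ cylinder K S T) (c a b d : X ⊕ K ⊕ Υ) :
    fderiv ℝ (M.conn c a b) p (M.frame d p) =
      Sum.elim (fun μ => pd μ (M.connX c a b) (xPart p) * M.connY c a b (yPart p))
        (Sum.elim (fun _ => 0) fun α => M.connX c a b (xPart p) * pd α (M.connY c a b) (yPart p))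
        d :=
  fderiv_sepFun_frame V.openS V.openT (V.connX_smooth c a b) (V.connY_smooth c a b) hp d

variable (M) in
/-- The Ricci tensor in the frame. -/
def frameRicci (p : X ⊕ K ⊕ Υ → ℝ) (b d : X ⊕ K ⊕ Υ) : ℝ :=
  ∑ j, (∑ i, ricci M.metric p i j * M.frame b p i) * M.frame d p j

theorem IsValid.frameRicci_eq (V : M.IsValid S T) {p : X ⊕ K ⊕ Υ → ℝ}
    (hp : p ∈ cylinder K S T) (b d : X ⊕ K ⊕ Υ) :
    M.frameRicci p b d =
      ∑ a, fderiv ℝ (M.conn a d b) p (M.frame a p)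
        - Sum.elim (fun μ => pd μ (M.divX b) (xPart p) * M.divY b (yPart p))
          (Sum.elim (fun _ => 0) fun α => M.divX b (xPart p) * pd α (M.divY b) (yPart p)) d
        + ∑ e, sepFun (M.divX e) (M.divY e) p * M.conn e d b p
        - ∑ a, ∑ e, M.conn e a d p * M.conn a e b p := by
  have hU := isOpen_cylinder (K := K) V.openS V.openT
  rw [frameRicci, V.isLeviCivitaFrame.ricci_eq hU V.isMetricOn
    (fun a b c q hq => ContDiffOn.diffAt hU
      (contDiffOn_sepFun (V.connX_smooth c a b) (V.connY_smooth c a b)) hq) hp]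
  have h1 : (fun q => ∑ a, M.conn a a b q) =ᶠ[nhds p] sepFun (M.divX b) (M.divY b) :=
    Filter.eventuallyEq_of_mem (hU.mem_nhds hp) fun q hq => V.sum_conn hq b
  rw [h1.fderiv_eq, fderiv_sepFun_frame V.openS V.openT (V.divX_smooth b) (V.divY_smooth b) hp d]
  simp only [V.sum_conn hp]

/-- Contracting `J` with the Kähler form produces `J²`, which is `-σ` on each block; the weight
comes out of the sum because `J` preserves blocks. -/
theorem IsValid.sum_J_kahlerForm (V : M.IsValid S T) {y : Υ → ℝ} (hy : y ∈ T) (F : Bl → ℝ)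
    (α β : Υ) : ∑ δ, F (M.blk δ) * M.J y δ α * kahlerForm M.γ M.J y δ β
      = -(F (M.blk α) * M.σ (M.blk α)) * M.γ y α β := by
  have h1 : ∀ δ, F (M.blk δ) * M.J y δ α = F (M.blk α) * M.J y δ α := fun δ => by
    by_cases h : M.blk δ = M.blk α
    · rw [h]
    · rw [V.J_blk y hy δ α h]; simp
  simp only [h1, kahlerForm, Matrix.mul_apply, Matrix.transpose_apply, Finset.mul_sum]
  rw [Finset.sum_comm]
  have h2 : ∀ ε, ∑ δ, F (M.blk α) * M.J y δ α * (M.J y ε δ * M.γ y ε β)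
      = F (M.blk α) * (∑ δ, M.J y ε δ * M.J y δ α) * M.γ y ε β := fun ε => by
    rw [Finset.mul_sum, Finset.sum_mul]
    exact Finset.sum_congr rfl fun δ _ => by ring
  simp only [h2, V.J_sq y hy]
  simp

/-- The only terms that survive the expansion form a block-weighted trace of `J`. -/
theorem IsValid.frameRicci_xk (V : M.IsValid S T) {p : X ⊕ K ⊕ Υ → ℝ}
    (hp : p ∈ cylinder K S T) (μ : X) (k : K) :
    M.frameRicci p (.inl μ) (.inr (.inl k)) = 0 ∧
      M.frameRicci p (.inr (.inl k)) (.inl μ) = 0 := by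
  have h := V.J_trace _ hp.2 fun b => (1 / 4) * M.φ μ b (xPart p)
    * (M.H k (xPart p) * M.C k b (xPart p) / M.f b (xPart p))
  constructor <;> rw [V.frameRicci_eq hp] <;>
    simp only [Fintype.sum_sum_type, V.fderiv_conn hp, Sum.elim_inl, Sum.elim_inr] <;>
    simp only [conn, sepFun, connX, connY, divX, divY, pd_const] <;> simp
  all_goals
    rw [← h]
    exact Finset.sum_congr rfl fun x _ => by ring

/-- Two contractions of Christoffel symbols with `φ` survive. They are opposite, because `φ` is
constant on blocks and the symbols do not mix blocks. -/
theorem IsValid.frameRicci_xy (V : M.IsValid S T) {p : X ⊕ K ⊕ Υ → ℝ}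
    (hp : p ∈ cylinder K S T) (μ : X) (α : Υ) :
    M.frameRicci p (.inl μ) (.inr (.inr α)) = 0 ∧
      M.frameRicci p (.inr (.inr α)) (.inl μ) = 0 := by
  have h : ∀ x, christoffel M.γ x x α (yPart p) * (2⁻¹ * M.φ μ (M.blk x) (xPart p))
      = christoffel M.γ x x α (yPart p) * (2⁻¹ * M.φ μ (M.blk α) (xPart p)) := fun x => by
    by_cases h : M.blk α = M.blk x
    · rw [h]
    · rw [V.Γ_blk _ hp.2 x x α fun h' => h h'.2]; simp
  constructor <;> rw [V.frameRicci_eq hp] <;>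
    simp only [Fintype.sum_sum_type, V.fderiv_conn hp, Sum.elim_inl, Sum.elim_inr] <;>
    simp only [conn, sepFun, connX, connY, divX, divY] <;> simp [pd_const]
  · simp only [h, Finset.sum_mul, sub_self]
  · simp only [mul_comm (2⁻¹ * _) (christoffel _ _ _ _ _), h, Finset.sum_mul, sub_self]

/-- What survives is a multiple of the divergence of `J`. This is where parallelism of the complex
structures enters. -/
theorem IsValid.frameRicci_ky (V : M.IsValid S T) {p : X ⊕ K ⊕ Υ → ℝ}
    (hp : p ∈ cylinder K S T) (k : K) (α : Υ) :
    M.frameRicci p (.inr (.inl k)) (.inr (.inr α)) = 0 ∧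
      M.frameRicci p (.inr (.inr α)) (.inr (.inl k)) = 0 := by
  have h := V.J_div _ hp.2 α
  have h2 : ∀ x z, christoffel M.γ z x α (yPart p) * (2⁻¹ * (M.H k (xPart p)
      * M.C k (M.blk z) (xPart p) / M.f (M.blk z) (xPart p)) * M.J (yPart p) x z)
      = (2⁻¹ * (M.H k (xPart p) * M.C k (M.blk α) (xPart p) / M.f (M.blk α) (xPart p)))
        * (christoffel M.γ z x α (yPart p) * M.J (yPart p) x z) := fun x z => by
    by_cases h : M.blk α = M.blk z
    · rw [h]; ring
    · rw [V.Γ_blk _ hp.2 z x α fun h' => h h'.2]; simp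
  have h3 : ∀ x, (∑ δ, christoffel M.γ δ δ x (yPart p)) * (2⁻¹ * (M.H k (xPart p)
      * M.C k (M.blk α) (xPart p) / M.f (M.blk α) (xPart p)) * M.J (yPart p) x α)
      = (2⁻¹ * (M.H k (xPart p) * M.C k (M.blk α) (xPart p) / M.f (M.blk α) (xPart p)))
        * ∑ δ, christoffel M.γ δ δ x (yPart p) * M.J (yPart p) x α := fun x => by
    rw [← Finset.sum_mul]; ring
  rw [Finset.sum_comm (f := fun δ ε => christoffel M.γ δ δ ε (yPart p) * M.J (yPart p) ε α)] at h
  constructor <;> rw [V.frameRicci_eq hp] <;>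
    simp only [Fintype.sum_sum_type, V.fderiv_conn hp, Sum.elim_inl, Sum.elim_inr] <;>
    simp only [conn, sepFun, connX, connY, divX, divY, pd_const] <;> simp
  · simp only [h2, h3, ← Finset.mul_sum]
    linear_combination (2⁻¹ * (M.H k (xPart p) * M.C k (M.blk α) (xPart p)
      / M.f (M.blk α) (xPart p))) * h
  · simp only [mul_comm (2⁻¹ * _ * _) (christoffel _ _ _ _ _)]
    rw [Finset.sum_comm (f := fun x z => christoffel M.γ x z α (yPart p) * (2⁻¹ * (M.H k (xPart p)
      * M.C k (M.blk x) (xPart p) / M.f (M.blk x) (xPart p)) * M.J (yPart p) z x))]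
    simp only [h2, h3, ← Finset.mul_sum]
    linear_combination (2⁻¹ * (M.H k (xPart p) * M.C k (M.blk α) (xPart p)
      / M.f (M.blk α) (xPart p))) * h

theorem IsValid.frameRicci_xx (V : M.IsValid S T) {p : X ⊕ K ⊕ Υ → ℝ}
    (hp : p ∈ cylinder K S T) (ν μ : X) :
    M.frameRicci p (.inl ν) (.inl μ) =
      ∑ l, pd l (M.cX l μ ν) (xPart p) - pd μ (M.w ν) (xPart p)
        + ∑ l, M.w l (xPart p) * M.cX l μ ν (xPart p)
        - ∑ l, ∑ m, M.cX m l μ (xPart p) * M.cX l m ν (xPart p)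
        - (1 / 4) * ∑ k, ∑ l, M.B μ l k (xPart p) / M.H l (xPart p)
          * (M.B ν k l (xPart p) / M.H k (xPart p))
        - (1 / 4) * ∑ α, M.φ μ (M.blk α) (xPart p) * M.φ ν (M.blk α) (xPart p) := by
  rw [V.frameRicci_eq hp]
  simp only [Fintype.sum_sum_type, V.fderiv_conn hp, Sum.elim_inl, Sum.elim_inr]
  simp only [conn, sepFun, connX, connY, divX, divY, pd_const]
  simp
  have h1 : ∀ k l, 2⁻¹ * (M.B μ l k (xPart p) / M.H l (xPart p)) * (2⁻¹ * (M.B ν k l (xPart p)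
      / M.H k (xPart p))) = 4⁻¹ * (M.B μ l k (xPart p) / M.H l (xPart p) * (M.B ν k l (xPart p)
      / M.H k (xPart p))) := fun k l => by ring
  have h2 : ∀ α, 2⁻¹ * M.φ μ (M.blk α) (xPart p) * (2⁻¹ * M.φ ν (M.blk α) (xPart p))
      = 4⁻¹ * (M.φ μ (M.blk α) (xPart p) * M.φ ν (M.blk α) (xPart p)) := fun α => by ring
  simp only [h1, h2, ← Finset.mul_sum]
  ring

theorem IsValid.frameRicci_kk (V : M.IsValid S T) {p : X ⊕ K ⊕ Υ → ℝ}
    (hp : p ∈ cylinder K S T) (k l : K) :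
    M.frameRicci p (.inr (.inl k)) (.inr (.inl l)) =
      ∑ μ, (-(1 / 2) * pd μ (fun x => M.H (M.e μ) x * M.B μ l k x) (xPart p)
        - (1 / 2) * M.w μ (xPart p) * (M.H (M.e μ) (xPart p) * M.B μ l k (xPart p))
        + (1 / 2) * M.H (M.e μ) (xPart p) * ∑ j, (M.B μ j l (xPart p) * M.B μ j k (xPart p)
            / M.H j (xPart p) - M.L μ j l (xPart p) * M.B μ j k (xPart p)
            - M.L μ j k (xPart p) * M.B μ j l (xPart p)))
      + (1 / 4) * M.H k (xPart p) * M.H l (xPart p) * ∑ α, M.C k (M.blk α) (xPart p)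
          * M.C l (M.blk α) (xPart p) / M.f (M.blk α) (xPart p) ^ 2 * M.σ (M.blk α) := by
  rw [V.frameRicci_eq hp]
  simp only [Fintype.sum_sum_type, V.fderiv_conn hp, Sum.elim_inl, Sum.elim_inr]
  simp only [conn, sepFun, connX, connY, divX, divY, pd_const]
  simp
  have h0 : ∀ μ, pd μ (fun x => -(2⁻¹ * (M.H (M.e μ) x * M.B μ l k x))) (xPart p)
      = -(2⁻¹ * pd μ (fun x => M.H (M.e μ) x * M.B μ l k x) (xPart p)) := fun μ => by
    rw [pd_neg, pd_const_mul]
    exact ContDiffOn.diffAt V.openS ((V.H_smooth _).mul (V.B_smooth _ _ _)) hp.1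
  -- The square of the fibration curvature: blocks decouple, and the trace of `J²` is collected from
  -- the diagonal of `J_sq`.
  have h1 : ∑ x, ∑ z, 2⁻¹ * (M.H l (xPart p) * M.C l (M.blk x) (xPart p)
      / M.f (M.blk x) (xPart p)) * M.J (yPart p) z x * (2⁻¹ * (M.H k (xPart p)
        * M.C k (M.blk z) (xPart p) / M.f (M.blk z) (xPart p)) * M.J (yPart p) x z)
      = -(4⁻¹ * M.H k (xPart p) * M.H l (xPart p) * ∑ α, M.C k (M.blk α) (xPart p)
          * M.C l (M.blk α) (xPart p) / M.f (M.blk α) (xPart p) ^ 2 * M.σ (M.blk α)) := by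
    rw [Finset.mul_sum, ← Finset.sum_neg_distrib]
    refine Finset.sum_congr rfl fun x _ => ?_
    have h := V.J_sq _ hp.2 x x
    rw [if_pos rfl] at h
    have h' : ∀ z, 2⁻¹ * (M.H l (xPart p) * M.C l (M.blk x) (xPart p)
      / M.f (M.blk x) (xPart p)) * M.J (yPart p) z x * (2⁻¹ * (M.H k (xPart p)
        * M.C k (M.blk z) (xPart p) / M.f (M.blk z) (xPart p)) * M.J (yPart p) x z)
        = (4⁻¹ * M.H k (xPart p) * M.H l (xPart p) * (M.C k (M.blk x) (xPart p)
          * M.C l (M.blk x) (xPart p) / M.f (M.blk x) (xPart p) ^ 2))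
          * (M.J (yPart p) x z * M.J (yPart p) z x) := fun z => by
      by_cases hz : M.blk x = M.blk z
      · rw [hz]; ring
      · rw [V.J_blk _ hp.2 _ _ hz]; ring
    simp only [h', ← Finset.mul_sum, h]
    ring
  rw [h1]
  simp only [h0]
  rw [Finset.sum_comm (f := fun x z => 2⁻¹ * (M.H (M.e z) (xPart p) * M.B z x l (xPart p))
    * (2⁻¹ * (M.B z x k (xPart p) / M.H x (xPart p)) - M.L z x k (xPart p)))]
  rw [Finset.sum_neg_distrib]
  have h5 : ∀ a b c d e : ℝ, -a + -b - (-c + (-d + -e)) = -a - b + (c + d) + e :=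
    fun _ _ _ _ _ => by ring
  rw [h5, ← Finset.sum_add_distrib, ← Finset.sum_neg_distrib, ← Finset.sum_sub_distrib,
    ← Finset.sum_add_distrib]
  congr 1
  refine Finset.sum_congr rfl fun μ _ => ?_
  rw [← Finset.sum_add_distrib, ← Finset.sum_sub_distrib, ← Finset.sum_sub_distrib,
    Finset.mul_sum]
  congr 1
  · ring
  · exact Finset.sum_congr rfl fun j _ => by ring

theorem IsValid.frameRicci_yy (V : M.IsValid S T) {p : X ⊕ K ⊕ Υ → ℝ}
    (hp : p ∈ cylinder K S T) (β α : Υ) :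
    M.frameRicci p (.inr (.inr β)) (.inr (.inr α)) = ricci M.γ (yPart p) β α
      + (∑ μ, (-(1 / 2) * pd μ (fun x => M.H (M.e μ) x * (M.φ μ (M.blk α) x * M.f (M.blk α) x))
            (xPart p)
          - (1 / 2) * M.w μ (xPart p) * (M.H (M.e μ) (xPart p) * (M.φ μ (M.blk α) (xPart p)
            * M.f (M.blk α) (xPart p)))
          + (1 / 2) * M.H (M.e μ) (xPart p) * M.φ μ (M.blk α) (xPart p) ^ 2
            * M.f (M.blk α) (xPart p))
        - (1 / 2) * ∑ k, M.H k (xPart p) * M.C k (M.blk α) (xPart p) ^ 2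
          / M.f (M.blk α) (xPart p) * M.σ (M.blk α)) * M.γ (yPart p) α β := by
  have hsy := V.γ_metric.symm _ hp.2
  rw [V.frameRicci_eq hp]
  simp only [Fintype.sum_sum_type, V.fderiv_conn hp, Sum.elim_inl, Sum.elim_inr]
  simp only [conn, sepFun, connX, connY, divX, divY, pd_const]
  simp
  have h0 : ∀ μ, pd μ (fun x => -(2⁻¹ * (M.H (M.e μ) x * (M.φ μ (M.blk α) x
        * M.f (M.blk α) x)))) (xPart p)
      = -(2⁻¹ * pd μ (fun x => M.H (M.e μ) x * (M.φ μ (M.blk α) x * M.f (M.blk α) x))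
        (xPart p)) := fun μ => by
    rw [pd_neg, pd_const_mul]
    exact ContDiffOn.diffAt V.openS ((V.H_smooth _).mul ((V.φ_smooth _ _).mul (V.f_smooth _))) hp.1
  have hΓ : ∀ a b c, christoffel M.γ a b c (yPart p) = christoffel M.γ a c b (yPart p) :=
    fun a b c => christoffel_symm V.openT V.γ_metric hp.2 a b c
  -- The purely base terms of the frame formula are the Ricci tensor of `γ`, up to the order of
  -- lower indices.
  have hR : ricci M.γ (yPart p) β α = ∑ x, pd x (fun y => christoffel M.γ x α β y) (yPart p)
      - pd α (fun y => ∑ δ, christoffel M.γ δ δ β y) (yPart p)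
      + ∑ x, (∑ δ, christoffel M.γ δ δ x (yPart p)) * christoffel M.γ x α β (yPart p)
      - ∑ x, ∑ z, christoffel M.γ z x α (yPart p) * christoffel M.γ x z β (yPart p) := by
    rw [pd_sum fun δ _ => ContDiffOn.diffAt V.openT
      (contDiffOn_christoffel V.openT V.γ_metric δ δ β) hp.2]
    simp only [ricci, Matrix.of_apply, Finset.sum_sub_distrib]
    have e1 : ∀ k, pd k (christoffel M.γ k β α) (yPart p)
        = pd k (fun y => christoffel M.γ k α β y) (yPart p) := fun k =>
      pd_congr V.openT (fun q hq => christoffel_symm V.openT V.γ_metric hq k β α) hp.2 k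
    have e2 : ∀ k, pd α (christoffel M.γ k β k) (yPart p)
        = pd α (fun y => christoffel M.γ k k β y) (yPart p) := fun k =>
      pd_congr V.openT (fun q hq => christoffel_symm V.openT V.γ_metric hq k β k) hp.2 α
    simp only [e1, e2, hΓ _ β, Finset.sum_mul]
    rw [Finset.sum_comm (f := fun k l => christoffel M.γ k k l (yPart p)
        * christoffel M.γ l α β (yPart p)), Finset.sum_comm (f := fun k l =>
        christoffel M.γ k α l (yPart p) * christoffel M.γ l k β (yPart p))]
    simp only [hΓ _ α]
    ring
  -- `h1` and `h2` are the two orders of the mixed product of connection coefficients; each accounts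
  -- for half of the curvature term in the statement.
  have h1 : ∑ x, ∑ z, 2⁻¹ * (M.H x (xPart p) * M.C x (M.blk α) (xPart p)
      / M.f (M.blk α) (xPart p)) * M.J (yPart p) z α * (2⁻¹ * M.C x (M.blk z) (xPart p)
        * kahlerForm M.γ M.J (yPart p) z β)
      = -(4⁻¹ * (∑ k, M.H k (xPart p) * M.C k (M.blk α) (xPart p) ^ 2
          / M.f (M.blk α) (xPart p) * M.σ (M.blk α)) * M.γ (yPart p) α β) := by
    rw [Finset.mul_sum, Finset.sum_mul, ← Finset.sum_neg_distrib]
    refine Finset.sum_congr rfl fun x _ => ?_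
    have h := V.sum_J_kahlerForm hp.2 (fun b => 4⁻¹ * (M.H x (xPart p)
      * M.C x (M.blk α) (xPart p) / M.f (M.blk α) (xPart p)) * M.C x b (xPart p)) α β
    have h' : ∀ z, 2⁻¹ * (M.H x (xPart p) * M.C x (M.blk α) (xPart p)
        / M.f (M.blk α) (xPart p)) * M.J (yPart p) z α * (2⁻¹ * M.C x (M.blk z) (xPart p)
          * kahlerForm M.γ M.J (yPart p) z β)
        = 4⁻¹ * (M.H x (xPart p) * M.C x (M.blk α) (xPart p) / M.f (M.blk α) (xPart p))
          * M.C x (M.blk z) (xPart p) * M.J (yPart p) z α * kahlerForm M.γ M.J (yPart p) z β :=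
      fun z => by ring
    simp only [h', h]
    ring
  have h2 : ∑ z, ∑ x, 2⁻¹ * M.C x (M.blk z) (xPart p) * kahlerForm M.γ M.J (yPart p) z α
      * (2⁻¹ * (M.H x (xPart p) * M.C x (M.blk β) (xPart p) / M.f (M.blk β) (xPart p))
        * M.J (yPart p) z β)
      = -(4⁻¹ * (∑ k, M.H k (xPart p) * M.C k (M.blk α) (xPart p) ^ 2
          / M.f (M.blk α) (xPart p) * M.σ (M.blk α)) * M.γ (yPart p) α β) := by
    rw [Finset.sum_comm, Finset.mul_sum, Finset.sum_mul, ← Finset.sum_neg_distrib]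
    refine Finset.sum_congr rfl fun x _ => ?_
    have h := V.sum_J_kahlerForm hp.2 (fun b => 4⁻¹ * (M.H x (xPart p)
      * M.C x (M.blk β) (xPart p) / M.f (M.blk β) (xPart p)) * M.C x b (xPart p)) β α
    have h' : ∀ z, 2⁻¹ * M.C x (M.blk z) (xPart p) * kahlerForm M.γ M.J (yPart p) z α
        * (2⁻¹ * (M.H x (xPart p) * M.C x (M.blk β) (xPart p) / M.f (M.blk β) (xPart p))
          * M.J (yPart p) z β)
        = 4⁻¹ * (M.H x (xPart p) * M.C x (M.blk β) (xPart p) / M.f (M.blk β) (xPart p))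
          * M.C x (M.blk z) (xPart p) * M.J (yPart p) z β * kahlerForm M.γ M.J (yPart p) z α :=
      fun z => by ring
    simp only [h', h]
    have h3 := V.f_mul_γ hp.2 (fun b => M.H x (xPart p) * M.C x b (xPart p) ^ 2
      / M.f b (xPart p) * M.σ b) α β
    rw [hsy β α]
    linear_combination (1 / 4) * h3
  have h3 : ∑ μ, 2⁻¹ * (M.H (M.e μ) (xPart p) * (M.φ μ (M.blk β) (xPart p)
      * M.f (M.blk β) (xPart p))) * M.γ (yPart p) β α * (2⁻¹ * M.φ μ (M.blk β) (xPart p))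
      = ∑ μ, 2⁻¹ * M.φ μ (M.blk α) (xPart p) * (2⁻¹ * (M.H (M.e μ) (xPart p)
        * (M.φ μ (M.blk α) (xPart p) * M.f (M.blk α) (xPart p))) * M.γ (yPart p) α β) := by
    refine Finset.sum_congr rfl fun μ _ => ?_
    have h3 := V.f_mul_γ hp.2 (fun b => M.φ μ b (xPart p) ^ 2 * M.f b (xPart p)) α β
    rw [hsy β α]
    linear_combination (-(1 / 4) * M.H (M.e μ) (xPart p)) * h3
  have h4 : (∑ μ, (-(2⁻¹ * pd μ (fun x => M.H (M.e μ) x * (M.φ μ (M.blk α) x * M.f (M.blk α) x))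
            (xPart p))
          - 2⁻¹ * M.w μ (xPart p) * (M.H (M.e μ) (xPart p) * (M.φ μ (M.blk α) (xPart p)
            * M.f (M.blk α) (xPart p)))
          + 2⁻¹ * M.H (M.e μ) (xPart p) * M.φ μ (M.blk α) (xPart p) ^ 2
            * M.f (M.blk α) (xPart p))) * M.γ (yPart p) α β
      = ∑ μ, -(2⁻¹ * pd μ (fun x => M.H (M.e μ) x * (M.φ μ (M.blk α) x * M.f (M.blk α) x))
            (xPart p)) * M.γ (yPart p) α β
        - ∑ μ, M.w μ (xPart p) * (2⁻¹ * (M.H (M.e μ) (xPart p) * (M.φ μ (M.blk α) (xPart p)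
            * M.f (M.blk α) (xPart p))) * M.γ (yPart p) α β)
        + 2 * ∑ μ, 2⁻¹ * M.φ μ (M.blk α) (xPart p) * (2⁻¹ * (M.H (M.e μ) (xPart p)
          * (M.φ μ (M.blk α) (xPart p) * M.f (M.blk α) (xPart p))) * M.γ (yPart p) α β) := by
    rw [Finset.mul_sum, ← Finset.sum_sub_distrib, ← Finset.sum_add_distrib, Finset.sum_mul]
    exact Finset.sum_congr rfl fun μ _ => by ring
  simp only [Finset.sum_add_distrib, Finset.sum_neg_distrib, Finset.sum_ite_eq',
    Finset.mem_univ, if_true] at h4 ⊢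
  rw [h1, h2, h3, hR]
  simp only [h0]
  linear_combination -h4

end FibData

end GenKerrNUT

namespace GenKerrNUT

/-! ### Traces of products of arrow-shaped matrices -/

section Arrow

variable {ι : Type} [Fintype ι] [DecidableEq ι]

/-- A matrix vanishing off the diagonal, the row `n` and the column `n`. -/
def arrow (n : ι) (d u v : ι → ℝ) (f : ℝ) (i j : ι) : ℝ :=
  (if i = j then d i else 0) + (if i = n then u j else 0) + (if j = n then v i else 0)
    + (if i = n ∧ j = n then f else 0)

/-- The connection matrices are supported on the diagonal, one row and one column, so the quadratic
terms of the Ricci tensor reduce to single sums. The vanishing at `n` keeps the corner entry from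
being counted more than once. -/
theorem sum_arrow_mul_arrow_self {n : ι} {d u v d' u' v' : ι → ℝ} (hd : d n = 0) (hu : u n = 0)
    (hv : v n = 0) (hd' : d' n = 0) (hu' : u' n = 0) (hv' : v' n = 0) (f f' : ℝ) :
    ∑ i, ∑ j, arrow n d u v f i j * arrow n d' u' v' f' j i
      = ∑ i, d i * d' i + ∑ i, u i * v' i + ∑ i, v i * u' i + f * f' := by
  simp only [arrow, add_mul, mul_add, ite_and, ite_mul, mul_ite, zero_mul, mul_zero,
    Finset.sum_add_distrib, Finset.sum_ite_eq, Finset.sum_ite_eq', Finset.mem_univ, if_true,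
    Finset.sum_ite_irrel, Finset.sum_const_zero]
  simp [hd, hu, hv, hd', hu', hv']
  ring

theorem sum_arrow_mul_arrow_of_ne {n m : ι} (h : n ≠ m) {d u v d' u' v' : ι → ℝ}
    (hu : u n = 0) (hv : v n = 0) (hu' : u' m = 0) (hv' : v' m = 0) (f f' : ℝ) :
    ∑ i, ∑ j, arrow n d u v f i j * arrow m d' u' v' f' j i
      = ∑ i, d i * d' i + d m * f' + f * d' n + u m * u' n + v m * v' n := by
  simp only [arrow, add_mul, mul_add, ite_and, ite_mul, mul_ite, zero_mul, mul_zero,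
    Finset.sum_add_distrib, Finset.sum_ite_eq, Finset.sum_ite_eq', Finset.mem_univ, if_true,
    Finset.sum_ite_irrel, Finset.sum_const_zero]
  simp [hu, hv, hu', hv', h.symm]
  try ring

end Arrow

section Coordinates

variable {ι : Type} [Fintype ι] [DecidableEq ι]

theorem differentiableAt_coord (i : ι) (p : ι → ℝ) : DifferentiableAt ℝ (fun x : ι → ℝ => x i) p :=
  differentiableAt_apply i p

theorem differentiableAt_coord_sq (i : ι) (p : ι → ℝ) :
    DifferentiableAt ℝ (fun x : ι → ℝ => x i ^ 2) p :=
  (differentiableAt_apply i p).pow 2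

theorem pd_coord (k i : ι) (p : ι → ℝ) :
    pd k (fun x => x i) p = if i = k then 1 else 0 := by
  have : HasFDerivAt (fun x : ι → ℝ => x i) (ContinuousLinearMap.proj (R := ℝ) i) p :=
    (ContinuousLinearMap.proj (R := ℝ) (φ := fun _ : ι => ℝ) i).hasFDerivAt
  rw [pd, this.fderiv, ContinuousLinearMap.proj_apply, Pi.single_apply]

theorem pd_coord_sq (k i : ι) (p : ι → ℝ) :
    pd k (fun x => x i ^ 2) p = if i = k then 2 * p i else 0 := by
  simp only [pow_two]
  rw [pd_mul (differentiableAt_coord i p) (differentiableAt_coord i p), pd_coord]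
  split_ifs <;> ring

end Coordinates

/-! ### Kerr-NUT data: nodes, logarithmic derivatives and partial fractions -/

namespace FibData

variable {X K Υ Bl : Type} [Fintype X] [Fintype K] [Fintype Υ]
  [DecidableEq X] [DecidableEq K] [DecidableEq Υ]
  {M : FibData X K Υ Bl} {S : Set (X → ℝ)} {T : Set (Υ → ℝ)}

variable (M) in
/-- The squared nodes: `x_ν²` for `e ν`, and `0` for an index which is not of this form. -/
def s (k : K) (x : X → ℝ) : ℝ := Function.extend M.e (fun ν => x ν ^ 2) 0 k

variable (M) in
/-- The indices of the vertical frame which do not belong to a coordinate `x_ν`. -/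
def extra : Finset K := Finset.univ \ Finset.univ.image M.e

variable (M) in
-- The value `0` at the node of `x_ν` itself lets sums over all nodes skip the singular term.
def r (ν : X) (k : K) (x : X → ℝ) : ℝ := if k = M.e ν then 0 else 2 / (x ν ^ 2 - M.s k x)

variable (M) in
-- For the concrete data this is the logarithmic `x_ν`-derivative of the product of the differences
-- between the node of `x_ν` and the others (`kerrNUT.pd_nodeProd`).
def tau (ν : X) (x : X → ℝ) : ℝ := ∑ k, M.t ν k x

variable (M) in
/-- The logarithmic derivative of the weight in `x_ν`. -/
def pw (a : Bl → ℝ) (ν : X) (x : X → ℝ) : ℝ :=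
  -(M.extra.card / x ν) + ∑ α, x ν / (x ν ^ 2 - a (M.blk α) ^ 2)

variable (M) in
-- The values to be interpolated, already divided by the node products (`kerrNUT.yh_eq`). With this
-- combination both the node contributions to `ricX` and the base components of the Ricci tensor
-- take a uniform form.
def yh (a : Bl → ℝ) (g₁ : X → (X → ℝ) → ℝ) (k : K) (x : X → ℝ) : ℝ :=
  Function.extend M.e (fun ν => x ν * g₁ ν x + (x ν * M.pw a ν x - 1) * M.H (M.e ν) x)
    (fun k => -2 * M.H k x) k

variable (M) in
/-- The mixed component `R^μ_μ` of the Ricci tensor. -/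
def ricX (a : Bl → ℝ) (g₁ g₂ : X → (X → ℝ) → ℝ) (μ : X) (x : X → ℝ) : ℝ :=
  -(1 / 2) * g₂ μ x - (1 / 2) * M.pw a μ x * g₁ μ x
    - (1 / 2) * M.H (M.e μ) x * ∑ α, (2 / (x μ ^ 2 - a (M.blk α) ^ 2)
      - (1 / 2) * M.φ μ (M.blk α) x ^ 2)
    + (1 / 2) * ∑ k, M.r μ k x * (M.yh a g₁ (M.e μ) x + M.yh a g₁ k x)

variable (M) in
/-- The explicit form of the data of the generalized Kerr-NUT metrics; `g₁ ν` and `g₂ ν` are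
the first two derivatives of a function of `x_ν`, divided by a product of differences of nodes. -/
structure IsKerrNUT (S : Set (X → ℝ)) (a : Bl → ℝ) (g₁ g₂ : X → (X → ℝ) → ℝ) : Prop where
  x_ne : ∀ x ∈ S, ∀ ν, x ν ≠ 0
  s_ne : ∀ x ∈ S, ∀ k l, k ≠ l → M.s k x ≠ M.s l x
  s_ne_a : ∀ x ∈ S, ∀ ν b, x ν ^ 2 ≠ a b ^ 2
  a_ne : ∀ k ∈ M.extra, ∀ α, a (M.blk α) ≠ 0
  σ_eq : ∀ α, a (M.blk α) ≠ 0 → M.σ (M.blk α) = 1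
  extra_le : ∀ k ∈ M.extra, ∀ l ∈ M.extra, k = l
  t_eq : ∀ x ∈ S, ∀ ν k, M.t ν k x = x ν * M.r ν k x
  φ_eq : ∀ x ∈ S, ∀ ν b, M.φ ν b x = 2 * x ν / (x ν ^ 2 - a b ^ 2)
  C_eq : ∀ x ∈ S, ∀ k b, M.C k b x = 2 * a b * M.f b x / (M.s k x - a b ^ 2)
  D_eq : ∀ x ∈ S, ∀ ν, M.D ν x = g₁ ν x - M.H (M.e ν) x * M.tau ν x
  g₁_diff : ∀ x ∈ S, ∀ ν, DifferentiableAt ℝ (g₁ ν) x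
  dg₁ : ∀ x ∈ S, ∀ ν, pd ν (g₁ ν) x = g₂ ν x - M.tau ν x * g₁ ν x

theorem s_e (he : Function.Injective M.e) (ν : X) (x : X → ℝ) : M.s (M.e ν) x = x ν ^ 2 :=
  he.extend_apply _ _ _

theorem mem_extra {k : K} : k ∈ M.extra ↔ ∀ ν, M.e ν ≠ k := by simp [extra]

theorem s_extra {k : K} (hk : k ∈ M.extra) (x : X → ℝ) : M.s k x = 0 :=
  Function.extend_apply' _ _ _ fun ⟨ν, h⟩ => mem_extra.1 hk ν h

theorem yh_e (he : Function.Injective M.e) (a : Bl → ℝ) (g₁ : X → (X → ℝ) → ℝ) (ν : X)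
    (x : X → ℝ) : M.yh a g₁ (M.e ν) x
      = x ν * g₁ ν x + (x ν * M.pw a ν x - 1) * M.H (M.e ν) x :=
  he.extend_apply _ _ _

theorem yh_extra {k : K} (hk : k ∈ M.extra) (a : Bl → ℝ) (g₁ : X → (X → ℝ) → ℝ)
    (x : X → ℝ) : M.yh a g₁ k x = -2 * M.H k x :=
  Function.extend_apply' _ _ _ fun ⟨ν, h⟩ => mem_extra.1 hk ν h

theorem sum_e (he : Function.Injective M.e) (F : K → ℝ) :
    ∑ k, F k = ∑ ν, F (M.e ν) + ∑ k ∈ M.extra, F k := by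
  rw [extra, ← Finset.sum_sdiff (Finset.subset_univ (Finset.univ.image M.e)), add_comm,
    Finset.sum_image he.injOn]

theorem exists_or_mem_extra (k : K) : (∃ ν, k = M.e ν) ∨ k ∈ M.extra := by
  by_cases h : k ∈ M.extra
  · exact Or.inr h
  · rw [mem_extra] at h; push Not at h; obtain ⟨ν, h⟩ := h; exact Or.inl ⟨ν, h.symm⟩

namespace IsKerrNUT

variable {a : Bl → ℝ} {g₁ g₂ : X → (X → ℝ) → ℝ}

theorem pd_s (he : Function.Injective M.e) (μ : X) (k : K) (x : X → ℝ) :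
    DifferentiableAt ℝ (M.s k) x ∧ pd μ (M.s k) x = if k = M.e μ then 2 * x μ else 0 := by
  rcases exists_or_mem_extra (M := M) k with ⟨ν, rfl⟩ | hk
  · have h : M.s (M.e ν) = fun x => x ν ^ 2 := funext fun x => s_e he ν x
    rw [h, pd_coord_sq]
    refine ⟨(differentiableAt_coord ν x).pow 2, ?_⟩
    by_cases h' : ν = μ
    · subst h'; simp
    · rw [if_neg h', if_neg fun h => h' (he h)]
  · have h : M.s k = fun x => 0 := funext fun x => s_extra hk x
    rw [h, pd_const, if_neg fun h => mem_extra.1 hk μ h.symm]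
    exact ⟨differentiableAt_const _, rfl⟩

theorem sub_ne (W : M.IsKerrNUT S a g₁ g₂) (he : Function.Injective M.e) {x : X → ℝ} (hx : x ∈ S)
    {ν : X} {k : K} (h : k ≠ M.e ν) : x ν ^ 2 - M.s k x ≠ 0 := by
  rw [← s_e he ν x]; exact sub_ne_zero.2 (W.s_ne x hx _ _ h.symm)

theorem pd_t (W : M.IsKerrNUT S a g₁ g₂) (V : M.IsValid S T) {x : X → ℝ} (hx : x ∈ S)
    (μ ν : X) (k : K) : pd μ (M.t ν k) x =
      (if μ = ν then M.r ν k x - M.t ν k x ^ 2 else 0)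
        - (if k = M.e μ then M.t ν k x * M.t μ (M.e ν) x else 0) := by
  rw [pd_congr V.openS (fun y hy => W.t_eq y hy ν k) hx, W.t_eq x hx, W.t_eq x hx μ]
  simp only [r]
  by_cases h : k = M.e ν
  · simp [h, pd_const]
  simp only [if_neg h]
  have h1 := W.sub_ne V.e_inj hx h
  obtain ⟨hd, hs⟩ := pd_s V.e_inj μ k x
  have hd' : DifferentiableAt ℝ (fun x => x ν ^ 2 - M.s k x) x :=
    ((differentiableAt_coord ν x).pow 2).sub hd
  have hi : DifferentiableAt ℝ (fun x => (x ν ^ 2 - M.s k x)⁻¹) x := hd'.inv h1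
  simp only [div_eq_mul_inv]
  rw [pd_mul (differentiableAt_coord ν x) ((differentiableAt_const _).fun_mul hi),
    pd_const_mul hi, pd_inv hd' h1, pd_sub (differentiableAt_coord_sq ν x) hd, hs,
    pd_coord, pd_coord_sq]
  by_cases hμ : μ = ν
  · subst hμ
    simp only [if_true, if_neg h]
    field_simp
    ring
  · have hν : ν ≠ μ := fun h => hμ h.symm
    simp only [if_neg hμ, if_neg hν]
    by_cases hk : k = M.e μ
    · have h3 : M.e ν ≠ M.e μ := fun h => hν (V.e_inj h)
      subst hk
      have h2 := W.sub_ne V.e_inj hx h3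
      rw [s_e V.e_inj] at h1 h2
      simp only [if_true, if_neg h3, s_e V.e_inj]
      have h4 : x μ ^ 2 - x ν ^ 2 = -(x ν ^ 2 - x μ ^ 2) := by ring
      rw [h4]
      field_simp
      ring
    · simp [hk]

theorem pd_φ (W : M.IsKerrNUT S a g₁ g₂) (V : M.IsValid S T) {x : X → ℝ} (hx : x ∈ S)
    (μ ν : X) (b : Bl) : pd μ (M.φ ν b) x =
      if μ = ν then 2 / (x ν ^ 2 - a b ^ 2) - M.φ ν b x ^ 2 else 0 := by
  rw [pd_congr V.openS (fun y hy => W.φ_eq y hy ν b) hx, W.φ_eq x hx]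
  have h1 := sub_ne_zero.2 (W.s_ne_a x hx ν b)
  have hd : DifferentiableAt ℝ (fun x : X → ℝ => x ν) x := differentiableAt_coord ν x
  have hd' : DifferentiableAt ℝ (fun x : X → ℝ => x ν ^ 2 - a b ^ 2) x :=
    (hd.pow 2).sub (differentiableAt_const _)
  have hi : DifferentiableAt ℝ (fun x : X → ℝ => (x ν ^ 2 - a b ^ 2)⁻¹) x := hd'.inv h1
  simp only [div_eq_mul_inv, mul_assoc]
  rw [pd_const_mul (hd.fun_mul hi), pd_mul hd hi, pd_inv hd' h1,
    pd_sub (differentiableAt_coord_sq ν x) (differentiableAt_const _), pd_const, pd_coord, pd_coord_sq]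
  by_cases h : μ = ν
  · subst h
    simp only [if_true]
    field_simp
    ring
  · have h' : ¬ν = μ := fun h' => h h'.symm
    simp [h, h']

theorem pd_tau (W : M.IsKerrNUT S a g₁ g₂) (V : M.IsValid S T) {x : X → ℝ} (hx : x ∈ S)
    (ν : X) : pd ν (M.tau ν) x = ∑ k, (M.r ν k x - M.t ν k x ^ 2) := by
  have : M.tau ν = fun x => ∑ k, M.t ν k x := rfl
  rw [this, pd_sum fun k _ => ContDiffOn.diffAt V.openS (V.t_smooth _ _) hx]
  refine Finset.sum_congr rfl fun k _ => ?_
  rw [W.pd_t V hx, if_pos rfl, V.t_self ν x hx]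
  simp

theorem pd_D (W : M.IsKerrNUT S a g₁ g₂) (V : M.IsValid S T) {x : X → ℝ} (hx : x ∈ S)
    (ν : X) : pd ν (M.D ν) x = g₂ ν x - M.tau ν x * g₁ ν x - M.D ν x * M.tau ν x
      - M.H (M.e ν) x * ∑ k, (M.r ν k x - M.t ν k x ^ 2) := by
  have hH := ContDiffOn.diffAt V.openS (V.H_smooth (M.e ν)) hx
  have ht : DifferentiableAt ℝ (M.tau ν) x :=
    DifferentiableAt.fun_sum fun k _ => ContDiffOn.diffAt V.openS (V.t_smooth _ _) hx
  rw [pd_congr V.openS (fun y hy => W.D_eq y hy ν) hx, pd_sub (W.g₁_diff x hx ν) (hH.fun_mul ht),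
    W.dg₁ x hx, pd_mul hH ht, V.dH ν _ x hx, W.pd_tau V hx, if_pos rfl]
  ring

/-- The divergence of `∂_ν`. -/
theorem w_eq (V : M.IsValid S T) {x : X → ℝ} (hx : x ∈ S)
    (ν : X) : M.w ν x = (1 / 2) * ∑ μ, M.t ν (M.e μ) x + (1 / 2) * M.tau ν x
      + (1 / 2) * ∑ α, M.φ ν (M.blk α) x := by
  have h0 : ∀ k, M.H k x ≠ 0 := fun k => V.H_ne k x hx
  have h1 : ∀ k, (1 / 2) * (M.B ν k k x / M.H k x) = (1 / 2) * M.t ν k x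
      + if k = M.e ν then (1 / 2) * (M.D ν x / M.H (M.e ν) x) else 0 := fun k => by
    have := h0 k
    by_cases h : k = M.e ν
    · subst h; simp [B, V.t_self ν x hx]
    · simp [B, h]; field_simp
  have h2 : ∀ l, M.cX l l ν x = (1 / 2) * M.t ν (M.e l) x
      - if l = ν then (1 / 2) * (M.D ν x / M.H (M.e ν) x) else 0 := fun l => by
    by_cases h : l = ν
    · subst h; simp [cX, V.t_self l x hx]
    · simp [cX, h]
      rintro rfl
      exact V.t_self _ x hx
  rw [w, tau]
  simp only [h1, h2, Finset.sum_add_distrib, Finset.sum_sub_distrib, Finset.sum_ite_eq',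
    Finset.mem_univ, if_true, ← Finset.mul_sum]
  ring

theorem t_extra (W : M.IsKerrNUT S a g₁ g₂) {x : X → ℝ} (hx : x ∈ S)
    (ν : X) {k : K} (hk : k ∈ M.extra) :
    M.t ν k x = 2 / x ν ∧ M.r ν k x = 2 / x ν ^ 2 := by
  have hk' : k ≠ M.e ν := fun h => mem_extra.1 hk ν h.symm
  have := W.x_ne x hx ν
  rw [W.t_eq x hx, r, if_neg hk', s_extra hk]
  constructor
  · field_simp; simp
  · simp

/-- In `w_eq` coordinate nodes are counted in both half sums but an extra node only in one.
Completing it to the full `tau` costs `1 / x_ν` per extra node, the first term of `pw`. -/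
theorem w_eq' (W : M.IsKerrNUT S a g₁ g₂) (V : M.IsValid S T) {x : X → ℝ} (hx : x ∈ S)
    (ν : X) : M.w ν x = M.tau ν x + M.pw a ν x := by
  have := W.x_ne x hx ν
  rw [w_eq V hx, tau, sum_e V.e_inj, Finset.sum_congr rfl fun k hk => (W.t_extra hx ν hk).1, pw]
  simp only [W.φ_eq x hx, mul_div_assoc, ← Finset.mul_sum, Finset.sum_const, nsmul_eq_mul]
  ring

theorem r_swap (V : M.IsValid S T) (μ ν : X) (x : X → ℝ) :
    M.r μ (M.e ν) x = -M.r ν (M.e μ) x := by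
  by_cases h : μ = ν
  · subst h; simp [r]
  have h1 : M.e ν ≠ M.e μ := fun h' => h (V.e_inj h').symm
  rw [r, r, if_neg h1, if_neg h1.symm, s_e V.e_inj, s_e V.e_inj, ← neg_sub, div_neg]

/-- Partial fractions for three distinct nodes. The conditional terms repair the identity when two
nodes coincide, where `t` is zero by convention. -/
theorem t_mul_t (W : M.IsKerrNUT S a g₁ g₂) (V : M.IsValid S T) {x : X → ℝ} (hx : x ∈ S)
    {μ ν : X} (h : μ ≠ ν) (k : K) :
    M.t μ (M.e ν) x * M.t ν k x + M.t ν (M.e μ) x * M.t μ k x = M.t μ k x * M.t ν k x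
      + (if k = M.e μ then M.t μ (M.e ν) x * M.t ν (M.e μ) x else 0)
      + (if k = M.e ν then M.t μ (M.e ν) x * M.t ν (M.e μ) x else 0) := by
  have hμν : M.e ν ≠ M.e μ := fun h' => h (V.e_inj h').symm
  by_cases h1 : k = M.e μ
  · subst h1; simp [V.t_self μ x hx, hμν.symm]
  by_cases h2 : k = M.e ν
  · subst h2; simp [V.t_self ν x hx, hμν, mul_comm]
  have e1 := W.sub_ne V.e_inj hx h1
  have e2 := W.sub_ne V.e_inj hx h2
  have e3 := W.sub_ne V.e_inj hx hμν
  rw [s_e V.e_inj] at e3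
  simp only [W.t_eq x hx, if_neg h1, if_neg h2, add_zero, r, if_neg hμν, if_neg hμν.symm,
    s_e V.e_inj]
  have e4 : x ν ^ 2 - x μ ^ 2 = -(x μ ^ 2 - x ν ^ 2) := by ring
  rw [e4]
  field_simp
  ring

/-- The same partial fraction identity with `a_b²` in the role of the third node. -/
theorem t_mul_φ (W : M.IsKerrNUT S a g₁ g₂) (V : M.IsValid S T) {x : X → ℝ} (hx : x ∈ S)
    {μ ν : X} (h : μ ≠ ν) (b : Bl) :
    M.t μ (M.e ν) x * M.φ ν b x + M.t ν (M.e μ) x * M.φ μ b x = M.φ μ b x * M.φ ν b x := by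
  have hμν : M.e ν ≠ M.e μ := fun h' => h (V.e_inj h').symm
  have e1 := sub_ne_zero.2 (W.s_ne_a x hx μ b)
  have e2 := sub_ne_zero.2 (W.s_ne_a x hx ν b)
  have e3 := W.sub_ne V.e_inj hx hμν
  rw [s_e V.e_inj] at e3
  simp only [W.t_eq x hx, W.φ_eq x hx, r, if_neg hμν, if_neg hμν.symm, s_e V.e_inj]
  have e4 : x ν ^ 2 - x μ ^ 2 = -(x μ ^ 2 - x ν ^ 2) := by ring
  rw [e4]
  field_simp
  ring

end IsKerrNUT

end FibData

end GenKerrNUT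

namespace GenKerrNUT

/-! ### The Ricci tensor in the directions of the coordinates `x_μ` -/

namespace FibData

namespace IsKerrNUT

variable {X K Υ Bl : Type} [Fintype X] [Fintype K] [Fintype Υ]
  [DecidableEq X] [DecidableEq K] [DecidableEq Υ]
  {M : FibData X K Υ Bl} {S : Set (X → ℝ)} {T : Set (Υ → ℝ)}
  {a : Bl → ℝ} {g₁ g₂ : X → (X → ℝ) → ℝ}

theorem cX_eq_arrow {x : X → ℝ} (l m n : X) :
    M.cX l m n x = arrow n (fun l => (1 / 2) * M.t n (M.e l) x) (fun m => (1 / 2) * M.t m (M.e n) x)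
      (fun l => -((1 / 2) * (M.H (M.e l) x * M.t l (M.e n) x / M.H (M.e n) x)))
      (-((1 / 2) * (M.D n x / M.H (M.e n) x))) l m := by
  have h1 : (l = m ∧ m = n) = (l = n ∧ m = n) :=
    propext ⟨fun h => ⟨h.1.trans h.2, h.2⟩, fun h => ⟨h.1.trans h.2.symm, h.2⟩⟩
  rw [cX, arrow]
  simp only [h1, eq_comm (a := m) (b := l), eq_comm (a := n) (b := l)]
  by_cases e1 : l = n <;> by_cases e2 : m = n <;> by_cases e3 : l = m <;> simp [*] at * <;> ring

theorem B_div_eq_arrow (V : M.IsValid S T) {x : X → ℝ} (hx : x ∈ S) (ν : X) (k l : K) :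
    M.B ν k l x / M.H k x = arrow (M.e ν) (fun k => M.t ν k x)
      (fun l => -(M.t ν l x * M.H l x / M.H (M.e ν) x)) (fun k => -M.t ν k x)
      (M.D ν x / M.H (M.e ν) x) k l := by
  have h0 := V.H_ne k x hx
  rw [B, arrow]
  by_cases e1 : k = M.e ν <;> by_cases e2 : l = M.e ν <;> by_cases e3 : k = l <;> simp_all
  all_goals field_simp

/-- The terms with `D` cancel between the quadratic terms of the `x`-block and of the vertical
block. What remains are the partial fraction identities `t_mul_t` and `t_mul_φ`, summed over the
coordinate nodes (`f1`), all nodes (`f2`) and the base coordinates (`f3`). -/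
theorem frameRicci_xx_of_ne (W : M.IsKerrNUT S a g₁ g₂) (V : M.IsValid S T)
    {p : X ⊕ K ⊕ Υ → ℝ} (hp : p ∈ cylinder K S T) {ν μ : X} (h : ν ≠ μ) :
    M.frameRicci p (.inl ν) (.inl μ) = 0 := by
  rw [V.frameRicci_xx hp]
  set x := xPart p with hxd
  have hx : x ∈ S := hp.1
  have hνμ : M.e ν ≠ M.e μ := fun h' => h (V.e_inj h')
  have hH := fun k => V.H_ne k x hx
  have ht : ∀ ν k, DifferentiableAt ℝ (M.t ν k) x :=
    fun ν k => ContDiffOn.diffAt V.openS (V.t_smooth _ _) hx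
  have hφ : ∀ ν b, DifferentiableAt ℝ (M.φ ν b) x :=
    fun ν k => ContDiffOn.diffAt V.openS (V.φ_smooth _ _) hx
  have e1 : ∑ l, pd l (M.cX l μ ν) x = -(M.t ν (M.e μ) x * M.t μ (M.e ν) x) := by
    have : ∀ l, M.cX l μ ν = fun x => (if ν = l then (1 / 2) * M.t μ (M.e l) x else 0)
        + (if μ = l then (1 / 2) * M.t ν (M.e l) x else 0) := fun l => by
      funext y
      simp [cX, h.symm]
    have h2 : ∀ l, pd l (M.cX l μ ν) x
        = (if ν = l then -((1 / 2) * (M.t ν (M.e μ) x * M.t μ (M.e ν) x)) else 0)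
        + (if μ = l then -((1 / 2) * (M.t ν (M.e μ) x * M.t μ (M.e ν) x)) else 0) := fun l => by
      rw [this]
      by_cases h1 : ν = l
      · subst h1
        simp only [if_true, if_neg h.symm, add_zero]
        rw [pd_const_mul (ht _ _), W.pd_t V hx]
        simp [h]; ring
      · by_cases h3 : μ = l
        · subst h3
          simp only [if_true, if_neg h, zero_add]
          rw [pd_const_mul (ht _ _), W.pd_t V hx]
          simp [h.symm]
        · simp [h1, h3, pd_const]
    simp only [h2, Finset.sum_add_distrib, Finset.sum_ite_eq, Finset.mem_univ, if_true]
    ring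
  have e2 : pd μ (M.w ν) x = -(M.t ν (M.e μ) x * M.t μ (M.e ν) x) := by
    have hs : ∀ k, pd μ (M.t ν k) x
        = -(if k = M.e μ then M.t ν (M.e μ) x * M.t μ (M.e ν) x else 0) := fun k => by
      rw [W.pd_t V hx, if_neg h.symm]
      by_cases hk : k = M.e μ <;> simp [hk]
    rw [pd_congr V.openS (fun y hy => w_eq V hy ν) hx]
    have d1 : DifferentiableAt ℝ (fun x => ∑ μ, M.t ν (M.e μ) x) x :=
      DifferentiableAt.fun_sum fun _ _ => ht _ _
    have d2 : DifferentiableAt ℝ (fun x => M.tau ν x) x := DifferentiableAt.fun_sum fun _ _ => ht _ _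
    have d3 : DifferentiableAt ℝ (fun x => ∑ α, M.φ ν (M.blk α) x) x :=
      DifferentiableAt.fun_sum fun _ _ => hφ _ _
    rw [pd_add ((d1.const_mul _).fun_add (d2.const_mul _)) (d3.const_mul _),
      pd_add (d1.const_mul _) (d2.const_mul _), pd_const_mul d1, pd_const_mul d2, pd_const_mul d3,
      pd_sum fun _ _ => ht _ _, pd_sum fun _ _ => hφ _ _]
    simp only [tau]
    rw [pd_sum fun _ _ => ht _ _]
    simp only [hs, W.pd_φ V hx, if_neg h.symm, Finset.sum_neg_distrib, Finset.sum_ite_eq',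
      V.e_inj.eq_iff, Finset.mem_univ, if_true, Finset.sum_const_zero]
    ring
  have e3 : ∑ l, M.w l x * M.cX l μ ν x
      = (1 / 2) * (M.t μ (M.e ν) x * M.w ν x + M.t ν (M.e μ) x * M.w μ x) := by
    simp only [cX, h.symm, mul_add, mul_ite, mul_zero, Finset.sum_add_distrib,
      Finset.sum_ite_eq, Finset.mem_univ, if_true, and_false, if_false, sub_zero]
    ring
  have e4 : ∑ l, ∑ m, M.cX m l μ x * M.cX l m ν x
      = (1 / 4) * ∑ l, M.t μ (M.e l) x * M.t ν (M.e l) x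
        - (1 / 4) * (M.t ν (M.e μ) x * (M.D μ x / M.H (M.e μ) x)
          + M.t μ (M.e ν) x * (M.D ν x / M.H (M.e ν) x))
        + (1 / 2) * (M.t μ (M.e ν) x * M.t ν (M.e μ) x) := by
    have := hH (M.e μ)
    have := hH (M.e ν)
    simp only [cX_eq_arrow, mul_comm (arrow μ _ _ _ _ _ _)]
    rw [sum_arrow_mul_arrow_of_ne h (by simp [V.t_self _ x hx]) (by simp [V.t_self _ x hx])
      (by simp [V.t_self _ x hx]) (by simp [V.t_self _ x hx])]
    rw [Finset.mul_sum, Finset.sum_congr rfl fun l _ => (by ring :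
      1 / 2 * M.t ν (M.e l) x * (1 / 2 * M.t μ (M.e l) x)
        = 1 / 4 * (M.t μ (M.e l) x * M.t ν (M.e l) x))]
    field_simp
    ring
  have e5 : ∑ k, ∑ l, M.B μ l k x / M.H l x * (M.B ν k l x / M.H k x)
      = ∑ k, M.t μ k x * M.t ν k x
        + (M.t ν (M.e μ) x * (M.D μ x / M.H (M.e μ) x)
          + M.t μ (M.e ν) x * (M.D ν x / M.H (M.e ν) x))
        + 2 * (M.t μ (M.e ν) x * M.t ν (M.e μ) x) := by
    have := hH (M.e μ)
    have := hH (M.e ν)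
    simp only [B_div_eq_arrow V hx, mul_comm (arrow (M.e μ) _ _ _ _ _ _)]
    rw [sum_arrow_mul_arrow_of_ne hνμ (by simp [V.t_self _ x hx]) (by simp [V.t_self _ x hx])
      (by simp [V.t_self _ x hx]) (by simp [V.t_self _ x hx])]
    rw [Finset.sum_congr rfl fun l _ => mul_comm (M.t ν l x) (M.t μ l x)]
    field_simp
    ring
  have f1 : M.t μ (M.e ν) x * ∑ l, M.t ν (M.e l) x + M.t ν (M.e μ) x * ∑ l, M.t μ (M.e l) x
      = ∑ l, M.t μ (M.e l) x * M.t ν (M.e l) x + 2 * (M.t μ (M.e ν) x * M.t ν (M.e μ) x) := by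
    rw [Finset.mul_sum, Finset.mul_sum, ← Finset.sum_add_distrib]
    simp only [W.t_mul_t V hx h.symm, Finset.sum_add_distrib, V.e_inj.eq_iff, Finset.sum_ite_eq',
      Finset.mem_univ, if_true]
    ring
  have f2 : M.t μ (M.e ν) x * M.tau ν x + M.t ν (M.e μ) x * M.tau μ x
      = ∑ l, M.t μ l x * M.t ν l x + 2 * (M.t μ (M.e ν) x * M.t ν (M.e μ) x) := by
    rw [tau, tau, Finset.mul_sum, Finset.mul_sum, ← Finset.sum_add_distrib]
    simp only [W.t_mul_t V hx h.symm, Finset.sum_add_distrib, Finset.sum_ite_eq',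
      Finset.mem_univ, if_true]
    ring
  have f3 : M.t μ (M.e ν) x * ∑ α, M.φ ν (M.blk α) x + M.t ν (M.e μ) x * ∑ α, M.φ μ (M.blk α) x
      = ∑ α, M.φ μ (M.blk α) x * M.φ ν (M.blk α) x := by
    rw [Finset.mul_sum, Finset.mul_sum, ← Finset.sum_add_distrib]
    simp only [W.t_mul_φ V hx h.symm]
  rw [e1, e2, e3, e4, e5, w_eq V hx, w_eq V hx]
  linear_combination (1 / 4) * f1 + (1 / 4) * f2 + (1 / 4) * f3

/-- Both squares have the denominator `(x_μ² - x_ν²)²`, and the difference of numerators `4 x_μ² - 4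
x_ν²` cancels one factor. -/
theorem t_sq_sub_t_sq (W : M.IsKerrNUT S a g₁ g₂) (V : M.IsValid S T) {x : X → ℝ} (hx : x ∈ S)
    (μ ν : X) : M.t μ (M.e ν) x ^ 2 - M.t ν (M.e μ) x ^ 2 = 2 * M.r μ (M.e ν) x := by
  by_cases h : μ = ν
  · subst h; simp [V.t_self _ x hx, r]
  have hμν : M.e ν ≠ M.e μ := fun h' => h (V.e_inj h').symm
  have e3 := W.sub_ne V.e_inj hx hμν
  rw [W.t_eq x hx, W.t_eq x hx, r_swap V ν μ, r, if_neg hμν]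
  rw [s_e V.e_inj] at e3 ⊢
  field_simp

/-- The contribution of a node to the mixed components of the Ricci tensor. -/
theorem node_term (W : M.IsKerrNUT S a g₁ g₂) (V : M.IsValid S T) {x : X → ℝ} (hx : x ∈ S)
    (ν : X) (k : K) (c : ℝ) (hk : k ∈ M.extra → c = -(1 / 2) * M.H k x * M.t ν k x ^ 2)
    (hk' : ∀ l, k = M.e l → c = -(1 / 2) * (M.D l x * M.t l (M.e ν) x
      + M.H (M.e l) x * M.r l (M.e ν) x) - (1 / 2) * M.w l x * M.H (M.e l) x * M.t l (M.e ν) x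
      + (1 / 2) * M.t l (M.e ν) x ^ 2 * M.H (M.e l) x
      - (1 / 2) * M.t ν (M.e l) x ^ 2 * M.H (M.e l) x) :
    c = (1 / 2) * M.r ν k x * M.yh a g₁ k x := by
  rcases exists_or_mem_extra (M := M) k with ⟨l, rfl⟩ | hke
  · rw [hk' l rfl, yh_e V.e_inj, W.D_eq x hx, W.w_eq' V hx]
    have h1 := W.t_sq_sub_t_sq V hx l ν
    have h2 := W.t_eq x hx l (M.e ν)
    have h3 := r_swap V l ν x
    rw [h3] at h1 h2 ⊢
    linear_combination (1 / 2) * M.H (M.e l) x * h1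
      - (1 / 2) * (g₁ l x + M.pw a l x * M.H (M.e l) x) * h2
  · obtain ⟨h1, h2⟩ := W.t_extra hx ν hke
    have := W.x_ne x hx ν
    rw [hk hke, yh_extra hke, h1, h2]
    field_simp

/-- Only extra nodes remain on both sides, and there `t² = 4 / x_ν² = 2 r`. -/
theorem sum_t_sq (W : M.IsKerrNUT S a g₁ g₂) (V : M.IsValid S T) {x : X → ℝ} (hx : x ∈ S)
    (ν : X) : ∑ k, M.t ν k x ^ 2 - ∑ μ, M.t ν (M.e μ) x ^ 2
      = 2 * (∑ k, M.r ν k x - ∑ μ, M.r ν (M.e μ) x) := by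
  rw [sum_e V.e_inj, sum_e V.e_inj (fun k => M.r ν k x), add_sub_cancel_left,
    add_sub_cancel_left, Finset.mul_sum]
  refine Finset.sum_congr rfl fun k hk => ?_
  rw [(W.t_extra hx ν hk).1, (W.t_extra hx ν hk).2]
  ring

/-- Bridge between the closed form and the raw expansion, with `node_term` applied to each node. It
serves twice: for `∂_ν` and for the vertical field of the same node. -/
theorem ricX_eq (W : M.IsKerrNUT S a g₁ g₂) (V : M.IsValid S T) {x : X → ℝ} (hx : x ∈ S)
    (ν : X) : M.ricX a g₁ g₂ ν x = -(1 / 2) * (∑ l, M.D l x * M.t l (M.e ν) x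
        + ∑ l, M.H (M.e l) x * M.r l (M.e ν) x)
      - (1 / 2) * ∑ l, M.w l x * M.H (M.e l) x * M.t l (M.e ν) x
      + (1 / 2) * ∑ l, M.t l (M.e ν) x ^ 2 * M.H (M.e l) x
      - (1 / 2) * ∑ k, M.t ν k x ^ 2 * M.H k x
      - (1 / 2) * pd ν (M.D ν) x - (1 / 2) * M.w ν x * M.D ν x
      - (1 / 2) * M.H (M.e ν) x * (∑ μ, M.r ν (M.e μ) x - (1 / 2) * ∑ μ, M.t ν (M.e μ) x ^ 2
        + ∑ k, M.r ν k x - (1 / 2) * ∑ k, M.t ν k x ^ 2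
        + ∑ α, 2 / (x ν ^ 2 - a (M.blk α) ^ 2) - (1 / 2) * ∑ α, M.φ ν (M.blk α) x ^ 2) := by
  have f1 : ∑ k, (1 / 2) * M.r ν k x * M.yh a g₁ k x
      = ∑ l, (-(1 / 2) * (M.D l x * M.t l (M.e ν) x
        + M.H (M.e l) x * M.r l (M.e ν) x) - (1 / 2) * M.w l x * M.H (M.e l) x * M.t l (M.e ν) x
        + (1 / 2) * M.t l (M.e ν) x ^ 2 * M.H (M.e l) x)
        - ∑ k, (1 / 2) * M.t ν k x ^ 2 * M.H k x := by
    rw [sum_e V.e_inj, sum_e V.e_inj (fun k => (1 / 2) * M.t ν k x ^ 2 * M.H k x), ← sub_sub,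
      ← Finset.sum_sub_distrib, sub_eq_add_neg, ← Finset.sum_neg_distrib]
    congr 1
    · refine Finset.sum_congr rfl fun l _ => (W.node_term V hx ν (M.e l) _
        (fun h => absurd rfl (mem_extra.1 h l)) fun l' h => ?_).symm
      rw [V.e_inj h]
    · refine Finset.sum_congr rfl fun k hk => (W.node_term V hx ν k _
        (fun h => by ring) fun l' h => absurd h.symm (mem_extra.1 hk l')).symm
  have f2 : M.tau ν x = x ν * ∑ k, M.r ν k x := by
    simp only [tau, W.t_eq x hx, Finset.mul_sum]
  have f3 := W.sum_t_sq V hx ν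
  have f4 : ∑ k, (1 / 2) * M.r ν k x * (M.yh a g₁ (M.e ν) x + M.yh a g₁ k x)
      = (1 / 2) * M.yh a g₁ (M.e ν) x * ∑ k, M.r ν k x
        + ∑ k, (1 / 2) * M.r ν k x * M.yh a g₁ k x := by
    rw [Finset.mul_sum, ← Finset.sum_add_distrib]
    exact Finset.sum_congr rfl fun k _ => by ring
  rw [W.pd_D V hx, ricX,
    Finset.mul_sum (f := fun k => M.r ν k x * (M.yh a g₁ (M.e ν) x + M.yh a g₁ k x)),
    Finset.sum_congr rfl fun k _ => (mul_assoc _ _ _).symm, f4, f1, yh_e V.e_inj]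
  simp only [mul_add, mul_sub, Finset.sum_add_distrib, Finset.sum_sub_distrib, mul_assoc,
    ← Finset.mul_sum, W.w_eq' V hx ν] at *
  linear_combination ((1 / 2) * M.pw a ν x) * W.D_eq x hx ν
    - ((1 / 2) * g₁ ν x + (1 / 2) * M.H (M.e ν) x * M.pw a ν x) * f2
    + ((1 / 4) * M.H (M.e ν) x) * f3

theorem frameRicci_xx_self (W : M.IsKerrNUT S a g₁ g₂) (V : M.IsValid S T)
    {p : X ⊕ K ⊕ Υ → ℝ} (hp : p ∈ cylinder K S T) (ν : X) :
    M.H (M.e ν) (xPart p) * M.frameRicci p (.inl ν) (.inl ν) = M.ricX a g₁ g₂ ν (xPart p) := by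
  rw [V.frameRicci_xx hp]
  set x := xPart p with hxd
  have hx : x ∈ S := hp.1
  have hH := fun k => V.H_ne k x hx
  have ht : ∀ ν k, DifferentiableAt ℝ (M.t ν k) x :=
    fun ν k => ContDiffOn.diffAt V.openS (V.t_smooth _ _) hx
  have hφ : ∀ ν b, DifferentiableAt ℝ (M.φ ν b) x :=
    fun ν k => ContDiffOn.diffAt V.openS (V.φ_smooth _ _) hx
  have hHd : ∀ k, DifferentiableAt ℝ (M.H k) x :=
    fun k => ContDiffOn.diffAt V.openS (V.H_smooth _) hx
  have hHi : ∀ k, DifferentiableAt ℝ (fun x => (M.H k x)⁻¹) x :=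
    fun k => (hHd k).inv (hH k)
  have hDd : ∀ ν, DifferentiableAt ℝ (M.D ν) x :=
    fun k => ContDiffOn.diffAt V.openS (V.D_smooth _) hx
  -- The symbol `cX l ν ν` has a different form for `l = ν`, where it is `-D / 2H`; hence the
  -- separate contribution of the diagonal term.
  have e1 : ∑ l, pd l (M.cX l ν ν) x = -(1 / 2) * (∑ l, (M.D l x * M.t l (M.e ν) x
        + M.H (M.e l) x * M.r l (M.e ν) x) / M.H (M.e ν) x
      + (pd ν (M.D ν) x / M.H (M.e ν) x - (M.D ν x / M.H (M.e ν) x) ^ 2)) := by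
    have h2 : ∀ l, pd l (M.cX l ν ν) x
        = -(1 / 2) * ((M.D l x * M.t l (M.e ν) x + M.H (M.e l) x * M.r l (M.e ν) x)
            / M.H (M.e ν) x) + if l = ν then
          -(1 / 2) * (pd ν (M.D ν) x / M.H (M.e ν) x - (M.D ν x / M.H (M.e ν) x) ^ 2)
          else 0 := fun l => by
      by_cases h : l = ν
      · subst h
        rw [pd_congr V.openS (f' := fun x => -(1 / 2) * (M.D l x * (M.H (M.e l) x)⁻¹))
          (fun y hy => by simp [cX, V.t_self l y hy]; ring) hx,
          pd_const_mul ((hDd l).fun_mul (hHi _)), pd_mul (hDd l) (hHi _), pd_inv (hHd _) (hH _),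
          V.dH l _ x hx, if_pos rfl, V.t_self l x hx, r, if_pos rfl, if_pos rfl]
        ring
      · have h2 : ¬ν = l := fun h' => h h'.symm
        rw [pd_congr V.openS (f' := fun x => -(1 / 2) * (M.H (M.e l) x * M.t l (M.e ν) x
            * (M.H (M.e ν) x)⁻¹))
          (fun y hy => by simp [cX, h, h2]; ring) hx,
          pd_const_mul (((hHd _).fun_mul (ht _ _)).fun_mul (hHi _)),
          pd_mul ((hHd _).fun_mul (ht _ _)) (hHi _), pd_mul (hHd _) (ht _ _),
          pd_inv (hHd _) (hH _), V.dH l _ x hx, V.dH l _ x hx, if_pos rfl,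
          if_neg fun h' => h (V.e_inj h').symm, W.pd_t V hx, if_pos rfl, V.t_self l x hx, if_neg h]
        have := hH (M.e ν)
        simp only [mul_zero, ite_self]
        field_simp
        ring
    simp only [h2, Finset.sum_add_distrib, Finset.sum_ite_eq', Finset.mem_univ, if_true,
      ← Finset.mul_sum]
    ring
  have e2 : pd ν (M.w ν) x = (1 / 2) * ∑ μ, (M.r ν (M.e μ) x - M.t ν (M.e μ) x ^ 2)
      + (1 / 2) * ∑ k, (M.r ν k x - M.t ν k x ^ 2)
      + (1 / 2) * ∑ α, (2 / (x ν ^ 2 - a (M.blk α) ^ 2) - M.φ ν (M.blk α) x ^ 2) := by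
    have hs : ∀ k, pd ν (M.t ν k) x = M.r ν k x - M.t ν k x ^ 2 := fun k => by
      rw [W.pd_t V hx, if_pos rfl, V.t_self ν x hx]
      simp
    rw [pd_congr V.openS (fun y hy => w_eq V hy ν) hx]
    have d1 : DifferentiableAt ℝ (fun x => ∑ μ, M.t ν (M.e μ) x) x :=
      DifferentiableAt.fun_sum fun _ _ => ht _ _
    have d2 : DifferentiableAt ℝ (fun x => M.tau ν x) x := DifferentiableAt.fun_sum fun _ _ => ht _ _
    have d3 : DifferentiableAt ℝ (fun x => ∑ α, M.φ ν (M.blk α) x) x :=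
      DifferentiableAt.fun_sum fun _ _ => hφ _ _
    rw [pd_add ((d1.const_mul _).fun_add (d2.const_mul _)) (d3.const_mul _),
      pd_add (d1.const_mul _) (d2.const_mul _), pd_const_mul d1, pd_const_mul d2, pd_const_mul d3,
      pd_sum fun _ _ => ht _ _, pd_sum fun _ _ => hφ _ _]
    simp only [tau]
    rw [pd_sum fun _ _ => ht _ _]
    simp only [hs, W.pd_φ V hx, if_true]
  have e3 : ∑ l, M.w l x * M.cX l ν ν x
      = -(1 / 2) * (∑ l, M.w l x * M.H (M.e l) x * M.t l (M.e ν) x / M.H (M.e ν) x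
        + M.w ν x * (M.D ν x / M.H (M.e ν) x)) := by
    simp only [cX, mul_add, mul_sub, mul_ite, mul_zero, Finset.sum_add_distrib,
      Finset.sum_sub_distrib, Finset.sum_ite_eq, Finset.sum_ite_eq', Finset.mem_univ, if_true,
      and_true, V.t_self ν x hx, Finset.mul_sum]
    rw [← sub_eq_zero, sub_sub, add_zero, zero_sub]
    rw [Finset.sum_congr rfl fun l _ => (by ring : M.w l x * (1 / 2 * (M.H (M.e l) x
      * M.t l (M.e ν) x / M.H (M.e ν) x)) = -(-(1 / 2) * (M.w l x * M.H (M.e l) x * M.t l (M.e ν) x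
        / M.H (M.e ν) x))), Finset.sum_neg_distrib]
    ring
  have e4 : ∑ l, ∑ m, M.cX m l ν x * M.cX l m ν x
      = (1 / 4) * ∑ l, M.t ν (M.e l) x ^ 2
        - (1 / 2) * ∑ l, M.t l (M.e ν) x ^ 2 * M.H (M.e l) x / M.H (M.e ν) x
        + (1 / 4) * (M.D ν x / M.H (M.e ν) x) ^ 2 := by
    have := hH (M.e ν)
    have h1 : ∀ l m, M.cX m l ν x * M.cX l m ν x = M.cX l m ν x * M.cX m l ν x :=
      fun _ _ => mul_comm _ _
    simp only [h1]
    simp only [cX_eq_arrow]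
    rw [sum_arrow_mul_arrow_self (by simp [V.t_self _ x hx]) (by simp [V.t_self _ x hx])
      (by simp [V.t_self _ x hx]) (by simp [V.t_self _ x hx]) (by simp [V.t_self _ x hx])
      (by simp [V.t_self _ x hx]), Finset.mul_sum, Finset.mul_sum,
      ← Finset.sum_add_distrib, ← Finset.sum_add_distrib, ← Finset.sum_sub_distrib]
    congr 1
    · refine Finset.sum_congr rfl fun l _ => by ring
    · ring
  have e5 : ∑ k, ∑ l, M.B ν l k x / M.H l x * (M.B ν k l x / M.H k x)
      = ∑ k, M.t ν k x ^ 2 + 2 * ∑ k, M.t ν k x ^ 2 * M.H k x / M.H (M.e ν) x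
        + (M.D ν x / M.H (M.e ν) x) ^ 2 := by
    have h1 : ∀ k l, M.B ν l k x / M.H l x * (M.B ν k l x / M.H k x)
        = (M.B ν k l x / M.H k x) * (M.B ν l k x / M.H l x) := fun _ _ => mul_comm _ _
    simp only [h1]
    simp only [B_div_eq_arrow V hx]
    rw [sum_arrow_mul_arrow_self (by simp [V.t_self _ x hx]) (by simp [V.t_self _ x hx])
      (by simp [V.t_self _ x hx]) (by simp [V.t_self _ x hx]) (by simp [V.t_self _ x hx])
      (by simp [V.t_self _ x hx]), Finset.mul_sum,
      ← Finset.sum_add_distrib, ← Finset.sum_add_distrib, ← Finset.sum_add_distrib]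
    congr 1
    · refine Finset.sum_congr rfl fun l _ => by ring
    · ring
  rw [e1, e2, e3, e4, e5, W.ricX_eq V hx]
  simp only [mul_add, mul_sub, Finset.sum_add_distrib, Finset.sum_sub_distrib, mul_assoc,
    ← Finset.mul_sum, ← Finset.sum_div] at *
  have h0 := hH (M.e ν)
  have hc : ∀ c A : ℝ, M.H (M.e ν) x * (c * (A / M.H (M.e ν) x)) = c * A := fun c A => by
    field_simp
  have hc' : ∀ c d A : ℝ, M.H (M.e ν) x * (c * (d * (A / M.H (M.e ν) x))) = c * (d * A) :=
    fun c d A => by field_simp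
  simp only [hc, hc', ← pow_two]
  ring

end IsKerrNUT

end FibData

end GenKerrNUT

namespace GenKerrNUT

/-! ### Contributions of single coordinates to the vertical Ricci tensor -/

namespace FibData

namespace IsKerrNUT

variable {X K Υ Bl : Type} [Fintype X] [Fintype K] [Fintype Υ]
  [DecidableEq X] [DecidableEq K] [DecidableEq Υ]
  {M : FibData X K Υ Bl} {S : Set (X → ℝ)} {T : Set (Υ → ℝ)}
  {a : Bl → ℝ} {g₁ g₂ : X → (X → ℝ) → ℝ}

variable (M) in
/-- The contribution of `x_μ` to the Ricci tensor on the vertical frame. -/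
def kkTerm (μ : X) (k l : K) (x : X → ℝ) : ℝ :=
  -(1 / 2) * pd μ (fun x => M.H (M.e μ) x * M.B μ l k x) x
    - (1 / 2) * M.w μ x * (M.H (M.e μ) x * M.B μ l k x)
    + (1 / 2) * M.H (M.e μ) x * ∑ j, (M.B μ j l x * M.B μ j k x
      / M.H j x - M.L μ j l x * M.B μ j k x - M.L μ j k x * M.B μ j l x)

theorem kkTerm_symm (μ : X) (k l : K) (x : X → ℝ) :
    kkTerm M μ k l x = kkTerm M μ l k x := by
  have h : ∀ x, M.B μ l k x = M.B μ k l x := fun x => B_symm _ _ _ _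
  simp only [kkTerm, h]
  congr 2
  exact Finset.sum_congr rfl fun j _ => by ring

/-- Here `B μ l k` is identically zero, so neither the derivative nor the divergence term is
present, and only the summation index `M.e μ` links the two fields. -/
theorem kkTerm_of_ne (V : M.IsValid S T) {x : X → ℝ} (hx : x ∈ S) {μ : X} {k l : K}
    (h : k ≠ l) (hk : k ≠ M.e μ) (hl : l ≠ M.e μ) :
    kkTerm M μ k l x = (1 / 2) * M.t μ k x * M.t μ l x * M.H k x * M.H l x := by
  have hB : ∀ x, M.B μ l k x = 0 := fun x => by simp [B, h.symm, hk, hl]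
  have h0 := V.H_ne (M.e μ) x hx
  have hs : ∑ j, (M.B μ j l x * M.B μ j k x
      / M.H j x - M.L μ j l x * M.B μ j k x - M.L μ j k x * M.B μ j l x)
      = M.t μ k x * M.t μ l x * M.H k x * M.H l x / M.H (M.e μ) x := by
    rw [Finset.sum_eq_single (M.e μ)]
    · simp [B, L, hk, hl, hk.symm, hl.symm]; ring
    · intro j _ hj
      have h1 := V.H_ne j x hx
      by_cases e1 : j = k
      · subst e1; simp [B, L, hk, hl, h]
      by_cases e2 : j = l
      · subst e2; simp [B, L, hk, hl, e1]
      · simp [B, L, hk, hl, hj, e1, e2]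
    · simp
  rw [kkTerm, hs]
  simp only [hB, mul_zero, pd_const]
  field_simp
  ring

/-- Only `j = M.e μ` and `j = k` contribute to the sum; its `D`-term cancels against the derivative
of `H (M.e μ)`. -/
theorem kkTerm_left (W : M.IsKerrNUT S a g₁ g₂) (V : M.IsValid S T) {x : X → ℝ} (hx : x ∈ S)
    {μ : X} {k : K} (hk : k ≠ M.e μ) :
    kkTerm M μ (M.e μ) k x = (1 / 2) * M.H (M.e μ) x * M.H k x
      * (M.r μ k x - M.t μ k x ^ 2 + M.w μ x * M.t μ k x) := by
  have hB : ∀ x ∈ S, M.H (M.e μ) x * M.B μ k (M.e μ) x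
    = -(M.H (M.e μ) x * (M.t μ k x * M.H k x)) := fun x hx => by simp [B, hk]
  have h0 := V.H_ne (M.e μ) x hx
  have ht : ∀ k, DifferentiableAt ℝ (M.t μ k) x :=
    fun k => ContDiffOn.diffAt V.openS (V.t_smooth _ _) hx
  have hH : ∀ k, DifferentiableAt ℝ (M.H k) x :=
    fun k => ContDiffOn.diffAt V.openS (V.H_smooth _) hx
  have hs : ∑ j, (M.B μ j k x * M.B μ j (M.e μ) x
      / M.H j x - M.L μ j k x * M.B μ j (M.e μ) x - M.L μ j (M.e μ) x * M.B μ j k x)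
      = -(M.D μ x * M.t μ k x * M.H k x / M.H (M.e μ) x) + M.t μ k x ^ 2 * M.H k x := by
    rw [← Finset.add_sum_erase _ _ (Finset.mem_univ (M.e μ)),
      Finset.sum_eq_single k]
    · have h1 := V.H_ne k x hx
      simp [B, L, hk, hk.symm, V.t_self μ x hx]
      field_simp
      ring
    · intro j hj hjk
      have hj := Finset.ne_of_mem_erase hj
      simp [B, L, hj, hjk, hk]
    · simp [hk]
  rw [kkTerm, hs, pd_congr V.openS hB hx, hB x hx, pd_neg,
    pd_mul (hH _) ((ht _).fun_mul (hH _)), pd_mul (ht _) (hH _), V.dH _ _ x hx, V.dH _ _ x hx,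
    if_pos rfl, if_neg hk, W.pd_t V hx, if_pos rfl, V.t_self μ x hx]
  simp only [mul_zero, ite_self]
  field_simp
  ring

theorem kkTerm_diag (W : M.IsKerrNUT S a g₁ g₂) (V : M.IsValid S T) {x : X → ℝ} (hx : x ∈ S)
    {μ : X} {k : K} (hk : k ≠ M.e μ) :
    kkTerm M μ k k x = M.H k x * (-(1 / 2) * (M.D μ x * M.t μ k x + M.H (M.e μ) x * M.r μ k x)
      - (1 / 2) * M.w μ x * M.H (M.e μ) x * M.t μ k x + (1 / 2) * M.t μ k x ^ 2 * M.H (M.e μ) x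
      + (1 / 2) * M.t μ k x ^ 2 * M.H k x) := by
  have hB : ∀ x ∈ S, M.H (M.e μ) x * M.B μ k k x
    = M.H (M.e μ) x * (M.t μ k x * M.H k x) := fun x hx => by simp [B, hk]
  have h0 := V.H_ne (M.e μ) x hx
  have ht : ∀ k, DifferentiableAt ℝ (M.t μ k) x :=
    fun k => ContDiffOn.diffAt V.openS (V.t_smooth _ _) hx
  have hH : ∀ k, DifferentiableAt ℝ (M.H k) x :=
    fun k => ContDiffOn.diffAt V.openS (V.H_smooth _) hx
  have hs : ∑ j, (M.B μ j k x * M.B μ j k x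
      / M.H j x - M.L μ j k x * M.B μ j k x - M.L μ j k x * M.B μ j k x)
      = M.t μ k x ^ 2 * M.H k x ^ 2 / M.H (M.e μ) x - M.t μ k x ^ 2 * M.H k x := by
    rw [← Finset.add_sum_erase _ _ (Finset.mem_univ (M.e μ)),
      Finset.sum_eq_single k]
    · have h1 := V.H_ne k x hx
      simp [B, L, hk, hk.symm]
      field_simp
      ring
    · intro j hj hjk
      have hj := Finset.ne_of_mem_erase hj
      simp [B, L, hj, hjk, hk]
    · simp [hk]
  rw [kkTerm, hs, pd_congr V.openS hB hx, hB x hx,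
    pd_mul (hH _) ((ht _).fun_mul (hH _)), pd_mul (ht _) (hH _), V.dH _ _ x hx, V.dH _ _ x hx,
    if_pos rfl, if_neg hk, W.pd_t V hx, if_pos rfl, V.t_self μ x hx]
  simp only [mul_zero, ite_self]
  field_simp
  ring

/-- Every `j` contributes here, since the row of `B` belonging to `M.e μ` is full; this produces the
sum of `t² H` over all nodes. -/
theorem kkTerm_self (V : M.IsValid S T) {x : X → ℝ} (hx : x ∈ S) (μ : X) :
    kkTerm M μ (M.e μ) (M.e μ) x = M.H (M.e μ) x * (-(1 / 2) * pd μ (M.D μ) x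
      - (1 / 2) * M.w μ x * M.D μ x - (1 / 2) * ∑ k, M.t μ k x ^ 2 * M.H k x) := by
  have hB : ∀ x ∈ S, M.H (M.e μ) x * M.B μ (M.e μ) (M.e μ) x
    = M.H (M.e μ) x * M.D μ x := fun x hx => by simp [B, V.t_self μ x hx]
  have h0 := V.H_ne (M.e μ) x hx
  have hH : ∀ k, DifferentiableAt ℝ (M.H k) x :=
    fun k => ContDiffOn.diffAt V.openS (V.H_smooth _) hx
  have hD : DifferentiableAt ℝ (M.D μ) x := ContDiffOn.diffAt V.openS (V.D_smooth _) hx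
  have hs : ∑ j, (M.B μ j (M.e μ) x * M.B μ j (M.e μ) x
      / M.H j x - M.L μ j (M.e μ) x * M.B μ j (M.e μ) x - M.L μ j (M.e μ) x * M.B μ j (M.e μ) x)
      = M.D μ x ^ 2 / M.H (M.e μ) x - ∑ k, M.t μ k x ^ 2 * M.H k x := by
    have : ∀ j, M.B μ j (M.e μ) x * M.B μ j (M.e μ) x
      / M.H j x - M.L μ j (M.e μ) x * M.B μ j (M.e μ) x - M.L μ j (M.e μ) x * M.B μ j (M.e μ) x
        = (if j = M.e μ then M.D μ x ^ 2 / M.H (M.e μ) x else 0) - M.t μ j x ^ 2 * M.H j x := by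
      intro j
      have h1 := V.H_ne j x hx
      by_cases hj : j = M.e μ
      · subst hj; simp [B, L, V.t_self μ x hx]; ring
      · simp [B, L, hj]
        field_simp
        ring
    simp only [this, Finset.sum_sub_distrib, Finset.sum_ite_eq', Finset.mem_univ, if_true]
  rw [kkTerm, hs, pd_congr V.openS hB hx, hB x hx, pd_mul (hH _) hD, V.dH _ _ x hx, if_pos rfl]
  field_simp
  ring

end IsKerrNUT

end FibData

end GenKerrNUT

namespace GenKerrNUT

/-! ### Vertical and base components of the Ricci tensor -/

namespace FibData

namespace IsKerrNUT

variable {X K Υ Bl : Type} [Fintype X] [Fintype K] [Fintype Υ]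
  [DecidableEq X] [DecidableEq K] [DecidableEq Υ]
  {M : FibData X K Υ Bl} {S : Set (X → ℝ)} {T : Set (Υ → ℝ)}
  {a : Bl → ℝ} {g₁ g₂ : X → (X → ℝ) → ℝ}

/-- The conformal factor cancels in `C / f`. The value of `σ` is irrelevant where `a = 0`, because
there `C` vanishes. -/
theorem C_mul_C (W : M.IsKerrNUT S a g₁ g₂) (V : M.IsValid S T) {x : X → ℝ} (hx : x ∈ S)
    (k l : K) : (1 / 4) * M.H k x * M.H l x * ∑ α, M.C k (M.blk α) x
        * M.C l (M.blk α) x / M.f (M.blk α) x ^ 2 * M.σ (M.blk α)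
      = M.H k x * M.H l x * ∑ α, a (M.blk α) ^ 2
        / ((M.s k x - a (M.blk α) ^ 2) * (M.s l x - a (M.blk α) ^ 2)) := by
  rw [Finset.mul_sum, Finset.mul_sum]
  refine Finset.sum_congr rfl fun α _ => ?_
  have := V.f_ne (M.blk α) x hx
  rw [W.C_eq x hx, W.C_eq x hx]
  by_cases h : a (M.blk α) = 0
  · simp [h]
  · rw [W.σ_eq α h]
    simp only [div_eq_mul_inv, mul_inv]
    field_simp
    ring

theorem frameRicci_kk_eq (W : M.IsKerrNUT S a g₁ g₂) (V : M.IsValid S T)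
    {p : X ⊕ K ⊕ Υ → ℝ} (hp : p ∈ cylinder K S T) (k l : K) :
    M.frameRicci p (.inr (.inl k)) (.inr (.inl l)) = ∑ μ, kkTerm M μ k l (xPart p)
      + M.H k (xPart p) * M.H l (xPart p) * ∑ α, a (M.blk α) ^ 2
        / ((M.s k (xPart p) - a (M.blk α) ^ 2) * (M.s l (xPart p) - a (M.blk α) ^ 2)) := by
  rw [V.frameRicci_kk hp, W.C_mul_C V hp.1]
  rfl

theorem kkTerm_ee (W : M.IsKerrNUT S a g₁ g₂) (V : M.IsValid S T) {x : X → ℝ} (hx : x ∈ S)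
    {κ ν : X} (h : κ ≠ ν) (μ : X) : kkTerm M μ (M.e κ) (M.e ν) x
      = (1 / 2) * M.H (M.e κ) x * M.H (M.e ν) x * (M.t μ (M.e κ) x * M.t μ (M.e ν) x
        + (if μ = ν then M.r ν (M.e κ) x - M.t ν (M.e κ) x ^ 2 + M.w ν x * M.t ν (M.e κ) x else 0)
        + (if μ = κ then M.r κ (M.e ν) x - M.t κ (M.e ν) x ^ 2 + M.w κ x * M.t κ (M.e ν) x
          else 0)) := by
  have hκν : M.e κ ≠ M.e ν := fun h' => h (V.e_inj h')
  by_cases h1 : μ = ν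
  · subst h1
    rw [kkTerm_symm, W.kkTerm_left V hx hκν, V.t_self μ x hx, if_pos rfl, if_neg h.symm]
    ring
  by_cases h2 : μ = κ
  · subst h2
    rw [W.kkTerm_left V hx hκν.symm, V.t_self μ x hx, if_pos rfl, if_neg h1]
    ring
  · rw [kkTerm_of_ne V hx hκν (fun h => h2 (V.e_inj h).symm) (fun h => h1 (V.e_inj h).symm),
      if_neg h1, if_neg h2]
    ring

/-- Again partial fractions for three nodes, now with the first factors exchanged as dictated by the
cross terms of `kkTerm_ee`; the conditional terms handle coincidences. -/
theorem t_swap_mul_t (W : M.IsKerrNUT S a g₁ g₂) (V : M.IsValid S T) {x : X → ℝ} (hx : x ∈ S)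
    {κ ν : X} (h : κ ≠ ν) (μ : X) :
    M.t ν (M.e κ) x * M.t ν (M.e μ) x + M.t κ (M.e ν) x * M.t κ (M.e μ) x
      = -(M.t μ (M.e κ) x * M.t μ (M.e ν) x) + (if μ = κ then M.t ν (M.e κ) x ^ 2 else 0)
        + (if μ = ν then M.t κ (M.e ν) x ^ 2 else 0) := by
  have hκν : M.e κ ≠ M.e ν := fun h' => h (V.e_inj h')
  by_cases h1 : μ = κ
  · subst h1
    rw [V.t_self μ x hx, if_pos rfl, if_neg h]
    ring
  by_cases h2 : μ = ν
  · subst h2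
    rw [V.t_self μ x hx, if_pos rfl, if_neg h1]
    ring
  have h1' : M.e μ ≠ M.e κ := fun h' => h1 (V.e_inj h')
  have h2' : M.e μ ≠ M.e ν := fun h' => h2 (V.e_inj h')
  have e1 := W.sub_ne V.e_inj hx h1'
  have e2 := W.sub_ne V.e_inj hx h2'
  have e3 := W.sub_ne V.e_inj hx hκν
  rw [s_e V.e_inj] at e1 e2 e3
  have e4 : x μ ^ 2 - x κ ^ 2 = -(x κ ^ 2 - x μ ^ 2) := by ring
  have e5 : x μ ^ 2 - x ν ^ 2 = -(x ν ^ 2 - x μ ^ 2) := by ring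
  have e6 : x κ ^ 2 - x ν ^ 2 = -(x ν ^ 2 - x κ ^ 2) := by ring
  simp only [W.t_eq x hx, r, if_neg h1', if_neg h2', if_neg hκν, if_neg hκν.symm, if_neg h1'.symm,
    if_neg h2'.symm, if_neg h1, if_neg h2, s_e V.e_inj]
  rw [e4, e5, e6]
  field_simp
  ring

theorem t_swap_mul_φ (W : M.IsKerrNUT S a g₁ g₂) (V : M.IsValid S T) {x : X → ℝ} (hx : x ∈ S)
    {κ ν : X} (h : κ ≠ ν) (b : Bl) :
    M.t ν (M.e κ) x * M.φ ν b x + M.t κ (M.e ν) x * M.φ κ b x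
      = -(4 * (a b ^ 2 / ((x κ ^ 2 - a b ^ 2) * (x ν ^ 2 - a b ^ 2)))) := by
  have hκν : M.e κ ≠ M.e ν := fun h' => h (V.e_inj h')
  have e1 := sub_ne_zero.2 (W.s_ne_a x hx κ b)
  have e2 := sub_ne_zero.2 (W.s_ne_a x hx ν b)
  have e3 := W.sub_ne V.e_inj hx hκν
  rw [s_e V.e_inj] at e3
  simp only [W.t_eq x hx, W.φ_eq x hx, r, if_neg hκν, if_neg hκν.symm, s_e V.e_inj]
  have e4 : x κ ^ 2 - x ν ^ 2 = -(x ν ^ 2 - x κ ^ 2) := by ring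
  rw [e4]
  field_simp
  ring

/-- The divergences `w` multiplied by `t` turn, through `t_swap_mul_t` and `t_swap_mul_φ`, into the
negatives of the quadratic terms and of the curvature term. Extra nodes cancel in `f2` because `r`
is skew under exchange of two coordinate nodes. -/
theorem frameRicci_ee_of_ne (W : M.IsKerrNUT S a g₁ g₂) (V : M.IsValid S T)
    {p : X ⊕ K ⊕ Υ → ℝ} (hp : p ∈ cylinder K S T) {κ ν : X} (h : κ ≠ ν) :
    M.frameRicci p (.inr (.inl (M.e κ))) (.inr (.inl (M.e ν))) = 0 := by
  rw [W.frameRicci_kk_eq V hp]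
  set x := xPart p with hxd
  have hx : x ∈ S := hp.1
  have f1 : M.t ν (M.e κ) x * ∑ μ, M.t ν (M.e μ) x + M.t κ (M.e ν) x * ∑ μ, M.t κ (M.e μ) x
      = -∑ μ, M.t μ (M.e κ) x * M.t μ (M.e ν) x + M.t ν (M.e κ) x ^ 2 + M.t κ (M.e ν) x ^ 2 := by
    rw [Finset.mul_sum, Finset.mul_sum, ← Finset.sum_add_distrib]
    simp only [W.t_swap_mul_t V hx h, Finset.sum_add_distrib, Finset.sum_ite_eq',
      Finset.mem_univ, if_true, Finset.sum_neg_distrib]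
  have f2 : M.t ν (M.e κ) x * M.tau ν x + M.t κ (M.e ν) x * M.tau κ x
      = -∑ μ, M.t μ (M.e κ) x * M.t μ (M.e ν) x + M.t ν (M.e κ) x ^ 2 + M.t κ (M.e ν) x ^ 2 := by
    rw [← f1, tau, tau, sum_e V.e_inj, sum_e V.e_inj (fun k => M.t κ k x), mul_add, mul_add,
      add_add_add_comm, add_eq_left, Finset.mul_sum, Finset.mul_sum, ← Finset.sum_add_distrib]
    refine Finset.sum_eq_zero fun k hk => ?_
    rw [(W.t_extra hx ν hk).1, (W.t_extra hx κ hk).1, W.t_eq x hx, W.t_eq x hx, r_swap V ν κ]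
    have := W.x_ne x hx ν
    have := W.x_ne x hx κ
    field_simp
    ring
  have f3 : M.t ν (M.e κ) x * ∑ α, M.φ ν (M.blk α) x + M.t κ (M.e ν) x * ∑ α, M.φ κ (M.blk α) x
      = -(4 * ∑ α, a (M.blk α) ^ 2
        / ((x κ ^ 2 - a (M.blk α) ^ 2) * (x ν ^ 2 - a (M.blk α) ^ 2))) := by
    rw [Finset.mul_sum, Finset.mul_sum, ← Finset.sum_add_distrib]
    simp only [W.t_swap_mul_φ V hx h, Finset.sum_neg_distrib, Finset.mul_sum]
  have f4 := r_swap V κ ν x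
  simp only [W.kkTerm_ee V hx h, ← Finset.mul_sum, Finset.sum_add_distrib, Finset.sum_ite_eq',
    Finset.mem_univ, if_true, s_e V.e_inj, w_eq V hx]
  linear_combination (1 / 4 * M.H (M.e κ) x * M.H (M.e ν) x) * (f1 + f2 + f3)
    + (1 / 2 * M.H (M.e κ) x * M.H (M.e ν) x) * f4

/-- The extra node lies at `0`, where the differences of nodes become monomials and `t` is `2 / x`;
uniqueness of the extra node makes `tau` exceed the coordinate sum by a single such term. -/
theorem frameRicci_extra (W : M.IsKerrNUT S a g₁ g₂) (V : M.IsValid S T)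
    {p : X ⊕ K ⊕ Υ → ℝ} (hp : p ∈ cylinder K S T) (κ : X) {k : K} (hk : k ∈ M.extra) :
    M.frameRicci p (.inr (.inl (M.e κ))) (.inr (.inl k)) = 0 := by
  rw [W.frameRicci_kk_eq V hp]
  set x := xPart p with hxd
  have hx : x ∈ S := hp.1
  have hke : ∀ ν, k ≠ M.e ν := fun ν h => mem_extra.1 hk ν h.symm
  have hxκ := W.x_ne x hx κ
  have h1 : ∀ μ, kkTerm M μ (M.e κ) k x = (1 / 2) * M.H (M.e κ) x * M.H k x
      * (2 * M.r μ (M.e κ) x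
        + (if μ = κ then M.r κ k x - M.t κ k x ^ 2 + M.w κ x * M.t κ k x else 0)) := fun μ => by
    by_cases h : μ = κ
    · subst h
      have h0 : M.r μ (M.e μ) x = 0 := if_pos rfl
      rw [W.kkTerm_left V hx (hke μ), if_pos rfl, h0]
      ring
    · rw [kkTerm_of_ne V hx (hke κ).symm (fun h' => h (V.e_inj h').symm) (hke μ), if_neg h,
        (W.t_extra hx μ hk).1, W.t_eq x hx]
      have := W.x_ne x hx μ
      field_simp
      ring
  have f1 : 2 * ∑ μ, M.r μ (M.e κ) x = -(2 / x κ * ∑ μ, M.t κ (M.e μ) x) := by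
    rw [Finset.mul_sum, Finset.mul_sum, ← Finset.sum_neg_distrib]
    refine Finset.sum_congr rfl fun μ _ => ?_
    rw [r_swap V, W.t_eq x hx]
    field_simp
  have f2 : M.tau κ x = ∑ μ, M.t κ (M.e μ) x + 2 / x κ := by
    have : M.extra = {k} := Finset.eq_singleton_iff_unique_mem.2
      ⟨hk, fun l hl => W.extra_le l hl k hk⟩
    rw [tau, sum_e V.e_inj, this, Finset.sum_singleton, (W.t_extra hx κ hk).1]
  have f3 : ∑ α, a (M.blk α) ^ 2 / ((x κ ^ 2 - a (M.blk α) ^ 2) * (0 - a (M.blk α) ^ 2))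
      = -(1 / (2 * x κ) * ∑ α, M.φ κ (M.blk α) x) := by
    rw [Finset.mul_sum, ← Finset.sum_neg_distrib]
    refine Finset.sum_congr rfl fun α _ => ?_
    have h1 := W.a_ne k hk α
    have h2 := sub_ne_zero.2 (W.s_ne_a x hx κ (M.blk α))
    rw [W.φ_eq x hx, zero_sub]
    field_simp
  simp only [h1, ← Finset.mul_sum, Finset.sum_add_distrib, Finset.sum_ite_eq',
    Finset.mem_univ, if_true, s_e V.e_inj, w_eq V hx, f2, (W.t_extra hx κ hk).1,
    (W.t_extra hx κ hk).2, s_extra hk, f3]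
  linear_combination (1 / 2 * M.H (M.e κ) x * M.H k x) * f1

theorem frameRicci_kk_of_ne (W : M.IsKerrNUT S a g₁ g₂) (V : M.IsValid S T)
    {p : X ⊕ K ⊕ Υ → ℝ} (hp : p ∈ cylinder K S T) {k l : K} (h : k ≠ l) :
    M.frameRicci p (.inr (.inl k)) (.inr (.inl l)) = 0 := by
  have hs : ∀ k l, M.frameRicci p (.inr (.inl k)) (.inr (.inl l))
      = M.frameRicci p (.inr (.inl l)) (.inr (.inl k)) := fun k l => by
    rw [W.frameRicci_kk_eq V hp, W.frameRicci_kk_eq V hp]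
    simp only [kkTerm_symm _ k l, mul_comm (M.H k _), mul_comm (M.s k _ - _)]
  rcases exists_or_mem_extra (M := M) k with ⟨κ, rfl⟩ | hk
  · rcases exists_or_mem_extra (M := M) l with ⟨ν, rfl⟩ | hl
    · exact W.frameRicci_ee_of_ne V hp fun h' => h (by rw [h'])
    · exact W.frameRicci_extra V hp κ hl
  · rcases exists_or_mem_extra (M := M) l with ⟨ν, rfl⟩ | hl
    · rw [hs]; exact W.frameRicci_extra V hp ν hk
    · exact absurd (W.extra_le k hk l hl) h

/-- The vertical field of the node `x_ν²` sees the same function `ricX` as `∂_ν`, so it imposes no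
new condition. -/
theorem frameRicci_ee_self (W : M.IsKerrNUT S a g₁ g₂) (V : M.IsValid S T)
    {p : X ⊕ K ⊕ Υ → ℝ} (hp : p ∈ cylinder K S T) (ν : X) :
    M.frameRicci p (.inr (.inl (M.e ν))) (.inr (.inl (M.e ν)))
      = M.H (M.e ν) (xPart p) * M.ricX a g₁ g₂ ν (xPart p) := by
  rw [W.frameRicci_kk_eq V hp]
  set x := xPart p with hxd
  have hx : x ∈ S := hp.1
  have h1 : ∀ μ, kkTerm M μ (M.e ν) (M.e ν) x = M.H (M.e ν) x * ((-(1 / 2) * (M.D μ x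
      * M.t μ (M.e ν) x + M.H (M.e μ) x * M.r μ (M.e ν) x)
      - (1 / 2) * (M.w μ x * M.H (M.e μ) x * M.t μ (M.e ν) x)
      + (1 / 2) * (M.t μ (M.e ν) x ^ 2 * M.H (M.e μ) x)
      + (1 / 2) * M.H (M.e ν) x * M.t μ (M.e ν) x ^ 2)
      + if μ = ν then (-(1 / 2) * pd ν (M.D ν) x
      - (1 / 2) * M.w ν x * M.D ν x - (1 / 2) * ∑ k, M.t ν k x ^ 2 * M.H k x) else 0) := fun μ => by
    by_cases h : μ = ν
    · subst h
      rw [kkTerm_self V hx, if_pos rfl, V.t_self μ x hx, r, if_pos rfl]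
      ring
    · rw [W.kkTerm_diag V hx fun h' => h (V.e_inj h').symm, if_neg h]
      ring
  have f1 : ∑ μ, M.t μ (M.e ν) x ^ 2 = ∑ μ, M.t ν (M.e μ) x ^ 2 - 2 * ∑ μ, M.r ν (M.e μ) x := by
    rw [Finset.mul_sum, ← Finset.sum_sub_distrib]
    exact Finset.sum_congr rfl fun μ _ => by linear_combination -W.t_sq_sub_t_sq V hx ν μ
  have f2 := W.sum_t_sq V hx ν
  have f3 : ∑ α, a (M.blk α) ^ 2 / ((x ν ^ 2 - a (M.blk α) ^ 2) * (x ν ^ 2 - a (M.blk α) ^ 2))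
      = (1 / 4) * ∑ α, M.φ ν (M.blk α) x ^ 2 - (1 / 2) * ∑ α, 2 / (x ν ^ 2 - a (M.blk α) ^ 2) := by
    rw [Finset.mul_sum, Finset.mul_sum, ← Finset.sum_sub_distrib]
    refine Finset.sum_congr rfl fun α _ => ?_
    have h2 := sub_ne_zero.2 (W.s_ne_a x hx ν (M.blk α))
    rw [W.φ_eq x hx]
    field_simp
    ring
  simp only [h1, ← Finset.mul_sum, Finset.sum_add_distrib, Finset.sum_sub_distrib,
    Finset.sum_ite_eq', Finset.mem_univ, if_true, s_e V.e_inj, W.ricX_eq V hx, f3]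
  linear_combination (1 / 2 * M.H (M.e ν) x ^ 2) * f1 - (1 / 4 * M.H (M.e ν) x ^ 2) * f2

theorem frameRicci_extra_self (W : M.IsKerrNUT S a g₁ g₂) (V : M.IsValid S T)
    {p : X ⊕ K ⊕ Υ → ℝ} (hp : p ∈ cylinder K S T) {k : K} (hk : k ∈ M.extra) :
    M.frameRicci p (.inr (.inl k)) (.inr (.inl k)) = M.H k (xPart p)
      * (-(1 / 2) * ∑ ν, M.r ν k (xPart p) * M.yh a g₁ (M.e ν) (xPart p)
        + M.H k (xPart p) * ∑ ν, M.r ν k (xPart p)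
        + M.H k (xPart p) * ∑ α, 1 / a (M.blk α) ^ 2) := by
  rw [W.frameRicci_kk_eq V hp]
  set x := xPart p with hxd
  have hx : x ∈ S := hp.1
  have hke : ∀ ν, k ≠ M.e ν := fun ν h => mem_extra.1 hk ν h.symm
  have h1 : ∀ μ, kkTerm M μ k k x = M.H k x * (-(1 / 2) * (M.r μ k x * M.yh a g₁ (M.e μ) x)
      + M.H k x * M.r μ k x) := fun μ => by
    have := W.x_ne x hx μ
    rw [W.kkTerm_diag V hx (hke μ), yh_e V.e_inj, W.w_eq' V hx, W.D_eq x hx,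
      (W.t_extra hx μ hk).1, (W.t_extra hx μ hk).2]
    field_simp
    ring
  simp only [h1, ← Finset.mul_sum, Finset.sum_add_distrib, s_extra hk]
  have : ∀ α, a (M.blk α) ^ 2 / ((0 - a (M.blk α) ^ 2) * (0 - a (M.blk α) ^ 2))
      = 1 / a (M.blk α) ^ 2 := fun α => by
    have := W.a_ne k hk α
    rw [zero_sub]; field_simp
  simp only [this]
  ring

/-- At a coordinate node the variation of the conformal factor leaves a remainder proportional to
`a² / (x_μ² - a²)²`, which the fibration curvature cancels. An extra node has only the curvature
term, which fixes its value of `yh` as `-2 H`. -/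
theorem frameRicci_base (W : M.IsKerrNUT S a g₁ g₂) (V : M.IsValid S T)
    {p : X ⊕ K ⊕ Υ → ℝ} (hp : p ∈ cylinder K S T) (β α : Υ) :
    M.frameRicci p (.inr (.inr β)) (.inr (.inr α)) = ricci M.γ (yPart p) β α
      - M.f (M.blk α) (xPart p) * (∑ k, M.yh a g₁ k (xPart p)
        / (M.s k (xPart p) - a (M.blk α) ^ 2)) * M.γ (yPart p) α β := by
  rw [V.frameRicci_yy hp, sub_eq_add_neg]
  set x := xPart p with hxd
  have hx : x ∈ S := hp.1
  congr 1
  rw [← neg_mul]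
  set b := M.blk α with hb
  have hf := V.f_ne b x hx
  have h1 : ∀ μ, -(1 / 2) * pd μ (fun x => M.H (M.e μ) x * (M.φ μ b x * M.f b x)) x
          - (1 / 2) * M.w μ x * (M.H (M.e μ) x * (M.φ μ b x * M.f b x))
          + (1 / 2) * M.H (M.e μ) x * M.φ μ b x ^ 2 * M.f b x
      = M.f b x * (-(M.yh a g₁ (M.e μ) x / (x μ ^ 2 - a b ^ 2))
        + 2 * M.H (M.e μ) x * a b ^ 2 / (x μ ^ 2 - a b ^ 2) ^ 2) := fun μ => by
    have hH : DifferentiableAt ℝ (M.H (M.e μ)) x := ContDiffOn.diffAt V.openS (V.H_smooth _) hx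
    have hφ : DifferentiableAt ℝ (M.φ μ b) x := ContDiffOn.diffAt V.openS (V.φ_smooth _ _) hx
    have hfd : DifferentiableAt ℝ (M.f b) x := ContDiffOn.diffAt V.openS (V.f_smooth _) hx
    have h2 := sub_ne_zero.2 (W.s_ne_a x hx μ b)
    rw [pd_mul hH (hφ.fun_mul hfd), pd_mul hφ hfd, V.dH _ _ x hx, if_pos rfl, W.pd_φ V hx,
      if_pos rfl, V.df _ _ x hx, W.w_eq' V hx, W.D_eq x hx, yh_e V.e_inj, W.φ_eq x hx]
    field_simp
    ring
  have h2 : ∀ k, M.H k x * M.C k b x ^ 2 / M.f b x * M.σ b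
      = M.f b x * (4 * M.H k x * a b ^ 2 / (M.s k x - a b ^ 2) ^ 2) := fun k => by
    rw [W.C_eq x hx]
    by_cases h : a b = 0
    · simp [h]
    · rw [W.σ_eq α h]
      simp only [div_eq_mul_inv]
      field_simp
      ring
  simp only [h1, h2, ← Finset.mul_sum]
  rw [sum_e V.e_inj, sum_e V.e_inj (fun k => M.yh a g₁ k x / (M.s k x - a b ^ 2))]
  have h3 : ∑ k ∈ M.extra, 4 * M.H k x * a b ^ 2 / (M.s k x - a b ^ 2) ^ 2
      = 2 * ∑ k ∈ M.extra, M.yh a g₁ k x / (M.s k x - a b ^ 2) := by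
    rw [Finset.mul_sum]
    refine Finset.sum_congr rfl fun k hk => ?_
    have := W.a_ne k hk α
    rw [← hb] at this
    rw [yh_extra hk, s_extra hk, zero_sub]
    field_simp
    ring
  have h4 : ∑ μ, 4 * M.H (M.e μ) x * a b ^ 2 / (x μ ^ 2 - a b ^ 2) ^ 2
      = 2 * ∑ μ, 2 * M.H (M.e μ) x * a b ^ 2 / (x μ ^ 2 - a b ^ 2) ^ 2 := by
    rw [Finset.mul_sum]
    exact Finset.sum_congr rfl fun μ _ => by ring
  simp only [s_e V.e_inj, h3, h4, Finset.sum_add_distrib, Finset.sum_neg_distrib]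
  ring

end IsKerrNUT

end FibData

end GenKerrNUT

namespace GenKerrNUT

theorem pd_prod {ι σ : Type} [Fintype ι] [DecidableEq ι] [DecidableEq σ] (k : ι) (s : Finset σ)
    {f : σ → (ι → ℝ) → ℝ} {p : ι → ℝ}
    (hf : ∀ i ∈ s, DifferentiableAt ℝ (f i) p) (h0 : ∀ i ∈ s, f i p ≠ 0) :
    DifferentiableAt ℝ (fun x => ∏ i ∈ s, f i x) p ∧
      pd k (fun x => ∏ i ∈ s, f i x) p = (∏ i ∈ s, f i p) * ∑ i ∈ s, pd k (f i) p / f i p := by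
  induction s using Finset.induction_on with
  | empty => simp [pd_const]
  | insert i s hi ih =>
    obtain ⟨h1, h2⟩ := ih (fun j hj => hf j (Finset.mem_insert_of_mem hj))
      fun j hj => h0 j (Finset.mem_insert_of_mem hj)
    have h3 := hf i (Finset.mem_insert_self i s)
    have h4 := h0 i (Finset.mem_insert_self i s)
    simp only [Finset.prod_insert hi, Finset.sum_insert hi]
    refine ⟨h3.fun_mul h1, ?_⟩
    rw [pd_mul h3 h1, h2]
    field_simp

/-! ### Lagrange interpolation with prescribed top coefficient -/

section Lagrange

open Polynomial

variable {κ : Type} [Fintype κ] [DecidableEq κ]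

/-- The product of the differences of a node and the other nodes. -/
def nodeProd (v : κ → ℝ) (k : κ) : ℝ := ∏ j ∈ Finset.univ.erase k, (v k - v j)

theorem nodeProd_ne_zero {v : κ → ℝ} (hv : Function.Injective v) (k : κ) : nodeProd v k ≠ 0 :=
  Finset.prod_ne_zero_iff.2 fun _ hj => sub_ne_zero.2 fun h =>
    Finset.ne_of_mem_erase hj (hv h).symm

/-- After subtracting `c` times the nodal polynomial, the degree is below the number of nodes, so
the rest equals its own interpolation polynomial, with the same values at the nodes. -/
theorem lagrange_eval {v : κ → ℝ} (hv : Function.Injective v) {P : ℝ[X]} {c : ℝ}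
    (hP : P.natDegree ≤ Fintype.card κ) (hc : P.coeff (Fintype.card κ) = c) (z : ℝ) :
    P.eval z = c * ∏ k, (z - v k)
      + ∑ k, P.eval (v k) / nodeProd v k * ∏ j ∈ Finset.univ.erase k, (z - v j) := by
  set Q : ℝ[X] := P - C c * _root_.Lagrange.nodal Finset.univ v with hQ
  have hn : (_root_.Lagrange.nodal Finset.univ v).Monic := _root_.Lagrange.nodal_monic
  have hnd : (_root_.Lagrange.nodal Finset.univ v).natDegree = Fintype.card κ := by
    rw [_root_.Lagrange.natDegree_nodal, Finset.card_univ]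
  have hdeg : Q.degree < (Finset.univ : Finset κ).card := by
    rw [Finset.card_univ, Polynomial.degree_lt_iff_coeff_zero]
    intro m hm
    rcases hm.eq_or_lt with rfl | hm
    · have : (_root_.Lagrange.nodal Finset.univ v).coeff (Fintype.card κ) = 1 := by
        rw [← hnd]; exact hn
      rw [hQ, coeff_sub, hc, coeff_C_mul, this, mul_one, sub_self]
    · rw [hQ, coeff_sub, coeff_C_mul, coeff_eq_zero_of_natDegree_lt (hP.trans_lt hm),
        coeff_eq_zero_of_natDegree_lt (by rw [hnd]; exact hm)]
      simp
  have hint := _root_.Lagrange.eq_interpolate (s := Finset.univ) hv.injOn hdeg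
  have h1 : Q.eval z = P.eval z - c * ∏ k, (z - v k) := by
    rw [hQ, eval_sub, eval_mul, eval_C, _root_.Lagrange.eval_nodal]
  have h2 : ∀ k, Q.eval (v k) = P.eval (v k) := fun k => by
    rw [hQ, eval_sub, eval_mul, eval_C,
      _root_.Lagrange.eval_nodal_at_node (Finset.mem_univ k), mul_zero, sub_zero]
  rw [← sub_eq_iff_eq_add', ← h1, hint, _root_.Lagrange.interpolate_apply, eval_finsetSum]
  refine Finset.sum_congr rfl fun k _ => ?_
  rw [eval_mul, eval_C, h2, _root_.Lagrange.basis, eval_prod, nodeProd, div_mul_eq_mul_div,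
    mul_div_assoc, ← Finset.prod_div_distrib]
  congr 1
  refine Finset.prod_congr rfl fun j _ => ?_
  simp [_root_.Lagrange.basisDivisor]
  ring

/-- The previous formula with the full product over the nodes extracted. In this form it evaluates
the base components of the Ricci tensor at `z = a²`. -/
theorem lagrange_eval_of_ne {v : κ → ℝ} (hv : Function.Injective v) {P : ℝ[X]} {c : ℝ}
    (hP : P.natDegree ≤ Fintype.card κ) (hc : P.coeff (Fintype.card κ) = c) {z : ℝ}
    (hz : ∀ k, v k ≠ z) :
    P.eval z = (∏ k, (z - v k)) * (c - ∑ k, P.eval (v k) / nodeProd v k / (v k - z)) := by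
  rw [lagrange_eval hv hP hc, mul_sub, mul_comm c, sub_eq_add_neg, Finset.mul_sum,
    ← Finset.sum_neg_distrib]
  congr 1
  refine Finset.sum_congr rfl fun k _ => ?_
  rw [← Finset.mul_prod_erase _ _ (Finset.mem_univ k)]
  have := sub_ne_zero.2 (hz k)
  have e : z - v k = -(v k - z) := by ring
  rw [e]
  field_simp

/-- Differentiate `lagrange_eval` at a node. Among the products only those with at most the factor
of `v k` removed by differentiation survive, and they pair up the values at `v k` and `v j`. The
left side is the expression met in the Ricci components, which explains why polynomials solve the
Einstein equations. -/
theorem lagrange_derivative {v : κ → ℝ} (hv : Function.Injective v) {P : ℝ[X]} {c : ℝ}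
    (hP : P.natDegree ≤ Fintype.card κ) (hc : P.coeff (Fintype.card κ) = c) (k : κ) :
    P.derivative.eval (v k) / nodeProd v k
      - ∑ j ∈ Finset.univ.erase k, (P.eval (v k) / nodeProd v k + P.eval (v j) / nodeProd v j)
        / (v k - v j) = c := by
  have hk := nodeProd_ne_zero hv k
  have hd : ∀ s : Finset κ, ∀ z, HasDerivAt (fun z => ∏ j ∈ s, (z - v j))
      (∑ i ∈ s, ∏ j ∈ s.erase i, (z - v j)) z := fun s z => by
    have := HasDerivAt.fun_finsetProd (u := s) (f := fun j z => z - v j) (f' := fun _ => (1 : ℝ))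
      (x := z) fun i _ => (hasDerivAt_id z).sub_const (v i)
    simpa using this
  have h1 := P.hasDerivAt (v k)
  have h2 : HasDerivAt (fun z => c * ∏ k, (z - v k)
      + ∑ k, P.eval (v k) / nodeProd v k * ∏ j ∈ Finset.univ.erase k, (z - v j)) _ (v k) :=
    ((hd _ (v k)).const_mul c).add (HasDerivAt.fun_sum fun i _ => (hd _ (v k)).const_mul _)
  rw [← funext fun z => lagrange_eval hv hP hc z] at h2
  rw [h1.unique h2, Finset.sum_eq_single k]
  rotate_left
  · intro i _ hi
    exact Finset.prod_eq_zero (Finset.mem_erase.2 ⟨hi.symm, Finset.mem_univ k⟩) (sub_self _)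
  · simp
  have h3 : ∀ i ∈ Finset.univ.erase k, ∑ l ∈ Finset.univ.erase i,
      ∏ j ∈ (Finset.univ.erase i).erase l, (v k - v j) = nodeProd v k / (v k - v i) := by
    intro i hi
    have hik := Finset.ne_of_mem_erase hi
    rw [Finset.sum_eq_single k]
    · rw [Finset.erase_right_comm, eq_div_iff (sub_ne_zero.2 fun h => hik (hv h).symm), mul_comm,
        Finset.mul_prod_erase _ (fun j => v k - v j) hi, nodeProd]
    · intro l hl hlk
      exact Finset.prod_eq_zero (Finset.mem_erase.2
        ⟨hlk.symm, Finset.mem_erase.2 ⟨hik.symm, Finset.mem_univ k⟩⟩) (sub_self _)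
    · simp [hik.symm]
  have h4 : ∀ l ∈ Finset.univ.erase k, ∏ j ∈ (Finset.univ.erase k).erase l, (v k - v j)
      = nodeProd v k / (v k - v l) := by
    intro l hl
    have hlk := Finset.ne_of_mem_erase hl
    rw [eq_div_iff (sub_ne_zero.2 fun h => hlk (hv h).symm), mul_comm,
        Finset.mul_prod_erase _ (fun j => v k - v j) hl, nodeProd]
  rw [← Finset.add_sum_erase _ _ (Finset.mem_univ k), Finset.sum_congr rfl h4]
  have h5 : ∏ j ∈ Finset.univ.erase k, (v k - v j) = nodeProd v k := rfl
  rw [h5, add_div, add_div, mul_div_cancel_right₀ _ hk, Finset.mul_sum, Finset.sum_div,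
    Finset.sum_div, add_sub_assoc, ← Finset.sum_add_distrib, ← Finset.sum_sub_distrib,
    Finset.sum_eq_zero, add_zero]
  intro i hi
  have := sub_ne_zero.2 fun h => Finset.ne_of_mem_erase hi (hv h).symm
  have := nodeProd_ne_zero hv i
  rw [h3 i hi]
  field_simp
  ring

end Lagrange

/-- The generating function of the elementary symmetric functions. -/
theorem prod_sub_eq_sum {σ : Type} [DecidableEq σ] (s : Finset σ) (v : σ → ℝ) (z : ℝ) :
    ∏ i ∈ s, (z - v i) = ∑ j ∈ Finset.range (s.card + 1),
      (-1) ^ j * (∑ t ∈ s.powersetCard j, ∏ i ∈ t, v i) * z ^ (s.card - j) := by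
  have h1 : ∀ i, z - v i = -v i + z := fun i => by ring
  simp only [h1]
  rw [Finset.prod_add, Finset.sum_powerset]
  refine Finset.sum_congr rfl fun j _ => ?_
  rw [Finset.mul_sum, Finset.sum_mul]
  refine Finset.sum_congr rfl fun t ht => ?_
  obtain ⟨ht, hj⟩ := Finset.mem_powersetCard.1 ht
  rw [Finset.prod_neg, hj, Finset.prod_const, Finset.card_sdiff_of_subset ht, hj]

end GenKerrNUT

namespace GenKerrNUT

section OneCoordinate

variable {ι : Type} [Fintype ι] [DecidableEq ι]

theorem pd_comp_coord (k i : ι) {F : ℝ → ℝ} {p : ι → ℝ} (hF : DifferentiableAt ℝ F (p i)) :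
    DifferentiableAt ℝ (fun x : ι → ℝ => F (x i)) p ∧
      pd k (fun x => F (x i)) p = if i = k then deriv F (p i) else 0 := by
  have h1 : HasFDerivAt (fun x : ι → ℝ => x i) (ContinuousLinearMap.proj (R := ℝ) i) p :=
    (ContinuousLinearMap.proj (R := ℝ) (φ := fun _ : ι => ℝ) i).hasFDerivAt
  have h2 : HasFDerivAt (fun x : ι → ℝ => F (x i)) _ p := hF.hasDerivAt.comp_hasFDerivAt p h1
  refine ⟨h2.differentiableAt, ?_⟩
  rw [pd, h2.fderiv]
  simp [Pi.single_apply]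

theorem contDiffOn_comp_coord {I : ι → Set ℝ} (i : ι) {F : ℝ → ℝ} (hF : ContDiffOn ℝ ∞ F (I i)) :
    ContDiffOn ℝ ∞ (fun x : ι → ℝ => F (x i)) (Set.univ.pi I) :=
  hF.comp (contDiff_apply ℝ ℝ i).contDiffOn fun _ hx => hx i (Set.mem_univ i)

end OneCoordinate

/-! ### The concrete data and their derivatives -/

namespace FibData

variable {ℓ κ : ℕ} {Υ Bl : Type} [Fintype Υ] [DecidableEq Υ]

/-- The data of the generalized Kerr-NUT metrics. -/
def kerrNUT (hκ : ℓ ≤ κ) (G : Fin ℓ → ℝ → ℝ) (g₀ : ℝ) (a : Bl → ℝ) (A : Fin κ → (Υ → ℝ) → Υ → ℝ)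
    (blk : Υ → Bl) (γ J : (Υ → ℝ) → Matrix Υ Υ ℝ) (σ : Bl → ℝ) :
    FibData (Fin ℓ) (Fin κ) Υ Bl :=
  let e := Fin.castLE hκ
  let s : Fin κ → (Fin ℓ → ℝ) → ℝ := fun k x => Function.extend e (fun ν => x ν ^ 2) 0 k
  let t : Fin ℓ → Fin κ → (Fin ℓ → ℝ) → ℝ :=
    fun ν k x => x ν * if k = e ν then 0 else 2 / (x ν ^ 2 - s k x)
  let H : Fin κ → (Fin ℓ → ℝ) → ℝ := fun k x =>
    Function.extend e (fun ν => G ν (x ν)) (fun _ => g₀) k / nodeProd (s · x) k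
  { e := e
    t := t
    H := H
    D := fun ν x => deriv (G ν) (x ν) / nodeProd (s · x) (e ν) - H (e ν) x * ∑ k, t ν k x
    φ := fun ν b x => 2 * x ν / (x ν ^ 2 - a b ^ 2)
    f := fun b x => ∏ μ, (x μ ^ 2 - a b ^ 2)
    C := fun k b x => 2 * a b * (∏ μ, (x μ ^ 2 - a b ^ 2)) / (s k x - a b ^ 2)
    eh := fun k j x => (-1) ^ (j : ℕ) * s k x ^ (κ - 1 - j) / nodeProd (s · x) k
    et := fun k j x => ∑ t ∈ (Finset.univ.erase k).powersetCard j, ∏ i ∈ t, s i x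
    c := fun j b => -2 * ((-1 : ℝ) ^ ((ℓ : ℤ) - (j : ℤ)) * a b ^ (2 * (ℓ : ℤ) - 2 * (j : ℤ) - 1))
    A := A
    blk := blk
    γ := γ
    J := J
    σ := σ }

/-- Conditions on the ranges of the coordinates `x_μ` and on the functions of one variable. -/
structure IsRange (I : Fin ℓ → Set ℝ) (κ : ℕ) (G : Fin ℓ → ℝ → ℝ) (g₀ : ℝ) (a : Bl → ℝ) :
    Prop where
  isOpen : ∀ μ, IsOpen (I μ)
  x_ne : ∀ μ, ∀ x ∈ I μ, x ≠ 0
  x_ne_x : ∀ μ ν, μ ≠ ν → ∀ x ∈ I μ, ∀ y ∈ I ν, x ^ 2 ≠ y ^ 2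
  x_ne_a : ∀ μ, ∀ x ∈ I μ, ∀ b, x ^ 2 ≠ a b ^ 2
  G_smooth : ∀ μ, ContDiffOn ℝ ∞ (G μ) (I μ)
  G_ne : ∀ μ, ∀ x ∈ I μ, G μ x ≠ 0
  g₀_ne : g₀ ≠ 0
  le_succ : κ ≤ ℓ + 1

namespace kerrNUT

variable {hκ : ℓ ≤ κ} {G : Fin ℓ → ℝ → ℝ} {g₀ : ℝ} {a : Bl → ℝ} {A : Fin κ → (Υ → ℝ) → Υ → ℝ}
  {blk : Υ → Bl} {γ J : (Υ → ℝ) → Matrix Υ Υ ℝ} {σ : Bl → ℝ} {I : Fin ℓ → Set ℝ}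

local notation "𝓜" => kerrNUT hκ G g₀ a A blk γ J σ

theorem e_inj : Function.Injective (𝓜).e := Fin.castLE_injective hκ

theorem t_eq (ν : Fin ℓ) (k : Fin κ) (x : Fin ℓ → ℝ) : (𝓜).t ν k x = x ν * (𝓜).r ν k x := rfl

theorem H_eq (k : Fin κ) (x : Fin ℓ → ℝ) : (𝓜).H k x = Function.extend (𝓜).e (fun ν => G ν (x ν))
    (fun _ => g₀) k / nodeProd ((𝓜).s · x) k := rfl

theorem card_extra : (𝓜).extra.card = κ - ℓ := by
  rw [extra, Finset.card_sdiff_of_subset (Finset.subset_univ _),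
    Finset.card_image_of_injective _ e_inj]
  simp

variable (R : IsRange I κ G g₀ a) {x : Fin ℓ → ℝ}
include R

/-- The squares `x_μ²` are distinct and nonzero by assumption, and `κ ≤ ℓ + 1` leaves room for at
most one extra node, at `0`. -/
theorem s_injective (hx : x ∈ Set.univ.pi I) : Function.Injective ((𝓜).s · x) := by
  have he : Function.Injective (𝓜).e := e_inj
  have hcard : (𝓜).extra.card ≤ 1 := by
    rw [card_extra]; have := R.le_succ; omega
  intro k l h
  by_contra hkl
  rcases exists_or_mem_extra (M := 𝓜) k with ⟨μ, rfl⟩ | hk <;>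
    rcases exists_or_mem_extra (M := 𝓜) l with ⟨ν, rfl⟩ | hl
  · have h : (𝓜).s ((𝓜).e μ) x = (𝓜).s ((𝓜).e ν) x := h
    rw [s_e he, s_e he] at h
    exact R.x_ne_x μ ν (fun h => hkl (by rw [h])) _ (hx μ trivial) _ (hx ν trivial) h
  · have h : (𝓜).s ((𝓜).e μ) x = (𝓜).s l x := h
    rw [s_e he, s_extra hl] at h
    exact R.x_ne μ _ (hx μ trivial) (pow_eq_zero_iff two_ne_zero |>.1 h)
  · have h : (𝓜).s k x = (𝓜).s ((𝓜).e ν) x := h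
    rw [s_e he, s_extra hk] at h
    exact R.x_ne ν _ (hx ν trivial) (pow_eq_zero_iff two_ne_zero |>.1 h.symm)
  · exact hkl (Finset.card_le_one.1 hcard k hk l hl)

theorem nodeProd_ne (hx : x ∈ Set.univ.pi I) (k : Fin κ) : nodeProd ((𝓜).s · x) k ≠ 0 :=
  nodeProd_ne_zero (s_injective R hx) k

omit R in
theorem contDiff_s (k : Fin κ) : ContDiff ℝ ∞ ((𝓜).s k) := by
  rcases exists_or_mem_extra (M := 𝓜) k with ⟨ν, rfl⟩ | hk
  · rw [funext fun x => s_e (M := 𝓜) e_inj ν x]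
    exact (contDiff_apply ℝ ℝ ν).pow 2
  · rw [funext fun x => s_extra (M := 𝓜) hk x]
    exact contDiff_const

omit R in
theorem contDiff_nodeProd (k : Fin κ) : ContDiff ℝ ∞ (fun x => nodeProd ((𝓜).s · x) k) :=
  contDiff_prod fun j _ => (contDiff_s k).sub (contDiff_s j)

theorem isOpen_pi : IsOpen (Set.univ.pi I) := isOpen_set_pi Set.finite_univ fun μ _ => R.isOpen μ

/-- Varying `x_ν` moves one node only. It occurs in all factors of its own product, giving `tau`,
and in exactly one factor of every other product, giving a single `t`. -/
theorem pd_nodeProd (hx : x ∈ Set.univ.pi I) (ν : Fin ℓ) (k : Fin κ) :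
    pd ν (fun x => nodeProd ((𝓜).s · x) k) x = nodeProd ((𝓜).s · x) k
      * if k = (𝓜).e ν then (𝓜).tau ν x else (𝓜).t ν k x := by
  have he : Function.Injective (𝓜).e := e_inj
  have hd : ∀ k, DifferentiableAt ℝ ((𝓜).s k) x :=
    fun k => (IsKerrNUT.pd_s he ν k x).1
  have hne : ∀ j ∈ Finset.univ.erase k, (𝓜).s k x - (𝓜).s j x ≠ 0 := fun j hj =>
    sub_ne_zero.2 fun h => Finset.ne_of_mem_erase hj (s_injective R hx h).symm
  rw [show (fun x => nodeProd ((𝓜).s · x) k)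
      = fun x => ∏ j ∈ Finset.univ.erase k, ((𝓜).s k x - (𝓜).s j x) from rfl,
    (pd_prod ν (Finset.univ.erase k) (fun j _ => (hd k).fun_sub (hd j)) hne).2]
  congr 1
  simp only [pd_sub (hd _) (hd _), (IsKerrNUT.pd_s he ν _ x).2]
  by_cases hk : k = (𝓜).e ν
  · subst hk
    have h0 : (𝓜).t ν ((𝓜).e ν) x = 0 := by rw [t_eq, r, if_pos rfl, mul_zero]
    rw [if_pos rfl, tau, ← Finset.add_sum_erase _ _ (Finset.mem_univ ((𝓜).e ν)), h0, zero_add,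
      if_pos rfl]
    refine Finset.sum_congr rfl fun j hj => ?_
    have := Finset.ne_of_mem_erase hj
    rw [if_neg this, t_eq, r, if_neg this, s_e he]
    ring
  · rw [if_neg hk, t_eq, r, if_neg hk, Finset.sum_eq_single ((𝓜).e ν)]
    · rw [if_neg hk, if_pos rfl, s_e he, ← neg_sub (x ν ^ 2)]
      rw [zero_sub, neg_div_neg_eq]
      ring
    · intro j _ hj
      rw [if_neg hj]; simp
    · simp [Ne.symm hk]

theorem contDiffOn_inv_nodeProd (k : Fin κ) :
    ContDiffOn ℝ ∞ (fun x => (nodeProd ((𝓜).s · x) k)⁻¹) (Set.univ.pi I) :=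
  (contDiff_nodeProd k).contDiffOn.inv fun _ hx => nodeProd_ne R hx k

theorem pd_inv_nodeProd (hx : x ∈ Set.univ.pi I) (ν : Fin ℓ) (k : Fin κ) :
    pd ν (fun x => (nodeProd ((𝓜).s · x) k)⁻¹) x = -(nodeProd ((𝓜).s · x) k)⁻¹
      * if k = (𝓜).e ν then (𝓜).tau ν x else (𝓜).t ν k x := by
  have h0 := nodeProd_ne (hκ := hκ) (A := A) (blk := blk) (γ := γ) (J := J) (σ := σ) R hx k
  rw [pd_inv (((contDiff_nodeProd k).differentiable (by norm_num)) x) h0, pd_nodeProd R hx]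
  field_simp

theorem t_smooth (ν : Fin ℓ) (k : Fin κ) : ContDiffOn ℝ ∞ ((𝓜).t ν k) (Set.univ.pi I) := by
  have he : Function.Injective (𝓜).e := e_inj
  rw [show (𝓜).t ν k = fun x => x ν * (𝓜).r ν k x from rfl]
  by_cases h : k = (𝓜).e ν
  · simp only [r, if_pos h]; exact contDiffOn_const.congr fun _ _ => mul_zero _
  · simp only [r, if_neg h]
    refine (contDiff_apply ℝ ℝ ν).contDiffOn.mul (contDiffOn_const.div
      (((contDiff_apply ℝ ℝ ν).pow 2).sub (contDiff_s k)).contDiffOn fun x hx => ?_)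
    rw [← s_e he ν x]
    exact sub_ne_zero.2 fun h' => h (s_injective R hx h').symm

theorem numerator_facts (k : Fin κ) :
    ContDiffOn ℝ ∞ (fun x : Fin ℓ → ℝ => Function.extend (𝓜).e (fun ν => G ν (x ν))
      (fun _ => g₀) k) (Set.univ.pi I) ∧
    ∀ x ∈ Set.univ.pi I, Function.extend (𝓜).e (fun ν => G ν (x ν)) (fun _ => g₀) k ≠ 0 ∧
      ∀ ν, pd ν (fun x : Fin ℓ → ℝ => Function.extend (𝓜).e (fun ν => G ν (x ν)) (fun _ => g₀) k) x
        = if k = (𝓜).e ν then deriv (G ν) (x ν) else 0 := by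
  have he : Function.Injective (𝓜).e := e_inj
  rcases exists_or_mem_extra (M := 𝓜) k with ⟨μ, rfl⟩ | hk
  · simp only [he.extend_apply]
    refine ⟨contDiffOn_comp_coord μ (R.G_smooth μ), fun x hx =>
      ⟨R.G_ne μ _ (hx μ trivial), fun ν => ?_⟩⟩
    rw [(pd_comp_coord ν μ ((R.G_smooth μ).contDiffAt ((R.isOpen μ).mem_nhds (hx μ trivial))
      |>.differentiableAt (by norm_num))).2]
    by_cases h : μ = ν
    · subst h; simp
    · rw [if_neg h, if_neg fun h' => h (he h')]
  · have hk' : ¬∃ ν, (𝓜).e ν = k := fun ⟨ν, h⟩ => mem_extra.1 hk ν h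
    simp only [Function.extend_apply' _ _ _ hk']
    refine ⟨contDiffOn_const, fun x hx => ⟨R.g₀_ne, fun ν => ?_⟩⟩
    rw [pd_const, if_neg fun h' => hk' ⟨ν, h'.symm⟩]

theorem H_smooth (k : Fin κ) : ContDiffOn ℝ ∞ ((𝓜).H k) (Set.univ.pi I) := by
  have h : (𝓜).H k = fun x => Function.extend (𝓜).e (fun ν => G ν (x ν)) (fun _ => g₀) k
    * (nodeProd ((𝓜).s · x) k)⁻¹ := rfl
  rw [h]
  exact (numerator_facts R k).1.mul (contDiffOn_inv_nodeProd R k)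

theorem dG_smooth (μ : Fin ℓ) : ContDiffOn ℝ ∞ (deriv (G μ)) (I μ) :=
  (R.G_smooth μ).deriv_of_isOpen (R.isOpen μ) (by norm_num)

theorem dH (hx : x ∈ Set.univ.pi I) (ν : Fin ℓ) (k : Fin κ) : pd ν ((𝓜).H k) x
    = if k = (𝓜).e ν then (𝓜).D ν x else -((𝓜).t ν k x * (𝓜).H k x) := by
  have h : (𝓜).H k = fun x => Function.extend (𝓜).e (fun ν => G ν (x ν)) (fun _ => g₀) k
    * (nodeProd ((𝓜).s · x) k)⁻¹ := rfl
  obtain ⟨h1, h2⟩ := numerator_facts (hκ := hκ) (A := A) (blk := blk) (γ := γ) (J := J) (σ := σ) R k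
  have h3 : DifferentiableAt ℝ (fun x => (nodeProd ((𝓜).s · x) k)⁻¹) x :=
    ContDiffOn.diffAt (isOpen_pi R) (contDiffOn_inv_nodeProd R k) hx
  rw [h, pd_mul (ContDiffOn.diffAt (isOpen_pi R) h1 hx) h3, (h2 x hx).2 ν,
    pd_inv_nodeProd R hx]
  by_cases hk : k = (𝓜).e ν
  · subst hk
    have hD : (𝓜).D ν x = deriv (G ν) (x ν) / nodeProd ((𝓜).s · x) ((𝓜).e ν)
      - (Function.extend (𝓜).e (fun ν => G ν (x ν)) (fun _ => g₀) ((𝓜).e ν)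
      / nodeProd ((𝓜).s · x) ((𝓜).e ν)) * (𝓜).tau ν x := rfl
    rw [if_pos rfl, if_pos rfl, if_pos rfl, hD]
    ring
  · rw [if_neg hk, if_neg hk, if_neg hk]
    ring

theorem overNode_facts {F : Fin ℓ → ℝ → ℝ} (hF : ∀ μ, ContDiffOn ℝ ∞ (F μ) (I μ)) (ν : Fin ℓ) :
    ContDiffOn ℝ ∞ (fun x => F ν (x ν) / nodeProd ((𝓜).s · x) ((𝓜).e ν)) (Set.univ.pi I) ∧
    ∀ x ∈ Set.univ.pi I, pd ν (fun x => F ν (x ν) / nodeProd ((𝓜).s · x) ((𝓜).e ν)) x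
      = deriv (F ν) (x ν) / nodeProd ((𝓜).s · x) ((𝓜).e ν)
        - (𝓜).tau ν x * (F ν (x ν) / nodeProd ((𝓜).s · x) ((𝓜).e ν)) := by
  have h1 := contDiffOn_comp_coord ν (hF ν)
  have h2 := contDiffOn_inv_nodeProd (hκ := hκ) (A := A) (blk := blk) (γ := γ) (J := J)
    (σ := σ) R ((𝓜).e ν)
  refine ⟨h1.mul h2, fun x hx => ?_⟩
  simp only [div_eq_mul_inv]
  rw [pd_mul (ContDiffOn.diffAt (isOpen_pi R) h1 hx) (ContDiffOn.diffAt (isOpen_pi R) h2 hx),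
    pd_inv_nodeProd R hx, if_pos rfl, (pd_comp_coord ν ν (((hF ν).contDiffAt
      ((R.isOpen ν).mem_nhds (hx ν trivial))).differentiableAt (by norm_num))).2, if_pos rfl]
  ring

end kerrNUT

end FibData

end GenKerrNUT

namespace GenKerrNUT

/-! ### Duality of the vertical frame and curvature of the fibration -/

namespace FibData

namespace kerrNUT

variable {ℓ κ : ℕ} {Υ Bl : Type} [Fintype Υ] [DecidableEq Υ]
  {hκ : ℓ ≤ κ} {G : Fin ℓ → ℝ → ℝ} {g₀ : ℝ} {a : Bl → ℝ} {A : Fin κ → (Υ → ℝ) → Υ → ℝ}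
  {blk : Υ → Bl} {γ J : (Υ → ℝ) → Matrix Υ Υ ℝ} {σ : Bl → ℝ} {I : Fin ℓ → Set ℝ}

local notation "𝓜" => kerrNUT hκ G g₀ a A blk γ J σ

variable (R : IsRange I κ G g₀ a) {x : Fin ℓ → ℝ}
include R

/-- Inversion of the Vandermonde matrix: the elementary symmetric functions without `s_k` generate
`∏_{i≠k} (z - s_i)`, which at `z = s_l` is zero for `l ≠ k` and the node product for `l = k`. -/
theorem dual (hx : x ∈ Set.univ.pi I) (k l : Fin κ) :
    ∑ j, (𝓜).et k j x * (𝓜).eh l j x = if k = l then 1 else 0 := by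
  have hne := nodeProd_ne (hκ := hκ) (A := A) (blk := blk) (γ := γ) (J := J) (σ := σ) R hx l
  have hκ0 : 0 < κ := k.pos
  have h1 : ∏ i ∈ Finset.univ.erase k, ((𝓜).s l x - (𝓜).s i x)
      = ∑ j : Fin κ, (-1) ^ (j : ℕ) * (𝓜).et k j x * (𝓜).s l x ^ (κ - 1 - j) := by
    rw [prod_sub_eq_sum, Finset.card_erase_of_mem (Finset.mem_univ k), Finset.card_fin,
      Nat.sub_add_cancel hκ0, Finset.sum_range]
    rfl
  have h2 : ∀ j : Fin κ, (𝓜).et k j x * (𝓜).eh l j x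
      = (-1) ^ (j : ℕ) * (𝓜).et k j x * (𝓜).s l x ^ (κ - 1 - j)
        / nodeProd ((𝓜).s · x) l := fun j => by
    have : (𝓜).eh l j x = (-1) ^ (j : ℕ) * (𝓜).s l x ^ (κ - 1 - j)
      / nodeProd ((𝓜).s · x) l := rfl
    rw [this]; ring
  simp only [h2]
  rw [← Finset.sum_div, ← h1]
  by_cases hkl : k = l
  · subst hkl
    rw [if_pos rfl]
    exact div_self hne
  · rw [if_neg hkl, Finset.prod_eq_zero (Finset.mem_erase.2 ⟨Ne.symm hkl, Finset.mem_univ l⟩)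
      (sub_self _), zero_div]

theorem eh_smooth (k j : Fin κ) : ContDiffOn ℝ ∞ ((𝓜).eh k j) (Set.univ.pi I) :=
  (contDiffOn_const.mul (((contDiff_s (hκ := hκ) (G := G) (g₀ := g₀) (a := a) (A := A) (blk := blk)
    (γ := γ) (J := J) (σ := σ) k).pow _).contDiffOn)).mul
    (contDiffOn_inv_nodeProd (hκ := hκ) (A := A) (blk := blk) (γ := γ) (J := J) (σ := σ) R k)

/-- For `k ≠ M.e ν` only the node product varies. For `k = M.e ν` the node itself varies as well,
and `lagrange_derivative` for a monomial turns that derivative into the sum over the other nodes. -/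
theorem deh (hx : x ∈ Set.univ.pi I) (ν : Fin ℓ) (k j : Fin κ) :
    pd ν ((𝓜).eh k j) x = -((𝓜).t ν k x * (𝓜).eh k j x)
      + if k = (𝓜).e ν then ∑ l, (𝓜).t ν l x * (𝓜).eh l j x else 0 := by
  have he : Function.Injective (𝓜).e := e_inj
  have h : ∀ k, (𝓜).eh k j = fun x => (-1) ^ (j : ℕ) * (((𝓜).s k x) ^ (κ - 1 - j)
    * (nodeProd ((𝓜).s · x) k)⁻¹) := fun k => funext fun y => by
      rw [← mul_assoc]; rfl
  have hs : DifferentiableAt ℝ ((𝓜).s k) x := (IsKerrNUT.pd_s he ν k x).1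
  have hp : ∀ n : ℕ, pd ν (fun x => (𝓜).s k x ^ n) x
      = n * (𝓜).s k x ^ (n - 1) * pd ν ((𝓜).s k) x := fun n => by
    have := hs.hasFDerivAt.pow n
    have h' : HasFDerivAt (fun x => (𝓜).s k x ^ n) _ x := this
    rw [pd, h'.fderiv]
    simp [pd]
  have hi : DifferentiableAt ℝ (fun x => (nodeProd ((𝓜).s · x) k)⁻¹) x :=
    ContDiffOn.diffAt (isOpen_pi R) (contDiffOn_inv_nodeProd R k) hx
  have hsp : DifferentiableAt ℝ (fun x => (𝓜).s k x ^ (κ - 1 - j)) x := hs.pow _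
  rw [h k, pd_const_mul (hsp.fun_mul hi), pd_mul hsp hi, hp, pd_inv_nodeProd R hx,
    (IsKerrNUT.pd_s he ν k x).2]
  by_cases hk : k = (𝓜).e ν
  · subst hk
    have ht : (𝓜).t ν ((𝓜).e ν) x = 0 := by rw [t_eq, r, if_pos rfl, mul_zero]
    rw [if_pos rfl, if_pos rfl, if_pos rfl, ht]
    -- The degree `κ - 1 - j` is less than `κ`, so the top coefficient is `0`.
    have hL := lagrange_derivative (s_injective (hκ := hκ) (A := A) (blk := blk) (γ := γ) (J := J)
      (σ := σ) R hx) (P := Polynomial.X ^ (κ - 1 - (j : ℕ))) (c := 0)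
      (by rw [Polynomial.natDegree_X_pow, Fintype.card_fin]; omega)
      (by rw [Polynomial.coeff_X_pow, Fintype.card_fin, if_neg (by have := j.2; omega)])
      ((𝓜).e ν)
    have hL2 : (𝓜).tau ν x = ∑ l ∈ Finset.univ.erase ((𝓜).e ν),
        2 * x ν * (1 / ((𝓜).s ((𝓜).e ν) x - (𝓜).s l x)) := by
      rw [tau, ← Finset.add_sum_erase _ _ (Finset.mem_univ ((𝓜).e ν)), ht, zero_add]
      refine Finset.sum_congr rfl fun l hl => ?_
      rw [t_eq, r, if_neg (Finset.ne_of_mem_erase hl), s_e he]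
      ring
    have hL3 : ∑ l, (𝓜).t ν l x * (𝓜).eh l j x = ∑ l ∈ Finset.univ.erase ((𝓜).e ν),
        (-1) ^ (j : ℕ) * (2 * x ν) * ((𝓜).s l x ^ (κ - 1 - j) / nodeProd ((𝓜).s · x) l
          / ((𝓜).s ((𝓜).e ν) x - (𝓜).s l x)) := by
      rw [← Finset.add_sum_erase _ _ (Finset.mem_univ ((𝓜).e ν)), ht, zero_mul, zero_add]
      refine Finset.sum_congr rfl fun l hl => ?_
      rw [t_eq, r, if_neg (Finset.ne_of_mem_erase hl), s_e he, h l]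
      ring
    simp only [Polynomial.derivative_X_pow, Polynomial.eval_mul, Polynomial.eval_pow,
      Polynomial.eval_X, add_div, Finset.sum_add_distrib,
      Polynomial.eval_C] at hL
    rw [hL3, hL2, ← Finset.mul_sum, ← Finset.mul_sum]
    have hL4 : ∑ l ∈ Finset.univ.erase ((𝓜).e ν), (𝓜).s ((𝓜).e ν) x ^ (κ - 1 - (j : ℕ))
        / nodeProd ((𝓜).s · x) ((𝓜).e ν) / ((𝓜).s ((𝓜).e ν) x - (𝓜).s l x)
        = (𝓜).s ((𝓜).e ν) x ^ (κ - 1 - (j : ℕ)) / nodeProd ((𝓜).s · x) ((𝓜).e ν)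
          * ∑ l ∈ Finset.univ.erase ((𝓜).e ν), 1 / ((𝓜).s ((𝓜).e ν) x - (𝓜).s l x) := by
      rw [Finset.mul_sum]
      exact Finset.sum_congr rfl fun l _ => by ring
    rw [hL4] at hL
    linear_combination ((-1) ^ (j : ℕ) * (2 * x ν)) * hL
  · rw [if_neg hk, if_neg hk, if_neg hk]
    beta_reduce
    ring

/-- Evaluate the monomial of degree `κ - 1 - j` at `a²` by interpolation: the sum over the nodes
becomes a pure power of `a`, independent of `x`. This constancy makes the curvature of the fibration
closed. -/
theorem C_eh (hx : x ∈ Set.univ.pi I) (b : Bl) (j : Fin κ) :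
    ∑ k, (𝓜).C k b x * (𝓜).eh k j x = (𝓜).c j b := by
  have he : Function.Injective (𝓜).e := e_inj
  have hc : (𝓜).c j b
    = -2 * ((-1 : ℝ) ^ ((ℓ : ℤ) - (j : ℤ)) * a b ^ (2 * (ℓ : ℤ) - 2 * (j : ℤ) - 1)) := rfl
  have hC : ∀ k, (𝓜).C k b x = 2 * a b * (𝓜).f b x / ((𝓜).s k x - a b ^ 2) := fun k => rfl
  have heh : ∀ k, (𝓜).eh k j x = (-1) ^ (j : ℕ) * (𝓜).s k x ^ (κ - 1 - j)
      / nodeProd ((𝓜).s · x) k := fun k => rfl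
  have hf : (𝓜).f b x = ∏ μ, (x μ ^ 2 - a b ^ 2) := rfl
  rw [hc]
  simp only [hC, heh]
  -- The exponent `2ℓ - 2j - 1` is odd, hence nonzero even when it is negative, so the power of `0`
  -- is `0`, in agreement with `C = 0`.
  by_cases h0 : a b = 0
  · rw [h0, zero_zpow _ (by omega)]
    simp
  have hz : ∀ k, (𝓜).s k x ≠ a b ^ 2 := fun k => by
    rcases exists_or_mem_extra (M := 𝓜) k with ⟨ν, rfl⟩ | hk
    · rw [s_e he]; exact R.x_ne_a ν _ (hx ν trivial) b
    · rw [s_extra hk]; exact (pow_ne_zero 2 h0).symm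
  have hL := lagrange_eval_of_ne (s_injective (hκ := hκ) (A := A) (blk := blk) (γ := γ) (J := J)
      (σ := σ) R hx) (P := Polynomial.X ^ (κ - 1 - (j : ℕ))) (c := 0)
      (by rw [Polynomial.natDegree_X_pow, Fintype.card_fin]; omega)
      (by rw [Polynomial.coeff_X_pow, Fintype.card_fin, if_neg (by have := j.2; omega)]) hz
  have hprod : ∏ k, (a b ^ 2 - (𝓜).s k x) = (-1) ^ ℓ * (𝓜).f b x * (a b ^ 2) ^ (κ - ℓ) := by
    have hsplit : ∏ k, (a b ^ 2 - (𝓜).s k x) = (∏ ν, (a b ^ 2 - (𝓜).s ((𝓜).e ν) x))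
        * ∏ k ∈ (𝓜).extra, (a b ^ 2 - (𝓜).s k x) := by
      rw [extra, ← Finset.prod_sdiff (Finset.subset_univ (Finset.univ.image (𝓜).e)), mul_comm,
        Finset.prod_image he.injOn]
    rw [hsplit, Finset.prod_congr (s₁ := (𝓜).extra) rfl fun k hk => by rw [s_extra hk, sub_zero],
      Finset.prod_const, card_extra, hf]
    congr 1
    simp only [s_e he]
    rw [Finset.prod_congr rfl fun ν _ => (neg_sub (x ν ^ 2) (a b ^ 2)).symm, Finset.prod_neg,
      Finset.card_fin]
  have hfne : (𝓜).f b x ≠ 0 := by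
    rw [hf]
    exact Finset.prod_ne_zero_iff.2 fun μ _ => sub_ne_zero.2 (R.x_ne_a μ _ (hx μ trivial) b)
  simp only [Polynomial.eval_pow, Polynomial.eval_X, hprod] at hL
  have hsum : ∑ k, 2 * a b * (𝓜).f b x / ((𝓜).s k x - a b ^ 2) * ((-1) ^ (j : ℕ)
      * (𝓜).s k x ^ (κ - 1 - j) / nodeProd ((𝓜).s · x) k)
      = 2 * a b * (𝓜).f b x * (-1) ^ (j : ℕ) * ∑ k, (𝓜).s k x ^ (κ - 1 - (j : ℕ))
        / nodeProd ((𝓜).s · x) k / ((𝓜).s k x - a b ^ 2) := by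
    rw [Finset.mul_sum]
    exact Finset.sum_congr rfl fun k _ => by ring
  rw [hsum]
  set Q := ∑ k, (𝓜).s k x ^ (κ - 1 - (j : ℕ))
        / nodeProd ((𝓜).s · x) k / ((𝓜).s k x - a b ^ 2)
  have h1 : (-1 : ℝ) ^ ((ℓ : ℤ) - (j : ℤ)) = (-1) ^ ℓ * (-1) ^ (j : ℕ) := by
    rw [zpow_sub₀ (by norm_num), zpow_natCast, zpow_natCast, div_eq_mul_inv, ← inv_pow]
    norm_num
  -- The exponent is `1 + 2 (κ - 1 - j) - 2 (κ - ℓ)`: the last part is the contribution of the extra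
  -- nodes to `∏ (a² - s_k)`, and for `j = ℓ` it makes the power negative.
  have h2 : a b ^ (2 * (ℓ : ℤ) - 2 * (j : ℤ) - 1) = a b * (a b ^ 2) ^ (κ - 1 - (j : ℕ))
      / (a b ^ 2) ^ (κ - ℓ) := by
    rw [eq_div_iff (pow_ne_zero _ (pow_ne_zero _ h0)), ← pow_mul, ← pow_mul, ← zpow_natCast,
      ← zpow_natCast, ← zpow_add₀ h0, ← zpow_one_add₀ h0]
    congr 1
    have := j.2
    push_cast [Nat.cast_sub hκ, Nat.cast_sub (show (j : ℕ) ≤ κ - 1 by omega),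
      Nat.cast_sub (show 1 ≤ κ by omega)]
    ring
  have h3 : ((-1 : ℝ) ^ ℓ) * (-1) ^ ℓ = 1 := by rw [← mul_pow]; norm_num
  rw [h1, h2, hL]
  have h4 : (a b ^ 2) ^ (κ - ℓ) ≠ 0 := pow_ne_zero _ (pow_ne_zero _ h0)
  rw [zero_sub]
  field_simp
  linear_combination (-Q) * h3

theorem C_smooth (k : Fin κ) (b : Bl) : ContDiffOn ℝ ∞ ((𝓜).C k b) (Set.univ.pi I) := by
  have he : Function.Injective (𝓜).e := e_inj
  have hC : (𝓜).C k b = fun x => 2 * a b * (∏ μ, (x μ ^ 2 - a b ^ 2)) / ((𝓜).s k x - a b ^ 2) :=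
    rfl
  rw [hC]
  by_cases h0 : a b = 0
  · exact (contDiffOn_const (c := (0 : ℝ))).congr fun _ _ => by simp [h0]
  · refine (contDiff_const.mul (contDiff_prod fun μ _ =>
      ((contDiff_apply ℝ ℝ μ).pow 2).sub contDiff_const)).contDiffOn.div
      ((contDiff_s k).sub contDiff_const).contDiffOn fun x hx => sub_ne_zero.2 ?_
    rcases exists_or_mem_extra (M := 𝓜) k with ⟨ν, rfl⟩ | hk
    · rw [s_e he]; exact R.x_ne_a ν _ (hx ν trivial) b
    · rw [s_extra hk]; exact (pow_ne_zero 2 h0).symm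

end kerrNUT

end FibData

end GenKerrNUT

namespace GenKerrNUT

/-! ### The Einstein equations as scalar equations -/

namespace FibData

section Einstein

variable {X K Υ Bl : Type} [Fintype X] [Fintype K] [Fintype Υ]
  [DecidableEq X] [DecidableEq K] [DecidableEq Υ]
  {M : FibData X K Υ Bl} {S : Set (X → ℝ)} {T : Set (Υ → ℝ)}

theorem IsValid.ricci_eq_smul_iff (V : M.IsValid S T) {p : X ⊕ K ⊕ Υ → ℝ}
    (hp : p ∈ cylinder K S T) (Λ : ℝ) : ricci M.metric p = Λ • M.metric p ↔
      ∀ b d, M.frameRicci p b d = Λ * M.frameMetric p b d := by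
  set F : Matrix (X ⊕ K ⊕ Υ) (X ⊕ K ⊕ Υ) ℝ := Matrix.of fun i a => M.frame a p i with hF
  have h1 : (Matrix.of fun a i => M.coframe a p i) * F = 1 := by
    ext a b
    rw [Matrix.mul_apply, Matrix.one_apply]
    exact V.coframe_frame hp a b
  have h2 : F * (Matrix.of fun a i => M.coframe a p i) = 1 := mul_eq_one_comm.1 h1
  have h3 : ∀ A : Matrix (X ⊕ K ⊕ Υ) (X ⊕ K ⊕ Υ) ℝ, ∀ b d,
      (F.transpose * A * F) b d = ∑ j, (∑ i, A i j * M.frame b p i) * M.frame d p j := by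
    intro A b d
    simp only [Matrix.mul_apply, Matrix.transpose_apply, hF, Matrix.of_apply]
    exact Finset.sum_congr rfl fun j _ => by
      rw [Finset.sum_congr rfl fun i _ => mul_comm (M.frame b p i) (A i j)]
  have h4 : ∀ b d, (F.transpose * M.metric p * F) b d = M.frameMetric p b d := fun b d => by
    rw [h3, ← inn_metric V hp, inn, Finset.sum_comm]
    exact Finset.sum_congr rfl fun j _ => by rw [Finset.sum_mul]
  have h5 : ∀ A B : Matrix (X ⊕ K ⊕ Υ) (X ⊕ K ⊕ Υ) ℝ,
      F.transpose * A * F = F.transpose * B * F → A = B := by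
    intro A B h
    have h6 := congrArg (fun Z => (Matrix.of fun a i => M.coframe a p i).transpose * Z
      * (Matrix.of fun a i => M.coframe a p i)) h
    have h7 : ∀ A, (Matrix.of fun a i => M.coframe a p i).transpose * (F.transpose * A * F)
      * (Matrix.of fun a i => M.coframe a p i) = A := fun A => by
      rw [← Matrix.mul_assoc, ← Matrix.mul_assoc, ← Matrix.transpose_mul, h2,
        Matrix.transpose_one, one_mul, Matrix.mul_assoc, h2, mul_one]
    simpa only [h7] using h6
  constructor
  · intro h b d
    rw [← h4, frameRicci, ← h3, h, Matrix.mul_smul, Matrix.smul_mul]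
    rfl
  · intro h
    apply h5
    ext b d
    rw [Matrix.mul_smul, Matrix.smul_mul, Matrix.smul_apply, smul_eq_mul, h4, ← h b d, h3]
    rfl

variable {a : Bl → ℝ} {g₁ g₂ : X → (X → ℝ) → ℝ}

/-- All mixed components vanish identically, and each coordinate direction shares its equation with
the vertical field of the same node. One equation per coordinate, one for an extra node and the base
block remain. -/
theorem IsKerrNUT.ricci_eq_smul_iff (W : M.IsKerrNUT S a g₁ g₂) (V : M.IsValid S T)
    {p : X ⊕ K ⊕ Υ → ℝ} (hp : p ∈ cylinder K S T) (Λ : ℝ) :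
    ricci M.metric p = Λ • M.metric p ↔
      (∀ ν, M.ricX a g₁ g₂ ν (xPart p) = Λ) ∧
      (∀ k ∈ M.extra, -(1 / 2) * ∑ ν, M.r ν k (xPart p) * M.yh a g₁ (M.e ν) (xPart p)
        + M.H k (xPart p) * ∑ ν, M.r ν k (xPart p)
        + M.H k (xPart p) * ∑ α, 1 / a (M.blk α) ^ 2 = Λ) ∧
      ∀ β α, ricci M.γ (yPart p) β α = M.f (M.blk α) (xPart p) * (Λ + ∑ k, M.yh a g₁ k (xPart p)
        / (M.s k (xPart p) - a (M.blk α) ^ 2)) * M.γ (yPart p) β α := by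
  rw [V.ricci_eq_smul_iff hp]
  have hH := fun k => V.H_ne k _ hp.1
  have hsy := V.γ_metric.symm _ hp.2
  constructor
  · intro h
    refine ⟨fun ν => ?_, fun k hk => ?_, fun β α => ?_⟩
    · have := h (.inl ν) (.inl ν)
      rw [← W.frameRicci_xx_self V hp, this]
      simp [frameMetric, sepFun, hX, hY]
      field_simp [hH]
    · have := h (.inr (.inl k)) (.inr (.inl k))
      rw [W.frameRicci_extra_self V hp hk] at this
      simp only [frameMetric, sepFun, hX, hY, Matrix.of_apply, if_true, mul_one] at this
      exact mul_left_cancel₀ (hH k) (by rw [this, mul_comm])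
    · have := h (.inr (.inr β)) (.inr (.inr α))
      rw [W.frameRicci_base V hp] at this
      simp only [frameMetric, sepFun, hX, hY, Matrix.of_apply] at this
      have h6 := V.f_mul_γ hp.2 (fun b => M.f b (xPart p)) β α
      linear_combination this + Λ * h6 + M.f (M.blk α) (xPart p) * (∑ k, M.yh a g₁ k (xPart p)
        / (M.s k (xPart p) - a (M.blk α) ^ 2)) * hsy α β
  · rintro ⟨h1, h2, h3⟩ b d
    rcases b with μ | k | β <;> rcases d with ν | l | α
    · by_cases h : μ = ν
      · subst h
        have := W.frameRicci_xx_self V hp μ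
        rw [h1] at this
        simp only [frameMetric, sepFun, hX, hY, Matrix.of_apply, if_true, mul_one]
        field_simp [hH]
        rw [mul_comm, this]
      · rw [W.frameRicci_xx_of_ne V hp h]
        simp [frameMetric, sepFun, hX, h]
    · rw [(V.frameRicci_xk hp μ l).1]; simp [frameMetric, sepFun, hX]
    · rw [(V.frameRicci_xy hp μ α).1]; simp [frameMetric, sepFun, hX]
    · rw [(V.frameRicci_xk hp ν k).2]; simp [frameMetric, sepFun, hX]
    · by_cases h : k = l
      · subst h
        simp only [frameMetric, sepFun, hX, hY, Matrix.of_apply, if_true, mul_one]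
        rcases exists_or_mem_extra (M := M) k with ⟨ν, rfl⟩ | hk
        · rw [W.frameRicci_ee_self V hp, h1, mul_comm]
        · rw [W.frameRicci_extra_self V hp hk, h2 k hk, mul_comm]
      · rw [W.frameRicci_kk_of_ne V hp h]
        simp [frameMetric, sepFun, hX, h]
    · rw [(V.frameRicci_ky hp k α).1]; simp [frameMetric, sepFun, hX]
    · rw [(V.frameRicci_xy hp ν β).2]; simp [frameMetric, sepFun, hX]
    · rw [(V.frameRicci_ky hp l β).2]; simp [frameMetric, sepFun, hX]
    · rw [W.frameRicci_base V hp, h3]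
      simp only [frameMetric, sepFun, hX, hY, Matrix.of_apply]
      have h6 := V.f_mul_γ hp.2 (fun b => M.f b (xPart p)) β α
      linear_combination -Λ * h6 - M.f (M.blk α) (xPart p) * (∑ k, M.yh a g₁ k (xPart p)
        / (M.s k (xPart p) - a (M.blk α) ^ 2)) * hsy α β

end Einstein

/-- Conditions on the base of the fibration. -/
structure IsBase {Υ Bl : Type} [Fintype Υ] [DecidableEq Υ] (ℓ : ℕ) {κ : ℕ} (a : Bl → ℝ)
    (A : Fin κ → (Υ → ℝ) → Υ → ℝ) (blk : Υ → Bl) (γ J : (Υ → ℝ) → Matrix Υ Υ ℝ) (σ : Bl → ℝ)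
    (T : Set (Υ → ℝ)) : Prop where
  openT : IsOpen T
  A_smooth : ∀ k α, ContDiffOn ℝ ∞ (fun y => A k y α) T
  J_smooth : ∀ α β, ContDiffOn ℝ ∞ (fun y => J y α β) T
  γ_metric : IsMetricOn T γ
  γ_blk : ∀ y ∈ T, ∀ α β, blk α ≠ blk β → γ y α β = 0
  J_blk : ∀ y ∈ T, ∀ α β, blk α ≠ blk β → J y α β = 0
  Γ_blk : ∀ y ∈ T, ∀ α β δ, ¬(blk β = blk α ∧ blk δ = blk α) → christoffel γ α β δ y = 0
  dA : ∀ y ∈ T, ∀ (j : Fin κ) α β,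
    pd α (fun y => A j y β) y - pd β (fun y => A j y α) y
    = -2 * ((-1 : ℝ) ^ ((ℓ : ℤ) - (j : ℤ)) * a (blk α) ^ (2 * (ℓ : ℤ) - 2 * (j : ℤ) - 1))
      * kahlerForm γ J y α β
  skew : ∀ y ∈ T, ∀ α β, kahlerForm γ J y α β = -kahlerForm γ J y β α
  J_sq : ∀ y ∈ T, ∀ α β, ∑ δ, J y α δ * J y δ β = if α = β then -σ (blk α) else 0
  J_trace : ∀ y ∈ T, ∀ c : Bl → ℝ, ∑ α, c (blk α) * J y α α = 0
  J_div : ∀ y ∈ T, ∀ α, ∑ δ, pd δ (fun y => J y δ α) y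
    + ∑ δ, ∑ ε, christoffel γ δ δ ε y * J y ε α
    - ∑ δ, ∑ ε, christoffel γ ε δ α y * J y δ ε = 0
  σ_eq : ∀ α, a (blk α) ≠ 0 → σ (blk α) = 1
  a_ne : ℓ < κ → ∀ α, a (blk α) ≠ 0

namespace kerrNUT

variable {ℓ κ : ℕ} {Υ Bl : Type} [Fintype Υ] [DecidableEq Υ]
  {hκ : ℓ ≤ κ} {G : Fin ℓ → ℝ → ℝ} {g₀ : ℝ} {a : Bl → ℝ} {A : Fin κ → (Υ → ℝ) → Υ → ℝ}
  {blk : Υ → Bl} {γ J : (Υ → ℝ) → Matrix Υ Υ ℝ} {σ : Bl → ℝ} {I : Fin ℓ → Set ℝ}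
  {T : Set (Υ → ℝ)}

local notation "𝓜" => kerrNUT hκ G g₀ a A blk γ J σ

theorem f_smooth (b : Bl) : ContDiff ℝ ∞ ((𝓜).f b) := by
  rw [show (𝓜).f b = fun x => ∏ μ, (x μ ^ 2 - a b ^ 2) from rfl]
  exact contDiff_prod fun μ _ => ((contDiff_apply ℝ ℝ μ).pow 2).sub contDiff_const

theorem df (R : IsRange I κ G g₀ a) {x : Fin ℓ → ℝ} (hx : x ∈ Set.univ.pi I) (ν : Fin ℓ) (b : Bl) :
    pd ν ((𝓜).f b) x = (𝓜).φ ν b x * (𝓜).f b x := by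
  have h1 : (𝓜).f b = fun x => ∏ μ, (x μ ^ 2 - a b ^ 2) := rfl
  have h2 : (𝓜).φ ν b x = 2 * x ν / (x ν ^ 2 - a b ^ 2) := rfl
  have h3 : ∀ μ, pd ν (fun x : Fin ℓ → ℝ => x μ ^ 2 - a b ^ 2) x
      = if μ = ν then 2 * x μ else 0 := fun μ => by
    rw [pd_sub (differentiableAt_coord_sq μ x) (differentiableAt_const _), pd_const, pd_coord_sq,
      sub_zero]
  rw [h1, h2, (pd_prod ν Finset.univ (fun μ _ =>
    (differentiableAt_coord_sq μ x).fun_sub (differentiableAt_const _))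
    fun μ _ => sub_ne_zero.2 (R.x_ne_a μ _ (hx μ trivial) b)).2, mul_comm,
    Finset.sum_eq_single ν]
  · rw [h3, if_pos rfl]
  · intro μ _ hμ
    rw [h3, if_neg hμ, zero_div]
  · simp

theorem isValid (R : IsRange I κ G g₀ a) (Bs : IsBase ℓ a A blk γ J σ T) :
    (𝓜).IsValid (Set.univ.pi I) T where
  e_inj := e_inj
  openS := isOpen_pi R
  openT := Bs.openT
  t_smooth := t_smooth R
  H_smooth := H_smooth R
  D_smooth ν := (overNode_facts (hκ := hκ) (A := A) (blk := blk) (γ := γ) (J := J) (σ := σ) R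
      (dG_smooth R) ν).1.sub
    ((H_smooth (hκ := hκ) (A := A) (blk := blk) (γ := γ) (J := J) (σ := σ) R _).mul
      (ContDiffOn.sum fun k _ => t_smooth (hκ := hκ) (A := A) (blk := blk) (γ := γ) (J := J)
        (σ := σ) R ν k))
  φ_smooth ν b := (contDiff_const.mul (contDiff_apply ℝ ℝ ν)).contDiffOn.div
    (((contDiff_apply ℝ ℝ ν).pow 2).sub contDiff_const).contDiffOn
    fun x hx => sub_ne_zero.2 (R.x_ne_a ν _ (hx ν trivial) b)
  f_smooth b := (f_smooth b).contDiffOn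
  C_smooth := C_smooth R
  eh_smooth := eh_smooth R
  et_smooth k j := by
    rw [show (𝓜).et k j = fun x => ∑ t ∈ (Finset.univ.erase k).powersetCard j,
      ∏ i ∈ t, (𝓜).s i x from rfl]
    exact (ContDiff.sum fun t _ => contDiff_prod fun i _ => contDiff_s i).contDiffOn
  A_smooth := Bs.A_smooth
  J_smooth := Bs.J_smooth
  γ_metric := Bs.γ_metric
  H_ne k x hx := div_ne_zero
    ((numerator_facts (hκ := hκ) (A := A) (blk := blk) (γ := γ) (J := J) (σ := σ) R k).2 x hx).1
    (nodeProd_ne (hκ := hκ) (A := A) (blk := blk) (γ := γ) (J := J) (σ := σ) R hx k)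
  f_ne b x hx := by
    rw [show (𝓜).f b x = ∏ μ, (x μ ^ 2 - a b ^ 2) from rfl]
    exact Finset.prod_ne_zero_iff.2 fun μ _ => sub_ne_zero.2 (R.x_ne_a μ _ (hx μ trivial) b)
  t_self ν x _ := by rw [t_eq, r, if_pos rfl, mul_zero]
  dH ν k x hx := dH R hx ν k
  df ν b x hx := df R hx ν b
  dual x hx := dual R hx
  deh x hx := deh R hx
  C_eh x hx := C_eh R hx
  γ_blk := Bs.γ_blk
  J_blk := Bs.J_blk
  Γ_blk := Bs.Γ_blk
  dA := Bs.dA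
  skew := Bs.skew
  J_sq := Bs.J_sq
  J_trace := Bs.J_trace
  J_div := Bs.J_div

theorem isKerrNUT (R : IsRange I κ G g₀ a) (Bs : IsBase ℓ a A blk γ J σ T) :
    (𝓜).IsKerrNUT (Set.univ.pi I) a
      (fun ν x => deriv (G ν) (x ν) / nodeProd ((𝓜).s · x) ((𝓜).e ν))
      (fun ν x => deriv (deriv (G ν)) (x ν) / nodeProd ((𝓜).s · x) ((𝓜).e ν)) where
  x_ne x hx ν := R.x_ne ν _ (hx ν trivial)
  s_ne x hx k l hkl h := hkl (s_injective (hκ := hκ) (A := A) (blk := blk) (γ := γ) (J := J)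
    (σ := σ) R hx h)
  s_ne_a x hx ν b := R.x_ne_a ν _ (hx ν trivial) b
  a_ne k hk := Bs.a_ne (by
    have := Finset.card_pos.2 ⟨k, hk⟩
    rw [card_extra] at this
    omega)
  σ_eq := Bs.σ_eq
  extra_le := Finset.card_le_one.1 (by rw [card_extra]; have := R.le_succ; omega)
  t_eq x _ ν k := t_eq ν k x
  φ_eq x _ ν b := rfl
  C_eq x _ k b := rfl
  D_eq x _ ν := rfl
  g₁_diff x hx ν := ContDiffOn.diffAt (isOpen_pi R) (overNode_facts R (dG_smooth R) ν).1 hx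
  dg₁ x hx ν := (overNode_facts R (dG_smooth R) ν).2 x hx

end kerrNUT

end FibData

end GenKerrNUT

namespace GenKerrNUT

/-! ### Curvature of product metrics -/

section Blocks

variable {Bl Υ : Type} [Fintype Bl] [DecidableEq Bl] [Fintype Υ] [DecidableEq Υ] {n : Bl → ℕ}
  (E : (Σ b, Fin (n b)) ≃ Υ)

/-- The projection to a factor of a product. -/
def blockProj (b : Bl) (y : Υ → ℝ) : Fin (n b) → ℝ := fun α => y (E ⟨b, α⟩)

/-- The sum of the pullbacks of tensors on the factors of a product. -/
def blockTensor (h : ∀ b, (Fin (n b) → ℝ) → Matrix (Fin (n b)) (Fin (n b)) ℝ) (y : Υ → ℝ) :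
    Matrix Υ Υ ℝ :=
  (Matrix.blockDiagonal' fun b => h b (blockProj E b y)).submatrix E.symm E.symm

/-- A product of domains. -/
def blockDomain (B : ∀ b, Set (Fin (n b) → ℝ)) : Set (Υ → ℝ) := {y | ∀ b, blockProj E b y ∈ B b}

/-- The block of an index. -/
def blockOf (u : Υ) : Bl := (E.symm u).1

variable {E} {g J h h' : ∀ b, (Fin (n b) → ℝ) → Matrix (Fin (n b)) (Fin (n b)) ℝ}
  {B : ∀ b, Set (Fin (n b) → ℝ)} {y : Υ → ℝ}

theorem blockOf_apply (b : Bl) (α : Fin (n b)) : blockOf E (E ⟨b, α⟩) = b := by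
  simp [blockOf]

theorem sum_block {R : Type*} [AddCommMonoid R] (F : Υ → R) : ∑ u, F u = ∑ b, ∑ α, F (E ⟨b, α⟩) := by
  rw [← E.sum_comp, Fintype.sum_sigma]

theorem exists_block (u : Υ) : ∃ b α, u = E ⟨b, α⟩ :=
  ⟨(E.symm u).1, (E.symm u).2, by simp⟩

theorem blockTensor_self (b : Bl) (α β : Fin (n b)) :
    blockTensor E h y (E ⟨b, α⟩) (E ⟨b, β⟩) = h b (blockProj E b y) α β := by
  simp [blockTensor]

theorem blockTensor_of_ne {b c : Bl} (hbc : b ≠ c) (α : Fin (n b)) (β : Fin (n c)) :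
    blockTensor E h y (E ⟨b, α⟩) (E ⟨c, β⟩) = 0 := by
  simp [blockTensor, Matrix.blockDiagonal'_apply_ne _ _ _ hbc]

theorem blockTensor_mul : blockTensor E h y * blockTensor E h' y
    = blockTensor E (fun b z => h b z * h' b z) y := by
  rw [blockTensor, blockTensor, Matrix.submatrix_mul_equiv, ← Matrix.blockDiagonal'_mul]
  rfl

theorem blockTensor_transpose : (blockTensor E h y).transpose
    = blockTensor E (fun b z => (h b z).transpose) y := by
  rw [blockTensor, Matrix.transpose_submatrix, Matrix.blockDiagonal'_transpose]
  rfl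

theorem kahlerForm_block : kahlerForm (blockTensor E g) (blockTensor E J) y
    = blockTensor E (fun b => kahlerForm (g b) (J b)) y := by
  rw [kahlerForm, blockTensor_transpose, blockTensor_mul]
  rfl

theorem blockTensor_mul_inv (hdet : ∀ b, (g b (blockProj E b y)).det ≠ 0) :
    blockTensor E g y * blockTensor E (fun b z => (g b z)⁻¹) y = 1 := by
  rw [blockTensor_mul, blockTensor]
  have : (fun b => g b (blockProj E b y) * (g b (blockProj E b y))⁻¹) = fun b => 1 :=
    funext fun b => Matrix.mul_nonsing_inv _ (isUnit_iff_ne_zero.2 (hdet b))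
  rw [this, show (fun b => (1 : Matrix (Fin (n b)) (Fin (n b)) ℝ)) = 1 from rfl,
    Matrix.blockDiagonal'_one, Matrix.submatrix_one_equiv]

theorem blockTensor_det_ne_zero (hdet : ∀ b, (g b (blockProj E b y)).det ≠ 0) :
    (blockTensor E g y).det ≠ 0 :=
  Matrix.det_ne_zero_of_right_inverse (blockTensor_mul_inv hdet)

theorem blockTensor_inv (hdet : ∀ b, (g b (blockProj E b y)).det ≠ 0) :
    (blockTensor E g y)⁻¹ = blockTensor E (fun b z => (g b z)⁻¹) y :=
  Matrix.inv_eq_right_inv (blockTensor_mul_inv hdet)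

theorem blockProj_single_self (b : Bl) (α : Fin (n b)) :
    blockProj E b (Pi.single (E ⟨b, α⟩) 1) = Pi.single α (1 : ℝ) := by
  funext β
  simp [blockProj, Pi.single_apply]

theorem blockProj_single_of_ne {b c : Bl} (hbc : b ≠ c) (α : Fin (n b)) :
    blockProj E c (Pi.single (E ⟨b, α⟩) (1 : ℝ)) = 0 := by
  funext β
  simp [blockProj, hbc.symm]

theorem hasFDerivAt_comp_blockProj {b : Bl} {F : (Fin (n b) → ℝ) → ℝ}
    (hF : DifferentiableAt ℝ F (blockProj E b y)) : DifferentiableAt ℝ (fun y => F (blockProj E b y)) y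
      ∧ ∀ v, fderiv ℝ (fun y => F (blockProj E b y)) y v
        = fderiv ℝ F (blockProj E b y) (blockProj E b v) := by
  let P : (Υ → ℝ) →L[ℝ] Fin (n b) → ℝ :=
    ContinuousLinearMap.pi fun α => ContinuousLinearMap.proj (E ⟨b, α⟩)
  have hP : HasFDerivAt (fun y => blockProj E b y) P y := P.hasFDerivAt
  have h := hF.hasFDerivAt.comp y hP
  have h' : HasFDerivAt (fun y => F (blockProj E b y)) _ y := h
  refine ⟨h'.differentiableAt, fun v => ?_⟩
  rw [h'.fderiv]
  rfl

theorem pd_block_self {b : Bl} {F : (Fin (n b) → ℝ) → ℝ}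
    (hF : DifferentiableAt ℝ F (blockProj E b y)) (α : Fin (n b)) :
    pd (E ⟨b, α⟩) (fun y => F (blockProj E b y)) y = pd α F (blockProj E b y) := by
  rw [pd, (hasFDerivAt_comp_blockProj hF).2, blockProj_single_self, pd]

theorem pd_block_of_ne {b c : Bl} (hbc : b ≠ c) {F : (Fin (n c) → ℝ) → ℝ}
    (hF : DifferentiableAt ℝ F (blockProj E c y)) (α : Fin (n b)) :
    pd (E ⟨b, α⟩) (fun y => F (blockProj E c y)) y = 0 := by
  rw [pd, (hasFDerivAt_comp_blockProj hF).2, blockProj_single_of_ne hbc, map_zero]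

theorem contDiff_blockProj (b : Bl) : ContDiff ℝ ∞ (fun y : Υ → ℝ => blockProj E b y) :=
  contDiff_pi.2 fun α => contDiff_apply ℝ ℝ (E ⟨b, α⟩)

theorem isOpen_blockDomain (hB : ∀ b, IsOpen (B b)) : IsOpen (blockDomain E B) := by
  have : blockDomain E B = ⋂ b, (fun y => blockProj E b y) ⁻¹' B b := by
    ext y; simp [blockDomain]
  rw [this]
  exact isOpen_iInter_of_finite fun b => (hB b).preimage (contDiff_blockProj b).continuous

theorem contDiffOn_comp_blockProj {b : Bl} {F : (Fin (n b) → ℝ) → ℝ} (hF : ContDiffOn ℝ ∞ F (B b)) :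
    ContDiffOn ℝ ∞ (fun y => F (blockProj E b y)) (blockDomain E B) :=
  hF.comp (contDiff_blockProj b).contDiffOn fun _ hy => hy b

theorem contDiffOn_blockTensor (hh : ∀ b α β, ContDiffOn ℝ ∞ (fun z => h b z α β) (B b)) (u v : Υ) :
    ContDiffOn ℝ ∞ (fun y => blockTensor E h y u v) (blockDomain E B) := by
  obtain ⟨b, α, rfl⟩ := exists_block (E := E) u
  obtain ⟨c, β, rfl⟩ := exists_block (E := E) v
  by_cases hbc : b = c
  · subst hbc
    simp only [blockTensor_self]
    exact contDiffOn_comp_blockProj (hh b α β)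
  · simp only [blockTensor_of_ne hbc]
    exact contDiffOn_const

variable (hB : ∀ b, IsOpen (B b)) (hg : ∀ b, IsMetricOn (B b) (g b))

include hg in
theorem isMetricOn_block : IsMetricOn (blockDomain E B) (blockTensor E g) where
  smooth := contDiffOn_blockTensor fun b => (hg b).smooth
  symm y hy u v := by
    obtain ⟨b, α, rfl⟩ := exists_block (E := E) u
    obtain ⟨c, β, rfl⟩ := exists_block (E := E) v
    by_cases hbc : b = c
    · subst hbc
      rw [blockTensor_self, blockTensor_self, (hg b).symm _ (hy b)]
    · rw [blockTensor_of_ne hbc, blockTensor_of_ne (Ne.symm hbc)]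
  nondeg y hy := blockTensor_det_ne_zero fun b => (hg b).nondeg _ (hy b)

include hB

theorem pd_blockTensor_eq_zero (hh : ∀ b α β, ContDiffOn ℝ ∞ (fun z => h b z α β) (B b))
    (hy : y ∈ blockDomain E B) {b c d : Bl} (α : Fin (n b)) (β : Fin (n c)) (δ : Fin (n d))
    (hbc : ¬(c = b ∧ d = b)) :
    pd (E ⟨b, α⟩) (fun y => blockTensor E h y (E ⟨c, β⟩) (E ⟨d, δ⟩)) y = 0 := by
  by_cases hcd : c = d
  · subst hcd
    simp only [blockTensor_self]
    exact pd_block_of_ne (fun h => hbc ⟨h.symm, h.symm⟩)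
      (ContDiffOn.diffAt (hB c) (hh c β δ) (hy c)) α
  · simp only [blockTensor_of_ne hcd]
    exact pd_const _ _ _

theorem pd_blockTensor_self (hh : ∀ b α β, ContDiffOn ℝ ∞ (fun z => h b z α β) (B b))
    (hy : y ∈ blockDomain E B) {b : Bl} (α β δ : Fin (n b)) :
    pd (E ⟨b, α⟩) (fun y => blockTensor E h y (E ⟨b, β⟩) (E ⟨b, δ⟩)) y
      = pd α (fun z => h b z β δ) (blockProj E b y) := by
  simp only [blockTensor_self]
  exact pd_block_self (ContDiffOn.diffAt (hB b) (hh b β δ) (hy b)) α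

include hg

theorem christoffel_block_self (hy : y ∈ blockDomain E B) (b : Bl) (α β δ : Fin (n b)) :
    christoffel (blockTensor E g) (E ⟨b, α⟩) (E ⟨b, β⟩) (E ⟨b, δ⟩) y
      = christoffel (g b) α β δ (blockProj E b y) := by
  have hs := fun b => (hg b).smooth
  rw [christoffel, christoffel, blockTensor_inv fun b => (hg b).nondeg _ (hy b), sum_block (E := E),
    Finset.sum_eq_single b]
  · congr 1
    refine Finset.sum_congr rfl fun ε _ => ?_
    rw [blockTensor_self (h := fun b z => (g b z)⁻¹), pd_blockTensor_self hB hs hy,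
      pd_blockTensor_self hB hs hy, pd_blockTensor_self hB hs hy]
  · intro c _ hc
    refine Finset.sum_eq_zero fun ε _ => ?_
    rw [blockTensor_of_ne hc.symm, zero_mul]
  · simp

theorem christoffel_block_of_ne (hy : y ∈ blockDomain E B) {b c d : Bl} (α : Fin (n b))
    (β : Fin (n c)) (δ : Fin (n d)) (h : ¬(c = b ∧ d = b)) :
    christoffel (blockTensor E g) (E ⟨b, α⟩) (E ⟨c, β⟩) (E ⟨d, δ⟩) y = 0 := by
  have hs := fun b => (hg b).smooth
  rw [christoffel, blockTensor_inv fun b => (hg b).nondeg _ (hy b), sum_block (E := E),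
    Finset.sum_eq_zero, mul_zero]
  intro e _
  refine Finset.sum_eq_zero fun ε _ => ?_
  by_cases he : e = b
  · subst he
    rw [pd_blockTensor_eq_zero hB hs hy β δ ε fun k => h ⟨k.2.symm, k.1.trans k.2.symm⟩,
      pd_blockTensor_eq_zero hB hs hy δ β ε fun k => h ⟨k.1.trans k.2.symm, k.2.symm⟩,
      pd_blockTensor_eq_zero hB hs hy ε β δ h]
    ring
  · rw [blockTensor_of_ne (Ne.symm he), zero_mul]

/-- Symbols with indices in one factor are those of the factor, and depend on its coordinates alone;
all others vanish on an open set together with their derivatives. -/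
theorem ricci_block_self (hy : y ∈ blockDomain E B) (b : Bl) (β δ : Fin (n b)) :
    ricci (blockTensor E g) y (E ⟨b, β⟩) (E ⟨b, δ⟩) = ricci (g b) (blockProj E b y) β δ := by
  have hU := isOpen_blockDomain (E := E) hB
  have hc := fun α β δ => contDiffOn_christoffel (hB b) (hg b) α β δ
  have key : ∀ α β δ ε : Fin (n b),
      pd (E ⟨b, ε⟩) (christoffel (blockTensor E g) (E ⟨b, α⟩) (E ⟨b, β⟩) (E ⟨b, δ⟩)) y
        = pd ε (christoffel (g b) α β δ) (blockProj E b y) := fun α β δ ε => by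
    rw [pd_congr hU (fun y hy => christoffel_block_self hB hg hy b α β δ) hy]
    exact pd_block_self (ContDiffOn.diffAt (hB b) (hc α β δ) (hy b)) ε
  have kz : ∀ {c : Bl} (α : Fin (n c)) (u : Υ) {d e : Bl} (β : Fin (n d)) (δ : Fin (n e)),
      ¬(d = c ∧ e = c) →
      pd u (christoffel (blockTensor E g) (E ⟨c, α⟩) (E ⟨d, β⟩) (E ⟨e, δ⟩)) y = 0 := by
    intro c α u d e β δ hh
    rw [pd_congr hU (fun y hy => christoffel_block_of_ne hB hg hy α β δ hh) hy]
    exact pd_const _ _ _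
  simp only [ricci, Matrix.of_apply]
  congr 1
  · rw [sum_block (E := E), Finset.sum_eq_single b]
    · refine Finset.sum_congr rfl fun α _ => ?_
      rw [key, key]
    · intro c _ hc
      refine Finset.sum_eq_zero fun α _ => ?_
      rw [kz _ _ _ _ fun k => hc k.1.symm, kz _ _ _ _ fun k => hc k.1.symm, sub_zero]
    · simp
  · rw [sum_block (E := E), Finset.sum_eq_single b]
    · refine Finset.sum_congr rfl fun α _ => ?_
      rw [sum_block (E := E), Finset.sum_eq_single b]
      · refine Finset.sum_congr rfl fun ε _ => ?_
        simp only [christoffel_block_self hB hg hy]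
      · intro c _ hc
        refine Finset.sum_eq_zero fun ε _ => ?_
        rw [christoffel_block_of_ne hB hg hy ε β δ fun k => hc k.1.symm,
          christoffel_block_of_ne hB hg hy ε β α fun k => hc k.1.symm]
        ring
      · simp
    · intro c _ hc
      refine Finset.sum_eq_zero fun α _ => ?_
      rw [sum_block (E := E)]
      refine Finset.sum_eq_zero fun d _ => Finset.sum_eq_zero fun ε _ => ?_
      rw [christoffel_block_of_ne hB hg hy α δ ε fun k => hc k.1.symm]
      by_cases hd : d = b
      · subst hd
        rw [christoffel_block_of_ne hB hg hy α α ε fun k => hc k.2.symm]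
        ring
      · rw [christoffel_block_of_ne hB hg hy ε β δ fun k => hd k.1.symm]
        ring
    · simp

theorem ricci_block_of_ne (hy : y ∈ blockDomain E B) {b c : Bl} (hbc : b ≠ c)
    (β : Fin (n b)) (δ : Fin (n c)) :
    ricci (blockTensor E g) y (E ⟨b, β⟩) (E ⟨c, δ⟩) = 0 := by
  have hU := isOpen_blockDomain (E := E) hB
  have hC := fun b α β δ => contDiffOn_christoffel (hB b) (hg b) α β δ
  have kz : ∀ {c : Bl} (α : Fin (n c)) (u : Υ) {d e : Bl} (β : Fin (n d)) (δ : Fin (n e)),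
      ¬(d = c ∧ e = c) →
      pd u (christoffel (blockTensor E g) (E ⟨c, α⟩) (E ⟨d, β⟩) (E ⟨e, δ⟩)) y = 0 := by
    intro c α u d e β δ hh
    rw [pd_congr hU (fun y hy => christoffel_block_of_ne hB hg hy α β δ hh) hy]
    exact pd_const _ _ _
  -- A nonzero symbol belongs to the factor `b` and does not depend on the coordinates of the factor
  -- `c`.
  have kn : ∀ (d : Bl) (α : Fin (n d)), 
      pd (E ⟨c, δ⟩) (christoffel (blockTensor E g) (E ⟨d, α⟩) (E ⟨b, β⟩) (E ⟨d, α⟩)) y = 0 := by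
    intro d α
    by_cases hd : b = d
    · subst hd
      rw [pd_congr hU (fun y hy => christoffel_block_self hB hg hy b α β α) hy]
      exact pd_block_of_ne hbc.symm (ContDiffOn.diffAt (hB b) (hC b α β α) (hy b)) δ
    · exact kz _ _ _ _ fun k => hd k.1
  simp only [ricci, Matrix.of_apply]
  rw [sum_block (E := E), sum_block (E := E), Finset.sum_eq_zero, Finset.sum_eq_zero, add_zero]
  · intro d _
    refine Finset.sum_eq_zero fun α _ => ?_
    rw [sum_block (E := E)]
    refine Finset.sum_eq_zero fun e _ => Finset.sum_eq_zero fun ε _ => ?_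
    rw [christoffel_block_of_ne hB hg hy ε β δ fun k => hbc (k.1.trans k.2.symm)]
    by_cases hd : c = d
    · by_cases he : b = e
      · rw [christoffel_block_of_ne hB hg hy α δ ε fun k => hbc (he.trans (k.2.trans hd.symm))]
        ring
      · rw [christoffel_block_of_ne hB hg hy ε β α fun k => he k.1]
        ring
    · rw [christoffel_block_of_ne hB hg hy α δ ε fun k => hd k.1]
      ring
  · intro d _
    refine Finset.sum_eq_zero fun α _ => ?_
    rw [kz α _ β δ fun k => hbc (k.1.trans k.2.symm), kn, sub_zero]

end Blocks

end GenKerrNUT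

namespace GenKerrNUT

/-- A chart with a metric, a parallel skew endomorphism of square `-s` and a potential. -/
structure IsFactor {ι : Type} [Fintype ι] [DecidableEq ι] (B : Set (ι → ℝ))
    (g J : (ι → ℝ) → Matrix ι ι ℝ) (β : (ι → ℝ) → ι → ℝ) (s : ℝ) : Prop where
  isOpen : IsOpen B
  metric : IsMetricOn B g
  smooth : ∀ i j, ContDiffOn ℝ ∞ (fun p => J p i j) B
  potential : IsPotentialOn B β (kahlerForm g J)
  skew : ∀ p ∈ B, ∀ i j, kahlerForm g J p i j = -kahlerForm g J p j i
  sq : ∀ p ∈ B, J p * J p = -(s • 1)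
  trace : ∀ p ∈ B, ∑ i, J p i i = 0
  div : ∀ p ∈ B, ∀ j, ∑ i, pd i (fun q => J q i j) p + ∑ i, ∑ l, christoffel g i i l p * J p l j
      - ∑ i, ∑ l, christoffel g l i j p * J p i l = 0

/-! ### Kähler factors and the factor with eigenvalue zero -/

section Factor

variable {ι : Type} [Fintype ι] [DecidableEq ι] {B : Set (ι → ℝ)}
  {g J : (ι → ℝ) → Matrix ι ι ℝ} {β : (ι → ℝ) → ι → ℝ}

/-- From `Jᵀ g J = g` and `J² = -1` follows `g J = -Jᵀ g`. Thus the Kähler form is skew, and `Jᵀ` is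
conjugate to `-J`, so the trace vanishes. The divergence is a contraction of `∇J = 0`. -/
theorem IsKahlerOn.isFactor (hB : IsOpen B) (hK : IsKahlerOn B g J)
    (hβ : IsPotentialOn B β (kahlerForm g J)) : IsFactor B g J β 1 := by
  have h1 : ∀ p ∈ B, g p * J p = -((J p).transpose * g p) := fun p hp => by
    rw [← Matrix.mul_one ((J p).transpose * g p), ← Matrix.mul_neg, ← hK.sq p hp,
      ← Matrix.mul_assoc, hK.hermitian p hp]
  have hsymm : ∀ p ∈ B, (g p).transpose = g p := fun p hp =>
    Matrix.ext fun i j => hK.metric.symm p hp j i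
  refine ⟨hB, hK.metric, hK.smooth, hβ, fun p hp i j => ?_, fun p hp => ?_, fun p hp => ?_,
    fun p hp j => ?_⟩
  · have := congrFun (congrFun (h1 p hp) j) i
    have h2 : (g p * J p) j i = kahlerForm g J p i j := by
      conv_lhs => rw [← hsymm p hp]
      rw [kahlerForm, ← Matrix.transpose_transpose (J p), ← Matrix.transpose_mul,
        Matrix.transpose_apply, Matrix.transpose_transpose]
    rw [← h2, this]
    rfl
  · rw [hK.sq p hp, one_smul]
  · have hu : IsUnit (g p).det := isUnit_iff_ne_zero.2 (hK.metric.nondeg p hp)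
    have h2 : (J p).transpose = -(g p * J p * (g p)⁻¹) := by
      rw [h1 p hp, Matrix.neg_mul, neg_neg, Matrix.mul_assoc, Matrix.mul_nonsing_inv _ hu,
        Matrix.mul_one]
    have h3 : (J p).trace = -(J p).trace := by
      conv_lhs => rw [← Matrix.trace_transpose, h2]
      rw [Matrix.trace_neg, Matrix.trace_mul_comm, ← Matrix.mul_assoc, Matrix.nonsing_inv_mul _ hu,
        Matrix.one_mul]
    have h4 : (J p).trace = 0 := by linarith
    exact h4
  · rw [← Finset.sum_add_distrib, ← Finset.sum_sub_distrib]
    exact Finset.sum_eq_zero fun i _ => hK.parallel p hp i i j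

/-- The factor `B^{(0)}` fits the same scheme with `J = 0`: it carries no Kähler form, and the
conditions on `J` are trivial with square `0`. -/
theorem IsMetricOn.isFactor (hB : IsOpen B) (hg : IsMetricOn B g) :
    IsFactor B g (fun _ => 0) (fun _ => 0) 0 := by
  have h : ∀ p, kahlerForm g (fun _ => 0) p = 0 := fun p => by simp [kahlerForm]
  refine ⟨hB, hg, fun i j => contDiffOn_const, ⟨fun i => contDiffOn_const, fun p _ i j => ?_⟩,
    fun p _ i j => ?_, fun p _ => by simp, fun p _ => by simp, fun p _ j => ?_⟩
  · simp [h, pd_const]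
  · simp [h]
  · simp [pd_const]

end Factor

section BlockBase

variable {Bl Υ : Type} [Fintype Bl] [DecidableEq Bl] [Fintype Υ] [DecidableEq Υ] {n : Bl → ℕ}

/-- The sum of multiples of the pullbacks of forms on the factors of a product. -/
def blockForm (E : (Σ b, Fin (n b)) ≃ Υ) (c : Bl → ℝ)
    (β : ∀ b, (Fin (n b) → ℝ) → Fin (n b) → ℝ) (y : Υ → ℝ) (u : Υ) : ℝ :=
  c (E.symm u).1 * β _ (blockProj E _ y) (E.symm u).2

variable {E : (Σ b, Fin (n b)) ≃ Υ} {g J : ∀ b, (Fin (n b) → ℝ) → Matrix (Fin (n b)) (Fin (n b)) ℝ}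
  {B : ∀ b, Set (Fin (n b) → ℝ)} {β : ∀ b, (Fin (n b) → ℝ) → Fin (n b) → ℝ} {y : Υ → ℝ}

theorem blockForm_apply (c : Bl → ℝ) (b : Bl) (α : Fin (n b)) :
    blockForm E c β y (E ⟨b, α⟩) = c b * β b (blockProj E b y) α := by
  -- Generalising the image of the index as `s` allows substitution of an equality of dependent
  -- pairs, with no transport between the types of the fibres.
  have : ∀ s : Σ b, Fin (n b), E.symm (E ⟨b, α⟩) = s →
      c s.1 * β _ (blockProj E _ y) s.2 = c b * β b (blockProj E b y) α := by
    rintro s hs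
    rw [Equiv.symm_apply_apply] at hs
    subst hs
    rfl
  exact this _ rfl

theorem IsFactor.isBase {ℓ κ : ℕ} {a : Bl → ℝ} {σ : Bl → ℝ}
    (hF : ∀ b, IsFactor (B b) (g b) (J b) (β b) (σ b)) (hσ : ∀ b, a b ≠ 0 → σ b = 1)
    (ha : ℓ < κ → ∀ u, a (blockOf E u) ≠ 0) :
    FibData.IsBase ℓ a (fun j : Fin κ => blockForm E (fun b => -2 *
        ((-1 : ℝ) ^ ((ℓ : ℤ) - (j : ℤ)) * a b ^ (2 * (ℓ : ℤ) - 2 * (j : ℤ) - 1))) β)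
      (blockOf E) (blockTensor E g) (blockTensor E J) σ (blockDomain E B) := by
  have hB := fun b => (hF b).isOpen
  have hg := fun b => (hF b).metric
  have hJ := fun b => (hF b).smooth
  refine ⟨isOpen_blockDomain hB, fun k u => ?_, contDiffOn_blockTensor hJ, isMetricOn_block hg,
    fun y _ u v h => ?_, fun y _ u v h => ?_, fun y hy u v w h => ?_, fun y hy j u v => ?_,
    fun y hy u v => ?_, fun y hy u v => ?_, fun y hy c => ?_, fun y hy u => ?_,
    fun u hu => hσ _ hu, ha⟩
  · obtain ⟨b, α, rfl⟩ := exists_block (E := E) u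
    simp only [blockForm_apply]
    exact contDiffOn_const.mul (contDiffOn_comp_blockProj ((hF b).potential.smooth α))
  · obtain ⟨b, α, rfl⟩ := exists_block (E := E) u
    obtain ⟨c, δ, rfl⟩ := exists_block (E := E) v
    rw [blockOf_apply, blockOf_apply] at h
    exact blockTensor_of_ne h α δ
  · obtain ⟨b, α, rfl⟩ := exists_block (E := E) u
    obtain ⟨c, δ, rfl⟩ := exists_block (E := E) v
    rw [blockOf_apply, blockOf_apply] at h
    exact blockTensor_of_ne h α δ
  · obtain ⟨b, α, rfl⟩ := exists_block (E := E) u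
    obtain ⟨c, δ, rfl⟩ := exists_block (E := E) v
    obtain ⟨d, ε, rfl⟩ := exists_block (E := E) w
    rw [blockOf_apply, blockOf_apply, blockOf_apply] at h
    exact christoffel_block_of_ne hB hg hy α δ ε h
  · obtain ⟨b, α, rfl⟩ := exists_block (E := E) u
    obtain ⟨c, δ, rfl⟩ := exists_block (E := E) v
    have hd : ∀ b α, DifferentiableAt ℝ (fun z => β b z α) (blockProj E b y) := fun b α =>
      ContDiffOn.diffAt (hB b) ((hF b).potential.smooth α) (hy b)
    have hd' : ∀ b α, DifferentiableAt ℝ (fun y => β b (blockProj E b y) α) y := fun b α =>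
      (hasFDerivAt_comp_blockProj (hd b α)).1
    rw [kahlerForm_block, blockOf_apply]
    simp only [blockForm_apply]
    rw [pd_const_mul (hd' _ _), pd_const_mul (hd' _ _)]
    by_cases hbc : b = c
    · subst hbc
      rw [pd_block_self (F := fun z => β b z δ) (hd b δ), pd_block_self (F := fun z => β b z α)
        (hd b α), blockTensor_self (h := fun b => kahlerForm (g b) (J b)),
        ← (hF b).potential.deriv_eq _ (hy b)]
      ring
    · rw [pd_block_of_ne hbc (F := fun z => β c z δ) (hd c δ), pd_block_of_ne (Ne.symm hbc)
        (F := fun z => β b z α) (hd b α), blockTensor_of_ne hbc]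
      ring
  · obtain ⟨b, α, rfl⟩ := exists_block (E := E) u
    obtain ⟨c, δ, rfl⟩ := exists_block (E := E) v
    rw [kahlerForm_block]
    by_cases hbc : b = c
    · subst hbc
      rw [blockTensor_self (h := fun b => kahlerForm (g b) (J b)),
        blockTensor_self (h := fun b => kahlerForm (g b) (J b)), (hF b).skew _ (hy b)]
    · rw [blockTensor_of_ne hbc, blockTensor_of_ne (Ne.symm hbc), neg_zero]
  · obtain ⟨b, α, rfl⟩ := exists_block (E := E) u
    obtain ⟨c, δ, rfl⟩ := exists_block (E := E) v
    have h : (blockTensor E J y * blockTensor E J y) (E ⟨b, α⟩) (E ⟨c, δ⟩) = _ :=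
      Matrix.mul_apply
    rw [← h, blockTensor_mul, blockOf_apply]
    by_cases hbc : b = c
    · subst hbc
      rw [blockTensor_self (h := fun b z => J b z * J b z), (hF b).sq _ (hy b)]
      by_cases hαδ : α = δ
      · subst hαδ; simp
      · rw [if_neg (by simpa using hαδ)]; simp [hαδ]
    · rw [blockTensor_of_ne hbc, if_neg (by intro h; exact hbc (congrArg Sigma.fst (E.injective h)))]
  · rw [sum_block (E := E)]
    simp only [blockOf_apply, blockTensor_self]
    refine Finset.sum_eq_zero fun b _ => ?_
    rw [← Finset.mul_sum, (hF b).trace _ (hy b), mul_zero]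
  · obtain ⟨b, α, rfl⟩ := exists_block (E := E) u
    rw [← (hF b).div _ (hy b) α]
    congr 1
    · congr 1
      · rw [sum_block (E := E), Finset.sum_eq_single b]
        · exact Finset.sum_congr rfl fun δ _ => pd_blockTensor_self hB hJ hy δ δ α
        · intro c _ hc
          exact Finset.sum_eq_zero fun δ _ =>
            pd_blockTensor_eq_zero hB hJ hy δ δ α fun k => hc k.2.symm
        · simp
      · rw [Finset.sum_comm, sum_block (E := E), Finset.sum_eq_single b]
        · rw [Finset.sum_comm, sum_block (E := E), Finset.sum_eq_single b]
          · simp only [christoffel_block_self hB hg hy, blockTensor_self]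
          · intro c _ hc
            refine Finset.sum_eq_zero fun δ _ => Finset.sum_eq_zero fun ε _ => ?_
            rw [christoffel_block_of_ne hB hg hy δ δ ε fun k => hc k.2.symm, zero_mul]
          · simp
        · intro c _ hc
          refine Finset.sum_eq_zero fun ε _ => Finset.sum_eq_zero fun δ _ => ?_
          rw [blockTensor_of_ne hc, mul_zero]
        · simp
    · rw [sum_block (E := E), Finset.sum_eq_single b]
      · refine Finset.sum_congr rfl fun δ _ => ?_
        rw [sum_block (E := E), Finset.sum_eq_single b]
        · simp only [christoffel_block_self hB hg hy, blockTensor_self]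
        · intro c _ hc
          refine Finset.sum_eq_zero fun ε _ => ?_
          rw [blockTensor_of_ne (Ne.symm hc), mul_zero]
        · simp
      · intro c _ hc
        refine Finset.sum_eq_zero fun δ _ => ?_
        rw [sum_block (E := E)]
        refine Finset.sum_eq_zero fun d _ => Finset.sum_eq_zero fun ε _ => ?_
        rw [christoffel_block_of_ne hB hg hy ε δ α fun k => hc (k.1.trans k.2.symm), zero_mul]
      · simp

end BlockBase

end GenKerrNUT

namespace GenKerrNUT

open Polynomial in
-- The nodal polynomial is monic and vanishes at all nodes, so adding `c` times it fixes the top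
-- coefficient without changing the values.
theorem exists_interpolation {κ : Type} [Fintype κ] [DecidableEq κ] {v : κ → ℝ}
    (hv : Function.Injective v) (r : κ → ℝ) (c : ℝ) : ∃ P : ℝ[X],
    P.natDegree ≤ Fintype.card κ ∧ P.coeff (Fintype.card κ) = c ∧ ∀ k, P.eval (v k) = r k := by
  have hd : (Lagrange.interpolate Finset.univ v r).degree < (Fintype.card κ : WithBot ℕ) :=
    Lagrange.degree_interpolate_lt r hv.injOn
  have hn : (Lagrange.nodal Finset.univ v).Monic := Lagrange.nodal_monic
  have hn' : (Lagrange.nodal Finset.univ v).natDegree = Fintype.card κ := by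
    rw [Lagrange.natDegree_nodal, Finset.card_univ]
  refine ⟨C c * Lagrange.nodal Finset.univ v + Lagrange.interpolate Finset.univ v r, ?_, ?_,
    fun k => ?_⟩
  · refine (natDegree_add_le _ _).trans (max_le ((natDegree_C_mul_le _ _).trans hn'.le) ?_)
    exact natDegree_le_of_degree_le hd.le
  · rw [coeff_add, coeff_C_mul, coeff_eq_zero_of_degree_lt hd, add_zero, ← hn', hn.coeff_natDegree,
      mul_one]
  · rw [eval_add, eval_mul, Lagrange.eval_nodal_at_node (Finset.mem_univ k),
      Lagrange.eval_interpolate_at_node r hv.injOn (Finset.mem_univ k), mul_zero, zero_add]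

/-! ### The Einstein equations in terms of an interpolating polynomial -/

namespace FibData

/-- Functions of one variable divided by the products of the differences of the nodes. -/
def overNode {X K Υ Bl : Type} [Fintype K] [DecidableEq K] (M : FibData X K Υ Bl) (F : X → ℝ → ℝ)
    (ν : X) (x : X → ℝ) : ℝ := F ν (x ν) / nodeProd (fun k => M.s k x) (M.e ν)

namespace kerrNUT

variable {ℓ κ : ℕ} {Υ Bl : Type} [Fintype Υ] [DecidableEq Υ]
  {hκ : ℓ ≤ κ} {G : Fin ℓ → ℝ → ℝ} {g₀ : ℝ} {a : Bl → ℝ} {A : Fin κ → (Υ → ℝ) → Υ → ℝ}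
  {blk : Υ → Bl} {γ J : (Υ → ℝ) → Matrix Υ Υ ℝ} {σ : Bl → ℝ} {I : Fin ℓ → Set ℝ}

local notation "𝓜" => kerrNUT hκ G g₀ a A blk γ J σ
local notation "𝓰₁" => overNode (kerrNUT hκ G g₀ a A blk γ J σ) fun ν => deriv (G ν)
local notation "𝓰₂" => overNode (kerrNUT hκ G g₀ a A blk γ J σ) fun ν => deriv (deriv (G ν))

/-- The logarithmic derivative of the weight as a function of one variable. -/
def pFun (n : ℕ) (a : Bl → ℝ) (blk : Υ → Bl) (u : ℝ) : ℝ :=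
  -(n / u) + ∑ α, u / (u ^ 2 - a (blk α) ^ 2)

/-- The left-hand side of the differential equation for the function `F` of one variable. -/
def yFun (n : ℕ) (a : Bl → ℝ) (blk : Υ → Bl) (F : ℝ → ℝ) (u : ℝ) : ℝ :=
  u * deriv F u + (u * pFun n a blk u - 1) * F u

theorem hasDerivAt_pFun (n : ℕ) {u : ℝ} (hu : u ≠ 0) (ha : ∀ b, u ^ 2 ≠ a b ^ 2) :
    HasDerivAt (pFun n a blk) (n / u ^ 2 + ∑ α, (1 / (u ^ 2 - a (blk α) ^ 2)
      - (1 / 2) * (2 * u / (u ^ 2 - a (blk α) ^ 2)) ^ 2)) u := by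
  have h1 : HasDerivAt (fun u : ℝ => -((n : ℝ) / u)) (n / u ^ 2) u := by
    have := ((hasDerivAt_inv hu).const_mul (n : ℝ)).neg
    refine (this.congr_deriv (by field_simp)).congr_of_eventuallyEq ?_
    exact Filter.Eventually.of_forall fun u => by simp [div_eq_mul_inv]
  refine h1.add (HasDerivAt.fun_sum fun α _ => ?_)
  have h0 := sub_ne_zero.2 (ha (blk α))
  have h2 := (hasDerivAt_id' u).fun_div (((hasDerivAt_id' u).fun_pow 2).sub_const (a (blk α) ^ 2)) h0
  refine h2.congr_deriv ?_
  simp only [Nat.cast_ofNat, Nat.add_one_sub_one, pow_one, mul_one]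
  field_simp

variable (R : IsRange I κ G g₀ a) {x : Fin ℓ → ℝ}
include R

/-- In `p + u p'` the terms with `n` cancel, and the remaining sum is the one multiplying `H` in
`ricX`. Thus the second-order expression in `G` is a first derivative of `yFun`. -/
theorem hasDerivAt_yFun (ν : Fin ℓ) (n : ℕ) {u : ℝ} (hu : u ∈ I ν) :
    HasDerivAt (yFun n a blk (G ν)) (u * deriv (deriv (G ν)) u + u * pFun n a blk u * deriv (G ν) u
      + u * (∑ α, (2 / (u ^ 2 - a (blk α) ^ 2)
      - (1 / 2) * (2 * u / (u ^ 2 - a (blk α) ^ 2)) ^ 2)) * G ν u) u := by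
  have hu0 := R.x_ne ν u hu
  have h1 : HasDerivAt (G ν) (deriv (G ν) u) u := (((R.G_smooth ν).contDiffAt
    ((R.isOpen ν).mem_nhds hu)).differentiableAt (by norm_num)).hasDerivAt
  have h2 : HasDerivAt (deriv (G ν)) (deriv (deriv (G ν)) u) u := (((dG_smooth R ν).contDiffAt
    ((R.isOpen ν).mem_nhds hu)).differentiableAt (by norm_num)).hasDerivAt
  have h3 := hasDerivAt_pFun (blk := blk) n hu0 (R.x_ne_a ν u hu)
  have h4 := ((hasDerivAt_id' u).fun_mul h2).fun_add
    ((((hasDerivAt_id' u).fun_mul h3).sub_const 1).fun_mul h1)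
  refine h4.congr_deriv ?_
  have h5 : ∑ α, (2 / (u ^ 2 - a (blk α) ^ 2) - (1 / 2) * (2 * u / (u ^ 2 - a (blk α) ^ 2)) ^ 2)
      = ∑ α, (1 / (u ^ 2 - a (blk α) ^ 2) - (1 / 2) * (2 * u / (u ^ 2 - a (blk α) ^ 2)) ^ 2)
        + ∑ α, 1 / (u ^ 2 - a (blk α) ^ 2) := by
    rw [← Finset.sum_add_distrib]
    exact Finset.sum_congr rfl fun α _ => by ring
  have h6 : u * ∑ α, 1 / (u ^ 2 - a (blk α) ^ 2) = ∑ α, u / (u ^ 2 - a (blk α) ^ 2) := by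
    rw [Finset.mul_sum]
    exact Finset.sum_congr rfl fun α _ => by ring
  have h7 : (n : ℝ) / u ^ 2 * u = n / u := by field_simp
  rw [h5]
  simp only [pFun]
  linear_combination G ν u * h7 - G ν u * h6

omit R in
/-- The values which the polynomial has at the nodes. -/
theorem yh_eq (k : Fin κ) : (𝓜).yh a 𝓰₁ k x = Function.extend (𝓜).e
    (fun ν => yFun (κ - ℓ) a blk (G ν) (x ν)) (fun _ => -2 * g₀) k
      / nodeProd (fun k => (𝓜).s k x) k := by
  have he : Function.Injective (𝓜).e := e_inj
  rcases exists_or_mem_extra (M := 𝓜) k with ⟨ν, rfl⟩ | hk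
  · rw [yh_e he, he.extend_apply, H_eq, he.extend_apply, pw, card_extra, yFun, pFun, overNode]
    have h : (𝓜).blk = blk := rfl
    rw [h]
    ring
  · have hk' : ¬∃ ν, (𝓜).e ν = k := fun ⟨ν, h⟩ => mem_extra.1 hk ν h
    rw [yh_extra hk, H_eq, Function.extend_apply' _ _ _ hk', Function.extend_apply' _ _ _ hk']
    ring

omit R in
theorem yh_e_eq (ν : Fin ℓ) : (𝓜).yh a 𝓰₁ ((𝓜).e ν) x = yFun (κ - ℓ) a blk (G ν) (x ν)
      / nodeProd (fun k => (𝓜).s k x) ((𝓜).e ν) := by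
  rw [yh_eq, e_inj.extend_apply]

/-- This puts `ricX` into the shape of the negative of the left side of `lagrange_derivative`; `y' /
(2 x_ν)` is the derivative with respect to the node `x_ν²`. -/
theorem ricX_yFun (hx : x ∈ Set.univ.pi I) (ν : Fin ℓ) : (𝓜).ricX a 𝓰₁ 𝓰₂ ν x
    = -(deriv (yFun (κ - ℓ) a blk (G ν)) (x ν) / (2 * x ν)) / nodeProd (fun k => (𝓜).s k x) ((𝓜).e ν)
      + ∑ k ∈ Finset.univ.erase ((𝓜).e ν), ((𝓜).yh a 𝓰₁ ((𝓜).e ν) x + (𝓜).yh a 𝓰₁ k x)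
        / ((𝓜).s ((𝓜).e ν) x - (𝓜).s k x) := by
  have he : Function.Injective (𝓜).e := e_inj
  have hu := hx ν trivial
  have hu0 := R.x_ne ν _ hu
  have h1 : (1 / 2) * ∑ k, (𝓜).r ν k x * ((𝓜).yh a 𝓰₁ ((𝓜).e ν) x + (𝓜).yh a 𝓰₁ k x)
      = ∑ k ∈ Finset.univ.erase ((𝓜).e ν), ((𝓜).yh a 𝓰₁ ((𝓜).e ν) x + (𝓜).yh a 𝓰₁ k x)
        / ((𝓜).s ((𝓜).e ν) x - (𝓜).s k x) := by
    rw [← Finset.add_sum_erase _ _ (Finset.mem_univ ((𝓜).e ν)), r, if_pos rfl, zero_mul, zero_add,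
      Finset.mul_sum]
    refine Finset.sum_congr rfl fun k hk => ?_
    rw [r, if_neg (Finset.ne_of_mem_erase hk), s_e he]
    ring
  have hb : (𝓜).blk = blk := rfl
  have hφ : ∀ b, (𝓜).φ ν b x = 2 * x ν / (x ν ^ 2 - a b ^ 2) := fun b => rfl
  have hg₁ : 𝓰₁ ν x = deriv (G ν) (x ν) / nodeProd (fun k => (𝓜).s k x) ((𝓜).e ν) := rfl
  have hg₂ : 𝓰₂ ν x = deriv (deriv (G ν)) (x ν) / nodeProd (fun k => (𝓜).s k x) ((𝓜).e ν) := rfl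
  rw [ricX, h1, hg₁, hg₂, (hasDerivAt_yFun (blk := blk) R ν (κ - ℓ) hu).deriv, H_eq, he.extend_apply, pw,
    card_extra, hb]
  simp only [hφ, pFun]
  congr 1
  have h2 := nodeProd_ne (hκ := hκ) (A := A) (blk := blk) (γ := γ) (J := J) (σ := σ) R hx ((𝓜).e ν)
  beta_reduce at h2
  generalize (∑ α, (2 / (x ν ^ 2 - a (blk α) ^ 2)
    - (1 / 2) * (2 * x ν / (x ν ^ 2 - a (blk α) ^ 2)) ^ 2)) = S₁
  generalize ∑ α, x ν / (x ν ^ 2 - a (blk α) ^ 2) = S₂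
  generalize nodeProd (fun k => (𝓜).s k x) ((𝓜).e ν) = n at *
  field_simp
  ring

open Polynomial in
-- Compare `ricX_yFun` with `lagrange_derivative` for `P`. Agreement with the data is required only
-- at the other nodes, so the defect at the node of `x_ν` survives and obeys a linear equation.
theorem ricX_eq_iff (hx : x ∈ Set.univ.pi I) (ν : Fin ℓ) {P : ℝ[X]} {Λ : ℝ} (hP : P.natDegree ≤ κ)
    (hc : P.coeff κ = -Λ) (hy : ∀ k, k ≠ (𝓜).e ν → P.eval ((𝓜).s k x)
      = Function.extend (𝓜).e (fun ν => yFun (κ - ℓ) a blk (G ν) (x ν)) (fun _ => -2 * g₀) k) :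
    (𝓜).ricX a 𝓰₁ 𝓰₂ ν x = Λ ↔
      deriv (yFun (κ - ℓ) a blk (G ν)) (x ν) / (2 * x ν) - P.derivative.eval (x ν ^ 2)
        = (yFun (κ - ℓ) a blk (G ν) (x ν) - P.eval (x ν ^ 2))
          * ∑ k ∈ Finset.univ.erase ((𝓜).e ν), 1 / (x ν ^ 2 - (𝓜).s k x) := by
  have he : Function.Injective (𝓜).e := e_inj
  have hv := s_injective (hκ := hκ) (A := A) (blk := blk) (γ := γ) (J := J) (σ := σ) R hx
  have h1 := lagrange_derivative hv (P := P) (c := -Λ) (by rwa [Fintype.card_fin])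
    (by rwa [Fintype.card_fin]) ((𝓜).e ν)
  beta_reduce at h1
  have h2 := nodeProd_ne (hκ := hκ) (A := A) (blk := blk) (γ := γ) (J := J) (σ := σ) R hx ((𝓜).e ν)
  beta_reduce at h2
  have h3 : ∑ k ∈ Finset.univ.erase ((𝓜).e ν), ((𝓜).yh a 𝓰₁ ((𝓜).e ν) x + (𝓜).yh a 𝓰₁ k x)
        / ((𝓜).s ((𝓜).e ν) x - (𝓜).s k x)
      = ∑ k ∈ Finset.univ.erase ((𝓜).e ν), (P.eval ((𝓜).s ((𝓜).e ν) x)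
          / nodeProd (fun k => (𝓜).s k x) ((𝓜).e ν) + P.eval ((𝓜).s k x)
          / nodeProd (fun k => (𝓜).s k x) k) / ((𝓜).s ((𝓜).e ν) x - (𝓜).s k x)
        + (yFun (κ - ℓ) a blk (G ν) (x ν) - P.eval (x ν ^ 2))
          / nodeProd (fun k => (𝓜).s k x) ((𝓜).e ν)
          * ∑ k ∈ Finset.univ.erase ((𝓜).e ν), 1 / (x ν ^ 2 - (𝓜).s k x) := by
    rw [Finset.mul_sum, ← Finset.sum_add_distrib]
    refine Finset.sum_congr rfl fun k hk => ?_
    rw [yh_e_eq, yh_eq, hy k (Finset.ne_of_mem_erase hk), s_e he]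
    ring
  rw [ricX_yFun R hx, h3]
  rw [s_e he] at h1 ⊢
  generalize (∑ k ∈ Finset.univ.erase ((𝓜).e ν), (P.eval (x ν ^ 2)
          / nodeProd (fun k => (𝓜).s k x) ((𝓜).e ν) + P.eval ((𝓜).s k x)
          / nodeProd (fun k => (𝓜).s k x) k) / (x ν ^ 2 - (𝓜).s k x)) = S at *
  generalize ∑ k ∈ Finset.univ.erase ((𝓜).e ν), 1 / (x ν ^ 2 - (𝓜).s k x) = Q at *
  generalize nodeProd (fun k => (𝓜).s k x) ((𝓜).e ν) = n at *
  generalize deriv (yFun (κ - ℓ) a blk (G ν)) (x ν) / (2 * x ν) = d at *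
  have h4 : P.derivative.eval (x ν ^ 2) / n * n = P.derivative.eval (x ν ^ 2) := by field_simp
  constructor
  · intro h
    have h5 : (-d / n + (S + (yFun (κ - ℓ) a blk (G ν) (x ν) - P.eval (x ν ^ 2)) / n * Q)) * n
      = Λ * n := by rw [h]
    have h6 : (-d / n + (S + (yFun (κ - ℓ) a blk (G ν) (x ν) - P.eval (x ν ^ 2)) / n * Q)) * n
      = -d + S * n + (yFun (κ - ℓ) a blk (G ν) (x ν) - P.eval (x ν ^ 2)) * Q := by
      field_simp; ring
    linear_combination h6 - h5 - n * h1 + h4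
  · intro h
    have h5 : (yFun (κ - ℓ) a blk (G ν) (x ν) - P.eval (x ν ^ 2)) / n * Q
      = d / n - P.derivative.eval (x ν ^ 2) / n := by
      rw [div_mul_eq_mul_div, ← h, sub_div]
    rw [h5]
    linear_combination -h1

open Polynomial in
-- At the node `0` there is no function of one variable, so `lagrange_derivative` fixes `P'(0)`; the
-- value comes from the curvature term `∑ 1 / a²`.
theorem extra_eq_iff (hx : x ∈ Set.univ.pi I) {k : Fin κ} (hk : k ∈ (𝓜).extra) {P : ℝ[X]} {Λ : ℝ}
    (hP : P.natDegree ≤ κ) (hc : P.coeff κ = -Λ) (hy : ∀ k, P.eval ((𝓜).s k x)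
      = Function.extend (𝓜).e (fun ν => yFun (κ - ℓ) a blk (G ν) (x ν)) (fun _ => -2 * g₀) k) :
    -(1 / 2) * ∑ ν, (𝓜).r ν k x * (𝓜).yh a 𝓰₁ ((𝓜).e ν) x
        + (𝓜).H k x * ∑ ν, (𝓜).r ν k x + (𝓜).H k x * ∑ α, 1 / a (blk α) ^ 2 = Λ ↔
      P.derivative.eval 0 = -g₀ * ∑ α, 1 / a (blk α) ^ 2 := by
  have he : Function.Injective (𝓜).e := e_inj
  have hv := s_injective (hκ := hκ) (A := A) (blk := blk) (γ := γ) (J := J) (σ := σ) R hx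
  have h1 := lagrange_derivative hv (P := P) (c := -Λ) (by rwa [Fintype.card_fin])
    (by rwa [Fintype.card_fin]) k
  beta_reduce at h1
  have h2 := nodeProd_ne (hκ := hκ) (A := A) (blk := blk) (γ := γ) (J := J) (σ := σ) R hx k
  beta_reduce at h2
  have hk' : ¬∃ ν, (𝓜).e ν = k := fun ⟨ν, h⟩ => mem_extra.1 hk ν h
  have hcard : (𝓜).extra = {k} := by
    refine Finset.eq_singleton_iff_unique_mem.2 ⟨hk, fun l hl => ?_⟩
    have hcard : (𝓜).extra.card ≤ 1 := by
      rw [card_extra]; have := R.le_succ; omega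
    exact Finset.card_le_one.1 hcard l hl k hk
  have hP0 : P.eval ((𝓜).s k x) = -2 * g₀ := by
    rw [hy, Function.extend_apply' _ _ _ hk']
  have hH : (𝓜).H k x = g₀ / nodeProd (fun k => (𝓜).s k x) k := by
    rw [H_eq, Function.extend_apply' _ _ _ hk']
  have h3 : ∑ j ∈ Finset.univ.erase k, (P.eval ((𝓜).s k x) / nodeProd (fun k => (𝓜).s k x) k
        + P.eval ((𝓜).s j x) / nodeProd (fun k => (𝓜).s k x) j) / ((𝓜).s k x - (𝓜).s j x)
      = -(1 / 2) * ∑ ν, (𝓜).r ν k x * (𝓜).yh a 𝓰₁ ((𝓜).e ν) x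
        + (𝓜).H k x * ∑ ν, (𝓜).r ν k x := by
    have h4 := sum_e (M := 𝓜) he fun j => if j = k then 0 else
      (P.eval ((𝓜).s k x) / nodeProd (fun k => (𝓜).s k x) k
        + P.eval ((𝓜).s j x) / nodeProd (fun k => (𝓜).s k x) j) / ((𝓜).s k x - (𝓜).s j x)
    rw [hcard, Finset.sum_singleton, if_pos rfl, add_zero, ← Finset.add_sum_erase _ _
      (Finset.mem_univ k), if_pos rfl, zero_add] at h4
    rw [Finset.sum_congr rfl fun j hj => (if_neg (Finset.ne_of_mem_erase hj)).symm, h4,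
      Finset.mul_sum, Finset.mul_sum, ← Finset.sum_add_distrib]
    refine Finset.sum_congr rfl fun ν _ => ?_
    rw [if_neg fun h => hk' ⟨ν, h⟩, hP0, hy, yh_e_eq, he.extend_apply, r,
      if_neg fun h => hk' ⟨ν, h.symm⟩, s_extra hk, s_e he, hH, zero_sub, sub_zero]
    have := R.x_ne ν _ (hx ν trivial)
    field_simp
    ring
  rw [h3] at h1
  rw [s_extra hk] at h1
  rw [hH] at h1 ⊢
  generalize -(1 / 2) * ∑ ν, (𝓜).r ν k x * (𝓜).yh a 𝓰₁ ((𝓜).e ν) x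
        + g₀ / nodeProd (fun k => (𝓜).s k x) k * ∑ ν, (𝓜).r ν k x = S at *
  generalize nodeProd (fun k => (𝓜).s k x) k = n at *
  generalize ∑ α, 1 / a (blk α) ^ 2 = Q at *
  constructor
  · intro h
    have h4 : (P.derivative.eval 0 / n + g₀ / n * Q) * n = 0 := by
      rw [show P.derivative.eval 0 / n + g₀ / n * Q = 0 by linear_combination h1 + h, zero_mul]
    have h5 : (P.derivative.eval 0 / n + g₀ / n * Q) * n = P.derivative.eval 0 + g₀ * Q := by
      field_simp
    linear_combination h4 - h5
  · intro h
    rw [h] at h1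
    linear_combination -h1

end kerrNUT

end FibData

end GenKerrNUT

namespace GenKerrNUT

/-- A homogeneous linear differential equation whose coefficient is the logarithmic derivative of
`∏ (u ^ 2 - v k)` determines a function vanishing at one point. -/
theorem eq_zero_of_deriv_eq {κ : Type} [DecidableEq κ] {I : Set ℝ} (hI : IsOpen I)
    (hI' : I.OrdConnected) {E : ℝ → ℝ} (hE : DifferentiableOn ℝ E I) (s : Finset κ) (v : κ → ℝ)
    (hv : ∀ u ∈ I, ∀ k ∈ s, u ^ 2 - v k ≠ 0)
    (h : ∀ u ∈ I, deriv E u = E u * ∑ k ∈ s, 2 * u / (u ^ 2 - v k)) {p : ℝ} (hp : p ∈ I)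
    (h0 : E p = 0) : ∀ u ∈ I, E u = 0 := by
  -- The product solves the same equation, so the quotient has zero derivative and is constant on
  -- the interval.
  have hd : ∀ u ∈ I, HasDerivAt (fun u => E u / ∏ k ∈ s, (u ^ 2 - v k)) 0 u := by
    intro u hu
    have hE' := ((hE u hu).differentiableAt (hI.mem_nhds hu)).hasDerivAt
    have hP : HasDerivAt (fun u : ℝ => ∏ k ∈ s, (u ^ 2 - v k))
        (∑ k ∈ s, (∏ j ∈ s.erase k, (u ^ 2 - v j)) • (2 * u)) u :=
      HasDerivAt.fun_finsetProd fun k _ => by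
        simpa using ((hasDerivAt_id' u).fun_pow 2).sub_const (v k)
    have hne : ∏ k ∈ s, (u ^ 2 - v k) ≠ 0 := Finset.prod_ne_zero_iff.2 (hv u hu)
    refine (hE'.fun_div hP hne).congr_deriv ?_
    have h1 : ∑ k ∈ s, (∏ j ∈ s.erase k, (u ^ 2 - v j)) • (2 * u)
        = (∏ k ∈ s, (u ^ 2 - v k)) * ∑ k ∈ s, 2 * u / (u ^ 2 - v k) := by
      rw [Finset.mul_sum]
      refine Finset.sum_congr rfl fun k hk => ?_
      rw [← Finset.mul_prod_erase s _ hk, smul_eq_mul]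
      have := hv u hu k hk
      field_simp
    rw [h1, h u hu, div_eq_zero_iff]
    left; ring
  intro u hu
  have hc := hI.is_const_of_deriv_eq_zero hI'.isPreconnected
    (f := fun u => E u / ∏ k ∈ s, (u ^ 2 - v k))
    (fun u hu => (hd u hu).differentiableAt.differentiableWithinAt)
    (fun u hu => (hd u hu).deriv) hu hp
  simp only [h0, zero_div] at hc
  exact (div_eq_zero_iff.1 hc).resolve_right (Finset.prod_ne_zero_iff.2 (hv u hu))

namespace FibData

/-! ### Existence of the polynomial and the constants of the base factors -/

namespace kerrNUT

variable {ℓ κ : ℕ} {Υ Bl : Type} [Fintype Υ] [DecidableEq Υ]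
  {hκ : ℓ ≤ κ} {G : Fin ℓ → ℝ → ℝ} {g₀ : ℝ} {a : Bl → ℝ} {A : Fin κ → (Υ → ℝ) → Υ → ℝ}
  {blk : Υ → Bl} {γ J : (Υ → ℝ) → Matrix Υ Υ ℝ} {σ : Bl → ℝ} {I : Fin ℓ → Set ℝ}

local notation "𝓜" => kerrNUT hκ G g₀ a A blk γ J σ
local notation "𝓰₁" => overNode (kerrNUT hκ G g₀ a A blk γ J σ) fun ν => deriv (G ν)
local notation "𝓰₂" => overNode (kerrNUT hκ G g₀ a A blk γ J σ) fun ν => deriv (deriv (G ν))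

/-- The polynomial which determines the functions of one variable. -/
structure IsPoly (I : Fin ℓ → Set ℝ) (κ : ℕ) (G : Fin ℓ → ℝ → ℝ) (g₀ : ℝ) (a : Bl → ℝ)
    (blk : Υ → Bl) (Λ : ℝ) (P : Polynomial ℝ) : Prop where
  natDegree_le : P.natDegree ≤ κ
  coeff_eq : P.coeff κ = -Λ
  yFun_eq : ∀ ν, ∀ u ∈ I ν, yFun (κ - ℓ) a blk (G ν) u = P.eval (u ^ 2)
  eval_zero : ℓ < κ → P.eval 0 = -2 * g₀
  derivative_eval_zero : ℓ < κ → P.derivative.eval 0 = -g₀ * ∑ α, 1 / a (blk α) ^ 2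

variable (R : IsRange I κ G g₀ a) {Λ : ℝ}

theorem IsPoly.eval_s {P : Polynomial ℝ} (h : IsPoly I κ G g₀ a blk Λ P) {x : Fin ℓ → ℝ}
    (hx : x ∈ Set.univ.pi I) (k : Fin κ) : P.eval ((𝓜).s k x)
      = Function.extend (𝓜).e (fun ν => yFun (κ - ℓ) a blk (G ν) (x ν)) (fun _ => -2 * g₀) k := by
  have he : Function.Injective (𝓜).e := e_inj
  rcases exists_or_mem_extra (M := 𝓜) k with ⟨ν, rfl⟩ | hk
  · rw [he.extend_apply, s_e he, h.yFun_eq ν _ (hx ν trivial)]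
  · have hlt : ℓ < κ := by
      have := Finset.card_pos.2 ⟨k, hk⟩
      rw [card_extra] at this
      omega
    rw [Function.extend_apply' _ _ _ fun ⟨ν, h⟩ => mem_extra.1 hk ν h, s_extra hk, h.eval_zero hlt]

include R

theorem IsPoly.einstein {P : Polynomial ℝ} (h : IsPoly I κ G g₀ a blk Λ P) {x : Fin ℓ → ℝ}
    (hx : x ∈ Set.univ.pi I) : (∀ ν, (𝓜).ricX a 𝓰₁ 𝓰₂ ν x = Λ) ∧
      ∀ k ∈ (𝓜).extra, -(1 / 2) * ∑ ν, (𝓜).r ν k x * (𝓜).yh a 𝓰₁ ((𝓜).e ν) x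
        + (𝓜).H k x * ∑ ν, (𝓜).r ν k x + (𝓜).H k x * ∑ α, 1 / a (blk α) ^ 2 = Λ := by
  refine ⟨fun ν => ?_, fun k hk => ?_⟩
  -- As `yFun` and `P(u²)` agree on an open interval, so do their derivatives, and both sides of
  -- `ricX_eq_iff` are zero.
  · have hu := hx ν trivial
    have hu0 := R.x_ne ν _ hu
    rw [ricX_eq_iff R hx ν h.natDegree_le h.coeff_eq fun k _ => h.eval_s hx k, h.yFun_eq ν _ hu,
      sub_self, zero_mul]
    have h1 : HasDerivAt (fun u : ℝ => P.eval (u ^ 2)) (P.derivative.eval (x ν ^ 2) * (2 * x ν))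
        (x ν) := by
      have h2 := (hasDerivAt_id' (x ν)).fun_pow 2
      have h3 := (P.hasDerivAt (x ν ^ 2)).comp (x ν) h2
      refine h3.congr_deriv ?_
      simp
    have h2 : yFun (κ - ℓ) a blk (G ν) =ᶠ[nhds (x ν)] fun u : ℝ => P.eval (u ^ 2) :=
      Filter.eventuallyEq_of_mem ((R.isOpen ν).mem_nhds hu) fun u hu => h.yFun_eq ν u hu
    rw [h2.deriv_eq, h1.deriv]
    field_simp
    ring
  · have hlt : ℓ < κ := by
      have := Finset.card_pos.2 ⟨k, hk⟩
      rw [card_extra] at this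
      omega
    exact (extra_eq_iff R hx hk h.natDegree_le h.coeff_eq fun k => h.eval_s hx k).2
      (h.derivative_eval_zero hlt)

/-- The polynomial is chosen at the base point `p` alone. Moving one coordinate at a time, the
linear equation of `ricX_eq_iff` with zero initial value propagates the agreement along each
interval. -/
theorem exists_isPoly (hI : ∀ ν, (I ν).OrdConnected) {p : Fin ℓ → ℝ} (hp : ∀ ν, p ν ∈ I ν)
    (h1 : ∀ x ∈ Set.univ.pi I, ∀ ν, (𝓜).ricX a 𝓰₁ 𝓰₂ ν x = Λ)
    (h2 : ∀ x ∈ Set.univ.pi I, ∀ k ∈ (𝓜).extra,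
      -(1 / 2) * ∑ ν, (𝓜).r ν k x * (𝓜).yh a 𝓰₁ ((𝓜).e ν) x
        + (𝓜).H k x * ∑ ν, (𝓜).r ν k x + (𝓜).H k x * ∑ α, 1 / a (blk α) ^ 2 = Λ) :
    ∃ P, IsPoly I κ G g₀ a blk Λ P := by
  have he : Function.Injective (𝓜).e := e_inj
  have hpI : p ∈ Set.univ.pi I := fun ν _ => hp ν
  obtain ⟨P, hP, hc, hy⟩ := exists_interpolation (s_injective (hκ := hκ) (A := A) (blk := blk)
    (γ := γ) (J := J) (σ := σ) R hpI) (Function.extend (𝓜).e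
      (fun ν => yFun (κ - ℓ) a blk (G ν) (p ν)) (fun _ => -2 * g₀)) (-Λ)
  rw [Fintype.card_fin] at hP hc
  have hex : ℓ < κ → ∃ k, k ∈ (𝓜).extra := fun hlt => Finset.card_pos.1 (by
    rw [card_extra]; omega)
  refine ⟨P, hP, hc, fun ν u hu => ?_, fun hlt => ?_, fun hlt => ?_⟩
  · have hs : ∀ w, ∀ k, k ≠ (𝓜).e ν → (𝓜).s k (Function.update p ν w) = (𝓜).s k p := by
      intro w k hk
      rcases exists_or_mem_extra (M := 𝓜) k with ⟨μ, rfl⟩ | hk'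
      · rw [s_e he, s_e he, Function.update_of_ne fun h => hk (by rw [h])]
      · rw [s_extra hk', s_extra hk']
    have hm : ∀ w ∈ I ν, Function.update p ν w ∈ Set.univ.pi I := by
      intro w hw μ _
      by_cases hμ : μ = ν
      · subst hμ; simpa using hw
      · rw [Function.update_of_ne hμ]; exact hp μ
    have hd : ∀ w : ℝ, HasDerivAt (fun u : ℝ => P.eval (u ^ 2))
        (P.derivative.eval (w ^ 2) * (2 * w)) w := fun w => by
      have h3 := (P.hasDerivAt (w ^ 2)).comp w ((hasDerivAt_id' w).fun_pow 2)
      refine h3.congr_deriv ?_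
      simp
    have hyd := fun w hw => (hasDerivAt_yFun (blk := blk) R ν (κ - ℓ) (u := w) hw).differentiableAt
    have hne : ∀ w ∈ I ν, ∀ k ∈ Finset.univ.erase ((𝓜).e ν), w ^ 2 - (𝓜).s k p ≠ 0 := by
      intro w hw k hk
      have h3 := s_injective (hκ := hκ) (A := A) (blk := blk) (γ := γ) (J := J) (σ := σ) R (hm w hw)
      have h4 := h3.ne (Finset.ne_of_mem_erase hk).symm
      beta_reduce at h4
      rw [s_e he, hs w k (Finset.ne_of_mem_erase hk), Function.update_self] at h4
      exact sub_ne_zero.2 h4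
    have key := eq_zero_of_deriv_eq (R.isOpen ν) (hI ν)
      (E := fun u => yFun (κ - ℓ) a blk (G ν) u - P.eval (u ^ 2))
      (fun w hw => ((hyd w hw).fun_sub (hd w).differentiableAt).differentiableWithinAt)
      (Finset.univ.erase ((𝓜).e ν)) (fun k => (𝓜).s k p) hne ?_ (hp ν) ?_ u hu
    · exact sub_eq_zero.1 key
    · intro w hw
      have hw0 := R.x_ne ν w hw
      have h3 := (ricX_eq_iff R (hm w hw) ν hP hc fun k hk => by
        rw [hs w k hk, hy]
        rcases exists_or_mem_extra (M := 𝓜) k with ⟨μ, rfl⟩ | hk'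
        · rw [he.extend_apply, he.extend_apply, Function.update_of_ne fun h => hk (by rw [h])]
        · have hk'' : ¬∃ ν, (𝓜).e ν = k := fun ⟨ν, h⟩ => mem_extra.1 hk' ν h
          rw [Function.extend_apply' _ _ _ hk'', Function.extend_apply' _ _ _ hk'']).1
        (h1 _ (hm w hw) ν)
      rw [Function.update_self, Finset.sum_congr rfl fun k hk => by
        rw [hs w k (Finset.ne_of_mem_erase hk)]] at h3
      rw [((hyd w hw).hasDerivAt.fun_sub (hd w)).deriv]
      -- `ricX_eq_iff` speaks of derivatives with respect to `w²`; multiplication by `2 w` converts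
      -- it to an equation in `w`.
      have h4 : ∑ k ∈ Finset.univ.erase ((𝓜).e ν), 2 * w / (w ^ 2 - (𝓜).s k p)
          = 2 * w * ∑ k ∈ Finset.univ.erase ((𝓜).e ν), 1 / (w ^ 2 - (𝓜).s k p) := by
        rw [Finset.mul_sum]
        exact Finset.sum_congr rfl fun k _ => by ring
      have h5 : deriv (yFun (κ - ℓ) a blk (G ν)) w
          = deriv (yFun (κ - ℓ) a blk (G ν)) w / (2 * w) * (2 * w) := by field_simp
      rw [h4, h5]
      linear_combination 2 * w * h3
    · have := hy ((𝓜).e ν)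
      beta_reduce at this
      rw [s_e he, he.extend_apply] at this
      exact sub_eq_zero.2 this.symm
  · obtain ⟨k, hk⟩ := hex hlt
    have := hy k
    beta_reduce at this
    rwa [s_extra hk, Function.extend_apply' _ _ _ fun ⟨ν, h⟩ => mem_extra.1 hk ν h] at this
  · obtain ⟨k, hk⟩ := hex hlt
    exact (extra_eq_iff R hpI hk hP hc hy).1 (h2 p hpI k hk)

/-- The Einstein constant which is required of a factor of the base. -/
theorem IsPoly.base_constant {P : Polynomial ℝ} (h : IsPoly I κ G g₀ a blk Λ P) {x : Fin ℓ → ℝ}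
    (hx : x ∈ Set.univ.pi I) {b : Bl} (hb : ℓ < κ → a b ≠ 0) :
    (𝓜).f b x * (Λ + ∑ k, (𝓜).yh a 𝓰₁ k x / ((𝓜).s k x - a b ^ 2))
      = (-1) ^ (ℓ + 1) * (P.eval (a b ^ 2) / (a b ^ 2) ^ (κ - ℓ)) := by
  have he : Function.Injective (𝓜).e := e_inj
  have hlt : ∀ k ∈ (𝓜).extra, ℓ < κ := fun k hk => by
    have := Finset.card_pos.2 ⟨k, hk⟩
    rw [card_extra] at this
    omega
  have hz : ∀ k, (𝓜).s k x ≠ a b ^ 2 := by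
    intro k
    rcases exists_or_mem_extra (M := 𝓜) k with ⟨ν, rfl⟩ | hk
    · rw [s_e he]; exact R.x_ne_a ν _ (hx ν trivial) b
    · rw [s_extra hk]; exact (pow_ne_zero 2 (hb (hlt k hk))).symm
  have h1 := lagrange_eval_of_ne (s_injective (hκ := hκ) (A := A) (blk := blk)
    (γ := γ) (J := J) (σ := σ) R hx) (P := P) (c := -Λ) (by rw [Fintype.card_fin]; exact h.natDegree_le)
    (by rw [Fintype.card_fin]; exact h.coeff_eq) hz
  have h2 : ∏ k, (a b ^ 2 - (𝓜).s k x) = (-1) ^ ℓ * (𝓜).f b x * (a b ^ 2) ^ (κ - ℓ) := by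
    have h3 : ∏ k, (a b ^ 2 - (𝓜).s k x)
        = (∏ ν, (a b ^ 2 - (𝓜).s ((𝓜).e ν) x)) * ∏ k ∈ (𝓜).extra, (a b ^ 2 - (𝓜).s k x) := by
      rw [extra, ← Finset.prod_sdiff (Finset.subset_univ (Finset.univ.image (𝓜).e)), mul_comm,
        Finset.prod_image he.injOn]
    have h4 : ∏ k ∈ (𝓜).extra, (a b ^ 2 - (𝓜).s k x) = (a b ^ 2) ^ (κ - ℓ) := by
      rw [Finset.prod_congr rfl fun k hk => by rw [s_extra hk, sub_zero], Finset.prod_const,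
        card_extra]
    have h5 : (𝓜).f b x = ∏ μ, (x μ ^ 2 - a b ^ 2) := rfl
    rw [h3, h4, h5]
    congr 1
    simp only [s_e he, ← neg_sub (_ ^ 2) (a b ^ 2)]
    rw [Finset.prod_neg, Finset.card_fin]
  -- Without an extra node the exponent is `0`, so the eigenvalue `0` of `B^{(0)}` is admissible.
  have h6 : (a b ^ 2) ^ (κ - ℓ) ≠ 0 := by
    by_cases h7 : ℓ < κ
    · exact pow_ne_zero _ (pow_ne_zero _ (hb h7))
    · rw [Nat.sub_eq_zero_of_le (by omega), pow_zero]; exact one_ne_zero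
  have h8 : ((-1 : ℝ) ^ ℓ) * (-1) ^ ℓ = 1 := by rw [← mul_pow]; norm_num
  rw [h1, h2]
  simp only [yh_eq, h.eval_s hx]
  rw [mul_assoc, mul_comm ((a b ^ 2) ^ (κ - ℓ)), ← mul_assoc, mul_div_assoc, div_self h6, mul_one]
  generalize (∑ k, Function.extend (𝓜).e (fun ν => yFun (κ - ℓ) a blk (G ν) (x ν))
    (fun _ => -2 * g₀) k / nodeProd (fun k => (𝓜).s k x) k / ((𝓜).s k x - a b ^ 2)) = S
  rw [pow_succ]
  linear_combination (𝓜).f b x * (-Λ - S) * h8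

end kerrNUT

end FibData

end GenKerrNUT

namespace GenKerrNUT

/-! ### The functions of one variable as explicit integrals -/

section IntegralForm

variable {N : ℕ} (m : Fin N → ℕ) (a : Fin N → ℝ) (m₀ : ℕ)

/-- The weight by which the functions `X_μ` become antiderivatives. -/
def weight (u : ℝ) : ℝ := u ^ ((m₀ : ℤ) - 1) * ∏ i, (u ^ 2 - a i ^ 2) ^ m i

variable {m a m₀} {u : ℝ}

theorem weight_ne_zero (hu : u ≠ 0) (ha : ∀ i, u ^ 2 ≠ a i ^ 2) : weight m a m₀ u ≠ 0 :=
  mul_ne_zero (zpow_ne_zero _ hu)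
    (Finset.prod_ne_zero_iff.2 fun i _ => pow_ne_zero _ (sub_ne_zero.2 (ha i)))

theorem hasDerivAt_weight (hu : u ≠ 0) (ha : ∀ i, u ^ 2 ≠ a i ^ 2) :
    HasDerivAt (weight m a m₀) (weight m a m₀ u
      * (((m₀ : ℝ) - 1) / u + ∑ i, 2 * m i * u / (u ^ 2 - a i ^ 2))) u := by
  have h1 : HasDerivAt (fun u : ℝ => ∏ i, (u ^ 2 - a i ^ 2) ^ m i)
      (∑ i, (∏ j ∈ Finset.univ.erase i, (u ^ 2 - a j ^ 2) ^ m j) •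
        (m i * (u ^ 2 - a i ^ 2) ^ (m i - 1) * (2 * u))) u :=
    HasDerivAt.fun_finsetProd fun i _ => by
      simpa using (((hasDerivAt_id' u).fun_pow 2).sub_const (a i ^ 2)).fun_pow (m i)
  have h2 : ∑ i, (∏ j ∈ Finset.univ.erase i, (u ^ 2 - a j ^ 2) ^ m j) •
        (m i * (u ^ 2 - a i ^ 2) ^ (m i - 1) * (2 * u))
      = (∏ i, (u ^ 2 - a i ^ 2) ^ m i) * ∑ i, 2 * m i * u / (u ^ 2 - a i ^ 2) := by
    rw [Finset.mul_sum]
    refine Finset.sum_congr rfl fun i _ => ?_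
    have h0 := sub_ne_zero.2 (ha i)
    rw [← Finset.mul_prod_erase Finset.univ _ (Finset.mem_univ i), smul_eq_mul]
    -- The exponent `m i - 1` is truncated at `m i = 0`, where the coefficient `m i` removes the
    -- term.
    rcases Nat.eq_zero_or_pos (m i) with hm | hm
    · simp [hm]
    · obtain ⟨k, hk⟩ : ∃ k, m i = k + 1 := ⟨m i - 1, by omega⟩
      rw [hk, Nat.add_sub_cancel, pow_succ]
      field_simp
      ring
  rw [h2] at h1
  have h3 := (hasDerivAt_zpow ((m₀ : ℤ) - 1) u (Or.inl hu)).fun_mul h1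
  refine h3.congr_deriv ?_
  rw [weight, zpow_sub_one₀ hu]
  push_cast
  field_simp

/-- The explicit form of a function of one variable is equivalent to a differential equation. -/
theorem exists_hasIntegralForm_iff {𝒳 X : ℝ → ℝ} {I : Set ℝ} (hI : IsOpen I) (hI' : I.OrdConnected)
    {p : ℝ} (hp : p ∈ I) (h0 : ∀ u ∈ I, u ≠ 0) (ha : ∀ u ∈ I, ∀ i, u ^ 2 ≠ a i ^ 2)
    (hX : DifferentiableOn ℝ X I) (h𝒳 : ContinuousOn 𝒳 I) :
    (∃ d, HasIntegralForm m a m₀ 𝒳 I p d X) ↔ ∀ u ∈ I, u * deriv X u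
      + (u * ((m₀ : ℝ) / u + ∑ i, 2 * m i * u / (u ^ 2 - a i ^ 2)) - 1) * X u = 𝒳 u := by
  set h : ℝ → ℝ := fun t => 𝒳 t * t ^ ((m₀ : ℤ) - 2) * ∏ i, (t ^ 2 - a i ^ 2) ^ m i with hh
  -- The exponents `m₀ - 2` and `m₀ - 1` differ by the factor `u` that multiplies the derivative in
  -- the differential equation.
  have hh' : ∀ u ∈ I, h u * u = 𝒳 u * weight m a m₀ u := by
    intro u hu
    have := h0 u hu
    rw [hh, weight, show (m₀ : ℤ) - 1 = (m₀ : ℤ) - 2 + 1 by ring, zpow_add_one₀ this]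
    ring
  have hW : ∀ u ∈ I, weight m a m₀ u ≠ 0 := fun u hu => weight_ne_zero (h0 u hu) (ha u hu)
  have hc : ContinuousOn h I := (h𝒳.mul (continuousOn_id.zpow₀ _ fun u hu => Or.inl (h0 u hu))).mul
    (continuousOn_finsetProd _ fun i _ => ((continuousOn_id.pow 2).sub continuousOn_const).pow _)
  have hsub : ∀ u ∈ I, Set.uIcc p u ⊆ I := fun u hu => hI'.uIcc_subset hp hu
  have hint : ∀ u ∈ I, IntervalIntegrable h MeasureTheory.volume p u := fun u hu =>
    (hc.mono (hsub u hu)).intervalIntegrable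
  have hXW : ∀ u ∈ I, HasDerivAt (fun u => X u * weight m a m₀ u) (deriv X u * weight m a m₀ u
      + X u * (weight m a m₀ u * (((m₀ : ℝ) - 1) / u + ∑ i, 2 * m i * u / (u ^ 2 - a i ^ 2)))) u :=
    fun u hu => ((hX u hu).differentiableAt (hI.mem_nhds hu)).hasDerivAt.fun_mul
      (hasDerivAt_weight (h0 u hu) (ha u hu))
  -- The weight is an integrating factor: the equation says that `X` times the weight has derivative
  -- `h`.
  have hode : ∀ u ∈ I, (u * deriv X u + (u * ((m₀ : ℝ) / u + ∑ i, 2 * m i * u / (u ^ 2 - a i ^ 2)) - 1)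
      * X u = 𝒳 u ↔ deriv X u * weight m a m₀ u
      + X u * (weight m a m₀ u * (((m₀ : ℝ) - 1) / u + ∑ i, 2 * m i * u / (u ^ 2 - a i ^ 2)))
      = h u) := by
    intro u hu
    have e0 := h0 u hu
    have e1 := hW u hu
    have e2 := hh' u hu
    generalize ∑ i, 2 * m i * u / (u ^ 2 - a i ^ 2) = S at *
    generalize weight m a m₀ u = W at *
    have e3 : u * ((m₀ : ℝ) / u + S) - 1 = u * (((m₀ : ℝ) - 1) / u + S) := by
      field_simp
      ring
    rw [e3]
    generalize ((m₀ : ℝ) - 1) / u + S = Q at *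
    constructor
    · intro h3
      refine mul_right_cancel₀ e0 ?_
      linear_combination W * h3 - e2
    · intro h3
      refine mul_right_cancel₀ e1 ?_
      linear_combination u * h3 + e2
  constructor
  · rintro ⟨d, hd⟩ u hu
    rw [hode u hu]
    have h1 : HasDerivAt (fun u => d + ∫ t in p..u, h t) (h u) u :=
      (intervalIntegral.integral_hasDerivAt_right (hint u hu)
        (hc.stronglyMeasurableAtFilter hI u hu) (hc.continuousAt (hI.mem_nhds hu))).const_add d
    have h2 : (fun u => X u * weight m a m₀ u) =ᶠ[nhds u] fun u => d + ∫ t in p..u, h t := by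
      refine Filter.eventuallyEq_of_mem (hI.mem_nhds hu) fun w hw => ?_
      have := hd w hw
      rw [this, ← weight, one_div, mul_comm, ← mul_assoc, mul_inv_cancel₀ (hW w hw), one_mul]
    exact (hXW u hu).unique (h1.congr_of_eventuallyEq h2)
  · intro hu
    -- The constant of integration is the value at the base point, where the integral vanishes.
    refine ⟨X p * weight m a m₀ p, fun w hw => ?_⟩
    have h1 := intervalIntegral.integral_eq_sub_of_hasDerivAt (f := fun u => X u * weight m a m₀ u)
      (f' := h) (fun u hu' => (hXW u (hsub w hw hu')).congr_deriv
        ((hode u (hsub w hw hu')).1 (hu u (hsub w hw hu')))) (hint w hw)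
    rw [← weight, h1, add_sub_cancel, one_div, mul_comm, mul_assoc, mul_inv_cancel₀ (hW w hw), mul_one]

end IntegralForm

end GenKerrNUT

namespace GenKerrNUT

namespace FibData

section MetricSum

variable {X K Υ Bl : Type} [Fintype X] [Fintype K] [Fintype Υ]
  [DecidableEq X] [DecidableEq K] [DecidableEq Υ] (M : FibData X K Υ Bl)

theorem metric_eq_sum (q : X ⊕ K ⊕ Υ → ℝ) : M.metric q
    = ∑ μ, (M.H (M.e μ) (xPart q))⁻¹ • Matrix.vecMulVec (M.coframe (.inl μ) q) (M.coframe (.inl μ) q)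
      + ∑ k, M.H k (xPart q) • Matrix.vecMulVec (M.coframe (.inr (.inl k)) q)
        (M.coframe (.inr (.inl k)) q)
      + ∑ u, ∑ v, (M.f (M.blk u) (xPart q) * M.γ (yPart q) u v) •
        Matrix.vecMulVec (M.coframe (.inr (.inr u)) q) (M.coframe (.inr (.inr v)) q) := by
  ext i j
  simp only [metric, Matrix.of_apply, Fintype.sum_sum_type, frameMetric, sepFun, hX, hY, zero_mul,
    Finset.sum_const_zero, add_zero, zero_add, one_mul, ite_mul, Finset.sum_ite_eq, Finset.mem_univ,
    if_true, Matrix.add_apply, Matrix.sum_apply, Matrix.smul_apply, Matrix.vecMulVec_apply,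
    smul_eq_mul, mul_assoc, add_assoc]

theorem base_sum_block {n : Bl → ℕ} [Fintype Bl] [DecidableEq Bl] (E : (Σ b, Fin (n b)) ≃ Υ)
    (hblk : M.blk = blockOf E) {g : ∀ b, (Fin (n b) → ℝ) → Matrix (Fin (n b)) (Fin (n b)) ℝ}
    (hγ : M.γ = blockTensor E g) (q : X ⊕ K ⊕ Υ → ℝ) :
    ∑ u, ∑ v, (M.f (M.blk u) (xPart q) * M.γ (yPart q) u v) •
        Matrix.vecMulVec (M.coframe (.inr (.inr u)) q) (M.coframe (.inr (.inr v)) q)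
      = ∑ b, M.f b (xPart q) • ∑ α, ∑ β, g b (blockProj E b (yPart q)) α β •
        Matrix.vecMulVec (Pi.single (.inr (.inr (E ⟨b, α⟩))) (1 : ℝ))
          (Pi.single (.inr (.inr (E ⟨b, β⟩))) 1) := by
  rw [sum_block (E := E)]
  refine Finset.sum_congr rfl fun b _ => ?_
  rw [Finset.smul_sum]
  refine Finset.sum_congr rfl fun α _ => ?_
  rw [sum_block (E := E), Finset.sum_eq_single b]
  · rw [Finset.smul_sum]
    refine Finset.sum_congr rfl fun β _ => ?_
    rw [hγ, hblk, blockTensor_self, blockOf_apply, smul_smul]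
    rfl
  · intro c _ hc
    refine Finset.sum_eq_zero fun β _ => ?_
    rw [hγ, blockTensor_of_ne (Ne.symm hc), mul_zero, zero_smul]
  · simp

end MetricSum

end FibData

/-! ### The total space as a fibration over the product of all factors -/

section Chart

variable {ℓ κ N : ℕ} {m : Fin N → ℕ} {m₀ : ℕ}

/-- A family indexed by the factors `B^{(0)}` (for `none`) and `B^{(i)}`. -/
def optFam {C : Option (Fin N) → Type} (c₀ : C none) (c : ∀ i, C (some i)) : ∀ b, C b
  | none => c₀
  | some i => c i

/-- The dimensions of the factors. -/
def factorDim (m : Fin N → ℕ) (m₀ : ℕ) : Option (Fin N) → ℕ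
  | none => m₀
  | some i => 2 * m i

/-- The indices of the coordinates on the factors. -/
def factorEquiv (m : Fin N → ℕ) (m₀ : ℕ) :
    (Σ b, Fin (factorDim m m₀ b)) ≃ (Σ i, Fin (2 * m i)) ⊕ Fin m₀ where
  toFun
    | ⟨none, α⟩ => Sum.inr α
    | ⟨some i, α⟩ => Sum.inl ⟨i, α⟩
  invFun
    | Sum.inr α => ⟨none, α⟩
    | Sum.inl ⟨i, α⟩ => ⟨some i, α⟩
  left_inv := by rintro ⟨_ | i, α⟩ <;> rfl
  right_inv := by rintro (⟨i, α⟩ | α) <;> rfl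

variable (a : Fin N → ℝ) (β : ∀ i, (Fin (2 * m i) → ℝ) → Fin (2 * m i) → ℝ)

/-- The potentials of the curvatures of the vertical fibration. -/
def connForm (ℓ κ : ℕ) (m₀ : ℕ) (j : Fin κ) :
    ((Σ i, Fin (2 * m i)) ⊕ Fin m₀ → ℝ) → (Σ i, Fin (2 * m i)) ⊕ Fin m₀ → ℝ :=
  blockForm (factorEquiv m m₀) (fun b => -2 *
    ((-1 : ℝ) ^ ((ℓ : ℤ) - (j : ℤ)) * optFam (C := fun _ => ℝ) 0 a b ^ (2 * (ℓ : ℤ) - 2 * (j : ℤ) - 1)))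
    (optFam (C := fun b => (Fin (factorDim m m₀ b) → ℝ) → Fin (factorDim m m₀ b) → ℝ)
      (fun _ => 0) β)

theorem theta_eq (j : Fin κ) (q : Idx ℓ κ N m m₀ → ℝ) : theta a β j q
    = Sum.elim (fun _ => 0) (Sum.elim (Pi.single j 1) (connForm a β ℓ κ m₀ j (yPart q))) := by
  funext i
  rcases i with μ | k | ⟨i, α⟩ | α
  · simp [theta, coordForm, pullY₁]
  · simp [theta, coordForm, pullY₁, Pi.single_apply]
  · have h : ∀ i', pullY₁ (m₀ := m₀) (ℓ := ℓ) (κ := κ) i' (β i' (yOf q i')) (iY i α)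
        = if i' = i then β i (yOf q i) α else 0 := by
      intro i'
      by_cases hi : i' = i
      · subst hi
        simp [pullY₁, coordForm, Pi.single_apply]
      · rw [if_neg hi]
        simp [pullY₁, coordForm, Ne.symm hi]
    have h2 : connForm a β ℓ κ m₀ j (yPart q) (Sum.inl ⟨i, α⟩)
      = -2 * ((-1 : ℝ) ^ ((ℓ : ℤ) - (j : ℤ)) * a i ^ (2 * (ℓ : ℤ) - 2 * (j : ℤ) - 1))
        * β i (yOf q i) α := rfl
    simp only [theta, Pi.sub_apply, Pi.smul_apply, Finset.sum_apply, smul_eq_mul, h, Sum.elim_inr, h2]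
    simp [coordForm]
    ring
  · have h2 : connForm a β ℓ κ m₀ j (yPart q) (Sum.inr α)
      = -2 * ((-1 : ℝ) ^ ((ℓ : ℤ) - (j : ℤ)) * 0 ^ (2 * (ℓ : ℤ) - 2 * (j : ℤ) - 1)) * 0 := rfl
    rw [Sum.elim_inr, Sum.elim_inr, h2, mul_zero]
    simp [theta, coordForm, pullY₁]

variable (g J : ∀ i, (Fin (2 * m i) → ℝ) → Matrix (Fin (2 * m i)) (Fin (2 * m i)) ℝ)
  (g₀ : (Fin m₀ → ℝ) → Matrix (Fin m₀) (Fin m₀) ℝ)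

/-- The Kähler metrics together with `g^{(0)}`. -/
abbrev factorTensor : ∀ b, (Fin (factorDim m m₀ b) → ℝ) →
    Matrix (Fin (factorDim m m₀ b)) (Fin (factorDim m m₀ b)) ℝ :=
  optFam (C := fun b => (Fin (factorDim m m₀ b) → ℝ) →
    Matrix (Fin (factorDim m m₀ b)) (Fin (factorDim m m₀ b)) ℝ) g₀ g

/-- The eigenvalues, with eigenvalue `0` for `B^{(0)}`. -/
abbrev factorEigenvalue : Option (Fin N) → ℝ := optFam (C := fun _ => ℝ) 0 a

/-- The generalized Kerr-NUT data of the total space. -/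
def totalData (hκ : ℓ ≤ κ) (G : Fin ℓ → ℝ → ℝ) (c : ℝ) :
    FibData (Fin ℓ) (Fin κ) ((Σ i, Fin (2 * m i)) ⊕ Fin m₀) (Option (Fin N)) :=
  FibData.kerrNUT hκ G c (factorEigenvalue a) (connForm a β ℓ κ m₀) (blockOf (factorEquiv m m₀))
    (blockTensor (factorEquiv m m₀) (factorTensor g g₀))
    (blockTensor (factorEquiv m m₀) (factorTensor J fun _ => 0))
    (optFam (C := fun _ => ℝ) 0 fun _ => 1)

variable {a β g J g₀} {hκ : ℓ ≤ κ} {G : Fin ℓ → ℝ → ℝ} {c : ℝ}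

theorem coframe_vertical_eq (k : Fin κ) (q : Idx ℓ κ N m m₀ → ℝ) :
    (totalData a β g J g₀ hκ G c).coframe (.inr (.inl k)) q
      = ∑ j, (totalData a β g J g₀ hκ G c).et k j (xOf q) • theta a β j q := by
  funext i
  simp only [theta_eq, Finset.sum_apply, Pi.smul_apply, smul_eq_mul]
  rcases i with μ | j | u
  · simp [FibData.coframe]
  · simp [FibData.coframe, Pi.single_apply]
    rfl
  · rfl

theorem metric_totalData (q : Idx ℓ κ N m m₀ → ℝ) : (totalData a β g J g₀ hκ G c).metric q
    = ∑ μ, ((totalData a β g J g₀ hκ G c).H (Fin.castLE hκ μ) (xOf q))⁻¹ • formSq (coordForm (iX μ))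
      + ∑ k, (totalData a β g J g₀ hκ G c).H k (xOf q) •
        formSq (∑ j, (totalData a β g J g₀ hκ G c).et k j (xOf q) • theta a β j q)
      + ∑ i, (∏ μ, (xOf q μ ^ 2 - a i ^ 2)) • pullY₂ i (g i (yOf q i))
      + Afun (xOf q) ℓ • pullZ₂ (g₀ (zOf q)) := by
  -- `A^{(ℓ)}` is the conformal factor belonging to the eigenvalue `0`, so the last term of the
  -- metric is one more base term.
  have h : Afun (xOf q) ℓ = ∏ μ, (xOf q μ ^ 2 - 0 ^ 2) := by
    have := Finset.powersetCard_self (Finset.univ : Finset (Fin ℓ))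
    rw [Finset.card_fin] at this
    simp [Afun, this]
  rw [FibData.metric_eq_sum, FibData.base_sum_block _ (factorEquiv m m₀) rfl rfl, Fintype.sum_option,
    h, add_assoc _ (∑ i, _) (_ • pullZ₂ _)]
  refine congrArg₂ (· + ·) (congrArg₂ (· + ·) rfl ?_) (add_comm _ _)
  simp only [coframe_vertical_eq]
  rfl

end Chart

/-! ### Node products and symmetric functions in the two cases -/

section Nodes

variable {ℓ : ℕ}

theorem general_facts {Υ Bl : Type} [Fintype Υ] [DecidableEq Υ] {G : Fin ℓ → ℝ → ℝ} {c : ℝ}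
    {a : Bl → ℝ} {A : Fin ℓ → (Υ → ℝ) → Υ → ℝ} {blk : Υ → Bl} {γ J : (Υ → ℝ) → Matrix Υ Υ ℝ}
    {σ : Bl → ℝ} (x : Fin ℓ → ℝ) (μ : Fin ℓ) :
    (FibData.kerrNUT le_rfl G c a A blk γ J σ).H μ x = G μ (x μ) / Ufun x μ ∧
    ∀ j : Fin ℓ, (FibData.kerrNUT le_rfl G c a A blk γ J σ).et μ j x = Amu x μ j := by
  set M := FibData.kerrNUT le_rfl G c a A blk γ J σ with hM
  have he : Function.Injective M.e := FibData.kerrNUT.e_inj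
  have hs : ∀ k, M.s k x = x k ^ 2 := fun k => FibData.s_e he k x
  constructor
  · have h := FibData.kerrNUT.H_eq (hκ := le_rfl) (G := G) (g₀ := c) (a := a) (A := A) (blk := blk)
      (γ := γ) (J := J) (σ := σ) μ x
    rw [← hM] at h
    have h2 : Function.extend M.e (fun ν => G ν (x ν)) (fun _ => c) μ = G μ (x μ) :=
      he.extend_apply _ _ μ
    rw [h, h2, nodeProd, Ufun]
    simp only [hs]
  · intro j
    rw [show M.et μ j x = ∑ t ∈ (Finset.univ.erase μ).powersetCard j, ∏ i ∈ t, M.s i x from rfl, Amu]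
    simp only [hs]

theorem univ_erase_castSucc (μ : Fin ℓ) : (Finset.univ : Finset (Fin (ℓ + 1))).erase μ.castSucc
    = insert (Fin.last ℓ) ((Finset.univ.erase μ).map Fin.castSuccEmb) := by
  ext k
  induction k using Fin.lastCases with
  | last => simp [Fin.ext_iff]; exact fun h => by have := μ.2; omega
  | cast k => simp [Fin.ext_iff]; intro h; have := k.2; omega

theorem univ_erase_last : (Finset.univ : Finset (Fin (ℓ + 1))).erase (Fin.last ℓ)
    = Finset.univ.map Fin.castSuccEmb := by
  ext k
  induction k using Fin.lastCases with
  | last => simp [Fin.ext_iff]; intro x; have := x.2; omega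
  | cast k => simp [Fin.ext_iff]; have := k.2; omega

/-- The extra node `0` multiplies the node product of `x_μ²` by `x_μ²`, has the node product `(-1)^ℓ
A^{(ℓ)}` itself, and does not contribute to symmetric functions. -/
theorem special_facts {Υ Bl : Type} [Fintype Υ] [DecidableEq Υ] {G : Fin ℓ → ℝ → ℝ} {c : ℝ}
    {a : Bl → ℝ} {A : Fin (ℓ + 1) → (Υ → ℝ) → Υ → ℝ} {blk : Υ → Bl} {γ J : (Υ → ℝ) → Matrix Υ Υ ℝ}
    {σ : Bl → ℝ} (x : Fin ℓ → ℝ) :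
    (∀ μ : Fin ℓ, (FibData.kerrNUT (Nat.le_add_right ℓ 1) G c a A blk γ J σ).H μ.castSucc x
      = G μ (x μ) / (x μ ^ 2 * Ufun x μ)) ∧
    (FibData.kerrNUT (Nat.le_add_right ℓ 1) G c a A blk γ J σ).H (Fin.last ℓ) x
      = c / ((-1) ^ ℓ * Afun x ℓ) ∧
    (∀ μ j : Fin ℓ, (FibData.kerrNUT (Nat.le_add_right ℓ 1) G c a A blk γ J σ).et μ.castSucc j.castSucc x
      = Amu x μ j) ∧
    (∀ μ : Fin ℓ, (FibData.kerrNUT (Nat.le_add_right ℓ 1) G c a A blk γ J σ).et μ.castSucc (Fin.last ℓ) x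
      = 0) ∧
    ∀ j : Fin (ℓ + 1), (FibData.kerrNUT (Nat.le_add_right ℓ 1) G c a A blk γ J σ).et (Fin.last ℓ) j x
      = Afun x j := by
  set M := FibData.kerrNUT (Nat.le_add_right ℓ 1) G c a A blk γ J σ with hM
  have he : Function.Injective M.e := FibData.kerrNUT.e_inj
  have hee : ∀ k : Fin ℓ, M.e k = k.castSucc := fun k => rfl
  have hs : ∀ k : Fin ℓ, M.s k.castSucc x = x k ^ 2 := fun k => FibData.s_e he k x
  have hex : Fin.last ℓ ∈ M.extra := FibData.mem_extra.2 fun ν => by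
    rw [hee]; exact (Fin.castSucc_lt_last ν).ne
  have hs0 : M.s (Fin.last ℓ) x = 0 := FibData.s_extra hex x
  have hH := fun k => FibData.kerrNUT.H_eq (hκ := Nat.le_succ ℓ) (G := G) (g₀ := c) (a := a) (A := A)
    (blk := blk) (γ := γ) (J := J) (σ := σ) k x
  simp only [← hM] at hH
  have hlast : ∀ s : Finset (Fin ℓ), Fin.last ℓ ∉ s.map Fin.castSuccEmb := fun s h => by
    obtain ⟨k, -, hk⟩ := Finset.mem_map.1 h
    exact (Fin.castSucc_lt_last k).ne hk
  have het : ∀ k j : Fin (ℓ + 1), M.et k j x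
    = ∑ t ∈ (Finset.univ.erase k).powersetCard j, ∏ i ∈ t, M.s i x := fun _ _ => rfl
  have hmap : ∀ (s : Finset (Fin ℓ)) (j : ℕ), ∑ t ∈ (s.map Fin.castSuccEmb).powersetCard j,
      ∏ i ∈ t, M.s i x = ∑ t ∈ s.powersetCard j, ∏ i ∈ t, x i ^ 2 := by
    intro s j
    rw [Finset.powersetCard_map, Finset.sum_map]
    refine Finset.sum_congr rfl fun t _ => ?_
    refine (Finset.prod_map t Fin.castSuccEmb fun i => M.s i x).trans ?_
    exact Finset.prod_congr rfl fun i _ => hs i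
  have hμ : ∀ (μ : Fin ℓ) (j : Fin (ℓ + 1)), M.et μ.castSucc j x = Amu x μ j := by
    intro μ j
    rw [het, univ_erase_castSucc, Amu, ← hmap]
    symm
    -- Subsets containing the last index contribute a product with the factor `0`.
    refine Finset.sum_subset (Finset.powersetCard_mono (Finset.subset_insert _ _)) fun t ht ht' => ?_
    rw [Finset.mem_powersetCard] at ht ht'
    have hl : Fin.last ℓ ∈ t := by
      by_contra h
      exact ht' ⟨(Finset.subset_insert_iff_of_notMem h).1 ht.1, ht.2⟩
    exact Finset.prod_eq_zero hl hs0
  refine ⟨fun μ => ?_, ?_, fun μ j => hμ μ j.castSucc, fun μ => ?_, fun j => ?_⟩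
  · have h2 : Function.extend M.e (fun ν => G ν (x ν)) (fun _ => c) μ.castSucc = G μ (x μ) :=
      he.extend_apply _ _ μ
    rw [hH, h2, nodeProd, univ_erase_castSucc, Finset.prod_insert (hlast _), Finset.prod_map, hs, hs0,
      sub_zero, Ufun]
    congr 2
    exact Finset.prod_congr rfl fun i _ => congrArg _ (hs i)
  · rw [hH, Function.extend_apply' _ _ _ fun ⟨ν, h⟩ => FibData.mem_extra.1 hex ν h, nodeProd,
      univ_erase_last, Finset.prod_map, hs0]
    congr 1
    have := Finset.powersetCard_self (Finset.univ : Finset (Fin ℓ))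
    rw [Finset.card_fin] at this
    rw [Afun, this, Finset.sum_singleton, Finset.prod_congr rfl fun i _ =>
      show (0 : ℝ) - M.s (Fin.castSuccEmb i) x = -(x i ^ 2) by rw [zero_sub]; exact congrArg _ (hs i),
      Finset.prod_neg, Finset.card_fin]
  -- No subset of order `ℓ` exists among the `ℓ - 1` remaining indices, so `θ_ℓ` is absent from the
  -- forms attached to the `x_μ`.
  · rw [hμ, Amu, Fin.val_last, Finset.powersetCard_eq_empty.2, Finset.sum_empty]
    rw [Finset.card_erase_of_mem (Finset.mem_univ μ), Finset.card_fin]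
    have := μ.pos
    omega
  · rw [het, univ_erase_last, hmap]
    rfl

end Nodes

/-! ### Identification of the given metrics with the fibration data -/

section Match

variable {ℓ N : ℕ} {m : Fin N → ℕ} {m₀ : ℕ} {a : Fin N → ℝ}
  {β : ∀ i, (Fin (2 * m i) → ℝ) → Fin (2 * m i) → ℝ}
  {g J : ∀ i, (Fin (2 * m i) → ℝ) → Matrix (Fin (2 * m i)) (Fin (2 * m i)) ℝ}
  {g₀ : (Fin m₀ → ℝ) → Matrix (Fin m₀) (Fin m₀) ℝ} {X : Fin ℓ → ℝ → ℝ}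

theorem generalMetric_eq (q : Idx ℓ ℓ N m m₀ → ℝ) :
    generalMetric X a g β g₀ q = (totalData a β g J g₀ le_rfl X 1).metric q := by
  rw [metric_totalData, generalMetric, mainPart]
  simp only [totalData]
  have h := fun μ => general_facts (G := X) (c := 1) (a := factorEigenvalue a)
    (A := connForm a β ℓ ℓ m₀) (blk := blockOf (factorEquiv m m₀))
    (γ := blockTensor (factorEquiv m m₀) (factorTensor g g₀))
    (J := blockTensor (factorEquiv m m₀) (factorTensor J fun _ => 0))
    (σ := optFam (C := fun _ => ℝ) 0 fun _ => 1) (xOf q) μ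
  congr 3
  · refine Finset.sum_congr rfl fun μ _ => ?_
    rw [show Fin.castLE (le_refl ℓ) μ = μ from rfl, (h μ).1, inv_div]
  · refine Finset.sum_congr rfl fun μ _ => ?_
    rw [(h μ).1]
    simp only [(h μ).2]
    rfl

/-- The numerators `X_μ u²` and `(-1)^ℓ c` undo the factors that the extra node brings into the node
products, so the vertical term of the extra node is the special form of `g^{(0)}`. -/
theorem specialMetric_eq {c : ℝ} {q : Idx ℓ (ℓ + 1) N m 0 → ℝ} (hq : ∀ μ, xOf q μ ≠ 0) :
    specialMetric X a g β c q = (totalData a β g J (fun _ => 0) (Nat.le_add_right ℓ 1)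
      (fun μ u => X μ u * u ^ 2) ((-1) ^ ℓ * c)).metric q := by
  rw [metric_totalData, specialMetric, mainPart]
  simp only [totalData]
  obtain ⟨h1, h2, h3, h4, h5⟩ := special_facts (G := fun μ u => X μ u * u ^ 2) (c := (-1) ^ ℓ * c)
    (a := factorEigenvalue a) (A := connForm a β ℓ (ℓ + 1) 0) (blk := blockOf (factorEquiv m 0))
    (γ := blockTensor (factorEquiv m 0) (factorTensor g fun _ => 0))
    (J := blockTensor (factorEquiv m 0) (factorTensor J fun _ => 0))
    (σ := optFam (C := fun _ => ℝ) 0 fun _ => 1) (xOf q)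
  have h0 : pullZ₂ (ℓ := ℓ) (κ := ℓ + 1) (m := m) (0 : Matrix (Fin 0) (Fin 0) ℝ) = 0 := by
    simp [pullZ₂]
  have hμ : ∀ μ : Fin ℓ, X μ (xOf q μ) * xOf q μ ^ 2 / (xOf q μ ^ 2 * Ufun (xOf q) μ)
      = X μ (xOf q μ) / Ufun (xOf q) μ := fun μ => by
    have := hq μ
    rw [mul_comm (X μ (xOf q μ)), mul_div_mul_left _ _ (pow_ne_zero 2 this)]
  have hc : (-1) ^ ℓ * c / ((-1) ^ ℓ * Afun (xOf q) ℓ) = Afun (xOf q) ℓ * (c / Afun (xOf q) ℓ ^ 2) := by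
    rw [mul_div_mul_left _ _ (pow_ne_zero _ (by norm_num))]
    have : Afun (xOf q) ℓ ≠ 0 := by
      have := Finset.powersetCard_self (Finset.univ : Finset (Fin ℓ))
      rw [Finset.card_fin] at this
      rw [Afun, this, Finset.sum_singleton]
      exact Finset.prod_ne_zero_iff.2 fun μ _ => pow_ne_zero 2 (hq μ)
    field_simp
  have hη : ∀ μ : Fin ℓ, ∑ j : Fin (ℓ + 1), (FibData.kerrNUT (Nat.le_add_right ℓ 1)
      (fun μ u => X μ u * u ^ 2) ((-1) ^ ℓ * c) (factorEigenvalue a) (connForm a β ℓ (ℓ + 1) 0)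
      (blockOf (factorEquiv m 0)) (blockTensor (factorEquiv m 0) (factorTensor g fun _ => 0))
      (blockTensor (factorEquiv m 0) (factorTensor J fun _ => 0))
      (optFam (C := fun _ => ℝ) 0 fun _ => 1)).et μ.castSucc j (xOf q) • theta a β j q
      = ∑ k : Fin ℓ, Amu (xOf q) μ k • theta a β k.castSucc q := fun μ => by
    rw [Fin.sum_univ_castSucc, h4, zero_smul, add_zero]
    simp only [h3]
  rw [h0, smul_zero, add_zero, smul_smul, add_right_comm _ _ (_ • _), add_assoc (∑ μ, _) (∑ μ, _)]
  refine congrArg₂ (· + ·) (congrArg₂ (· + ·) (Finset.sum_congr rfl fun μ _ => ?_) ?_) rfl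
  · exact congrArg (· • _) ((inv_div _ _).symm.trans (by rw [← hμ μ, ← h1 μ]; rfl))
  · refine Eq.symm ((Fin.sum_univ_castSucc _).trans ?_)
    refine congrArg₂ (· + ·) (Finset.sum_congr rfl fun μ _ => ?_) ?_
    · rw [h1, hμ, hη]
      rfl
    · rw [h2, hc]
      simp only [h5]

end Match

end GenKerrNUT

namespace GenKerrNUT

/-! ### The Einstein condition for the fibration data -/

section Congr

variable {ι : Type} [Fintype ι] [DecidableEq ι] {U : Set (ι → ℝ)}
  {g g' : (ι → ℝ) → Matrix ι ι ℝ}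

/-- Locality of curvature. It is needed because the special metric agrees with the fibration data
only where no `x_μ` vanishes. -/
theorem ricci_congr (hU : IsOpen U) (h : ∀ q ∈ U, g q = g' q) {p : ι → ℝ} (hp : p ∈ U) :
    ricci g p = ricci g' p := by
  have h1 : ∀ q ∈ U, ∀ k i j, christoffel g k i j q = christoffel g' k i j q := by
    intro q hq k i j
    have h2 : ∀ i j l, pd i (fun q => g q j l) q = pd i (fun q => g' q j l) q := fun i j l =>
      pd_congr hU (fun q hq => by rw [h q hq]) hq i
    simp only [christoffel, h2, h q hq]
  have h3 : ∀ l k i j, pd l (christoffel g k i j) p = pd l (christoffel g' k i j) p :=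
    fun l k i j => pd_congr hU (fun q hq => h1 q hq k i j) hp l
  ext i j
  simp only [ricci, Matrix.of_apply, h3, h1 p hp]

theorem isEinsteinOn_congr (hU : IsOpen U) (h : ∀ q ∈ U, g q = g' q) (Λ : ℝ) :
    IsEinsteinOn U g Λ ↔ IsEinsteinOn U g' Λ := by
  refine forall₂_congr fun p hp => ?_
  rw [ricci_congr hU h hp, h p hp]

end Congr

section BlockPoint

variable {Bl Υ : Type} [Fintype Bl] [DecidableEq Bl] [Fintype Υ] [DecidableEq Υ] {n : Bl → ℕ}
  (E : (Σ b, Fin (n b)) ≃ Υ)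

/-- The point of a product with given projections. -/
def blockPoint (z : ∀ b, Fin (n b) → ℝ) : Υ → ℝ := fun u => z (E.symm u).1 (E.symm u).2

variable {E}

theorem blockProj_blockPoint (z : ∀ b, Fin (n b) → ℝ) (b : Bl) :
    blockProj E b (blockPoint E z) = z b := by
  funext α
  rw [blockProj, blockPoint, Equiv.symm_apply_apply]

theorem sum_comp_blockOf (F : Bl → ℝ) : ∑ u, F (blockOf E u) = ∑ b, n b * F b := by
  rw [sum_block (E := E)]
  simp only [blockOf_apply, Finset.sum_const, Finset.card_univ, Fintype.card_fin, nsmul_eq_mul]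

end BlockPoint

namespace FibData

namespace kerrNUT

variable {ℓ κ : ℕ} {Υ Bl : Type} [Fintype Bl] [DecidableEq Bl] [Fintype Υ] [DecidableEq Υ]
  {n : Bl → ℕ} {E : (Σ b, Fin (n b)) ≃ Υ} {hκ : ℓ ≤ κ} {G : Fin ℓ → ℝ → ℝ} {g₀ : ℝ} {a : Bl → ℝ}
  {A : Fin κ → (Υ → ℝ) → Υ → ℝ} {g : ∀ b, (Fin (n b) → ℝ) → Matrix (Fin (n b)) (Fin (n b)) ℝ}
  {J : (Υ → ℝ) → Matrix Υ Υ ℝ} {σ : Bl → ℝ} {I : Fin ℓ → Set ℝ}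
  {B : ∀ b, Set (Fin (n b) → ℝ)} {Λ : ℝ}

local notation "𝓜" => kerrNUT hκ G g₀ a A (blockOf E) (blockTensor E g) J σ
local notation "𝓰₁" => overNode (kerrNUT hκ G g₀ a A (blockOf E) (blockTensor E g) J σ) fun ν => deriv (G ν)
local notation "𝓰₂" => overNode (kerrNUT hκ G g₀ a A (blockOf E) (blockTensor E g) J σ) fun ν => deriv (deriv (G ν))

/-- The equations for `x_μ` and for the extra node do not involve the base, so one base point yields
`P`. Given `P`, the coefficient in the base equation is a constant on each factor, and the equation
splits into Einstein conditions on the factors. -/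
theorem isEinsteinOn_iff (R : IsRange I κ G g₀ a)
    (Bs : IsBase ℓ a A (blockOf E) (blockTensor E g) J σ (blockDomain E B))
    (hB : ∀ b, IsOpen (B b)) (hBne : ∀ b, (B b).Nonempty) (hg : ∀ b, IsMetricOn (B b) (g b))
    (hI : ∀ ν, (I ν).OrdConnected) {p : Fin ℓ → ℝ} (hp : ∀ ν, p ν ∈ I ν) :
    IsEinsteinOn (cylinder (Fin κ) (Set.univ.pi I) (blockDomain E B)) (𝓜).metric Λ ↔
      ∃ P, IsPoly I κ G g₀ a (blockOf E) Λ P ∧ ∀ b, IsEinsteinOn (B b) (g b)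
        ((-1) ^ (ℓ + 1) * (P.eval (a b ^ 2) / (a b ^ 2) ^ (κ - ℓ))) := by
  have W : (𝓜).IsKerrNUT (Set.univ.pi I) a 𝓰₁ 𝓰₂ := isKerrNUT R Bs
  have V : (𝓜).IsValid (Set.univ.pi I) (blockDomain E B) := isValid R Bs
  have hpI : p ∈ Set.univ.pi I := fun ν _ => hp ν
  have hbase : ∀ {P}, IsPoly I κ G g₀ a (blockOf E) Λ P → ∀ x ∈ Set.univ.pi I, ∀ u,
      (𝓜).f (blockOf E u) x * (Λ + ∑ k, (𝓜).yh a 𝓰₁ k x / ((𝓜).s k x - a (blockOf E u) ^ 2))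
        = (-1) ^ (ℓ + 1) * (P.eval (a (blockOf E u) ^ 2) / (a (blockOf E u) ^ 2) ^ (κ - ℓ)) :=
    fun h x hx u => h.base_constant R hx fun hlt => Bs.a_ne hlt u
  constructor
  · intro h
    choose z₀ hz₀ using hBne
    have hy₀ : blockPoint E z₀ ∈ blockDomain E B := fun b => by
      rw [blockProj_blockPoint]; exact hz₀ b
    have key : ∀ x ∈ Set.univ.pi I, ∀ y ∈ blockDomain E B, _ := fun x hx y hy =>
      (W.ricci_eq_smul_iff V (p := Sum.elim x (Sum.elim (fun _ => 0) y)) ⟨hx, hy⟩ Λ).1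
        (h _ ⟨hx, hy⟩)
    obtain ⟨P, hP⟩ := exists_isPoly R hI hp (fun x hx => (key x hx _ hy₀).1)
      fun x hx => (key x hx _ hy₀).2.1
    refine ⟨P, hP, fun b z hz => ?_⟩
    -- Only the factor `b` varies, the others are held at the chosen points.
    have hy : blockPoint E (Function.update z₀ b z) ∈ blockDomain E B := fun c => by
      rw [blockProj_blockPoint]
      by_cases hc : c = b
      · subst hc; rwa [Function.update_self]
      · rw [Function.update_of_ne hc]; exact hz₀ c
    have hz' : blockProj E b (blockPoint E (Function.update z₀ b z)) = z := by
      rw [blockProj_blockPoint, Function.update_self]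
    ext α β
    have h1 : ricci (blockTensor E g) (blockPoint E (Function.update z₀ b z)) (E ⟨b, α⟩) (E ⟨b, β⟩)
        = (𝓜).f (blockOf E (E ⟨b, β⟩)) p * (Λ + ∑ k, (𝓜).yh a 𝓰₁ k p
          / ((𝓜).s k p - a (blockOf E (E ⟨b, β⟩)) ^ 2))
          * blockTensor E g (blockPoint E (Function.update z₀ b z)) (E ⟨b, α⟩) (E ⟨b, β⟩) :=
      (key p hpI _ hy).2.2 (E ⟨b, α⟩) (E ⟨b, β⟩)
    rw [hbase hP p hpI, ricci_block_self hB hg hy, blockTensor_self, blockOf_apply, hz'] at h1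
    exact h1
  · rintro ⟨P, hP, hE⟩ q hq
    refine (W.ricci_eq_smul_iff V hq Λ).2 ⟨(hP.einstein R hq.1).1, (hP.einstein R hq.1).2,
      fun u v => ?_⟩
    change ricci (blockTensor E g) (yPart q) u v = (𝓜).f (blockOf E v) (xPart q)
      * (Λ + ∑ k, (𝓜).yh a 𝓰₁ k (xPart q) / ((𝓜).s k (xPart q) - a (blockOf E v) ^ 2))
      * blockTensor E g (yPart q) u v
    rw [hbase hP _ hq.1]
    obtain ⟨b, α, rfl⟩ := exists_block (E := E) u
    obtain ⟨c, δ, rfl⟩ := exists_block (E := E) v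
    by_cases hbc : b = c
    · subst hbc
      rw [ricci_block_self hB hg hq.2, blockTensor_self, blockOf_apply, hE b _ (hq.2 b)]
      rfl
    · rw [ricci_block_of_ne hB hg hq.2 hbc, blockTensor_of_ne hbc, mul_zero]

end kerrNUT

end FibData

section Total

variable {ℓ κ N : ℕ} {m : Fin N → ℕ} {m₀ : ℕ} {a : Fin N → ℝ} {I : Fin ℓ → Set ℝ} {p : Fin ℓ → ℝ}
  {X G : Fin ℓ → ℝ → ℝ} {B : ∀ i, Set (Fin (2 * m i) → ℝ)} {B₀ : Set (Fin m₀ → ℝ)}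
  {g J : ∀ i, (Fin (2 * m i) → ℝ) → Matrix (Fin (2 * m i)) (Fin (2 * m i)) ℝ}
  {β : ∀ i, (Fin (2 * m i) → ℝ) → Fin (2 * m i) → ℝ}
  {g₀ : (Fin m₀ → ℝ) → Matrix (Fin m₀) (Fin m₀) ℝ} {Λ c : ℝ} {hκ : ℓ ≤ κ}

theorem region_eq : region κ I B B₀ = cylinder (Fin κ) (Set.univ.pi I)
    (blockDomain (factorEquiv m m₀) (optFam (C := fun b => Set (Fin (factorDim m m₀ b) → ℝ)) B₀ B)) := by
  ext q
  constructor
  · rintro ⟨h1, h2, h3⟩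
    exact ⟨fun μ _ => h1 μ, Option.forall.2 ⟨h3, h2⟩⟩
  · rintro ⟨h1, h2⟩
    exact ⟨fun μ => h1 μ trivial, fun i => h2 (some i), h2 none⟩

theorem isOpen_region (hI : ∀ μ, IsOpen (I μ)) (hB : ∀ i, IsOpen (B i)) (hB₀ : IsOpen B₀) :
    IsOpen (region κ I B B₀) := by
  have h1 : ∀ μ, IsOpen {q : Idx ℓ κ N m m₀ → ℝ | xOf q μ ∈ I μ} := fun μ =>
    (hI μ).preimage (continuous_apply _)
  have h2 : ∀ i, IsOpen {q : Idx ℓ κ N m m₀ → ℝ | yOf q i ∈ B i} := fun i =>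
    (hB i).preimage (continuous_pi fun α => continuous_apply _)
  have h3 : IsOpen {q : Idx ℓ κ N m m₀ → ℝ | zOf q ∈ B₀} :=
    hB₀.preimage (continuous_pi fun α => continuous_apply _)
  have : region κ I B B₀ = (⋂ μ, {q : Idx ℓ κ N m m₀ → ℝ | xOf q μ ∈ I μ})
      ∩ ((⋂ i, {q : Idx ℓ κ N m m₀ → ℝ | yOf q i ∈ B i}) ∩ {q | zOf q ∈ B₀}) := by
    ext q; simp [region]
  rw [this]
  exact (isOpen_iInter_of_finite h1).inter ((isOpen_iInter_of_finite h2).inter h3)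

/-- The constant for `B₀` is `(-1)^{ℓ+1} P(0)` when `κ = ℓ`. With an extra node it contains a
division by zero, but then `B₀` has dimension zero and the condition is empty. -/
theorem isEinsteinOn_totalData_iff (R : FibData.IsRange I κ G c (factorEigenvalue a))
    (ha : ∀ i, a i ≠ 0) (hm₀ : ℓ < κ → m₀ = 0)
    (hB : ∀ i, IsOpen (B i)) (hBne : ∀ i, (B i).Nonempty) (hK : ∀ i, IsKahlerOn (B i) (g i) (J i))
    (hβ : ∀ i, IsPotentialOn (B i) (β i) (kahlerForm (g i) (J i)))
    (hB₀ : IsOpen B₀) (hB₀ne : B₀.Nonempty) (hg₀ : IsMetricOn B₀ g₀)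
    (hI : ∀ ν, (I ν).OrdConnected) (hp : ∀ ν, p ν ∈ I ν) :
    IsEinsteinOn (region κ I B B₀) (totalData a β g J g₀ hκ G c).metric Λ ↔
      ∃ P, FibData.kerrNUT.IsPoly I κ G c (factorEigenvalue a) (blockOf (factorEquiv m m₀)) Λ P ∧
        (∀ i, IsKahlerEinsteinOn (B i) (g i) (J i)
          ((-1) ^ (ℓ + 1) * (P.eval (a i ^ 2) / (a i ^ 2) ^ (κ - ℓ)))) ∧
        IsEinsteinOn B₀ g₀ ((-1) ^ (ℓ + 1) * (P.eval (0 ^ 2) / (0 ^ 2) ^ (κ - ℓ))) := by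
  have hF : ∀ b, IsFactor (optFam (C := fun b => Set (Fin (factorDim m m₀ b) → ℝ)) B₀ B b)
      (factorTensor g g₀ b) (factorTensor J (fun _ => 0) b)
      (optFam (C := fun b => (Fin (factorDim m m₀ b) → ℝ) → Fin (factorDim m m₀ b) → ℝ)
        (fun _ => 0) β b) (optFam (C := fun _ => ℝ) 0 (fun _ => 1) b) := by
    rintro (_ | i)
    · exact IsMetricOn.isFactor hB₀ hg₀
    · exact (hK i).isFactor (hB i) (hβ i)
  have Bs := IsFactor.isBase (ℓ := ℓ) (κ := κ) (a := factorEigenvalue a)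
    (E := factorEquiv m m₀) hF (by rintro (_ | i) h; exacts [absurd rfl h, rfl])
    (by
      rintro hlt (⟨i, α⟩ | α)
      -- With an extra node every base coordinate must have a nonzero eigenvalue; the second
      -- alternative is void because `m₀ = 0`.
      · exact ha i
      · rw [hm₀ hlt] at α
        exact α.elim0)
  rw [region_eq]
  refine (FibData.kerrNUT.isEinsteinOn_iff R Bs (fun b => (hF b).isOpen)
    (Option.forall.2 ⟨hB₀ne, hBne⟩) (fun b => (hF b).metric) hI hp).trans
    (exists_congr fun P => and_congr_right fun _ => ?_)
  rw [Option.forall, and_comm]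
  exact and_congr_left fun _ => forall_congr' fun i => ⟨fun h => ⟨hK i, h⟩, fun h => h.2⟩

theorem sum_factor (F : Option (Fin N) → ℝ) : ∑ u, F (blockOf (factorEquiv m m₀) u)
    = m₀ * F none + ∑ i, 2 * m i * F (some i) := by
  rw [sum_comp_blockOf, Fintype.sum_option]
  simp [factorDim]

theorem pFun_factor (n : ℕ) {u : ℝ} (hu : u ≠ 0) :
    FibData.kerrNUT.pFun n (factorEigenvalue a) (blockOf (factorEquiv m m₀)) u
      = -(n / u) + (m₀ / u + ∑ i, 2 * m i * u / (u ^ 2 - a i ^ 2)) := by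
  rw [FibData.kerrNUT.pFun, sum_factor fun b => u / (u ^ 2 - factorEigenvalue a b ^ 2)]
  have h : (m₀ : ℝ) * (u / (u ^ 2 - 0 ^ 2)) = m₀ / u := by field_simp; simp
  have h0 : factorEigenvalue a none = 0 := rfl
  rw [h0, h]
  congr 2
  exact Finset.sum_congr rfl fun i _ => (mul_div_assoc _ _ _).symm

theorem neg_one_zpow_sub_one (ℓ : ℕ) : (-1 : ℝ) ^ ((ℓ : ℤ) - 1) = (-1) ^ (ℓ + 1) := by
  rw [zpow_sub_one₀ (by norm_num), zpow_natCast, pow_succ]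
  norm_num

end Total

/-! ### Polynomials in the squares and the functions `𝒳` -/

section Polynomials

open Polynomial

theorem exists_poly_coeff (n : ℕ) (α : ℕ → ℝ) : ∃ P : ℝ[X], P.natDegree ≤ n ∧
    ∀ i ≤ n, P.coeff i = α i := by
  refine ⟨∑ i ∈ Finset.range (n + 1), monomial i (α i), ?_, fun i hi => ?_⟩
  · refine natDegree_sum_le_of_forall_le _ _ fun i hi => (natDegree_monomial_le _).trans ?_
    exact Nat.lt_succ_iff.1 (Finset.mem_range.1 hi)
  · rw [finsetSum_coeff, Finset.sum_eq_single i]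
    · rw [coeff_monomial, if_pos rfl]
    · intro j _ hj
      rw [coeff_monomial, if_neg hj]
    · intro h
      exact absurd (Finset.mem_range.2 (Nat.lt_succ_iff.2 hi)) h

theorem eval_sq_eq_calX {n : ℕ} {P : ℝ[X]} (hP : P.natDegree ≤ n) (x : ℝ) :
    P.eval (x ^ 2) = calX n P.coeff x := by
  rw [eval_eq_sum_range' (Nat.lt_succ_of_le hP), calX]
  exact Finset.sum_congr rfl fun i _ => by rw [pow_mul]

/-- Splitting off the constant term and a factor `x²` shifts the coefficients by one: the constant
term of `P` becomes `α_{-1}`, the linear one `α_0`. -/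
theorem eval_sq_eq_calXSpecial {n : ℕ} {P : ℝ[X]} (hP : P.natDegree ≤ n + 1) {x : ℝ} (hx : x ≠ 0) :
    P.eval (x ^ 2) = x ^ 2 * calXSpecial n (P.coeff 0) (fun i => P.coeff (i + 1)) x := by
  rw [eval_sq_eq_calX hP, calX, Finset.sum_range_succ', calXSpecial, calX, mul_add,
    mul_div_cancel₀ _ (pow_ne_zero 2 hx), Finset.mul_sum, add_comm]
  simp only [mul_zero, pow_zero, mul_one]
  congr 1
  exact Finset.sum_congr rfl fun i _ => by ring

theorem calX_congr {n : ℕ} {α α' : ℕ → ℝ} (h : ∀ i ≤ n, α i = α' i) : calX n α = calX n α' := by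
  funext x
  exact Finset.sum_congr rfl fun i hi => by rw [h i (Nat.lt_succ_iff.1 (Finset.mem_range.1 hi))]

theorem continuous_calX (n : ℕ) (α : ℕ → ℝ) : Continuous (calX n α) :=
  continuous_finsetSum _ fun _ _ => continuous_const.mul (continuous_id.pow _)

end Polynomials

end GenKerrNUT

namespace GenKerrNUT

/-! ### The two equivalences -/

section Conclusion

variable {ℓ N : ℕ} {m : Fin N → ℕ} {a : Fin N → ℝ} {I : Fin ℓ → Set ℝ} {p : Fin ℓ → ℝ}
  {X : Fin ℓ → ℝ → ℝ} {B : ∀ i, Set (Fin (2 * m i) → ℝ)}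
  {g J : ∀ i, (Fin (2 * m i) → ℝ) → Matrix (Fin (2 * m i)) (Fin (2 * m i)) ℝ}
  {β : ∀ i, (Fin (2 * m i) → ℝ) → Fin (2 * m i) → ℝ} {Λ : ℝ}

theorem isRange_general (hIopen : ∀ μ, IsOpen (I μ)) (hx0 : ∀ μ, ∀ x ∈ I μ, x ≠ 0)
    (hxa : ∀ μ, ∀ x ∈ I μ, ∀ i, x ^ 2 ≠ a i ^ 2)
    (hxx : ∀ μ ν, μ ≠ ν → ∀ x ∈ I μ, ∀ y ∈ I ν, x ^ 2 ≠ y ^ 2)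
    (hXsmooth : ∀ μ, ContDiffOn ℝ ∞ (X μ) (I μ)) (hX0 : ∀ μ, ∀ x ∈ I μ, X μ x ≠ 0) :
    FibData.IsRange I ℓ X 1 (factorEigenvalue a) where
  isOpen := hIopen
  x_ne := hx0
  x_ne_x := hxx
  x_ne_a μ x hx := Option.forall.2
    ⟨fun h => hx0 μ x hx (pow_eq_zero_iff two_ne_zero |>.1 (h.trans (zero_pow two_ne_zero))),
      hxa μ x hx⟩
  G_smooth := hXsmooth
  G_ne := hX0
  g₀_ne := one_ne_zero
  le_succ := Nat.le_succ ℓ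

theorem isRange_special {c : ℝ} (hc : c ≠ 0) (hIopen : ∀ μ, IsOpen (I μ))
    (hx0 : ∀ μ, ∀ x ∈ I μ, x ≠ 0) (hxa : ∀ μ, ∀ x ∈ I μ, ∀ i, x ^ 2 ≠ a i ^ 2)
    (hxx : ∀ μ ν, μ ≠ ν → ∀ x ∈ I μ, ∀ y ∈ I ν, x ^ 2 ≠ y ^ 2)
    (hXsmooth : ∀ μ, ContDiffOn ℝ ∞ (X μ) (I μ)) (hX0 : ∀ μ, ∀ x ∈ I μ, X μ x ≠ 0) :
    FibData.IsRange I (ℓ + 1) (fun μ u => X μ u * u ^ 2) ((-1) ^ ℓ * c) (factorEigenvalue a) where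
  isOpen := hIopen
  x_ne := hx0
  x_ne_x := hxx
  x_ne_a μ x hx := Option.forall.2
    ⟨fun h => hx0 μ x hx (pow_eq_zero_iff two_ne_zero |>.1 (h.trans (zero_pow two_ne_zero))),
      hxa μ x hx⟩
  G_smooth μ := (hXsmooth μ).mul (contDiff_id.pow 2).contDiffOn
  G_ne μ x hx := mul_ne_zero (hX0 μ x hx) (pow_ne_zero 2 (hx0 μ x hx))
  g₀_ne := mul_ne_zero (pow_ne_zero _ (by norm_num)) hc
  le_succ := le_rfl

theorem yFun_general {m₀ : ℕ} {F : ℝ → ℝ} {u : ℝ} (hu : u ≠ 0) :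
    FibData.kerrNUT.yFun (ℓ - ℓ) (factorEigenvalue a) (blockOf (factorEquiv m m₀)) F u
      = u * deriv F u + (u * ((m₀ : ℝ) / u + ∑ i, 2 * m i * u / (u ^ 2 - a i ^ 2)) - 1) * F u := by
  rw [FibData.kerrNUT.yFun, pFun_factor _ hu, Nat.sub_self, Nat.cast_zero, zero_div, neg_zero,
    zero_add]

/-- Differentiating `F u²` adds `2 F` in the bracket, and the extra node changes `u p - 1` to `u S -
2`. The sum is the expression for `m₀ = 1`, times `u²`. -/
theorem yFun_special {F : ℝ → ℝ} {u : ℝ} (hu : u ≠ 0) (hF : DifferentiableAt ℝ F u) :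
    FibData.kerrNUT.yFun (ℓ + 1 - ℓ) (factorEigenvalue a) (blockOf (factorEquiv m 0))
      (fun u => F u * u ^ 2) u = u ^ 2 * (u * deriv F u
        + (u * (((1 : ℕ) : ℝ) / u + ∑ i, 2 * m i * u / (u ^ 2 - a i ^ 2)) - 1) * F u) := by
  rw [FibData.kerrNUT.yFun, pFun_factor _ hu, Nat.add_sub_cancel_left,
    (hF.hasDerivAt.fun_mul ((hasDerivAt_id' u).fun_pow 2)).deriv]
  generalize ∑ i, 2 * m i * u / (u ^ 2 - a i ^ 2) = S
  have h1 : u * (-(((1 : ℕ) : ℝ) / u) + (((0 : ℕ) : ℝ) / u + S)) = u * S - 1 := by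
    field_simp; push_cast; ring
  have h2 : u * (((1 : ℕ) : ℝ) / u + S) = u * S + 1 := by
    field_simp; push_cast; ring
  rw [h1, h2]
  push_cast
  ring

variable (ha : ∀ i, a i ≠ 0) (hIopen : ∀ μ, IsOpen (I μ)) (hIconn : ∀ μ, (I μ).OrdConnected)
  (hp : ∀ μ, p μ ∈ I μ) (hx0 : ∀ μ, ∀ x ∈ I μ, x ≠ 0)
  (hxa : ∀ μ, ∀ x ∈ I μ, ∀ i, x ^ 2 ≠ a i ^ 2)
  (hxx : ∀ μ ν, μ ≠ ν → ∀ x ∈ I μ, ∀ y ∈ I ν, x ^ 2 ≠ y ^ 2)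
  (hXsmooth : ∀ μ, ContDiffOn ℝ ∞ (X μ) (I μ)) (hX0 : ∀ μ, ∀ x ∈ I μ, X μ x ≠ 0)
  (hBopen : ∀ i, IsOpen (B i)) (hBne : ∀ i, (B i).Nonempty)
  (hK : ∀ i, IsKahlerOn (B i) (g i) (J i))
  (hβ : ∀ i, IsPotentialOn (B i) (β i) (kahlerForm (g i) (J i)))
include ha hIopen hIconn hp hx0 hxa hxx hXsmooth hX0 hBopen hBne hK hβ

theorem isEinsteinOn_generalMetric_iff {m₀ : ℕ} {B₀ : Set (Fin m₀ → ℝ)}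
    {g₀ : (Fin m₀ → ℝ) → Matrix (Fin m₀) (Fin m₀) ℝ} (hB₀ : IsOpen B₀) (hB₀ne : B₀.Nonempty)
    (hg₀ : IsMetricOn B₀ g₀) :
    IsEinsteinOn (region ℓ I B B₀) (generalMetric X a g β g₀) Λ ↔
      ∃ (α : ℕ → ℝ) (d : Fin ℓ → ℝ), α ℓ = -Λ ∧
        (∀ μ, HasIntegralForm m a m₀ (calX ℓ α) (I μ) (p μ) (d μ) (X μ)) ∧
        (∀ i, IsKahlerEinsteinOn (B i) (g i) (J i) ((-1 : ℝ) ^ ((ℓ : ℤ) - 1) * calX ℓ α (a i))) ∧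
        IsEinsteinOn B₀ g₀ ((-1 : ℝ) ^ ((ℓ : ℤ) - 1) * α 0) := by
  have hform : ∀ α : ℕ → ℝ, (∃ d : Fin ℓ → ℝ,
      ∀ μ, HasIntegralForm m a m₀ (calX ℓ α) (I μ) (p μ) (d μ) (X μ)) ↔
      ∀ μ, ∀ u ∈ I μ, FibData.kerrNUT.yFun (ℓ - ℓ) (factorEigenvalue a)
        (blockOf (factorEquiv m m₀)) (X μ) u = calX ℓ α u := by
    intro α
    rw [← Classical.skolem (p := fun μ d => HasIntegralForm m a m₀ (calX ℓ α) (I μ) (p μ) d (X μ))]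
    refine forall_congr' fun μ => ?_
    rw [exists_hasIntegralForm_iff (hIopen μ) (hIconn μ) (hp μ) (hx0 μ) (hxa μ)
      ((hXsmooth μ).differentiableOn (by norm_num)) (continuous_calX ℓ α).continuousOn]
    exact forall₂_congr fun u hu => by rw [yFun_general (hx0 μ u hu)]
  rw [show generalMetric X a g β g₀ = (totalData a β g J g₀ le_rfl X 1).metric from
    funext generalMetric_eq, isEinsteinOn_totalData_iff (isRange_general hIopen hx0 hxa hxx
      hXsmooth hX0) ha (fun h => absurd h (lt_irrefl _)) hBopen hBne hK hβ hB₀ hB₀ne hg₀ hIconn hp,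
    neg_one_zpow_sub_one]
  simp only [Nat.sub_self, pow_zero, div_one]
  constructor
  · rintro ⟨P, hP, h1, h2⟩
    have hα := eval_sq_eq_calX hP.natDegree_le
    obtain ⟨d, hd⟩ := (hform P.coeff).2 fun μ u hu => by rw [hP.yFun_eq μ u hu, hα]
    refine ⟨P.coeff, d, hP.coeff_eq, hd, fun i => ?_, ?_⟩
    · rw [← hα]; exact h1 i
    · rw [Polynomial.coeff_zero_eq_eval_zero]
      rwa [zero_pow two_ne_zero] at h2
  · rintro ⟨α, d, h1, h2, h3, h4⟩
    -- The sequence `α` may be arbitrary beyond `ℓ`; only its first `ℓ + 1` terms enter `P` and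
    -- `calX`.
    obtain ⟨P, hP, hc⟩ := exists_poly_coeff ℓ α
    have hα : ∀ u, P.eval (u ^ 2) = calX ℓ α u := fun u => by
      rw [eval_sq_eq_calX hP, calX_congr hc]
    refine ⟨P, ⟨hP, (hc ℓ le_rfl).trans h1, fun μ u hu => ?_, fun h => absurd h (lt_irrefl _),
      fun h => absurd h (lt_irrefl _)⟩, fun i => ?_, ?_⟩
    · rw [(hform α).1 ⟨d, h2⟩ μ u hu, hα]
    · rw [hα]; exact h3 i
    · rw [zero_pow two_ne_zero, ← Polynomial.coeff_zero_eq_eval_zero, hc 0 (Nat.zero_le _)]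
      exact h4

theorem isEinsteinOn_specialMetric_iff {c : ℝ} (hc : c ≠ 0) :
    IsEinsteinOn (region (ℓ + 1) I B Set.univ) (specialMetric X a g β c) Λ ↔
      ∃ (αm : ℝ) (α : ℕ → ℝ) (d : Fin ℓ → ℝ), α ℓ = -Λ ∧
        α 0 = (-1 : ℝ) ^ ((ℓ : ℤ) - 1) * 2 * c * ∑ j, (m j : ℝ) / a j ^ 2 ∧
        αm = (-1 : ℝ) ^ ((ℓ : ℤ) - 1) * 2 * c ∧
        (∀ μ, HasIntegralForm m a 1 (calXSpecial ℓ αm α) (I μ) (p μ) (d μ) (X μ)) ∧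
        (∀ i, IsKahlerEinsteinOn (B i) (g i) (J i)
          ((-1 : ℝ) ^ ((ℓ : ℤ) - 1) * calXSpecial ℓ αm α (a i))) := by
  have hform : ∀ (αm : ℝ) (α : ℕ → ℝ), (∃ d : Fin ℓ → ℝ,
      ∀ μ, HasIntegralForm m a 1 (calXSpecial ℓ αm α) (I μ) (p μ) (d μ) (X μ)) ↔
      ∀ μ, ∀ u ∈ I μ, FibData.kerrNUT.yFun (ℓ + 1 - ℓ) (factorEigenvalue a)
        (blockOf (factorEquiv m 0)) (fun u => X μ u * u ^ 2) u = u ^ 2 * calXSpecial ℓ αm α u := by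
    intro αm α
    rw [← Classical.skolem (p := fun μ d =>
      HasIntegralForm m a 1 (calXSpecial ℓ αm α) (I μ) (p μ) d (X μ))]
    refine forall_congr' fun μ => ?_
    have hXd := (hXsmooth μ).differentiableOn (by norm_num)
    have h𝒳 : ContinuousOn (calXSpecial ℓ αm α) (I μ) :=
      (continuousOn_const.div (continuousOn_id.pow 2) fun u hu => pow_ne_zero 2 (hx0 μ u hu)).add
        (continuous_calX ℓ α).continuousOn
    rw [exists_hasIntegralForm_iff (hIopen μ) (hIconn μ) (hp μ) (hx0 μ) (hxa μ) hXd h𝒳]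
    refine forall₂_congr fun u hu => ?_
    rw [yFun_special (hx0 μ u hu) ((hXd u hu).differentiableAt ((hIopen μ).mem_nhds hu))]
    exact (mul_right_inj' (pow_ne_zero 2 (hx0 μ u hu))).symm
  -- Each `B^{(i)}` has `2 m_i` coordinates, hence the factor `2` in the constraint on `α_0`.
  have hsum : ∑ u, 1 / factorEigenvalue a (blockOf (factorEquiv m 0) u) ^ 2
      = 2 * ∑ j, (m j : ℝ) / a j ^ 2 := by
    rw [sum_factor fun b => 1 / factorEigenvalue a b ^ 2, Nat.cast_zero, zero_mul, zero_add,
      Finset.mul_sum]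
    exact Finset.sum_congr rfl fun i _ => by
      show 2 * (m i : ℝ) * (1 / a i ^ 2) = _
      ring
  -- In dimension zero the zero tensor is a metric, since the empty determinant is `1`.
  have h0 : IsMetricOn (Set.univ : Set (Fin 0 → ℝ)) (fun _ => 0) :=
    ⟨fun i => i.elim0, fun _ _ i => i.elim0, fun _ _ => by simp⟩
  rw [isEinsteinOn_congr (isOpen_region hIopen hBopen isOpen_univ)
    (fun q hq => specialMetric_eq (J := J) fun μ => hx0 μ _ (hq.1 μ)),
    isEinsteinOn_totalData_iff (isRange_special hc hIopen hx0 hxa hxx hXsmooth hX0) ha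
      (fun _ => rfl) hBopen hBne hK hβ isOpen_univ Set.univ_nonempty h0 hIconn hp,
    neg_one_zpow_sub_one]
  have hlt := Nat.lt_succ_self ℓ
  have ha2 : ∀ i, (a i ^ 2) ^ (ℓ + 1 - ℓ) = a i ^ 2 := fun i => by
    rw [Nat.add_sub_cancel_left, pow_one]
  constructor
  · rintro ⟨P, hP, h1, -⟩
    have hα := fun {u : ℝ} => eval_sq_eq_calXSpecial (x := u) hP.natDegree_le
    obtain ⟨d, hd⟩ := (hform (P.coeff 0) fun i => P.coeff (i + 1)).2 fun μ u hu => by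
      rw [hP.yFun_eq μ u hu, hα (hx0 μ u hu)]
    refine ⟨P.coeff 0, fun i => P.coeff (i + 1), d, hP.coeff_eq, ?_, ?_, hd, fun i => ?_⟩
    -- The condition on `P'(0)` at the extra node is the constraint on `α_0`, and the one on `P(0)`
    -- is that on `α_{-1}`; the signs combine as `-(-1)^ℓ = (-1)^{ℓ-1}`.
    · have h2 := hP.derivative_eval_zero hlt
      rw [← Polynomial.coeff_zero_eq_eval_zero, Polynomial.coeff_derivative, hsum] at h2
      simp only [Nat.cast_zero, zero_add, mul_one] at h2
      show P.coeff 1 = _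
      rw [h2, pow_succ]
      ring
    · rw [Polynomial.coeff_zero_eq_eval_zero, hP.eval_zero hlt, pow_succ]
      ring
    · have h2 := h1 i
      rwa [hα (ha i), ha2, mul_div_cancel_left₀ _ (pow_ne_zero 2 (ha i))] at h2
  · rintro ⟨αm, α, d, h1, h2, h3, h4, h5⟩
    -- The coefficients of `P` are `α_{-1}, α_0, …, α_ℓ` in this order.
    obtain ⟨P, hP, hc⟩ := exists_poly_coeff (ℓ + 1) (fun i => Nat.casesOn i αm α)
    have hα : ∀ {u : ℝ}, u ≠ 0 → P.eval (u ^ 2) = u ^ 2 * calXSpecial ℓ αm α u := fun {u} hu => by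
      rw [eval_sq_eq_calXSpecial hP hu, hc 0 (Nat.zero_le _), calXSpecial, calXSpecial,
        calX_congr fun i hi => hc (i + 1) (Nat.succ_le_succ hi)]
      rfl
    refine ⟨P, ⟨hP, (hc (ℓ + 1) le_rfl).trans h1, fun μ u hu => ?_, fun _ => ?_, fun _ => ?_⟩,
      fun i => ?_, fun z _ => Matrix.ext fun i => i.elim0⟩
    · rw [(hform αm α).1 ⟨d, h4⟩ μ u hu, hα (hx0 μ u hu)]
    · rw [← Polynomial.coeff_zero_eq_eval_zero, hc 0 (Nat.zero_le _)]
      show αm = _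
      rw [h3, pow_succ]
      ring
    · rw [← Polynomial.coeff_zero_eq_eval_zero, Polynomial.coeff_derivative, hsum,
        hc (0 + 1) (by omega)]
      show α 0 * _ = _
      rw [h2, pow_succ]
      push_cast
      ring
    · rw [hα (ha i), ha2, mul_div_cancel_left₀ _ (pow_ne_zero 2 (ha i))]
      exact h5 i

end Conclusion

end GenKerrNUT

end

open GenKerrNUT in
theorem theorem5p4
    {ℓ N : ℕ} (m : Fin N → ℕ)
    -- the nonzero constant eigenvalues
    (a : Fin N → ℝ) (ha : ∀ i, a i ≠ 0)
    -- `x_μ` ranges over an open interval `I_μ` with base point `p_μ`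
    (I : Fin ℓ → Set ℝ) (hIopen : ∀ μ, IsOpen (I μ)) (hIconn : ∀ μ, (I μ).OrdConnected)
    (p : Fin ℓ → ℝ) (hp : ∀ μ, p μ ∈ I μ)
    (hx0 : ∀ μ, ∀ x ∈ I μ, x ≠ 0)
    (hxa : ∀ μ, ∀ x ∈ I μ, ∀ i, x ^ 2 ≠ a i ^ 2)
    (hxx : ∀ μ ν, μ ≠ ν → ∀ x ∈ I μ, ∀ y ∈ I ν, x ^ 2 ≠ y ^ 2)
    -- the functions `X_μ` of the single variable `x_μ`
    (X : Fin ℓ → ℝ → ℝ) (hXsmooth : ∀ μ, ContDiffOn ℝ (∞ : WithTop ℕ∞) (X μ) (I μ))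
    (hX0 : ∀ μ, ∀ x ∈ I μ, X μ x ≠ 0)
    -- the Kähler manifolds `B^{(i)}` and potentials of their Kähler forms
    (B : ∀ i, Set (Fin (2 * m i) → ℝ)) (hBopen : ∀ i, IsOpen (B i))
    (hBne : ∀ i, (B i).Nonempty)
    (g J : ∀ i, (Fin (2 * m i) → ℝ) → Matrix (Fin (2 * m i)) (Fin (2 * m i)) ℝ)
    (hK : ∀ i, IsKahlerOn (B i) (g i) (J i))
    (β : ∀ i, (Fin (2 * m i) → ℝ) → Fin (2 * m i) → ℝ)
    (hβ : ∀ i, IsPotentialOn (B i) (β i) (kahlerForm (g i) (J i)))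
    (Λ : ℝ) :
    -- general `g^{(0)}` on an `m₀`-dimensional manifold
    (∀ (m₀ : ℕ) (B₀ : Set (Fin m₀ → ℝ)) (g₀ : (Fin m₀ → ℝ) → Matrix (Fin m₀) (Fin m₀) ℝ),
      IsOpen B₀ → B₀.Nonempty → IsMetricOn B₀ g₀ →
      (IsEinsteinOn (region ℓ I B B₀) (generalMetric X a g β g₀) Λ ↔
        ∃ (α : ℕ → ℝ) (d : Fin ℓ → ℝ), α ℓ = -Λ ∧
          (∀ μ, HasIntegralForm m a m₀ (calX ℓ α) (I μ) (p μ) (d μ) (X μ)) ∧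
          (∀ i, IsKahlerEinsteinOn (B i) (g i) (J i)
            ((-1 : ℝ) ^ ((ℓ : ℤ) - 1) * calX ℓ α (a i))) ∧
          IsEinsteinOn B₀ g₀ ((-1 : ℝ) ^ ((ℓ : ℤ) - 1) * α 0))) ∧
    -- the special one-dimensional `g^{(0)}`
    (∀ c : ℝ, c ≠ 0 →
      (IsEinsteinOn (region (ℓ + 1) I B Set.univ) (specialMetric X a g β c) Λ ↔
        ∃ (αm : ℝ) (α : ℕ → ℝ) (d : Fin ℓ → ℝ), α ℓ = -Λ ∧
          α 0 = (-1 : ℝ) ^ ((ℓ : ℤ) - 1) * 2 * c * ∑ j, (m j : ℝ) / a j ^ 2 ∧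
          αm = (-1 : ℝ) ^ ((ℓ : ℤ) - 1) * 2 * c ∧
          (∀ μ, HasIntegralForm m a 1 (calXSpecial ℓ αm α) (I μ) (p μ) (d μ) (X μ)) ∧
          (∀ i, IsKahlerEinsteinOn (B i) (g i) (J i)
            ((-1 : ℝ) ^ ((ℓ : ℤ) - 1) * calXSpecial ℓ αm α (a i))))) := by
  exact ⟨fun m₀ B₀ g₀ hB₀ hB₀ne hg₀ => isEinsteinOn_generalMetric_iff ha hIopen hIconn hp hx0 hxa hxx
      hXsmooth hX0 hBopen hBne hK hβ hB₀ hB₀ne hg₀,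
    fun c hc => isEinsteinOn_specialMetric_iff ha hIopen hIconn hp hx0 hxa hxx hXsmooth hX0 hBopen
      hBne hK hβ hc⟩
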